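/- Let $1\le m\le d$ and let $M\subset\mathbb R^d$ be a compact smooth $m$-dimensional embedded submanifold with smooth boundary $\partial M$, every connected component of which meets $\partial M$ (for instance, $M$ connected and $\partial M\neq\emptyset$). Let $\mu$ and $\tau$ be the Riemannian volume measures of $M$ and $\partial M$, let $\mathbf n$ be the outward unit normal of $M$ along $\partial M$, and let $$\kappa_{\mathbf n}=\sum_{i,j=1}^{m-1}h^{ij}\,(\partial_i\partial_j\Psi\cdot\mathbf n)$$ for any local parametrization $\Psi$ of $\partial M$, where $(h^{ij})$ is the inverse of the matrix $h_{ij}=\partial_i\Psi\cdot\partial_j\Psi$ (so $\kappa_{\mathbf n}$ is $m-1$ times the mean curvature of $\partial M$ in the direction $\mathbf n$). Let $R:[0,\infty)\to[0,\infty)$ be $C^1$ with Lipschitz derivative, with $R(r)=0$ for $r>1$ and $R\ge c$ on $[0,\tfrac12]$ for some $c>0$. Put $\bar R(r)=\int_r^\infty R(s)\,ds$, $\bar{\bar R}(r)=\int_r^\infty\bar R(s)\,ds$, and for $\delta>0$ $$R_\delta(x,y)=\frac{1}{(4\pi\delta^2)^{m/2}}R\Big(\frac{|x-y|^2}{4\delta^2}\Big),$$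 and define $\bar R_\delta,\bar{\bar R}_\delta$ in the same way from $\bar R,\bar{\bar R}$. For $u\in L^2(M)$, $v\in L^2(\partial M)$ and $f\in H^1(M)$ (with boundary values in the sense of traces) let $$\mathcal L_\delta u(x)=\frac1{\delta^2}\int_M (u(x)-u(y))R_\delta(x,y)\,d\mu_y,$$ $$\mathcal G_\delta v(x)=\int_{\partial M}v(y)\big(2+\kappa_{\mathbf n}(y)\,(x-y)\cdot\mathbf n(y)\big)\bar R_\delta(x,y)\,d\tau_y,$$ $$\mathcal D_\delta u(x)=\int_{M}u(y)\big(2-\kappa_{\mathbf n}(x)\,(x-y)\cdot\mathbf n(x)\big)\bar R_\delta(x,y)\,d\mu_y,$$ $$\tilde R_\delta(x)=4\delta^2\int_{\partial M}\bar{\bar R}_\delta(x,y)\,d\tau_y-\int_M\kappa_{\mathbf n}(x)\big((x-y)\cdot\mathbf n(x)\big)^2\bar R_\delta(x,y)\,d\mu_y,$$ $$\mathcal P_\delta f(x)=\int_M f(y)\bar R_\delta(x,y)\,d\mu_y-\int_{\partial M}\big((x-y)\cdot\mathbf n(y)\big)f(y)\bar R_\delta(x,y)\,d\tau_y,$$ $$\mathcal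 Q_\delta f(x)=-2\delta^2\int_M f(y)\bar{\bar R}_\delta(x,y)\,d\mu_y .$$ Then there are constants $\delta_0>0$ and $C$, depending only on $M$ and $R$, such that for every $\delta\in(0,\delta_0)$ and every $f\in H^1(M)$ the following hold. 1. There is exactly one pair $u_\delta\in L^2(M)$, $v_\delta\in L^2(\partial M)$ with $$\mathcal L_\delta u_\delta-\mathcal G_\delta v_\delta=\mathcal P_\delta f\ \text{ a.e. on } M,\qquad \mathcal D_\delta u_\delta+\tilde R_\delta v_\delta=\mathcal Q_\delta f\ \text{ a.e. on }\partial M,$$ and it satisfies $\|u_\delta\|_{L^2(M)}^2+\delta\|v_\delta\|_{L^2(\partial M)}^2\le C\|f\|_{H^1(M)}^2$. 2. Moreover $u_\delta\in H^1(M)$ and $\|u_\delta\|_{H^1(M)}^2\le C\|f\|_{H^1(M)}^2$. -/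

import Mathlib

open MeasureTheory Filter Topology
open scoped ContDiff NNReal

noncomputable section

namespace NonlocalPoisson

/-- The ambient Euclidean space `ℝ^d`. -/
abbrev E (d : ℕ) : Type := EuclideanSpace ℝ (Fin d)

section Geometry

variable {d : ℕ}

/-- The model slice `ℝ^m × {0} ⊆ ℝ^d`. -/
def flatModel (d m : ℕ) : Set (E d) :=
  {z | ∀ i : Fin d, m ≤ i.val → z i = 0}

/-- The model half slice: the points of `ℝ^m × {0} ⊆ ℝ^d` whose `m`-th coordinate
(the one with index `m - 1`) is nonnegative. -/
def halfModel (d m : ℕ) : Set (E d) :=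
  {z | z ∈ flatModel d m ∧ ∀ i : Fin d, i.val + 1 = m → 0 ≤ z i}

/-- A smooth diffeomorphism between two open subsets of `ℝ^d`. -/
def IsLocalDiffeo (Φ : OpenPartialHomeomorph (E d) (E d)) : Prop :=
  ContDiffOn ℝ ∞ Φ Φ.source ∧ ContDiffOn ℝ ∞ Φ.symm Φ.target

/-- Near `x` the set `M` is a smoothly straightened piece of `ℝ^m`. -/
def IsInteriorPoint (M : Set (E d)) (m : ℕ) (x : E d) : Prop :=
  ∃ Φ : OpenPartialHomeomorph (E d) (E d), IsLocalDiffeo Φ ∧ x ∈ Φ.source ∧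
    ∀ y ∈ Φ.source, (y ∈ M ↔ Φ y ∈ flatModel d m)

/-- Near `x` the set `M` is a smoothly straightened piece of a half space of `ℝ^m`, and `x`
corresponds to a point on the boundary of the half space. -/
def IsBoundaryPoint (M : Set (E d)) (m : ℕ) (x : E d) : Prop :=
  ∃ Φ : OpenPartialHomeomorph (E d) (E d), IsLocalDiffeo Φ ∧ x ∈ Φ.source ∧
    (∀ y ∈ Φ.source, (y ∈ M ↔ Φ y ∈ halfModel d m)) ∧
    ∀ i : Fin d, i.val + 1 = m → Φ x i = 0

/-- The manifold boundary `∂M`. -/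
def bdry (M : Set (E d)) (m : ℕ) : Set (E d) :=
  {x | x ∈ M ∧ IsBoundaryPoint M m x}

/-- `M` is a compact smooth `m`-dimensional submanifold with (possibly empty) boundary
of `ℝ^d`. -/
structure IsCompactSubmanifold (M : Set (E d)) (m : ℕ) : Prop where
  isCompact : IsCompact M
  locally_flat : ∀ x ∈ M, IsInteriorPoint M m x ∨ IsBoundaryPoint M m x

/-- The Riemannian volume of `M`: the `m`-dimensional Hausdorff measure, normalised to agree with
Lebesgue measure on `ℝ^m`, restricted to `M`. -/
def vol (M : Set (E d)) (m : ℕ) : Measure (E d) :=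
  (Measure.euclideanHausdorffMeasure m).restrict M

/-- The Riemannian volume of `∂M`, which has dimension `m - 1`. -/
def bvol (M : Set (E d)) (m : ℕ) : Measure (E d) :=
  (Measure.euclideanHausdorffMeasure (m - 1)).restrict (bdry M m)

/-- The tangent space `T_x M`, as a linear subspace of `ℝ^d`. -/
def tangentSpace (M : Set (E d)) (x : E d) : Submodule ℝ (E d) :=
  Submodule.span ℝ (tangentConeAt ℝ M x)

/-- The gradient on `M` of a smooth function on `ℝ^d`: the tangential part of the gradient. -/
def tangentialGradient (M : Set (E d)) (φ : E d → ℝ) (x : E d) : E d :=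
  (tangentSpace M x).starProjection (gradient φ x)

/-- `n` is the outward unit normal of `M` at its boundary point `x`: the unit vector of `T_x M`
whose inner product with every one-sided tangent direction of `M` is nonpositive (at a boundary
point these directions form a closed half space of `T_x M`). -/
def IsOutwardNormal (M : Set (E d)) (x n : E d) : Prop :=
  n ∈ tangentSpace M x ∧ ‖n‖ = 1 ∧ ∀ w ∈ tangentConeAt ℝ≥0 M x, inner ℝ n w ≤ 0

/-- The outward unit normal of `M` at its boundary point `x`. -/
def outwardNormal (M : Set (E d)) (x : E d) : E d :=
  Classical.epsilon (IsOutwardNormal M x)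

/-- `Ψ` restricts near `s` to a smooth local parametrization of the `k`-dimensional manifold `S`. -/
structure IsLocalParam (S : Set (E d)) (k : ℕ) (Ψ : E k → E d) (s : E k) : Prop where
  contDiffAt : ContDiffAt ℝ ∞ Ψ s
  eventually_mem : ∀ᶠ w in 𝓝 s, Ψ w ∈ S
  injective_fderiv : Function.Injective (fderiv ℝ Ψ s)

/-- The partial derivative `∂Ψ/∂s_i`. -/
def partialDeriv {k : ℕ} (Ψ : E k → E d) (i : Fin k) (s : E k) : E d :=
  fderiv ℝ Ψ s (EuclideanSpace.single i 1)

/-- The first fundamental form `h_{ij}`. -/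
def firstForm {k : ℕ} (Ψ : E k → E d) (s : E k) : Matrix (Fin k) (Fin k) ℝ :=
  Matrix.of fun i j => inner ℝ (partialDeriv Ψ i s) (partialDeriv Ψ j s)

/-- The second fundamental form `l_{ij}` in the direction `n`. -/
def secondForm {k : ℕ} (Ψ : E k → E d) (n : E d) (s : E k) : Matrix (Fin k) (Fin k) ℝ :=
  Matrix.of fun i j => inner ℝ (partialDeriv (partialDeriv Ψ j) i s) n

/-- `κ_n(x) = ∑ h^{ij} l_{ij}`, that is, `m - 1` times the mean curvature of `∂M` at `x` in the
direction of the outward normal; the sum does not depend on the parametrization. -/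
def curvature (M : Set (E d)) (m : ℕ) (x : E d) : ℝ :=
  Classical.epsilon fun c : ℝ => ∃ (Ψ : E (m - 1) → E d) (s : E (m - 1)),
    IsLocalParam (bdry M m) (m - 1) Ψ s ∧ Ψ s = x ∧
      c = ∑ i, ∑ j, (firstForm Ψ s)⁻¹ i j * secondForm Ψ (outwardNormal M x) s i j

end Geometry

section Sobolev

variable {d : ℕ}

/-- `L²(M)`. -/
abbrev L2 (M : Set (E d)) (m : ℕ) : Type := Lp ℝ 2 (vol M m)

/-- `L²(M; ℝ^d)`. -/
abbrev L2Vec (M : Set (E d)) (m : ℕ) : Type := Lp (E d) 2 (vol M m)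

/-- `L²(∂M)`. -/
abbrev L2Bdry (M : Set (E d)) (m : ℕ) : Type := Lp ℝ 2 (bvol M m)

/-- The pairs `(φ, ∇_M φ)` with `φ` smooth on `M`. -/
def smoothPairs (M : Set (E d)) (m : ℕ) : Set (L2 M m × L2Vec M m) :=
  {p | ∃ φ : E d → ℝ, ContDiff ℝ ∞ φ ∧
    p.1 =ᵐ[vol M m] φ ∧ p.2 =ᵐ[vol M m] tangentialGradient M φ}

/-- The Sobolev space `H¹(M)`, the completion of `C^∞(M)` in the `H¹` norm; an element is given
together with its gradient, as a limit of pairs `(φ, ∇_M φ)` in `L²`. -/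
def H1 (M : Set (E d)) (m : ℕ) : Set (L2 M m × L2Vec M m) :=
  closure (smoothPairs M m)

/-- The square of the `H¹` norm. -/
def h1NormSq {M : Set (E d)} {m : ℕ} (p : L2 M m × L2Vec M m) : ℝ :=
  ‖p.1‖ ^ 2 + ‖p.2‖ ^ 2

/-- The triples `(φ, ∇_M φ, φ|_{∂M})` with `φ` smooth on `M`. -/
def smoothTriples (M : Set (E d)) (m : ℕ) : Set (L2 M m × L2Vec M m × L2Bdry M m) :=
  {p | ∃ φ : E d → ℝ, ContDiff ℝ ∞ φ ∧
    p.1 =ᵐ[vol M m] φ ∧ p.2.1 =ᵐ[vol M m] tangentialGradient M φ ∧ p.2.2 =ᵐ[bvol M m] φ}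

/-- The boundary trace of an element of `H¹(M)`: the limit in `L²(∂M)` of the boundary values of
smooth functions that converge to it in `H¹(M)`. -/
def trace {M : Set (E d)} {m : ℕ} (p : L2 M m × L2Vec M m) : L2Bdry M m :=
  Classical.epsilon fun g => (p.1, p.2, g) ∈ closure (smoothTriples M m)

end Sobolev

section Model

/-- The assumptions on the kernel profile `R : [0, ∞) → ℝ`; the values of `R` on the negative
half line play no role. -/
structure IsKernel (R : ℝ → ℝ) : Prop where
  contDiffOn : ContDiffOn ℝ 1 R (Set.Ici 0)
  lipschitz_deriv : ∃ K : ℝ≥0, LipschitzOnWith K (derivWithin R (Set.Ici 0)) (Set.Ici 0)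
  nonneg : ∀ r, 0 ≤ r → 0 ≤ R r
  support : ∀ r, 1 < r → R r = 0
  nondegenerate : ∃ c, 0 < c ∧ ∀ r, 0 ≤ r → r ≤ 1 / 2 → c ≤ R r

/-- `R̄(r) = ∫_r^∞ R(s) ds`. -/
def tail (R : ℝ → ℝ) (r : ℝ) : ℝ := ∫ s in Set.Ioi r, R s

variable {d : ℕ}

/-- `R_δ(x, y) = C_δ R(|x - y|² / (4 δ²))` with `C_δ = (4 π δ²)^(-m/2)`. -/
def ker (m : ℕ) (R : ℝ → ℝ) (δ : ℝ) (x y : E d) : ℝ :=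
  1 / (4 * Real.pi * δ ^ 2) ^ ((m : ℝ) / 2) * R (‖x - y‖ ^ 2 / (4 * δ ^ 2))

/-- `R̄_δ`. -/
def kerBar (m : ℕ) (R : ℝ → ℝ) (δ : ℝ) (x y : E d) : ℝ := ker m (tail R) δ x y

/-- `R̿_δ`, where `R̿(r) = ∫_r^∞ R̄(s) ds`. -/
def kerBarBar (m : ℕ) (R : ℝ → ℝ) (δ : ℝ) (x y : E d) : ℝ := ker m (tail (tail R)) δ x y

variable (M : Set (E d)) (m : ℕ) (R : ℝ → ℝ) (δ : ℝ)

def opL (u : E d → ℝ) (x : E d) : ℝ :=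
  1 / δ ^ 2 * ∫ y, (u x - u y) * ker m R δ x y ∂(vol M m)

def opG (v : E d → ℝ) (x : E d) : ℝ :=
  ∫ y, v y * (2 + inner ℝ (x - y) (curvature M m y • outwardNormal M y)) * kerBar m R δ x y
    ∂(bvol M m)

def opD (u : E d → ℝ) (x : E d) : ℝ :=
  ∫ y, u y * (2 - inner ℝ (x - y) (curvature M m x • outwardNormal M x)) * kerBar m R δ x y
    ∂(vol M m)

def tildeR (x : E d) : ℝ :=
  4 * δ ^ 2 * (∫ y, kerBarBar m R δ x y ∂(bvol M m)) -
    ∫ y, curvature M m x * (inner ℝ (x - y) (outwardNormal M x)) ^ 2 * kerBar m R δ x y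
      ∂(vol M m)

/-- Here `g` stands for the boundary values of `f`. -/
def opP (f g : E d → ℝ) (x : E d) : ℝ :=
  (∫ y, f y * kerBar m R δ x y ∂(vol M m)) -
    ∫ y, inner ℝ (x - y) (outwardNormal M y) * g y * kerBar m R δ x y ∂(bvol M m)

def opQ (f : E d → ℝ) (x : E d) : ℝ :=
  -2 * δ ^ 2 * ∫ y, f y * kerBarBar m R δ x y ∂(vol M m)

/-- `(u, v)` solves the nonlocal system with right-hand side `f ∈ H¹(M)`. -/
def IsSolution (f : L2 M m × L2Vec M m) (u : L2 M m) (v : L2Bdry M m) : Prop :=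
  (∀ᵐ x ∂(vol M m), opL M m R δ u x - opG M m R δ v x = opP M m R δ f.1 (trace f) x) ∧
  ∀ᵐ x ∂(bvol M m), opD M m R δ u x + tildeR M m R δ x * v x = opQ M m R δ f.1 x

end Model

end NonlocalPoisson

end

/-! The system hides a coercive problem. Exchanging `x` and `y` shows that `𝒢_δ` is the `L²` adjoint
of `𝒟_δ` (`UniformBounds.integral_opG_mul`). Pairing the first equation with `u` and the second with
`v` therefore cancels the coupling and leaves `⟨L u, u⟩ + ⟨R̃ v, v⟩ = ⟨p, u⟩ + ⟨q, v⟩`, where `p`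
and `q` are the data. By symmetrisation `⟨L u, u⟩` is `(2 δ²)⁻¹` times the double integral of `(u(x)
- u(y))² R_δ(x, y)`, hence nonnegative. The weight `R̃_δ` is comparable to `δ`: its boundary
integral contributes order `δ² · δ⁻¹`, its curvature term only `δ²`. So the identity controls the
energy and `δ ‖v‖²`, but not yet `‖u‖`.

The heart is the coercivity estimate `‖u‖² ≤ K (‖𝒟_δ u‖² + 2 ⟨L u, u⟩)` with `K` independent of `δ`
(`exists_coercivity`). Since `u` is only in `L²`, it is replaced by its normalised kernel average
`s`. Cauchy-Schwarz bounds `‖u - s‖²` by the nonlocal energy. It also bounds the Dirichlet energy of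
`s` by `δ⁻²` times the nonlocal energy, thanks to the pointwise inequality `R'² ≤ B R`, which
follows from `R ≥ 0`, the Lipschitz derivative and the nondegeneracy near `0`. A Poincaré inequality
with boundary values applies to `s`, because every component of `M` meets `∂M`. The boundary values
of `s` are recovered from `𝒟_δ u`, which is nearly a weighted average of `u`; the error consists of
differences of `s` over distance `2 δ` and of `u - s`, both controlled by the energy.

In the a priori estimate `𝒟_δ u = q - R̃_δ v` is inserted, and the terms in `u` and `v` are absorbed
by Young's inequality (`energy_absorption`). This gives uniqueness and the bound. For existence,
eliminating `v` leaves an equation for `u` with the coercive operator `L + 𝒟* R̃⁻¹ 𝒟`, so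
Lax-Milgram applies. For regularity, the first equation is solved pointwise for `u(x)`: it equals
the kernel average plus `δ² (𝒢_δ v + 𝒫_δ f)`, divided by the kernel mass. This representative is
`C¹` near `M`, hence in `H¹(M)`, and its gradient is estimated like that of `s`, the factor `δ²`
paying for the singular source.

From the geometry only soft facts enter: convex bi-Lipschitz charts, which give Ahlfors regularity
of both measures, the trace and Poincaré inequalities and the estimate of differences over short
distances (`lintegral_segment_le`); and continuity of the normal and of the curvature on the compact
boundary. The value of the curvature plays no role in the estimates beyond boundedness and
measurability. -/

noncomputable section

namespace NonlocalPoisson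

/-! ### The flat and half-space models -/

/-- The linear map `ℝ^k → ℝ^d` that pads with zeros or forgets the last coordinates. -/
def coordMap (k d : ℕ) : E k →L[ℝ] E d :=
  LinearMap.toContinuousLinearMap
    { toFun := fun z => WithLp.toLp 2 fun i => if h : i.val < k then z ⟨i.val, h⟩ else 0
      map_add' := fun z w => by
        ext i; by_cases h : i.val < k <;> simp [h]
      map_smul' := fun c z => by
        ext i; by_cases h : i.val < k <;> simp [h] }

lemma coordMap_apply {k d : ℕ} (z : E k) (i : Fin d) :
    coordMap k d z i = if h : i.val < k then z ⟨i.val, h⟩ else 0 := rfl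

lemma coordMap_mem_flatModel {k d : ℕ} (z : E k) : coordMap k d z ∈ flatModel d k := by
  intro i hi
  rw [coordMap_apply, dif_neg (by omega)]

lemma coordMap_coordMap {k d : ℕ} (h : k ≤ d) (z : E k) : coordMap d k (coordMap k d z) = z := by
  ext i
  rw [coordMap_apply, dif_pos (by omega), coordMap_apply, dif_pos i.2]

lemma coordMap_coordMap_of_mem {k d : ℕ} {w : E d} (hw : w ∈ flatModel d k) :
    coordMap k d (coordMap d k w) = w := by
  ext i
  rw [coordMap_apply]
  split_ifs with hi
  · rw [coordMap_apply, dif_pos i.2]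
  · exact (hw i (by omega)).symm

lemma norm_coordMap {k d : ℕ} (h : k ≤ d) (z : E k) : ‖coordMap k d z‖ = ‖z‖ := by
  rw [EuclideanSpace.norm_eq, EuclideanSpace.norm_eq]
  congr 1
  symm
  refine Fintype.sum_of_injective (Fin.castLE h) (Fin.castLE_injective h) _ _ ?_ ?_
  · intro i hi
    rw [coordMap_apply, dif_neg, norm_zero, zero_pow two_ne_zero]
    intro hlt
    exact hi ⟨⟨i.val, hlt⟩, rfl⟩
  · intro i
    rw [coordMap_apply, dif_pos (by simp)]
    rfl

lemma dist_coordMap {k d : ℕ} (h : k ≤ d) (z w : E k) :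
    dist (coordMap k d z) (coordMap k d w) = dist z w := by
  rw [dist_eq_norm, dist_eq_norm, ← map_sub, norm_coordMap h]

/-- `flatModel` as a linear subspace. -/
def flatSubspace (d m : ℕ) : Submodule ℝ (E d) where
  carrier := flatModel d m
  add_mem' := fun {a b} ha hb i hi => by simp [ha i hi, hb i hi]
  zero_mem' := fun i _ => rfl
  smul_mem' := fun c a ha i hi => by simp [ha i hi]

lemma isClosed_flatModel {d m : ℕ} : IsClosed (flatModel d m) :=
  (flatSubspace d m).closed_of_finiteDimensional

lemma continuous_coord {d : ℕ} (i : Fin d) : Continuous fun z : E d => z i :=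
  (EuclideanSpace.proj i : E d →L[ℝ] ℝ).continuous

lemma halfModel_eq {d m : ℕ} : halfModel d m =
    flatModel d m ∩ ⋂ (i : Fin d) (_ : i.val + 1 = m), {z : E d | 0 ≤ z i} := by
  ext z; simp [halfModel]

lemma isClosed_halfModel {d m : ℕ} : IsClosed (halfModel d m) := by
  rw [halfModel_eq]
  exact isClosed_flatModel.inter (isClosed_iInter fun i => isClosed_iInter fun _ =>
    isClosed_le continuous_const (continuous_coord i))

lemma convex_halfModel {d m : ℕ} : Convex ℝ (halfModel d m) := by
  intro x hx y hy a b ha hb _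
  refine ⟨(flatSubspace d m).add_mem ((flatSubspace d m).smul_mem a hx.1)
    ((flatSubspace d m).smul_mem b hy.1), fun i hi => ?_⟩
  have h1 := hx.2 i hi
  have h2 := hy.2 i hi
  simp only [PiLp.add_apply, PiLp.smul_apply, smul_eq_mul]
  positivity

lemma convex_flatModel {d m : ℕ} : Convex ℝ (flatModel d m) := (flatSubspace d m).convex

lemma halfModel_subset {d m : ℕ} : halfModel d m ⊆ flatModel d m := fun _ h => h.1

/-! ### Straightening diffeomorphisms and tangent cones -/

section LocalDiffeo

variable {d : ℕ} {Φ : OpenPartialHomeomorph (E d) (E d)}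

lemma IsLocalDiffeo.contDiffAt (h : IsLocalDiffeo Φ) {x : E d} (hx : x ∈ Φ.source) :
    ContDiffAt ℝ ∞ Φ x := h.1.contDiffAt (Φ.open_source.mem_nhds hx)

lemma IsLocalDiffeo.contDiffAt_symm (h : IsLocalDiffeo Φ) {z : E d} (hz : z ∈ Φ.target) :
    ContDiffAt ℝ ∞ Φ.symm z := h.2.contDiffAt (Φ.open_target.mem_nhds hz)

lemma IsLocalDiffeo.hasFDerivAt (h : IsLocalDiffeo Φ) {x : E d} (hx : x ∈ Φ.source) :
    HasFDerivAt Φ (fderiv ℝ Φ x) x :=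
  ((h.contDiffAt hx).differentiableAt (by simp)).hasFDerivAt

lemma IsLocalDiffeo.hasFDerivAt_symm (h : IsLocalDiffeo Φ) {z : E d} (hz : z ∈ Φ.target) :
    HasFDerivAt Φ.symm (fderiv ℝ Φ.symm z) z :=
  ((h.contDiffAt_symm hz).differentiableAt (by simp)).hasFDerivAt

lemma IsLocalDiffeo.fderiv_symm_fderiv (h : IsLocalDiffeo Φ) {z : E d} (hz : z ∈ Φ.target)
    (v : E d) : fderiv ℝ Φ.symm z (fderiv ℝ Φ (Φ.symm z) v) = v := by
  have hs := Φ.map_target hz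
  have h1 : HasFDerivAt Φ.symm (fderiv ℝ Φ.symm z) (Φ (Φ.symm z)) := by
    rw [Φ.right_inv hz]; exact h.hasFDerivAt_symm hz
  have h2 := h1.comp _ (h.hasFDerivAt hs)
  have h3 : HasFDerivAt (Φ.symm ∘ Φ) (ContinuousLinearMap.id ℝ (E d)) (Φ.symm z) :=
    (hasFDerivAt_id _).congr_of_eventuallyEq (Φ.eventually_left_inverse hs)
  exact congrArg (fun L : E d →L[ℝ] E d => L v) (h2.unique h3)

lemma IsLocalDiffeo.fderiv_fderiv_symm (h : IsLocalDiffeo Φ) {z : E d} (hz : z ∈ Φ.target)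
    (v : E d) : fderiv ℝ Φ (Φ.symm z) (fderiv ℝ Φ.symm z v) = v := by
  have hs := Φ.map_target hz
  have h2 := (h.hasFDerivAt hs).comp _ (h.hasFDerivAt_symm hz)
  have h3 : HasFDerivAt (Φ ∘ Φ.symm) (ContinuousLinearMap.id ℝ (E d)) z :=
    (hasFDerivAt_id _).congr_of_eventuallyEq (Φ.eventually_right_inverse hz)
  exact congrArg (fun L : E d →L[ℝ] E d => L v) (h2.unique h3)

variable {M N : Set (E d)}

/-- Directions that stay in the model are mapped to one-sided tangent directions. -/
lemma fderiv_symm_mem_tangentConeAt (h : IsLocalDiffeo Φ)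
    (hMN : ∀ y ∈ Φ.source, (y ∈ M ↔ Φ y ∈ N)) {z : E d} (hz : z ∈ Φ.target) {w : E d}
    (hw : ∀ t : ℝ, 0 ≤ t → z + t • w ∈ N) :
    fderiv ℝ Φ.symm z w ∈ tangentConeAt ℝ≥0 M (Φ.symm z) := by
  have hlim : Tendsto (fun n : ℕ => ((n : ℝ)⁻¹) • w) atTop (𝓝 0) := by
    simpa using (tendsto_inv_atTop_nhds_zero_nat (𝕜 := ℝ)).smul_const w
  have hcw : Tendsto (fun n : ℕ => (n : ℝ) • ((n : ℝ)⁻¹ • w)) atTop (𝓝 w) := by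
    refine tendsto_const_nhds.congr' ?_
    filter_upwards [eventually_gt_atTop 0] with n hn
    rw [smul_smul, mul_inv_cancel₀ (by positivity), one_smul]
  have hzl : Tendsto (fun n : ℕ => z + (n : ℝ)⁻¹ • w) atTop (𝓝 z) := by
    simpa using tendsto_const_nhds.add hlim
  -- The displacements to the images of `z + w / n`, rescaled by the nonnegative scalars `n`,
  -- converge to the derivative in direction `w`.
  refine mem_tangentConeAt_of_seq atTop (fun n : ℕ => (n : ℝ≥0))
    (fun n => Φ.symm (z + (n : ℝ)⁻¹ • w) - Φ.symm z) ?_ ?_ ?_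
  · rw [tendsto_sub_nhds_zero_iff]
    exact ((h.hasFDerivAt_symm hz).continuousAt.tendsto).comp hzl
  · filter_upwards [hzl.eventually (Φ.open_target.mem_nhds hz)] with n hn
    rw [add_sub_cancel, hMN _ (Φ.map_target hn), Φ.right_inv hn]
    exact hw _ (by positivity)
  · have := (h.hasFDerivAt_symm hz).hasFDerivWithinAt (s := Set.univ) |>.lim hlim
      (by simp) hcw
    refine this.congr fun n => ?_
    rw [NNReal.smul_def]; simp

lemma tangentConeAt_nnreal_subset (x : E d) : tangentConeAt ℝ≥0 M x ⊆ tangentConeAt ℝ M x := by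
  intro y hy
  obtain ⟨α, l, hl, c, e, h1, h2, h3⟩ := exists_fun_of_mem_tangentConeAt hy
  exact mem_tangentConeAt_of_seq l (fun a => (c a : ℝ)) e h1 h2 h3

/-- The differential of the straightening maps tangent directions into the model plane. -/
lemma fderiv_mem_flatModel (h : IsLocalDiffeo Φ) {m : ℕ}
    (hMN : ∀ y ∈ Φ.source, (y ∈ M ↔ Φ y ∈ N)) (hN : N ⊆ flatModel d m) {x : E d}
    (hx : x ∈ Φ.source) (hxM : x ∈ M) {y : E d} (hy : y ∈ tangentConeAt ℝ M x) :
    fderiv ℝ Φ x y ∈ flatModel d m := by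
  obtain ⟨α, l, hl, c, e, h1, h2, h3⟩ := exists_fun_of_mem_tangentConeAt hy
  have hxe : Tendsto (fun a => x + e a) l (𝓝 x) := by simpa using tendsto_const_nhds.add h1
  have hlim := (h.hasFDerivAt hx).hasFDerivWithinAt (s := M) |>.lim h1 h2 h3
  refine isClosed_flatModel.mem_of_tendsto hlim ?_
  filter_upwards [h2, hxe.eventually (Φ.open_source.mem_nhds hx)] with a ha hs
  exact (flatSubspace d m).smul_mem _ ((flatSubspace d m).sub_mem (hN ((hMN _ hs).1 ha))
    (hN ((hMN _ hx).1 hxM)))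

/-- At a boundary point, one-sided tangent directions point into the half space. -/
lemma fderiv_mem_halfModel (h : IsLocalDiffeo Φ) {m : ℕ}
    (hMN : ∀ y ∈ Φ.source, (y ∈ M ↔ Φ y ∈ halfModel d m)) {x : E d}
    (hx : x ∈ Φ.source) (hxM : x ∈ M) (hx0 : ∀ i : Fin d, i.val + 1 = m → Φ x i = 0)
    {y : E d} (hy : y ∈ tangentConeAt ℝ≥0 M x) :
    fderiv ℝ Φ x y ∈ halfModel d m := by
  obtain ⟨α, l, hl, c, e, h1, h2, h3⟩ := exists_fun_of_mem_tangentConeAt hy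
  have hxe : Tendsto (fun a => x + e a) l (𝓝 x) := by simpa using tendsto_const_nhds.add h1
  have hlim := (h.hasFDerivAt hx).hasFDerivWithinAt (s := M) |>.lim h1 h2
    (c := fun a => (c a : ℝ)) h3
  refine isClosed_halfModel.mem_of_tendsto hlim ?_
  filter_upwards [h2, hxe.eventually (Φ.open_source.mem_nhds hx)] with a ha hs
  have ha' := (hMN _ hs).1 ha
  refine ⟨(flatSubspace d m).smul_mem _ ((flatSubspace d m).sub_mem ha'.1
    ((hMN _ hx).1 hxM).1), fun i hi => ?_⟩
  have := ha'.2 i hi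
  simp only [PiLp.smul_apply, PiLp.sub_apply, hx0 i hi, sub_zero, smul_eq_mul]
  positivity

/-- The models for the pieces of a manifold: closed convex subsets of the plane such that from each
point every line can be followed in one of its two directions. -/
structure IsModel (N : Set (E d)) (m : ℕ) : Prop where
  subset : N ⊆ flatModel d m
  convex : Convex ℝ N
  isClosed : IsClosed N
  direction : ∀ z ∈ N, ∀ w ∈ flatModel d m,
    (∀ t : ℝ, 0 ≤ t → z + t • w ∈ N) ∨ (∀ t : ℝ, 0 ≤ t → z + t • (-w) ∈ N)
  nonempty_interior : ∀ z ∈ N, ∀ r : ℝ, 0 < r →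
    (interior {w : E m | coordMap m d w ∈ N} ∩ Metric.ball (coordMap d m z) r).Nonempty

lemma isModel_flatModel {m : ℕ} : IsModel (flatModel d m) m where
  subset := subset_rfl
  convex := convex_flatModel
  isClosed := isClosed_flatModel
  direction := fun _ hz w hw => Or.inl fun t _ =>
    (flatSubspace d m).add_mem hz ((flatSubspace d m).smul_mem t hw)
  nonempty_interior := fun z _ r hr => by
    have : {w : E m | coordMap m d w ∈ flatModel d m} = Set.univ :=
      Set.eq_univ_of_forall coordMap_mem_flatModel
    rw [this, interior_univ]
    exact ⟨_, trivial, Metric.mem_ball_self hr⟩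

lemma add_smul_mem_halfModel {m : ℕ} {z w : E d} (hz : z ∈ halfModel d m)
    (hw : w ∈ halfModel d m) {t : ℝ} (ht : 0 ≤ t) : z + t • w ∈ halfModel d m := by
  refine ⟨(flatSubspace d m).add_mem hz.1 ((flatSubspace d m).smul_mem t hw.1), fun i hi => ?_⟩
  have h1 := hz.2 i hi
  have h2 := hw.2 i hi
  simp only [PiLp.add_apply, PiLp.smul_apply, smul_eq_mul]
  positivity

lemma mem_or_neg_mem_halfModel {m : ℕ} {w : E d} (hw : w ∈ flatModel d m) :
    w ∈ halfModel d m ∨ -w ∈ halfModel d m := by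
  by_cases hex : ∃ i : Fin d, i.val + 1 = m ∧ w i < 0
  · obtain ⟨i, hi, hwi⟩ := hex
    refine Or.inr ⟨(flatSubspace d m).neg_mem hw, fun j hj => ?_⟩
    have : j = i := Fin.ext (by omega)
    subst this
    simp only [PiLp.neg_apply]; linarith
  · push Not at hex
    exact Or.inl ⟨hw, hex⟩

lemma isModel_halfModel {m : ℕ} (hm : 1 ≤ m) (hmd : m ≤ d) : IsModel (halfModel d m) m where
  subset := halfModel_subset
  convex := convex_halfModel
  isClosed := isClosed_halfModel
  direction := fun _ hz _ hw => (mem_or_neg_mem_halfModel hw).imp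
    (fun h _ ht => add_smul_mem_halfModel hz h ht) (fun h _ ht => add_smul_mem_halfModel hz h ht)
  nonempty_interior := fun z hz r hr => by
    let j : Fin m := ⟨m - 1, by omega⟩
    have hopen : IsOpen {w : E m | 0 < w j} := isOpen_lt continuous_const (continuous_coord j)
    have hsub : {w : E m | 0 < w j} ⊆ {w : E m | coordMap m d w ∈ halfModel d m} := by
      intro w hw
      refine ⟨coordMap_mem_flatModel w, fun i hi => ?_⟩
      rw [coordMap_apply, dif_pos (by omega)]
      have : (⟨i.val, by omega⟩ : Fin m) = j := Fin.ext (by simp [j]; omega)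
      rw [this]; exact le_of_lt hw
    -- A push by `r / 2` into the half space leaves the boundary hyperplane without leaving the
    -- ball.
    refine ⟨coordMap d m z + EuclideanSpace.single j (r / 2), interior_maximal hsub hopen ?_, ?_⟩
    · have h0 : 0 ≤ coordMap d m z j := by
        rw [coordMap_apply, dif_pos (by simp [j]; omega)]
        exact hz.2 _ (by simp [j]; omega)
      simp only [Set.mem_ofPred_eq, PiLp.add_apply, PiLp.single_apply, if_true]
      linarith
    · rw [Metric.mem_ball, dist_eq_norm, add_sub_cancel_left, PiLp.norm_single,
        Real.norm_eq_abs, abs_of_pos (by linarith)]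
      linarith

/-- The tangent space in terms of a straightening. -/
lemma tangentSpace_eq {m : ℕ} (h : IsLocalDiffeo Φ)
    (hMN : ∀ y ∈ Φ.source, (y ∈ M ↔ Φ y ∈ N)) (hN : IsModel N m) {z : E d} (hz : z ∈ Φ.target)
    (hzN : z ∈ N) :
    tangentSpace M (Φ.symm z) = ((fderiv ℝ Φ.symm z).comp (coordMap m d)).range := by
  have hs := Φ.map_target hz
  have hxM : Φ.symm z ∈ M := by rw [hMN _ hs, Φ.right_inv hz]; exact hzN
  apply le_antisymm
  · rw [tangentSpace, Submodule.span_le]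
    intro y hy
    have h1 := fderiv_mem_flatModel h hMN hN.subset hs hxM hy
    refine ⟨coordMap d m (fderiv ℝ Φ (Φ.symm z) y), ?_⟩
    change fderiv ℝ Φ.symm z (coordMap m d (coordMap d m _)) = y
    rw [coordMap_coordMap_of_mem h1, h.fderiv_symm_fderiv hz]
  · rintro _ ⟨w, rfl⟩
    have key : ∀ v, (∀ t : ℝ, 0 ≤ t → z + t • v ∈ N) →
        fderiv ℝ Φ.symm z v ∈ tangentSpace M (Φ.symm z) := fun v hv =>
      Submodule.subset_span (tangentConeAt_nnreal_subset _
        (fderiv_symm_mem_tangentConeAt h hMN hz hv))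
    -- At a boundary point perhaps only one of `w` and `-w` can be followed inside the model; for a
    -- linear span either one suffices.
    rcases hN.direction z hzN (coordMap m d w) (coordMap_mem_flatModel w) with h1 | h1
    · exact key _ h1
    · have := (tangentSpace M (Φ.symm z)).neg_mem (key _ h1)
      rwa [map_neg, neg_neg] at this

end LocalDiffeo

/-! ### Convex bi-Lipschitz charts -/

/-- A convex bi-Lipschitz smooth chart of the `m`-dimensional manifold `M` around `p`. -/
structure Chart {d : ℕ} (M : Set (E d)) (m : ℕ) (p : E d) where
  F : E m → E d
  G : E d → E m
  Q : Set (E m)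
  U : Set (E d)
  L : ℝ≥0
  one_le_L : 1 ≤ L
  convex : Convex ℝ Q
  isCompact : IsCompact Q
  volume_pos : 0 < volume Q
  isOpen : IsOpen U
  mem : p ∈ U
  mapsTo : ∀ z ∈ Q, F z ∈ M
  G_mem : ∀ x ∈ M, x ∈ U → G x ∈ Q
  F_G : ∀ x ∈ M, x ∈ U → F (G x) = x
  G_F : ∀ z ∈ Q, G (F z) = z
  measurable_G : Measurable G
  continuousOn_G : ContinuousOn G U
  dist_F_le : ∀ z ∈ Q, ∀ w ∈ Q, dist (F z) (F w) ≤ L * dist z w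
  dist_le : ∀ z ∈ Q, ∀ w ∈ Q, dist z w ≤ L * dist (F z) (F w)
  contDiffAt : ∀ z ∈ Q, ContDiffAt ℝ ∞ F z
  injective : ∀ z ∈ Q, Function.Injective (fderiv ℝ F z)
  tangentSpace_eq : ∀ z ∈ Q, tangentSpace M (F z) = (fderiv ℝ F z).range

/-- The inverse straightening is restricted to a closed ball of the model around `Φ p`. The ball is
so small that `Φ` and its inverse are Lipschitz there, by strict differentiability; intersecting the
convex closed model with it gives a convex compact domain. -/
lemma exists_chart {d m : ℕ} (hmd : m ≤ d) {M N : Set (E d)} {p : E d}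
    {Φ : OpenPartialHomeomorph (E d) (E d)} (h : IsLocalDiffeo Φ)
    (hMN : ∀ y ∈ Φ.source, (y ∈ M ↔ Φ y ∈ N)) (hN : IsModel N m) (hp : p ∈ Φ.source)
    (hpM : p ∈ M) : Nonempty (Chart M m p) := by
  classical
  have hq := Φ.map_source hp
  have hqN : Φ p ∈ N := (hMN p hp).1 hpM
  obtain ⟨K₁, t₁, ht₁, hK₁⟩ := (((h.contDiffAt hp).of_le (by simp)).hasStrictFDerivAt
    (n := 1) one_ne_zero).exists_lipschitzOnWith
  obtain ⟨K₂, t₂, ht₂, hK₂⟩ := (((h.contDiffAt_symm hq).of_le (by simp)).hasStrictFDerivAt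
    (n := 1) one_ne_zero).exists_lipschitzOnWith
  have hpre : Φ.symm ⁻¹' t₁ ∈ 𝓝 (Φ p) := by
    refine (Φ.continuousAt_symm hq).preimage_mem_nhds ?_
    rwa [Φ.left_inv hp]
  obtain ⟨r, hr, hrs⟩ := Metric.nhds_basis_closedBall.mem_iff.1
    (inter_mem (inter_mem ht₂ hpre) (Φ.open_target.mem_nhds hq))
  let B := Metric.closedBall (Φ p) r
  have hB : ∀ z ∈ B, z ∈ t₂ ∧ Φ.symm z ∈ t₁ ∧ z ∈ Φ.target := fun z hz =>
    ⟨(hrs hz).1.1, (hrs hz).1.2, (hrs hz).2⟩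
  let Q : Set (E m) := coordMap m d ⁻¹' (B ∩ N)
  have hpq : coordMap m d (coordMap d m (Φ p)) = Φ p := coordMap_coordMap_of_mem (hN.subset hqN)
  have hQ : ∀ z ∈ Q, coordMap m d z ∈ B ∧ coordMap m d z ∈ N := fun z hz => hz
  have hQball : Q = Metric.closedBall (coordMap d m (Φ p)) r ∩ {z | coordMap m d z ∈ N} := by
    ext z
    simp only [Q, B, Set.mem_preimage, Set.mem_inter_iff, Metric.mem_closedBall,
      Set.mem_ofPred_eq]
    rw [← dist_coordMap hmd z, hpq]
  have hFder : ∀ z ∈ Q, fderiv ℝ (Φ.symm ∘ coordMap m d) z =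
      (fderiv ℝ Φ.symm (coordMap m d z)).comp (coordMap m d) := fun z hz =>
    ((h.hasFDerivAt_symm (hB _ hz.1).2.2).comp z (coordMap m d).hasFDerivAt).fderiv
  have hpU : p ∈ Φ.source ∩ Φ ⁻¹' Metric.ball (Φ p) r :=
    ⟨hp, by rw [Set.mem_preimage, Metric.mem_ball, dist_self]; exact hr⟩
  refine ⟨{
    F := Φ.symm ∘ coordMap m d
    -- Extended by zero off the source, because measures are pushed forward by `G` and this requires
    -- measurability on all of `ℝ^d`.
    G := Φ.source.piecewise (coordMap d m ∘ Φ) 0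
    Q := Q
    U := Φ.source ∩ Φ ⁻¹' Metric.ball (Φ p) r
    L := max 1 (max K₁ K₂)
    one_le_L := le_max_left _ _
    convex := ?_, isCompact := ?_, volume_pos := ?_, isOpen := ?_, mem := ?_, mapsTo := ?_
    G_mem := ?_, F_G := ?_, G_F := ?_, measurable_G := ?_, continuousOn_G := ?_,
    dist_F_le := ?_, dist_le := ?_, contDiffAt := ?_, injective := ?_, tangentSpace_eq := ?_ }⟩
  · exact ((convex_closedBall _ _).inter hN.convex).linear_preimage (coordMap m d).toLinearMap
  · rw [hQball]
    exact (isCompact_closedBall _ _).inter_right (hN.isClosed.preimage (coordMap m d).continuous)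
  · rw [hQball]
    obtain ⟨w, hw⟩ := hN.nonempty_interior _ hqN r hr
    refine lt_of_lt_of_le ((isOpen_interior.inter Metric.isOpen_ball).measure_pos volume ⟨w, hw⟩)
      (measure_mono fun y hy => ⟨Metric.ball_subset_closedBall hy.2, interior_subset hy.1⟩)
  · exact Φ.isOpen_inter_preimage Metric.isOpen_ball
  · exact hpU
  · intro z hz
    have hz' := hB _ hz.1
    change Φ.symm (coordMap m d z) ∈ M
    rw [hMN _ (Φ.map_target hz'.2.2), Φ.right_inv hz'.2.2]
    exact hz.2
  · intro x hxM hxU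
    have hxN := (hMN x hxU.1).1 hxM
    rw [Set.piecewise_eq_of_mem _ _ _ hxU.1]
    change coordMap m d (coordMap d m (Φ x)) ∈ B ∩ N
    rw [coordMap_coordMap_of_mem (hN.subset hxN)]
    exact ⟨Metric.ball_subset_closedBall hxU.2, hxN⟩
  · intro x hxM hxU
    rw [Set.piecewise_eq_of_mem _ _ _ hxU.1]
    change Φ.symm (coordMap m d (coordMap d m (Φ x))) = x
    rw [coordMap_coordMap_of_mem (hN.subset ((hMN x hxU.1).1 hxM)), Φ.left_inv hxU.1]
  · intro z hz
    have hz' := hB _ hz.1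
    rw [Function.comp_apply, Set.piecewise_eq_of_mem _ _ _ (Φ.map_target hz'.2.2)]
    rw [Function.comp_apply, Φ.right_inv hz'.2.2, coordMap_coordMap hmd]
  · refine measurable_of_restrict_of_restrict_compl Φ.open_source.measurableSet ?_ ?_
    · rw [Set.domRestrict_piecewise]
      exact ((coordMap d m).continuous.comp_continuousOn
        Φ.continuousOn).domRestrict.measurable
    · rw [Set.domRestrict_piecewise_compl]
      exact measurable_const
  · refine ContinuousOn.congr (f := coordMap d m ∘ Φ) ?_ fun x hx =>
      Set.piecewise_eq_of_mem _ _ _ hx.1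
    exact (coordMap d m).continuous.comp_continuousOn (Φ.continuousOn.mono Set.inter_subset_left)
  · intro z hz w hw
    refine (hK₂.dist_le_mul _ (hB _ hz.1).1 _ (hB _ hw.1).1).trans ?_
    rw [dist_coordMap hmd]
    gcongr
    exact_mod_cast (le_max_right K₁ K₂).trans (le_max_right _ _)
  · intro z hz w hw
    have := hK₁.dist_le_mul _ (hB _ hz.1).2.1 _ (hB _ hw.1).2.1
    rw [Φ.right_inv (hB _ hz.1).2.2, Φ.right_inv (hB _ hw.1).2.2, dist_coordMap hmd] at this
    refine this.trans ?_
    change _ ≤ _ * dist (Φ.symm (coordMap m d z)) (Φ.symm (coordMap m d w))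
    gcongr
    exact_mod_cast (le_max_left K₁ K₂).trans (le_max_right _ _)
  · intro z hz
    exact (h.contDiffAt_symm (hB _ hz.1).2.2).comp z (coordMap m d).contDiff.contDiffAt
  · intro z hz
    rw [hFder z hz]
    intro a b hab
    have h1 : coordMap m d a = coordMap m d b := by
      have := congrArg (fderiv ℝ Φ (Φ.symm (coordMap m d z))) hab
      simpa [h.fderiv_fderiv_symm (hB _ hz.1).2.2] using this
    rw [← coordMap_coordMap hmd a, h1, coordMap_coordMap hmd]
  · intro z hz
    rw [hFder z hz]
    exact NonlocalPoisson.tangentSpace_eq h hMN hN (hB _ hz.1).2.2 hz.2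

/-! ### Interior and boundary points -/

section Boundary

variable {d m : ℕ} {M : Set (E d)}

lemma mem_flatModel_pred_iff (hm : 1 ≤ m) {z : E d} :
    z ∈ flatModel d (m - 1) ↔
      z ∈ halfModel d m ∧ ∀ i : Fin d, i.val + 1 = m → z i = 0 := by
  constructor
  · intro h
    exact ⟨⟨fun i hi => h i (by omega), fun i hi => (h i (by omega)).ge⟩,
      fun i hi => h i (by omega)⟩
  · rintro ⟨h1, h2⟩ i hi
    rcases Nat.lt_or_ge i.val m with h | h
    · exact h2 i (by omega)
    · exact h1.1 i h

/-- The one-sided tangent cone tells the two kinds of points apart: it is symmetric at an interior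
point, while at a boundary point it contains the inward vector `e` of the half space but not its
opposite. Here `e` is carried through one chart, negated in the other, and carried back. -/
lemma not_isBoundaryPoint_of_isInteriorPoint (hm : 1 ≤ m) (hmd : m ≤ d) {x : E d} (hxM : x ∈ M)
    (hx : IsInteriorPoint M m x) : ¬ IsBoundaryPoint M m x := by
  rintro ⟨Φ, hΦ, hxΦ, hΦM, hΦ0⟩
  obtain ⟨Ψ, hΨ, hxΨ, hΨM⟩ := hx
  let j : Fin d := ⟨m - 1, by omega⟩
  have hj : j.val + 1 = m := by simp [j]; omega
  let e : E d := EuclideanSpace.single j 1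
  have he : e ∈ halfModel d m := by
    refine ⟨fun i hi => ?_, fun i hi => ?_⟩
    · simp only [e, PiLp.single_apply]
      rw [if_neg]; rintro rfl; omega
    · simp only [e, PiLp.single_apply]
      split_ifs <;> norm_num
  have hxt := Φ.map_source hxΦ
  have hxt' := Ψ.map_source hxΨ
  have h1 := fderiv_symm_mem_tangentConeAt hΦ hΦM hxt (w := e)
    fun t ht => add_smul_mem_halfModel ((hΦM x hxΦ).1 hxM) he ht
  rw [Φ.left_inv hxΦ] at h1
  have h2 := fderiv_mem_flatModel hΨ hΨM subset_rfl hxΨ hxM (tangentConeAt_nnreal_subset x h1)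
  have h3 := fderiv_symm_mem_tangentConeAt hΨ hΨM hxt' (w := -(fderiv ℝ Ψ x (fderiv ℝ Φ.symm (Φ x) e)))
    fun t _ => (flatSubspace d m).add_mem ((hΨM x hxΨ).1 hxM)
      ((flatSubspace d m).smul_mem t ((flatSubspace d m).neg_mem h2))
  have h4 := hΨ.fderiv_symm_fderiv hxt' (fderiv ℝ Φ.symm (Φ x) e)
  rw [Ψ.left_inv hxΨ] at h3 h4
  rw [map_neg, h4] at h3
  have h5 := fderiv_mem_halfModel hΦ hΦM hxΦ hxM hΦ0 h3
  have h6 := hΦ.fderiv_fderiv_symm hxt e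
  rw [Φ.left_inv hxΦ] at h6
  rw [map_neg, h6] at h5
  have := h5.2 j hj
  simp [e] at this
  linarith

lemma IsLocalDiffeo.restrOpen {Φ : OpenPartialHomeomorph (E d) (E d)} (h : IsLocalDiffeo Φ)
    {s : Set (E d)} (hs : IsOpen s) : IsLocalDiffeo (Φ.restrOpen s hs) := by
  refine ⟨h.1.mono ?_, h.2.mono ?_⟩
  · rw [Φ.restrOpen_source]; exact Set.inter_subset_left
  · intro z hz
    exact hz.1

/-- In a boundary chart, the boundary is a flat piece of dimension `m - 1`. -/
lemma mem_bdry_iff (hm : 1 ≤ m) (hmd : m ≤ d) {Φ : OpenPartialHomeomorph (E d) (E d)}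
    (hΦ : IsLocalDiffeo Φ) (hΦM : ∀ y ∈ Φ.source, (y ∈ M ↔ Φ y ∈ halfModel d m)) {y : E d}
    (hy : y ∈ Φ.source) : y ∈ bdry M m ↔ Φ y ∈ flatModel d (m - 1) := by
  rw [mem_flatModel_pred_iff hm]
  constructor
  · rintro ⟨hyM, hyb⟩
    have hyh := (hΦM y hy).1 hyM
    refine ⟨hyh, ?_⟩
    by_contra hne
    push Not at hne
    obtain ⟨j, hj, hne⟩ := hne
    have hpos : 0 < Φ y j := lt_of_le_of_ne (hyh.2 j hj) (Ne.symm hne)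
    -- Where the last coordinate is positive the half slice and the full slice coincide, so the
    -- restricted chart makes `y` an interior point.
    refine not_isBoundaryPoint_of_isInteriorPoint hm hmd hyM ?_ hyb
    have hopen : IsOpen (Φ.source ∩ Φ ⁻¹' {z : E d | 0 < z j}) :=
      Φ.isOpen_inter_preimage (isOpen_lt continuous_const (continuous_coord j))
    refine ⟨Φ.restrOpen _ hopen, hΦ.restrOpen hopen, ?_, ?_⟩
    · rw [Φ.restrOpen_source]; exact ⟨hy, hy, hpos⟩
    · intro w hw
      rw [Φ.restrOpen_source] at hw
      change w ∈ M ↔ Φ w ∈ flatModel d m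
      rw [hΦM w hw.1]
      refine ⟨fun h => h.1, fun h => ⟨h, fun i hi => ?_⟩⟩
      have : i = j := Fin.ext (by omega)
      subst this
      exact le_of_lt hw.2.2
  · rintro ⟨h1, h2⟩
    exact ⟨(hΦM y hy).2 h1, Φ, hΦ, hy, hΦM, h2⟩

/-- An interior chart exhibits every point of `M` in its source as interior, so interior points form
a relatively open set. -/
lemma IsCompactSubmanifold.isClosed_bdry (hm : 1 ≤ m) (hmd : m ≤ d)
    (hM : IsCompactSubmanifold M m) : IsClosed (bdry M m) := by
  rw [← isOpen_compl_iff, isOpen_iff_mem_nhds]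
  intro x hx
  by_cases hxM : x ∈ M
  · rcases hM.locally_flat x hxM with h | h
    · obtain ⟨Φ, hΦ, hxΦ, hΦM⟩ := h
      filter_upwards [Φ.open_source.mem_nhds hxΦ] with y hy hyb
      exact not_isBoundaryPoint_of_isInteriorPoint hm hmd hyb.1 ⟨Φ, hΦ, hy, hΦM⟩ hyb.2
    · exact absurd ⟨hxM, h⟩ hx
  · filter_upwards [hM.isCompact.isClosed.isOpen_compl.mem_nhds hxM] with y hy hyb
    exact hy hyb.1

lemma IsCompactSubmanifold.isCompact_bdry (hm : 1 ≤ m) (hmd : m ≤ d)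
    (hM : IsCompactSubmanifold M m) : IsCompact (bdry M m) :=
  hM.isCompact.of_isClosed_subset (hM.isClosed_bdry hm hmd) fun _ h => h.1

lemma IsCompactSubmanifold.nonempty_chart (hm : 1 ≤ m) (hmd : m ≤ d)
    (hM : IsCompactSubmanifold M m) {p : E d} (hp : p ∈ M) : Nonempty (Chart M m p) := by
  rcases hM.locally_flat p hp with h | h
  · obtain ⟨Φ, hΦ, hxΦ, hΦM⟩ := h
    exact exists_chart hmd hΦ hΦM isModel_flatModel hxΦ hp
  · obtain ⟨Φ, hΦ, hxΦ, hΦM, -⟩ := h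
    exact exists_chart hmd hΦ hΦM (isModel_halfModel hm hmd) hxΦ hp

lemma nonempty_chart_bdry (hm : 1 ≤ m) (hmd : m ≤ d) {p : E d} (hp : p ∈ bdry M m) :
    Nonempty (Chart (bdry M m) (m - 1) p) := by
  obtain ⟨Φ, hΦ, hxΦ, hΦM, -⟩ := hp.2
  exact exists_chart (by omega) hΦ (fun y hy => mem_bdry_iff hm hmd hΦ hΦM hy)
    isModel_flatModel hxΦ hp

end Boundary

/-! ### Pseudo-inverses and projections onto the range -/

section Projection

variable {d m : ℕ}

/-- For injective `A`, the composition `A (A* A)⁻¹`. -/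
def pseudoInv (A : E m →L[ℝ] E d) : E m →L[ℝ] E d :=
  A.comp (ContinuousLinearMap.inverse ((ContinuousLinearMap.adjoint A).comp A))

lemma isInvertible_adjoint_comp {A : E m →L[ℝ] E d} (hA : Function.Injective A) :
    ((ContinuousLinearMap.adjoint A).comp A).IsInvertible := by
  have hinj : Function.Injective ((ContinuousLinearMap.adjoint A).comp A) := by
    rw [injective_iff_map_eq_zero]
    intro a ha
    have : inner ℝ (A a) (A a) = 0 := by
      rw [← ContinuousLinearMap.adjoint_inner_left]
      change inner ℝ (((ContinuousLinearMap.adjoint A).comp A) a) a = 0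
      rw [ha, inner_zero_left]
    exact (injective_iff_map_eq_zero A).1 hA a (inner_self_eq_zero.1 this)
  refine ⟨(LinearEquiv.ofInjectiveEndo _ hinj).toContinuousLinearEquiv, ?_⟩
  ext a
  rfl

lemma adjoint_pseudoInv {A : E m →L[ℝ] E d} (hA : Function.Injective A) (a : E m) :
    ContinuousLinearMap.adjoint A (pseudoInv A a) = a := by
  obtain ⟨e, he⟩ := isInvertible_adjoint_comp hA
  change ((ContinuousLinearMap.adjoint A).comp A)
    (ContinuousLinearMap.inverse ((ContinuousLinearMap.adjoint A).comp A) a) = a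
  rw [← he, ContinuousLinearMap.inverse_equiv]
  simp

/-- This makes `pseudoInv A (lastVec hm)` orthogonal to the images of the other coordinate
directions, that is, normal to the boundary within the tangent space. -/
lemma inner_pseudoInv {A : E m →L[ℝ] E d} (hA : Function.Injective A) (a b : E m) :
    inner ℝ (pseudoInv A a) (A b) = inner ℝ a b := by
  rw [← ContinuousLinearMap.adjoint_inner_left, adjoint_pseudoInv hA]

lemma pseudoInv_mem_range (A : E m →L[ℝ] E d) (a : E m) : pseudoInv A a ∈ A.range :=
  ⟨_, rfl⟩

lemma eq_pseudoInv {A : E m →L[ℝ] E d} (hA : Function.Injective A) {y : E d}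
    (hy : y ∈ A.range) : y = pseudoInv A (ContinuousLinearMap.adjoint A y) := by
  obtain ⟨a, rfl⟩ := hy
  obtain ⟨e, he⟩ := isInvertible_adjoint_comp hA
  change A a = A (ContinuousLinearMap.inverse ((ContinuousLinearMap.adjoint A).comp A)
    (((ContinuousLinearMap.adjoint A).comp A) a))
  rw [← he, ContinuousLinearMap.inverse_equiv]
  simp

lemma pseudoInv_ne_zero {A : E m →L[ℝ] E d} (hA : Function.Injective A) {a : E m} (ha : a ≠ 0) :
    pseudoInv A a ≠ 0 := by
  intro h
  have := adjoint_pseudoInv hA a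
  rw [h, map_zero] at this
  exact ha this.symm

/-- The formula `A (A* A)⁻¹ A*` shows that the projection depends continuously on an injective `A`.
-/
lemma starProjection_range {A : E m →L[ℝ] E d} (hA : Function.Injective A) :
    A.range.starProjection = (pseudoInv A).comp (ContinuousLinearMap.adjoint A) := by
  ext1 v
  refine Submodule.eq_starProjection_of_mem_of_inner_eq_zero (pseudoInv_mem_range A _) ?_
  rintro _ ⟨b, rfl⟩
  change inner ℝ (v - pseudoInv A (ContinuousLinearMap.adjoint A v)) (A b) = 0
  rw [inner_sub_left, inner_pseudoInv hA, ContinuousLinearMap.adjoint_inner_left, sub_self]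

lemma continuousAt_pseudoInv {A : E m →L[ℝ] E d} (hA : Function.Injective A) :
    ContinuousAt (pseudoInv (d := d) (m := m)) A := by
  have hadj : Continuous fun A : E m →L[ℝ] E d => ContinuousLinearMap.adjoint A :=
    (ContinuousLinearMap.adjoint (𝕜 := ℝ) (E := E m) (F := E d)).continuous
  have h1 : ContinuousAt (fun A : E m →L[ℝ] E d => (ContinuousLinearMap.adjoint A).comp A) A :=
    (hadj.clm_comp continuous_id).continuousAt
  have h2 : ContinuousAt ContinuousLinearMap.inverse ((ContinuousLinearMap.adjoint A).comp A) := by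
    exact ((isInvertible_adjoint_comp hA).contDiffAt_map_inverse (n := 0)).continuousAt
  exact continuousAt_id.clm_comp (ContinuousAt.comp (f := fun A : E m →L[ℝ] E d =>
    (ContinuousLinearMap.adjoint A).comp A) h2 h1)

end Projection

/-! ### Continuity of the tangent planes -/

section Tangential

variable {d m : ℕ} {M : Set (E d)}

lemma starProjection_congr {K K' : Submodule ℝ (E d)} (h : K = K') :
    K.starProjection = K'.starProjection := by subst h; rfl

lemma Chart.continuousAt_fderiv {p : E d} (c : Chart M m p) {z : E m} (hz : z ∈ c.Q) :
    ContinuousAt (fderiv ℝ c.F) z :=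
  ((c.contDiffAt z hz).fderiv_right (m := 0) (by simp)).continuousAt

/-- Needed so that the tangential gradient of a `C¹` function is continuous on `M`, hence square
integrable. -/
lemma IsCompactSubmanifold.continuousOn_starProjection (hm : 1 ≤ m) (hmd : m ≤ d)
    (hM : IsCompactSubmanifold M m) :
    ContinuousOn (fun x => (tangentSpace M x).starProjection) M := by
  intro x hx
  obtain ⟨c⟩ := hM.nonempty_chart hm hmd hx
  have hU := c.isOpen.mem_nhds c.mem
  have hQ := c.G_mem x hx c.mem
  have hA : ContinuousWithinAt (fun y => fderiv ℝ c.F (c.G y)) M x :=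
    (c.continuousAt_fderiv hQ).comp_continuousWithinAt
      (c.continuousOn_G.continuousAt hU).continuousWithinAt
  have hinj := c.injective _ hQ
  have key : ContinuousWithinAt (fun y => (pseudoInv (fderiv ℝ c.F (c.G y))).comp
      (ContinuousLinearMap.adjoint (fderiv ℝ c.F (c.G y)))) M x := by
    refine ContinuousWithinAt.clm_comp ?_ ?_
    · exact (continuousAt_pseudoInv hinj).comp_continuousWithinAt
        (f := fun y => fderiv ℝ c.F (c.G y)) hA
    · exact ((ContinuousLinearMap.adjoint (𝕜 := ℝ) (E := E m)
        (F := E d)).continuous.continuousAt).comp_continuousWithinAt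
        (f := fun y => fderiv ℝ c.F (c.G y)) hA
  have heq : ∀ y ∈ M, y ∈ c.U → (tangentSpace M y).starProjection =
      (pseudoInv (fderiv ℝ c.F (c.G y))).comp
        (ContinuousLinearMap.adjoint (fderiv ℝ c.F (c.G y))) := by
    intro y hy hyU
    have h1 := c.tangentSpace_eq _ (c.G_mem y hy hyU)
    rw [c.F_G y hy hyU] at h1
    rw [starProjection_congr h1, starProjection_range (c.injective _ (c.G_mem y hy hyU))]
  refine key.congr_of_eventuallyEq ?_ (heq x hx c.mem)
  filter_upwards [self_mem_nhdsWithin, mem_nhdsWithin_of_mem_nhds hU] with y hy hyU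
  exact heq y hy hyU

end Tangential

/-! ### The outward unit normal -/

section Normal

variable {d m : ℕ} {M : Set (E d)} {Φ : OpenPartialHomeomorph (E d) (E d)}

/-- The differential at `x` of the parametrization of `M` given by a straightening. -/
def paramDeriv (m : ℕ) (Φ : OpenPartialHomeomorph (E d) (E d)) (x : E d) : E m →L[ℝ] E d :=
  (fderiv ℝ Φ.symm (Φ x)).comp (coordMap m d)

lemma injective_paramDeriv (hmd : m ≤ d) (hΦ : IsLocalDiffeo Φ) {x : E d} (hx : x ∈ Φ.source) :
    Function.Injective (paramDeriv m Φ x) := by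
  intro a b hab
  have h1 : coordMap m d a = coordMap m d b := by
    have := congrArg (fderiv ℝ Φ (Φ.symm (Φ x))) hab
    simpa [paramDeriv, hΦ.fderiv_fderiv_symm (Φ.map_source hx)] using this
  rw [← coordMap_coordMap hmd a, h1, coordMap_coordMap hmd]

lemma continuousAt_paramDeriv (hΦ : IsLocalDiffeo Φ) {x : E d} (hx : x ∈ Φ.source) :
    ContinuousAt (paramDeriv m Φ) x := by
  have h1 : ContinuousAt (fun y => fderiv ℝ Φ.symm (Φ y)) x :=
    ContinuousAt.comp (f := Φ) (((hΦ.contDiffAt_symm (Φ.map_source hx)).fderiv_right (m := 0)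
      (by simp)).continuousAt) (Φ.continuousAt hx)
  exact h1.clm_comp continuousAt_const

/-- The last unit vector of `ℝ^m`. -/
def lastVec (hm : 1 ≤ m) : E m := EuclideanSpace.single ⟨m - 1, by omega⟩ 1

lemma inner_lastVec (hm : 1 ≤ m) (w : E m) :
    inner ℝ (lastVec hm) w = w ⟨m - 1, by omega⟩ := by
  rw [lastVec, EuclideanSpace.inner_single_left]; simp

lemma lastVec_ne_zero (hm : 1 ≤ m) : lastVec hm ≠ 0 := by
  intro h
  have := inner_lastVec hm (lastVec hm)
  rw [h, inner_zero_left] at this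
  rw [← h] at this
  simp [lastVec] at this

/-- The outward unit normal in terms of the straightening. -/
def chartNormal (hm : 1 ≤ m) (Φ : OpenPartialHomeomorph (E d) (E d)) (x : E d) : E d :=
  -(‖pseudoInv (paramDeriv m Φ x) (lastVec hm)‖⁻¹ • pseudoInv (paramDeriv m Φ x) (lastVec hm))

/-- A tangent vector `n` is determined by `a = A* n`. The sign condition on one-sided directions
says `a · w ≤ 0` for all `w` in the half space, which forces `a` to be a nonpositive multiple of the
last unit vector; the unit length fixes the multiple. This uniqueness identifies the normal picked
by `Classical.epsilon`. -/
lemma isOutwardNormal_iff (hm : 1 ≤ m) (hmd : m ≤ d) (hΦ : IsLocalDiffeo Φ)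
    (hΦM : ∀ y ∈ Φ.source, (y ∈ M ↔ Φ y ∈ halfModel d m)) {x : E d} (hx : x ∈ Φ.source)
    (hxM : x ∈ M) (hx0 : ∀ i : Fin d, i.val + 1 = m → Φ x i = 0) (n : E d) :
    IsOutwardNormal M x n ↔ n = chartNormal hm Φ x := by
  have hxt := Φ.map_source hx
  have hhalf := (hΦM x hx).1 hxM
  have htan := NonlocalPoisson.tangentSpace_eq hΦ hΦM (isModel_halfModel hm hmd) hxt hhalf
  rw [Φ.left_inv hx] at htan
  change tangentSpace M x = (paramDeriv m Φ x).range at htan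
  set A := paramDeriv m Φ x with hA
  have hinj : Function.Injective A := injective_paramDeriv hmd hΦ hx
  set N := pseudoInv A (lastVec hm) with hN
  have hN0 : 0 < ‖N‖ := norm_pos_iff.2 (pseudoInv_ne_zero hinj (lastVec_ne_zero hm))
  let j : Fin m := ⟨m - 1, by omega⟩
  change _ ↔ n = -(‖N‖⁻¹ • N)
  constructor
  · rintro ⟨h1, h2, h3⟩
    rw [htan] at h1
    have hn := eq_pseudoInv hinj h1
    set a := ContinuousLinearMap.adjoint A n with ha
    have hle : ∀ w : E m, 0 ≤ w j → inner ℝ a w ≤ 0 := by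
      intro w hw
      have hwh : coordMap m d w ∈ halfModel d m := by
        refine ⟨coordMap_mem_flatModel w, fun i hi => ?_⟩
        rw [coordMap_apply, dif_pos (by omega)]
        have : (⟨i.val, by omega⟩ : Fin m) = j := Fin.ext (by simp [j]; omega)
        rw [this]; exact hw
      have hmem := fderiv_symm_mem_tangentConeAt hΦ hΦM hxt (w := coordMap m d w)
        fun t ht => add_smul_mem_halfModel hhalf hwh ht
      rw [Φ.left_inv hx] at hmem
      rw [ha, ContinuousLinearMap.adjoint_inner_left]
      exact h3 _ hmem
    -- Both `e_i` and `-e_i` lie in the half space for `i ≠ j`, so those coordinates of `a` vanish.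
    have haj : a = a j • lastVec hm := by
      ext i
      by_cases hij : i = j
      · subst hij
        simp [lastVec, j]
      · have hp := hle (EuclideanSpace.single i 1) (by simp [Ne.symm hij])
        have hq := hle (-EuclideanSpace.single i 1) (by simp [Ne.symm hij])
        rw [inner_neg_right] at hq
        rw [EuclideanSpace.inner_single_right] at hp hq
        simp only [one_mul, conj_trivial] at hp hq
        have hz : a i = 0 := by linarith
        rw [hz]
        simp only [lastVec, PiLp.smul_apply, PiLp.single_apply, smul_eq_mul]
        rw [if_neg hij, mul_zero]
    have hajle : a j ≤ 0 := by
      have := hle (lastVec hm) (by simp [lastVec, j])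
      rwa [real_inner_comm, inner_lastVec] at this
    rw [haj, map_smul, ← hN] at hn
    rw [hn, norm_smul, Real.norm_eq_abs, abs_of_nonpos hajle] at h2
    rw [hn, ← neg_smul]
    congr 1
    field_simp
    linarith
  · rintro rfl
    refine ⟨?_, ?_, ?_⟩
    · rw [htan]
      exact Submodule.neg_mem _ (Submodule.smul_mem _ _ (pseudoInv_mem_range A _))
    · rw [norm_neg, norm_smul, norm_inv, norm_norm, inv_mul_cancel₀ hN0.ne']
    · intro w hw
      have hwh := fderiv_mem_halfModel hΦ hΦM hx hxM hx0 hw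
      have hwA : w = A (coordMap d m (fderiv ℝ Φ x w)) := by
        have := hΦ.fderiv_symm_fderiv hxt w
        rw [Φ.left_inv hx] at this
        change w = fderiv ℝ Φ.symm (Φ x) (coordMap m d (coordMap d m _))
        rw [coordMap_coordMap_of_mem hwh.1, this]
      rw [inner_neg_left, real_inner_smul_left, hwA, hN, inner_pseudoInv hinj, inner_lastVec]
      rw [neg_nonpos]
      have : 0 ≤ coordMap d m (fderiv ℝ Φ x w) j := by
        rw [coordMap_apply, dif_pos (by simp [j]; omega)]
        exact hwh.2 _ (by simp [j]; omega)
      exact mul_nonneg (inv_nonneg.2 (norm_nonneg _)) this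

lemma outwardNormal_eq (hm : 1 ≤ m) (hmd : m ≤ d) (hΦ : IsLocalDiffeo Φ)
    (hΦM : ∀ y ∈ Φ.source, (y ∈ M ↔ Φ y ∈ halfModel d m)) {x : E d} (hx : x ∈ Φ.source)
    (hxb : x ∈ bdry M m) : outwardNormal M x = chartNormal hm Φ x := by
  have h := (mem_flatModel_pred_iff hm).1 ((mem_bdry_iff hm hmd hΦ hΦM hx).1 hxb)
  have hiff := isOutwardNormal_iff hm hmd hΦ hΦM hx hxb.1 h.2
  exact (hiff _).1 (Classical.epsilon_spec (p := IsOutwardNormal M x) ⟨_, (hiff _).2 rfl⟩)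

lemma isOutwardNormal_outwardNormal (hm : 1 ≤ m) (hmd : m ≤ d) {x : E d}
    (hxb : x ∈ bdry M m) : IsOutwardNormal M x (outwardNormal M x) := by
  obtain ⟨Φ, hΦ, hx, hΦM, hx0⟩ := hxb.2
  have hiff := isOutwardNormal_iff hm hmd hΦ hΦM hx hxb.1 hx0
  exact (hiff _).2 (outwardNormal_eq hm hmd hΦ hΦM hx hxb)

lemma continuousAt_chartNormal (hm : 1 ≤ m) (hmd : m ≤ d) (hΦ : IsLocalDiffeo Φ) {x : E d}
    (hx : x ∈ Φ.source) : ContinuousAt (chartNormal (m := m) hm Φ) x := by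
  have hinj := injective_paramDeriv hmd hΦ hx
  have h1 : ContinuousAt (fun y => pseudoInv (paramDeriv m Φ y) (lastVec hm)) x :=
    (ContinuousAt.comp (f := paramDeriv m Φ) (continuousAt_pseudoInv hinj)
      (continuousAt_paramDeriv hΦ hx)).clm_apply continuousAt_const
  exact ((h1.norm.inv₀ (norm_ne_zero_iff.2
    (pseudoInv_ne_zero hinj (lastVec_ne_zero hm)))).smul h1).neg

lemma continuousOn_outwardNormal (hm : 1 ≤ m) (hmd : m ≤ d) :
    ContinuousOn (outwardNormal M) (bdry M m) := by
  intro x hxb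
  obtain ⟨Φ, hΦ, hx, hΦM, hx0⟩ := hxb.2
  refine (continuousAt_chartNormal hm hmd hΦ hx).continuousWithinAt.congr_of_eventuallyEq ?_
    (outwardNormal_eq hm hmd hΦ hΦM hx hxb)
  filter_upwards [self_mem_nhdsWithin, mem_nhdsWithin_of_mem_nhds (Φ.open_source.mem_nhds hx)]
    with y hy hyΦ
  exact outwardNormal_eq hm hmd hΦ hΦM hyΦ hy

/-- Orthogonality to the boundary is what removes the tangential term when the curvature is computed
in two parametrizations. -/
lemma inner_outwardNormal_paramDeriv (hm : 1 ≤ m) (hmd : m ≤ d) (hΦ : IsLocalDiffeo Φ)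
    (hΦM : ∀ y ∈ Φ.source, (y ∈ M ↔ Φ y ∈ halfModel d m)) {x : E d} (hx : x ∈ Φ.source)
    (hxb : x ∈ bdry M m) (w : E (m - 1)) :
    inner ℝ (outwardNormal M x) (paramDeriv (m - 1) Φ x w) = 0 := by
  have hinj := injective_paramDeriv hmd hΦ hx
  have hw : coordMap (m - 1) d w = coordMap m d (coordMap d m (coordMap (m - 1) d w)) := by
    rw [coordMap_coordMap_of_mem]
    exact fun i hi => coordMap_mem_flatModel w i (by omega)
  have hpd : paramDeriv (m - 1) Φ x w =
      paramDeriv m Φ x (coordMap d m (coordMap (m - 1) d w)) := by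
    change fderiv ℝ Φ.symm (Φ x) (coordMap (m - 1) d w) = _
    conv_lhs => rw [hw]
    rfl
  rw [outwardNormal_eq hm hmd hΦ hΦM hx hxb, chartNormal, inner_neg_left, real_inner_smul_left,
    hpd, inner_pseudoInv hinj, inner_lastVec, coordMap_apply, dif_pos (by simp; omega),
    coordMap_apply, dif_neg (by simp), mul_zero, neg_zero]

end Normal

/-! ### The curvature and its independence of the parametrization -/

section Curvature

variable {d k : ℕ}

/-- The trace `∑ h^{ij} l_{ij}` for the parametrization `Ψ`. -/
def paramCurvature (Ψ : E k → E d) (n : E d) (s : E k) : ℝ :=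
  ∑ i, ∑ j, (firstForm Ψ s)⁻¹ i j * secondForm Ψ n s i j

lemma sum_mul_eq_trace (X Y : Matrix (Fin k) (Fin k) ℝ) :
    ∑ i, ∑ j, X i j * Y i j = (X * Y.transpose).trace := by
  simp [Matrix.trace, Matrix.mul_apply, Matrix.diag]

/-- The same congruence by `T` on both forms conjugates `X⁻¹ Yᵀ` by `T`, and the trace ignores
conjugation. -/
lemma trace_inv_congr (T X Y : Matrix (Fin k) (Fin k) ℝ) (hT : IsUnit T) :
    ((T.transpose * X * T)⁻¹ * (T.transpose * Y * T).transpose).trace =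
      (X⁻¹ * Y.transpose).trace := by
  have hd : IsUnit T.det := (Matrix.isUnit_iff_isUnit_det T).1 hT
  have hdt : IsUnit T.transpose.det := by rwa [Matrix.det_transpose]
  rw [Matrix.mul_inv_rev, Matrix.mul_inv_rev, Matrix.transpose_mul, Matrix.transpose_mul,
    Matrix.transpose_transpose]
  have : T⁻¹ * (X⁻¹ * T.transpose⁻¹) * (T.transpose * (Y.transpose * T)) =
      T⁻¹ * (X⁻¹ * Y.transpose) * T := by
    calc _ = T⁻¹ * X⁻¹ * (T.transpose⁻¹ * T.transpose) * Y.transpose * T := by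
          simp only [Matrix.mul_assoc]
      _ = _ := by rw [Matrix.nonsing_inv_mul _ hdt, Matrix.mul_one]; simp only [Matrix.mul_assoc]
  rw [this, Matrix.trace_mul_cycle, Matrix.mul_nonsing_inv _ hd, Matrix.one_mul]

/-- The matrix of a linear endomorphism of `ℝ^k`. -/
def endoMatrix (T : E k →L[ℝ] E k) : Matrix (Fin k) (Fin k) ℝ :=
  Matrix.of fun a i => T (EuclideanSpace.single i 1) a

lemma sum_single (v : E k) : v = ∑ a, v a • (EuclideanSpace.single a 1 : E k) := by
  ext i
  simp [Pi.single_apply]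

lemma isUnit_endoMatrix {T : E k →L[ℝ] E k} (hT : Function.Injective T) :
    IsUnit (endoMatrix T) := by
  rw [← Matrix.mulVec_injective_iff_isUnit]
  have key : ∀ v : Fin k → ℝ, (endoMatrix T).mulVec v = (T (WithLp.toLp 2 v)).ofLp := by
    intro v
    conv_rhs => rw [sum_single (WithLp.toLp 2 v)]
    ext a
    simp [Matrix.mulVec, dotProduct, endoMatrix, map_sum, mul_comm]
  intro v w hvw
  rw [key, key] at hvw
  have := hT (WithLp.ofLp_injective 2 hvw)
  exact WithLp.toLp_injective 2 this

lemma bilin_endoMatrix (B : E k →ₗ[ℝ] E k →ₗ[ℝ] ℝ) (T : E k →L[ℝ] E k) :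
    (Matrix.of fun i j => B (T (EuclideanSpace.single i 1)) (T (EuclideanSpace.single j 1))) =
      (endoMatrix T).transpose *
        (Matrix.of fun a b => B (EuclideanSpace.single a 1) (EuclideanSpace.single b 1)) *
        endoMatrix T := by
  ext i j
  rw [Matrix.of_apply, sum_single (T (EuclideanSpace.single i 1)),
    sum_single (T (EuclideanSpace.single j 1))]
  simp only [map_sum, map_smul, LinearMap.sum_apply, LinearMap.smul_apply, smul_eq_mul,
    Matrix.mul_apply, Matrix.transpose_apply, Matrix.of_apply, endoMatrix, Finset.sum_mul]
  rw [Finset.sum_congr rfl fun b _ => Finset.mul_sum _ _ _]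
  refine Finset.sum_congr rfl fun b _ => Finset.sum_congr rfl fun a _ => ?_
  ring

/-- The second derivatives of `θ` contribute only a vector in the range of `DF`. Its value is left
unspecified because the normal annihilates it. -/
lemma partialDeriv_partialDeriv_comp {F : E k → E d} {θ : E k → E k} {Ψ : E k → E d} {s : E k}
    (hF : ContDiffAt ℝ ∞ F (θ s)) (hθ : ContDiffAt ℝ ∞ θ s) (hΨ : Ψ =ᶠ[𝓝 s] F ∘ θ)
    (i j : Fin k) : ∃ w : E k, partialDeriv (partialDeriv Ψ j) i s =
      fderiv ℝ (fderiv ℝ F) (θ s) (fderiv ℝ θ s (EuclideanSpace.single i 1))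
        (fderiv ℝ θ s (EuclideanSpace.single j 1)) + fderiv ℝ F (θ s) w := by
  have hFd : ∀ᶠ z in 𝓝 (θ s), DifferentiableAt ℝ F z :=
    ((hF.of_le (m := 1) (by simp)).eventually (by simp)).mono
      fun z hz => hz.differentiableAt (by simp)
  have hθd : ∀ᶠ z in 𝓝 s, DifferentiableAt ℝ θ z :=
    ((hθ.of_le (m := 1) (by simp)).eventually (by simp)).mono
      fun z hz => hz.differentiableAt (by simp)
  have h1 : partialDeriv Ψ j =ᶠ[𝓝 s] fun w => fderiv ℝ F (θ w)
      (fderiv ℝ θ w (EuclideanSpace.single j 1)) := by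
    filter_upwards [hΨ.eventuallyEq_nhds, hθ.continuousAt.eventually hFd, hθd] with w hw h2 h3
    rw [partialDeriv, hw.fderiv_eq, fderiv_comp _ h2 h3]
    rfl
  have hF2 : DifferentiableAt ℝ (fderiv ℝ F) (θ s) :=
    (hF.fderiv_right (m := ∞) (by simp)).differentiableAt (by simp)
  have hθ2 : DifferentiableAt ℝ (fderiv ℝ θ) s :=
    (hθ.fderiv_right (m := ∞) (by simp)).differentiableAt (by simp)
  have hc := hF2.hasFDerivAt.comp s (hθ.differentiableAt (by simp)).hasFDerivAt
  have hu := hθ2.hasFDerivAt.clm_apply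
    (hasFDerivAt_const (EuclideanSpace.single j (1 : ℝ) : E k) s)
  have := hc.clm_apply hu
  rw [partialDeriv, h1.fderiv_eq]
  rw [show (fun w => fderiv ℝ F (θ w) (fderiv ℝ θ w (EuclideanSpace.single j 1))) =
    fun w => (fderiv ℝ F ∘ θ) w (fderiv ℝ θ w (EuclideanSpace.single j 1)) from rfl, this.fderiv]
  refine ⟨fderiv ℝ (fderiv ℝ θ) s (EuclideanSpace.single i 1) (EuclideanSpace.single j 1), ?_⟩
  simp [add_comm]

/-- The curvature does not depend on the parametrization. -/
lemma paramCurvature_comp {F : E k → E d} {θ : E k → E k} {Ψ : E k → E d} {s : E k} {n : E d}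
    (hF : ContDiffAt ℝ ∞ F (θ s)) (hn : ∀ w, inner ℝ n (fderiv ℝ F (θ s) w) = 0)
    (hθ : ContDiffAt ℝ ∞ θ s) (hΨ : Ψ =ᶠ[𝓝 s] F ∘ θ)
    (hinj : Function.Injective (fderiv ℝ Ψ s)) :
    paramCurvature Ψ n s = paramCurvature F n (θ s) := by
  set T := fderiv ℝ θ s with hT
  set A := fderiv ℝ F (θ s) with hA
  have hΨA : fderiv ℝ Ψ s = A.comp T := by
    rw [hΨ.fderiv_eq, fderiv_comp _ (hF.differentiableAt (by simp))
      (hθ.differentiableAt (by simp))]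
  have hTinj : Function.Injective T := by
    intro a b hab
    refine hinj ?_
    rw [hΨA]
    change A (T a) = A (T b)
    rw [hab]
  let B₁ : E k →ₗ[ℝ] E k →ₗ[ℝ] ℝ := LinearMap.mk₂ ℝ (fun a b => inner ℝ (A a) (A b))
    (fun a b c => by simp [inner_add_left]) (fun c a b => by simp [inner_smul_left])
    (fun a b c => by simp [inner_add_right]) (fun c a b => by simp [inner_smul_right])
  let B₂ : E k →ₗ[ℝ] E k →ₗ[ℝ] ℝ := LinearMap.mk₂ ℝ
    (fun a b => inner ℝ (fderiv ℝ (fderiv ℝ F) (θ s) a b) n)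
    (fun a b c => by simp [inner_add_left]) (fun c a b => by simp [inner_smul_left])
    (fun a b c => by simp [inner_add_left]) (fun c a b => by simp [inner_smul_left])
  have hF1 : firstForm F (θ s) =
      Matrix.of fun a b => B₁ (EuclideanSpace.single a 1) (EuclideanSpace.single b 1) := rfl
  have hΨ1 : firstForm Ψ s = Matrix.of fun i j =>
      B₁ (T (EuclideanSpace.single i 1)) (T (EuclideanSpace.single j 1)) := by
    ext i j
    simp only [firstForm, partialDeriv, hΨA, Matrix.of_apply]
    rfl
  have hΨ2 : secondForm Ψ n s = Matrix.of fun i j =>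
      B₂ (T (EuclideanSpace.single i 1)) (T (EuclideanSpace.single j 1)) := by
    ext i j
    obtain ⟨w, hw⟩ := partialDeriv_partialDeriv_comp hF hθ hΨ i j
    simp only [secondForm, Matrix.of_apply, hw, inner_add_left]
    rw [real_inner_comm, real_inner_comm n (fderiv ℝ F (θ s) w), hn w, add_zero]
    rw [real_inner_comm]
    rfl
  have hF2 : secondForm F n (θ s) =
      Matrix.of fun a b => B₂ (EuclideanSpace.single a 1) (EuclideanSpace.single b 1) := by
    ext i j
    -- The case of the identity change of variables expresses the iterated partial derivatives of
    -- `F` through its second derivative.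
    obtain ⟨w, hw⟩ := partialDeriv_partialDeriv_comp (θ := id) (s := θ s) (Ψ := F) hF contDiffAt_id
      (Eventually.of_forall fun _ => rfl) i j
    simp only [secondForm, Matrix.of_apply, hw, inner_add_left, fderiv_id, id]
    rw [real_inner_comm, real_inner_comm n (fderiv ℝ F (θ s) w), hn w, add_zero]
    rw [real_inner_comm]
    rfl
  rw [paramCurvature, paramCurvature, sum_mul_eq_trace, sum_mul_eq_trace, hΨ1, hΨ2, hF1, hF2,
    bilin_endoMatrix B₁ T, bilin_endoMatrix B₂ T, trace_inv_congr _ _ _ (isUnit_endoMatrix hTinj)]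

/-- The quadratic form of the matrix at `v` is `|DF v|²`, positive for `v ≠ 0`. -/
lemma isUnit_firstForm {F : E k → E d} {z : E k} (hinj : Function.Injective (fderiv ℝ F z)) :
    IsUnit (firstForm F z) := by
  rw [← Matrix.mulVec_injective_iff_isUnit]
  have key : ∀ v : Fin k → ℝ, v ⬝ᵥ (firstForm F z).mulVec v =
      inner ℝ (fderiv ℝ F z (WithLp.toLp 2 v)) (fderiv ℝ F z (WithLp.toLp 2 v)) := by
    intro v
    conv_rhs => rw [sum_single (WithLp.toLp 2 v)]
    simp only [dotProduct, Matrix.mulVec, firstForm, Matrix.of_apply, partialDeriv, map_sum,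
      map_smul, sum_inner, inner_sum, inner_smul_left, inner_smul_right, conj_trivial,
      Finset.mul_sum]
    rw [Finset.sum_comm]
    refine Finset.sum_congr rfl fun i _ => Finset.sum_congr rfl fun j _ => ?_
    rw [real_inner_comm]; ring
  intro v w hvw
  have h0 : (firstForm F z).mulVec (v - w) = 0 := by rw [Matrix.mulVec_sub, hvw, sub_self]
  have h1 := key (v - w)
  rw [h0, dotProduct_zero] at h1
  have h2 := inner_self_eq_zero.1 h1.symm
  have h3 := (injective_iff_map_eq_zero (fderiv ℝ F z)).1 hinj _ h2
  exact sub_eq_zero.1 (WithLp.toLp_injective 2 h3)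

lemma continuousAt_matrix_inv {X : Matrix (Fin k) (Fin k) ℝ} (hX : IsUnit X) :
    ContinuousAt (fun Y : Matrix (Fin k) (Fin k) ℝ => Y⁻¹) X := by
  have hd : X.det ≠ 0 := ((Matrix.isUnit_iff_isUnit_det X).1 hX).ne_zero
  simp only [Matrix.inv_def, Ring.inverse_eq_inv']
  exact ((continuous_id.matrix_det.continuousAt).inv₀ hd).smul
    continuous_id.matrix_adjugate.continuousAt

/-- Joint continuity of the curvature of a parametrization in the point and the normal. -/
lemma continuousAt_paramCurvature {F : E k → E d} {z : E k} {n : E d} (hF : ContDiffAt ℝ ∞ F z)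
    (hinj : Function.Injective (fderiv ℝ F z)) :
    ContinuousAt (fun q : E k × E d => paramCurvature F q.2 q.1) (z, n) := by
  have hp : ∀ i, ContDiffAt ℝ ∞ (partialDeriv F i) z := fun i =>
    (hF.fderiv_right (m := ∞) (by simp)).clm_apply contDiffAt_const
  have hpp : ∀ i j, ContinuousAt (partialDeriv (partialDeriv F j) i) z := fun i j =>
    (((hp j).fderiv_right (m := ∞) (by simp)).clm_apply contDiffAt_const).continuousAt
  have hfst : ContinuousAt (Prod.fst : E k × E d → E k) (z, n) := continuousAt_fst
  have h1 : ContinuousAt (fun q : E k × E d => firstForm F q.1) (z, n) := by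
    refine continuousAt_pi.2 fun i => continuousAt_pi.2 fun j => ?_
    exact (ContinuousAt.comp (f := Prod.fst) (hp i).continuousAt hfst).inner (𝕜 := ℝ)
      (ContinuousAt.comp (f := Prod.fst) (hp j).continuousAt hfst)
  have h2 : ContinuousAt (fun q : E k × E d => (firstForm F q.1)⁻¹) (z, n) :=
    ContinuousAt.comp (f := fun q : E k × E d => firstForm F q.1)
      (continuousAt_matrix_inv (isUnit_firstForm hinj)) h1
  refine tendsto_finsetSum _ fun i _ => tendsto_finsetSum _ fun j _ => ?_
  refine ContinuousAt.mul ?_ ?_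
  · exact continuousAt_pi.1 (continuousAt_pi.1 h2 i) j
  · exact (ContinuousAt.comp (f := Prod.fst) (hpp i j) hfst).inner (𝕜 := ℝ) continuousAt_snd

end Curvature

section Curvature

variable {d m : ℕ} {M : Set (E d)} {Φ : OpenPartialHomeomorph (E d) (E d)}

/-- Every local parametrization of the boundary near `x` factors through the straightened one, with
change of variables `coordMap d k ∘ Φ ∘ Ψ`. So the parametrization chosen by `Classical.epsilon`
gives the same number. -/
lemma curvature_eq (hm : 1 ≤ m) (hmd : m ≤ d) (hΦ : IsLocalDiffeo Φ)
    (hΦM : ∀ y ∈ Φ.source, (y ∈ M ↔ Φ y ∈ halfModel d m)) {x : E d} (hx : x ∈ Φ.source)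
    (hxb : x ∈ bdry M m) : curvature M m x =
      paramCurvature (Φ.symm ∘ coordMap (m - 1) d) (outwardNormal M x)
        (coordMap d (m - 1) (Φ x)) := by
  set k := m - 1 with hk
  have hb := fun y hy => mem_bdry_iff hm hmd hΦ hΦM (y := y) hy
  have hxt := Φ.map_source hx
  have hz : coordMap k d (coordMap d k (Φ x)) = Φ x :=
    coordMap_coordMap_of_mem ((hb x hx).1 hxb)
  have hF : ContDiffAt ℝ ∞ (Φ.symm ∘ coordMap k d) (coordMap d k (Φ x)) := by
    refine ContDiffAt.comp _ ?_ (coordMap k d).contDiff.contDiffAt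
    rw [hz]; exact hΦ.contDiffAt_symm hxt
  have hFd : fderiv ℝ (Φ.symm ∘ coordMap k d) (coordMap d k (Φ x)) = paramDeriv k Φ x := by
    have h1 : HasFDerivAt Φ.symm (fderiv ℝ Φ.symm (Φ x)) (coordMap k d (coordMap d k (Φ x))) := by
      rw [hz]; exact hΦ.hasFDerivAt_symm hxt
    exact (h1.comp _ (coordMap k d).hasFDerivAt).fderiv
  have hn : ∀ w, inner ℝ (outwardNormal M x)
      (fderiv ℝ (Φ.symm ∘ coordMap k d) (coordMap d k (Φ x)) w) = 0 := by
    intro w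
    rw [hFd]
    exact inner_outwardNormal_paramDeriv hm hmd hΦ hΦM hx hxb w
  have hparam : IsLocalParam (bdry M m) k (Φ.symm ∘ coordMap k d) (coordMap d k (Φ x)) := by
    refine ⟨hF, ?_, ?_⟩
    · have : ∀ᶠ w in 𝓝 (coordMap d k (Φ x)), coordMap k d w ∈ Φ.target := by
        refine (coordMap k d).continuous.continuousAt.eventually ?_
        rw [hz]
        exact Φ.open_target.mem_nhds hxt
      filter_upwards [this] with w hw
      change Φ.symm (coordMap k d w) ∈ _
      rw [hb _ (Φ.map_target hw), Φ.right_inv hw]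
      exact coordMap_mem_flatModel w
    · rw [hFd]
      exact injective_paramDeriv (by omega) hΦ hx
  have hFx : (Φ.symm ∘ coordMap k d) (coordMap d k (Φ x)) = x := by
    rw [Function.comp_apply, hz, Φ.left_inv hx]
  obtain ⟨Ψ, s, hΨ, hΨs, hc⟩ := Classical.epsilon_spec (p := fun c : ℝ =>
    ∃ (Ψ : E (m - 1) → E d) (s : E (m - 1)), IsLocalParam (bdry M m) (m - 1) Ψ s ∧ Ψ s = x ∧
      c = ∑ i, ∑ j, (firstForm Ψ s)⁻¹ i j * secondForm Ψ (outwardNormal M x) s i j)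
    ⟨_, _, _, hparam, hFx, rfl⟩
  change curvature M m x = paramCurvature Ψ (outwardNormal M x) s at hc
  rw [hc]
  have hΨcont := hΨ.contDiffAt.continuousAt
  have hsrc : ∀ᶠ w in 𝓝 s, Ψ w ∈ Φ.source :=
    hΨcont.eventually (Φ.open_source.mem_nhds (by rw [hΨs]; exact hx))
  have hθs : (coordMap d k ∘ Φ ∘ Ψ) s = coordMap d k (Φ x) := by simp [hΨs]
  rw [← hθs] at hF hn ⊢
  refine paramCurvature_comp hF hn ?_ ?_ hΨ.injective_fderiv
  · refine (coordMap d k).contDiff.contDiffAt.comp s (ContDiffAt.comp s ?_ hΨ.contDiffAt)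
    rw [hΨs]; exact hΦ.contDiffAt hx
  · filter_upwards [hsrc, hΨ.eventually_mem] with w hw hwb
    change Ψ w = Φ.symm (coordMap k d (coordMap d k (Φ (Ψ w))))
    rw [coordMap_coordMap_of_mem ((hb _ hw).1 hwb), Φ.left_inv hw]

/-- Continuity on the compact boundary yields boundedness and measurability, the only properties of
the curvature that the estimates use. -/
lemma continuousOn_curvature (hm : 1 ≤ m) (hmd : m ≤ d) :
    ContinuousOn (curvature M m) (bdry M m) := by
  intro x hxb
  obtain ⟨Φ, hΦ, hx, hΦM, hx0⟩ := hxb.2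
  have hxt := Φ.map_source hx
  have hz : coordMap (m - 1) d (coordMap d (m - 1) (Φ x)) = Φ x :=
    coordMap_coordMap_of_mem ((mem_bdry_iff hm hmd hΦ hΦM hx).1 hxb)
  have hF : ContDiffAt ℝ ∞ (Φ.symm ∘ coordMap (m - 1) d) (coordMap d (m - 1) (Φ x)) := by
    refine ContDiffAt.comp _ ?_ (coordMap (m - 1) d).contDiff.contDiffAt
    rw [hz]; exact hΦ.contDiffAt_symm hxt
  have hFd : fderiv ℝ (Φ.symm ∘ coordMap (m - 1) d) (coordMap d (m - 1) (Φ x)) =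
      paramDeriv (m - 1) Φ x := by
    have h1 : HasFDerivAt Φ.symm (fderiv ℝ Φ.symm (Φ x))
        (coordMap (m - 1) d (coordMap d (m - 1) (Φ x))) := by
      rw [hz]; exact hΦ.hasFDerivAt_symm hxt
    exact (h1.comp _ (coordMap (m - 1) d).hasFDerivAt).fderiv
  have hinj : Function.Injective
      (fderiv ℝ (Φ.symm ∘ coordMap (m - 1) d) (coordMap d (m - 1) (Φ x))) := by
    rw [hFd]; exact injective_paramDeriv (by omega) hΦ hx
  have h1 : ContinuousWithinAt (fun y => (coordMap d (m - 1) (Φ y), outwardNormal M y))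
      (bdry M m) x :=
    (((coordMap d (m - 1)).continuous.continuousAt.comp
      (Φ.continuousAt hx)).continuousWithinAt).prodMk (continuousOn_outwardNormal hm hmd x hxb)
  have h2 := (continuousAt_paramCurvature (n := outwardNormal M x) hF hinj)
  have h3 := h2.comp_continuousWithinAt
    (f := fun y => (coordMap d (m - 1) (Φ y), outwardNormal M y)) h1
  refine h3.congr_of_eventuallyEq ?_ (curvature_eq hm hmd hΦ hΦM hx hxb)
  filter_upwards [self_mem_nhdsWithin, mem_nhdsWithin_of_mem_nhds (Φ.open_source.mem_nhds hx)]
    with y hy hyΦ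
  exact curvature_eq hm hmd hΦ hΦM hyΦ hy

end Curvature

open scoped ENNReal

/-! ### The indicator of nearby pairs -/

section Near

/-- The indicator function of the pairs of points at distance at most `ρ`. -/
def near {k : ℕ} (ρ : ℝ) (x y : E k) : ℝ≥0∞ := if dist x y ≤ ρ then 1 else 0

variable {k : ℕ}

lemma measurable_near {X : Type*} [MeasurableSpace X] (ρ : ℝ) {f g : X → E k}
    (hf : Measurable f) (hg : Measurable g) : Measurable fun x => near ρ (f x) (g x) :=
  Measurable.ite (measurableSet_le (hf.dist hg) measurable_const)
    measurable_const measurable_const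

lemma near_comm (ρ : ℝ) (x y : E k) : near ρ x y = near ρ y x := by
  rw [near, near, dist_comm]

lemma near_of_le {ρ : ℝ} {x y : E k} (h : dist x y ≤ ρ) : near ρ x y = 1 := if_pos h

lemma near_le_one (ρ : ℝ) (x y : E k) : near ρ x y ≤ 1 := by
  rw [near]; split_ifs <;> simp

lemma lintegral_near (ρ : ℝ) (y : E k) (τ : Measure (E k)) :
    ∫⁻ x, near ρ x y ∂τ = τ (Metric.closedBall y ρ) := by
  have : (fun x => near ρ x y) = (Metric.closedBall y ρ).indicator 1 := by
    ext x
    classical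
    rw [Set.indicator_apply]
    simp [near]
  rw [this, lintegral_indicator_one Metric.isClosed_closedBall.measurableSet]

lemma lintegral_near_right (ρ : ℝ) (x : E k) (τ : Measure (E k)) :
    ∫⁻ y, near ρ x y ∂τ = τ (Metric.closedBall x ρ) := by
  simp_rw [near_comm ρ x]; exact lintegral_near ρ x τ

end Near

/-! ### Cauchy-Schwarz inequalities for the Lebesgue integral -/

section CauchySchwarz

variable {X : Type*} [MeasurableSpace X]

lemma sq_lintegral_mul_le (τ : Measure X) {f g : X → ℝ≥0∞} (hf : AEMeasurable f τ)
    (hg : AEMeasurable g τ) :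
    (∫⁻ x, f x * g x ∂τ) ^ 2 ≤ (∫⁻ x, f x ^ 2 ∂τ) * ∫⁻ x, g x ^ 2 ∂τ := by
  have h := ENNReal.lintegral_mul_le_Lp_mul_Lq τ Real.HolderConjugate.two_two hf hg
  have h2 : ∀ a : ℝ≥0∞, (a ^ (1 / (2 : ℝ))) ^ 2 = a := fun a => by
    rw [← ENNReal.rpow_natCast, ← ENNReal.rpow_mul]; norm_num
  calc _ ≤ _ := pow_le_pow_left' h 2
    _ = _ := by
      rw [mul_pow, h2, h2]
      simp only [ENNReal.rpow_two]

/-- Cauchy-Schwarz with a weight. -/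
lemma sq_lintegral_mul_weight_le (τ : Measure X) {w f : X → ℝ≥0∞} (hw : AEMeasurable w τ)
    (hf : AEMeasurable f τ) :
    (∫⁻ x, w x * f x ∂τ) ^ 2 ≤ (∫⁻ x, w x ∂τ) * ∫⁻ x, w x * f x ^ 2 ∂τ := by
  have h2 : ∀ a : ℝ≥0∞, (a ^ (1 / (2 : ℝ))) ^ 2 = a := fun a => by
    rw [← ENNReal.rpow_natCast, ← ENNReal.rpow_mul]; norm_num
  have h := sq_lintegral_mul_le τ (hw.pow_const (1 / (2 : ℝ)))
    ((hw.pow_const (1 / (2 : ℝ))).mul hf)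
  simp only [Pi.mul_apply, ← mul_assoc, mul_pow, h2] at h
  simpa only [← sq, h2] using h

/-- Writes `f = s · (s⁻¹ f)` and applies Cauchy-Schwarz with weight `s`. The weight is chosen later
to make an integral along segments converge. -/
lemma sq_lintegral_le (τ : Measure X) {s f : X → ℝ≥0∞} (hs : AEMeasurable s τ)
    (hf : AEMeasurable f τ) (h0 : ∀ᵐ x ∂τ, s x ≠ 0) (htop : ∀ᵐ x ∂τ, s x ≠ ⊤) :
    (∫⁻ x, f x ∂τ) ^ 2 ≤ (∫⁻ x, s x ∂τ) * ∫⁻ x, (s x)⁻¹ * f x ^ 2 ∂τ := by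
  have h := sq_lintegral_mul_weight_le τ hs (hs.inv.mul hf)
  have e1 : ∫⁻ x, s x * (s⁻¹ * f) x ∂τ = ∫⁻ x, f x ∂τ := by
    refine lintegral_congr_ae ?_
    filter_upwards [h0, htop] with x h0 ht
    rw [Pi.mul_apply, Pi.inv_apply, ← mul_assoc, ENNReal.mul_inv_cancel h0 ht, one_mul]
  have e2 : ∫⁻ x, s x * (s⁻¹ * f) x ^ 2 ∂τ = ∫⁻ x, (s x)⁻¹ * f x ^ 2 ∂τ := by
    refine lintegral_congr_ae ?_
    filter_upwards [h0, htop] with x h0 ht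
    rw [Pi.mul_apply, Pi.inv_apply, mul_pow, sq (s x)⁻¹, ← mul_assoc, ← mul_assoc,
      ENNReal.mul_inv_cancel h0 ht, one_mul]
  rwa [e1, e2] at h

end CauchySchwarz

/-! ### Differences along segments -/

section Segment

variable {m : ℕ}

lemma lintegral_rpow_neg_half :
    ∫⁻ t in Set.Ioo (0 : ℝ) 1, ENNReal.ofReal (t ^ (-(1 / 2) : ℝ)) = 2 := by
  have hInt : IntervalIntegrable (fun t : ℝ => t ^ (-(1 / 2) : ℝ)) volume 0 1 :=
    intervalIntegral.intervalIntegrable_rpow' (by norm_num)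
  have h1 : ∫ t in (0 : ℝ)..1, t ^ (-(1 / 2) : ℝ) = 2 := by
    rw [integral_rpow (Or.inl (by norm_num))]; norm_num
  rw [intervalIntegral.integral_of_le zero_le_one, integral_Ioc_eq_integral_Ioo] at h1
  rw [← ofReal_integral_eq_lintegral_ofReal, h1]
  · simp
  · exact ((intervalIntegrable_iff_integrableOn_Ioo_of_le zero_le_one).1 hInt)
  · refine (ae_restrict_iff' measurableSet_Ioo).2 (Eventually.of_forall fun t ht => ?_)
    exact Real.rpow_nonneg ht.1.le _

lemma lintegral_homothety {f : E m → ℝ≥0∞} (hf : Measurable f) (a : E m) {t : ℝ} (ht : 0 < t) :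
    ∫⁻ y, f (a + t • (y - a)) = ENNReal.ofReal ((t ^ m)⁻¹) * ∫⁻ z, f z := by
  calc ∫⁻ y, f (a + t • (y - a)) = ∫⁻ y, f (a + t • y) :=
        lintegral_sub_right_eq_self (fun y => f (a + t • y)) a
    _ = ∫⁻ y, f (a + y) ∂(Measure.map (fun x : E m => t • x) volume) := by
        rw [lintegral_map (f := fun y => f (a + y)) (hf.comp (measurable_const_add a))
          (measurable_const_smul t)]
    _ = ENNReal.ofReal ((t ^ m)⁻¹) * ∫⁻ y, f (a + y) := by
        rw [Measure.map_addHaar_smul volume ht.ne', lintegral_smul_measure,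
          finrank_euclideanSpace_fin, abs_of_pos (by positivity), smul_eq_mul]
    _ = _ := by rw [lintegral_add_left_eq_self (fun y => f y) a]

lemma measurable_segment_integrand {Z : Type*} [MeasurableSpace Z] (ρ : ℝ) {s : ℝ → ℝ≥0∞}
    (hs : Measurable s) {H : E m → ℝ≥0∞} (hH : Measurable H) {a y : Z → E m} {t : Z → ℝ}
    (ha : Measurable a) (hy : Measurable y) (ht : Measurable t) :
    Measurable fun q => (s (t q))⁻¹ * (near ρ (a q) (y q) * H (a q + t q • (y q - a q))) :=
  (hs.comp ht).inv.mul ((measurable_near ρ ha hy).mul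
    (hH.comp (ha.add (ht.smul (hy.sub ha)))))

/-- The basic estimate for differences along segments: they are controlled by the gradient, even
when one of the end points is restricted to a set of codimension one. -/
lemma lintegral_segment_le {X : Type*} [MeasurableSpace X] (hm : 1 ≤ m) (τ : Measure X) [SFinite τ]
    {G : X → E m} (hG : Measurable G) {Q : Set (E m)} (hQ : MeasurableSet Q) (hQc : Convex ℝ Q)
    (hGQ : ∀ᵐ x ∂τ, G x ∈ Q) {g : E m → ℝ} {h : E m → ℝ≥0∞} (hh : Measurable h)
    (hgh : ∀ a ∈ Q, ∀ b ∈ Q, ‖g a - g b‖ₑ ≤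
      ENNReal.ofReal (dist a b) * ∫⁻ t in Set.Ioo (0 : ℝ) 1, h (a + t • (b - a)))
    {A : ℝ≥0∞} (hA : ∀ z ∈ Q, ∀ r : ℝ, 0 < r →
      ∫⁻ x, near r (G x) z ∂τ ≤ A * ENNReal.ofReal r ^ (m - 1)) {ρ : ℝ} (hρ : 0 < ρ) :
    ∫⁻ x, (∫⁻ y in Q, near ρ (G x) y * ‖g (G x) - g y‖ₑ ^ 2) ∂τ ≤
      4 * A * ENNReal.ofReal ρ ^ (m + 1) * ∫⁻ z in Q, h z ^ 2 := by
  -- The homothety of ratio `t` costs `t^(-m)`, while the codimension-one measure of a ball of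
  -- radius `t ρ` gains only `t^(m-1)`. The net `t⁻¹` is not integrable at `0`; the factor `s⁻¹ =
  -- t^(1/2)` from weighted Cauchy-Schwarz improves it to `t^(-1/2)`, and `s` itself is integrable.
  set s : ℝ → ℝ≥0∞ := fun t => ENNReal.ofReal (t ^ (-(1 / 2) : ℝ)) with hs
  have hsm : Measurable s := ENNReal.measurable_ofReal.comp (measurable_id.pow_const _)
  have hspos : ∀ t ∈ Set.Ioo (0 : ℝ) 1, s t ≠ 0 := fun t ht => by
    simp only [hs, ne_eq, ENNReal.ofReal_eq_zero, not_le]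
    exact Real.rpow_pos_of_pos ht.1 _
  set H : E m → ℝ≥0∞ := Q.indicator fun z => h z ^ 2 with hH
  have hHm : Measurable H := (hh.pow_const 2).indicator hQ
  have hpt : ∀ a ∈ Q, ∀ b ∈ Q, near ρ a b * ‖g a - g b‖ₑ ^ 2 ≤
      2 * ENNReal.ofReal ρ ^ 2 * ∫⁻ t in Set.Ioo (0 : ℝ) 1,
        (s t)⁻¹ * (near ρ a b * H (a + t • (b - a))) := by
    intro a ha b hb
    by_cases hab : dist a b ≤ ρ
    · rw [near_of_le hab, one_mul]
      simp only [one_mul]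
      have h1 : (∫⁻ t in Set.Ioo (0 : ℝ) 1, h (a + t • (b - a))) ^ 2 ≤
          2 * ∫⁻ t in Set.Ioo (0 : ℝ) 1, (s t)⁻¹ * h (a + t • (b - a)) ^ 2 := by
        have := sq_lintegral_le (volume.restrict (Set.Ioo (0 : ℝ) 1)) hsm.aemeasurable
          (f := fun t => h (a + t • (b - a))) (hh.comp (by fun_prop)).aemeasurable
          ((ae_restrict_iff' measurableSet_Ioo).2 (Eventually.of_forall hspos))
          (Eventually.of_forall fun t => ENNReal.ofReal_ne_top)
        rwa [lintegral_rpow_neg_half] at this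
      have h2 : ∫⁻ t in Set.Ioo (0 : ℝ) 1, (s t)⁻¹ * h (a + t • (b - a)) ^ 2 =
          ∫⁻ t in Set.Ioo (0 : ℝ) 1, (s t)⁻¹ * H (a + t • (b - a)) := by
        refine setLIntegral_congr_fun measurableSet_Ioo fun t ht => ?_
        simp only [hH]
        rw [Set.indicator_of_mem (hQc.add_smul_sub_mem ha hb ⟨ht.1.le, ht.2.le⟩)]
      have h3 : ‖g a - g b‖ₑ ≤ ENNReal.ofReal ρ *
          ∫⁻ t in Set.Ioo (0 : ℝ) 1, h (a + t • (b - a)) :=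
        (hgh a ha b hb).trans (mul_le_mul_left (ENNReal.ofReal_le_ofReal hab) _)
      have h4 := pow_le_pow_left' h3 2
      rw [mul_pow] at h4
      rw [← h2, mul_comm 2 (ENNReal.ofReal ρ ^ 2), mul_assoc]
      exact h4.trans (mul_le_mul_right h1 _)
    · rw [near, if_neg hab, zero_mul]; exact zero_le
  have hInt : ∀ t ∈ Set.Ioo (0 : ℝ) 1, ∫⁻ x, (∫⁻ y, (s t)⁻¹ *
      (near ρ (G x) y * H (G x + t • (y - G x)))) ∂τ ≤
        s t * (A * ENNReal.ofReal ρ ^ (m - 1) * ∫⁻ z in Q, h z ^ 2) := by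
    intro t ht
    -- The point `z = a + t (y - a)` is at distance `t |a - y|` from `a`, so the cutoff radius
    -- becomes `t ρ` in the variable `z`.
    have e1 : ∀ a y : E m, near ρ a y * H (a + t • (y - a)) =
        (fun z => near (t * ρ) a z * H z) (a + t • (y - a)) := by
      intro a y
      have : near ρ a y = near (t * ρ) a (a + t • (y - a)) := by
        simp only [near]
        have : dist a (a + t • (y - a)) = t * dist a y := by
          rw [dist_eq_norm, dist_comm, dist_eq_norm, sub_add_cancel_left, norm_neg, norm_smul,
            Real.norm_eq_abs, abs_of_pos ht.1]
        simp only [this, mul_le_mul_iff_right₀ ht.1]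
      simp only [this]
    have e2 : ∀ a : E m, Measurable fun z => near (t * ρ) a z * H z := fun a =>
      (measurable_near _ measurable_const measurable_id).mul hHm
    have e3 : ∀ x, ∫⁻ y, (s t)⁻¹ * (near ρ (G x) y * H (G x + t • (y - G x))) =
        (s t)⁻¹ * (ENNReal.ofReal ((t ^ m)⁻¹) * ∫⁻ z, near (t * ρ) (G x) z * H z) := by
      intro x
      rw [lintegral_const_mul' _ _ (ENNReal.inv_ne_top.2 (hspos t ht))]
      simp_rw [e1 (G x)]
      rw [lintegral_homothety (e2 (G x)) (G x) ht.1]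
    simp_rw [e3]
    rw [lintegral_const_mul' _ _ (ENNReal.inv_ne_top.2 (hspos t ht)),
      lintegral_const_mul' _ _ ENNReal.ofReal_ne_top, lintegral_lintegral_swap]
    swap
    · refine Measurable.aemeasurable ?_
      exact (measurable_near _ (hG.comp measurable_fst) measurable_snd).mul
        (hHm.comp measurable_snd)
    -- With `z` fixed, the integral over `x` is the `τ`-mass of points whose chart image is within
    -- `t ρ` of `z`.
    have e4 : ∫⁻ z, ∫⁻ x, near (t * ρ) (G x) z * H z ∂τ ≤
        A * ENNReal.ofReal (t * ρ) ^ (m - 1) * ∫⁻ z in Q, h z ^ 2 := by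
      rw [← lintegral_indicator hQ, ← lintegral_const_mul _ hHm]
      refine lintegral_mono fun z => ?_
      rw [lintegral_mul_const _ (measurable_near _ hG measurable_const)]
      by_cases hz : z ∈ Q
      · gcongr
        exact hA z hz _ (mul_pos ht.1 hρ)
      · simp [hH, hz]
    -- The exponents add up as `1/2 - m + (m - 1) = -1/2`.
    have e5 : (s t)⁻¹ * ENNReal.ofReal ((t ^ m)⁻¹) * ENNReal.ofReal t ^ (m - 1) = s t := by
      simp only [hs]
      rw [← ENNReal.ofReal_inv_of_pos (Real.rpow_pos_of_pos ht.1 _), ← ENNReal.ofReal_pow ht.1.le,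
        ← ENNReal.ofReal_mul (by have := ht.1; positivity),
        ← ENNReal.ofReal_mul (by have := ht.1; positivity)]
      congr 1
      rw [← Real.rpow_neg ht.1.le, ← Real.rpow_natCast, ← Real.rpow_natCast, ← Real.rpow_neg ht.1.le,
        ← Real.rpow_add ht.1, ← Real.rpow_add ht.1]
      congr 1
      push_cast [Nat.cast_sub hm]
      ring
    calc _ ≤ (s t)⁻¹ * (ENNReal.ofReal ((t ^ m)⁻¹) *
          (A * ENNReal.ofReal (t * ρ) ^ (m - 1) * ∫⁻ z in Q, h z ^ 2)) := by gcongr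
      _ = ((s t)⁻¹ * ENNReal.ofReal ((t ^ m)⁻¹) * ENNReal.ofReal t ^ (m - 1)) *
          (A * ENNReal.ofReal ρ ^ (m - 1) * ∫⁻ z in Q, h z ^ 2) := by
        rw [ENNReal.ofReal_mul ht.1.le, mul_pow]; ring
      _ = _ := by rw [e5]
  have hswap : ∫⁻ x, (∫⁻ y, ∫⁻ t in Set.Ioo (0 : ℝ) 1,
      (s t)⁻¹ * (near ρ (G x) y * H (G x + t • (y - G x)))) ∂τ =
      ∫⁻ t in Set.Ioo (0 : ℝ) 1, ∫⁻ x, (∫⁻ y,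
        (s t)⁻¹ * (near ρ (G x) y * H (G x + t • (y - G x)))) ∂τ := by
    have e1 : ∀ x, ∫⁻ y, ∫⁻ t in Set.Ioo (0 : ℝ) 1,
        (s t)⁻¹ * (near ρ (G x) y * H (G x + t • (y - G x))) =
        ∫⁻ t in Set.Ioo (0 : ℝ) 1, ∫⁻ y,
          (s t)⁻¹ * (near ρ (G x) y * H (G x + t • (y - G x))) := fun x =>
      lintegral_lintegral_swap (measurable_segment_integrand ρ hsm hHm measurable_const
        measurable_fst measurable_snd).aemeasurable
    simp_rw [e1]
    refine lintegral_lintegral_swap (Measurable.aemeasurable ?_)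
    exact Measurable.lintegral_prod_right' (f := fun q : (X × ℝ) × E m =>
      (s q.1.2)⁻¹ * (near ρ (G q.1.1) q.2 * H (G q.1.1 + q.1.2 • (q.2 - G q.1.1))))
      (measurable_segment_integrand ρ hsm hHm (hG.comp (measurable_fst.comp measurable_fst))
        measurable_snd (measurable_snd.comp measurable_fst))
  calc ∫⁻ x, (∫⁻ y in Q, near ρ (G x) y * ‖g (G x) - g y‖ₑ ^ 2) ∂τ
      ≤ ∫⁻ x, (∫⁻ y, 2 * ENNReal.ofReal ρ ^ 2 * ∫⁻ t in Set.Ioo (0 : ℝ) 1,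
        (s t)⁻¹ * (near ρ (G x) y * H (G x + t • (y - G x)))) ∂τ := by
        refine lintegral_mono_ae ?_
        filter_upwards [hGQ] with x hx
        calc _ ≤ ∫⁻ y in Q, 2 * ENNReal.ofReal ρ ^ 2 * ∫⁻ t in Set.Ioo (0 : ℝ) 1,
            (s t)⁻¹ * (near ρ (G x) y * H (G x + t • (y - G x))) :=
              setLIntegral_mono' hQ fun y hy => hpt _ hx y hy
          _ ≤ _ := setLIntegral_le_lintegral _ _
    _ = 2 * ENNReal.ofReal ρ ^ 2 * ∫⁻ t in Set.Ioo (0 : ℝ) 1, ∫⁻ x, (∫⁻ y,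
        (s t)⁻¹ * (near ρ (G x) y * H (G x + t • (y - G x)))) ∂τ := by
        have hne : 2 * ENNReal.ofReal ρ ^ 2 ≠ ⊤ :=
          ENNReal.mul_ne_top (by simp) (ENNReal.pow_ne_top ENNReal.ofReal_ne_top)
        simp_rw [lintegral_const_mul' _ _ hne]
        rw [hswap]
    _ ≤ 2 * ENNReal.ofReal ρ ^ 2 * ∫⁻ t in Set.Ioo (0 : ℝ) 1,
        s t * (A * ENNReal.ofReal ρ ^ (m - 1) * ∫⁻ z in Q, h z ^ 2) := by
        exact mul_le_mul_right (setLIntegral_mono' measurableSet_Ioo hInt) _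
    _ = _ := by
        rw [lintegral_mul_const _ hsm, lintegral_rpow_neg_half]
        have : ENNReal.ofReal ρ ^ (m + 1) = ENNReal.ofReal ρ ^ 2 * ENNReal.ofReal ρ ^ (m - 1) := by
          rw [← pow_add]; congr 1; omega
        rw [this]; ring

end Segment

/-! ### Hausdorff measure in charts and Ahlfors regularity -/

section ChartMeasure

variable {d k : ℕ} {S : Set (E d)} {p : E d}

lemma euclideanHausdorffMeasure_image_le {k a b : ℕ} {K : ℝ≥0} {f : E a → E b} {s : Set (E a)}
    (h : LipschitzOnWith K f s) :
    (Measure.euclideanHausdorffMeasure k) (f '' s) ≤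
      (K : ℝ≥0∞) ^ k * Measure.euclideanHausdorffMeasure k s := by
  rw [Measure.euclideanHausdorffMeasure_def, Measure.euclideanHausdorffMeasure_def,
    Measure.smul_apply, Measure.smul_apply, mul_smul_comm]
  rw [ENNReal.smul_def, ENNReal.smul_def, smul_eq_mul, smul_eq_mul]
  refine mul_le_mul_right ?_ _
  have := h.hausdorffMeasure_image_le (d := (k : ℝ)) (Nat.cast_nonneg k)
  rwa [ENNReal.rpow_natCast] at this

lemma Chart.measure_image_le (c : Chart S k p) {s : Set (E k)} (hs : s ⊆ c.Q) :
    (Measure.euclideanHausdorffMeasure k) (c.F '' s) ≤ (c.L : ℝ≥0∞) ^ k * volume s := by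
  rw [← EuclideanSpace.euclideanHausdorffMeasure_eq_volume]
  refine euclideanHausdorffMeasure_image_le (LipschitzOnWith.of_dist_le_mul fun x hx y hy => ?_)
  exact c.dist_F_le x (hs hx) y (hs hy)

lemma Chart.volume_le (c : Chart S k p) {s : Set (E k)} (hs : s ⊆ c.Q) :
    volume s ≤ (c.L : ℝ≥0∞) ^ k * Measure.euclideanHausdorffMeasure k (c.F '' s) := by
  rw [← EuclideanSpace.euclideanHausdorffMeasure_eq_volume]
  have himg : c.G '' (c.F '' s) = s := by
    rw [← Set.image_comp]
    refine (Set.image_congr fun z hz => c.G_F z (hs hz)).trans (Set.image_id' s)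
  conv_lhs => rw [← himg]
  refine euclideanHausdorffMeasure_image_le (LipschitzOnWith.of_dist_le_mul ?_)
  rintro _ ⟨z, hz, rfl⟩ _ ⟨w, hw, rfl⟩
  rw [c.G_F z (hs hz), c.G_F w (hs hw)]
  exact c.dist_le z (hs hz) w (hs hw)

lemma Chart.continuousOn_F (c : Chart S k p) : ContinuousOn c.F c.Q := fun z hz =>
  (c.contDiffAt z hz).continuousAt.continuousWithinAt

/-- Only comparability of measures is needed, up to the factor `L^k`, so the bi-Lipschitz bounds
replace a change of variables formula with Jacobian. -/
lemma Chart.restrict_le (c : Chart S k p) :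
    (Measure.euclideanHausdorffMeasure k).restrict (S ∩ c.U) ≤
      ((c.L : ℝ≥0∞) ^ k) • Measure.map c.F (volume.restrict c.Q) := by
  have hF : AEMeasurable c.F (volume.restrict c.Q) :=
    c.continuousOn_F.aemeasurable c.isCompact.isClosed.measurableSet
  refine Measure.le_iff.2 fun s hs => ?_
  rw [Measure.restrict_apply hs, Measure.smul_apply, Measure.map_apply_of_aemeasurable hF hs,
    Measure.restrict_apply' c.isCompact.isClosed.measurableSet, smul_eq_mul]
  refine le_trans (measure_mono ?_) (c.measure_image_le (s := c.F ⁻¹' s ∩ c.Q)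
    Set.inter_subset_right)
  rintro x ⟨hxs, hxS, hxU⟩
  refine ⟨c.G x, ⟨?_, c.G_mem x hxS hxU⟩, c.F_G x hxS hxU⟩
  rw [Set.mem_preimage, c.F_G x hxS hxU]; exact hxs

lemma Chart.volume_restrict_le (c : Chart S k p) :
    volume.restrict c.Q ≤ ((c.L : ℝ≥0∞) ^ k) •
      Measure.map c.G ((Measure.euclideanHausdorffMeasure k).restrict (c.F '' c.Q)) := by
  have hFQ : MeasurableSet (c.F '' c.Q) :=
    (c.isCompact.image_of_continuousOn c.continuousOn_F).isClosed.measurableSet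
  refine Measure.le_iff.2 fun s hs => ?_
  rw [Measure.restrict_apply hs, Measure.smul_apply, Measure.map_apply c.measurable_G hs,
    Measure.restrict_apply' hFQ, smul_eq_mul]
  refine (c.volume_le (s := s ∩ c.Q) Set.inter_subset_right).trans ?_
  refine mul_le_mul_right (measure_mono ?_) _
  rintro _ ⟨z, ⟨hzs, hzQ⟩, rfl⟩
  refine ⟨?_, z, hzQ, rfl⟩
  rw [Set.mem_preimage, c.G_F z hzQ]; exact hzs

lemma Chart.lintegral_le (c : Chart S k p) (f : E d → ℝ≥0∞) :
    ∫⁻ y in S ∩ c.U, f y ∂(Measure.euclideanHausdorffMeasure k) ≤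
      (c.L : ℝ≥0∞) ^ k * ∫⁻ z in c.Q, f (c.F z) := by
  refine (lintegral_mono' c.restrict_le le_rfl).trans ?_
  rw [lintegral_smul_measure, smul_eq_mul]
  exact mul_le_mul_right (lintegral_map_le _ _) _

lemma Chart.lintegral_comp_le (c : Chart S k p) (f : E d → ℝ≥0∞) :
    ∫⁻ z in c.Q, f (c.F z) ≤ (c.L : ℝ≥0∞) ^ k * ∫⁻ x, f x ∂(vol S k) := by
  have hFQ : MeasurableSet (c.F '' c.Q) :=
    (c.isCompact.image_of_continuousOn c.continuousOn_F).isClosed.measurableSet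
  refine (lintegral_mono' c.volume_restrict_le le_rfl).trans ?_
  rw [lintegral_smul_measure, smul_eq_mul]
  refine mul_le_mul_right ((lintegral_map_le _ _).trans ?_) _
  calc _ = ∫⁻ x in c.F '' c.Q, f x ∂(Measure.euclideanHausdorffMeasure k) := by
        refine setLIntegral_congr_fun hFQ ?_
        rintro _ ⟨z, hz, rfl⟩
        simp only [c.G_F z hz]
    _ ≤ _ := by
        refine lintegral_mono' (Measure.restrict_mono ?_ le_rfl) le_rfl
        rintro _ ⟨z, hz, rfl⟩
        exact c.mapsTo z hz

lemma Chart.volume_Q_lt_top (c : Chart S k p) : volume c.Q < ⊤ := c.isCompact.measure_lt_top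

/-- If the ball meets the chart at `y`, its other points of the chart are within `2 r` of `y`, and
their parameters lie in a Euclidean ball of radius `2 L r`. -/
lemma Chart.measure_closedBall_le (c : Chart S k p) : ∃ A : ℝ≥0, ∀ x : E d, ∀ r : ℝ, 0 < r →
    (vol S k) (Metric.closedBall x r ∩ c.U) ≤ A * ENNReal.ofReal r ^ k := by
  have hfin : volume (Metric.ball (0 : E k) 1) ≠ ⊤ := measure_ball_lt_top.ne
  refine ⟨c.L ^ k * ((2 * c.L) ^ k * (volume (Metric.ball (0 : E k) 1)).toNNReal),
    fun x r hr => ?_⟩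
  rw [vol, Measure.restrict_apply (Metric.isClosed_closedBall.measurableSet.inter
    c.isOpen.measurableSet)]
  rcases (Metric.closedBall x r ∩ c.U ∩ S).eq_empty_or_nonempty with h | ⟨y, ⟨hyr, hyU⟩, hyS⟩
  · rw [h, measure_empty]; exact zero_le
  have hsub : Metric.closedBall x r ∩ c.U ∩ S ⊆
      c.F '' (c.Q ∩ Metric.closedBall (c.G y) (2 * c.L * r)) := by
    rintro w ⟨⟨hwr, hwU⟩, hwS⟩
    refine ⟨c.G w, ⟨c.G_mem w hwS hwU, ?_⟩, c.F_G w hwS hwU⟩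
    have h1 := c.dist_le _ (c.G_mem w hwS hwU) _ (c.G_mem y hyS hyU)
    rw [c.F_G w hwS hwU, c.F_G y hyS hyU] at h1
    have h2 : dist w y ≤ 2 * r := by
      have := dist_triangle_right w y x
      rw [Metric.mem_closedBall] at hwr hyr
      linarith
    rw [Metric.mem_closedBall]
    calc _ ≤ _ := h1
      _ ≤ c.L * (2 * r) := by gcongr
      _ = _ := by ring
  refine (measure_mono hsub).trans ((c.measure_image_le Set.inter_subset_left).trans ?_)
  calc (c.L : ℝ≥0∞) ^ k * volume (c.Q ∩ Metric.closedBall (c.G y) (2 * c.L * r))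
      ≤ (c.L : ℝ≥0∞) ^ k * volume (Metric.closedBall (c.G y) (2 * c.L * r)) := by
        gcongr; exact Set.inter_subset_right
    _ = _ := by
        rw [Measure.addHaar_closedBall volume _ (by positivity), finrank_euclideanSpace_fin,
          ENNReal.ofReal_pow (by positivity), ENNReal.ofReal_mul (by positivity),
          ENNReal.ofReal_mul (by positivity)]
        push_cast
        rw [ENNReal.coe_toNNReal hfin, ENNReal.ofReal_coe_nnreal, ENNReal.ofReal_ofNat, mul_pow]
        ring

/-- Shrinking `Q` towards `z` by the ratio `r / D` keeps it inside `Q`, by convexity, and moves it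
into the ball. Convexity thus replaces a cone condition at boundary points. -/
lemma volume_inter_closedBall_ge {Q : Set (E k)} (hQ : Convex ℝ Q) {D : ℝ} {z : E k}
    (hz : z ∈ Q) (hD : ∀ w ∈ Q, dist w z ≤ D) {r : ℝ} (hr : 0 < r) (hrD : r ≤ D) :
    ENNReal.ofReal (r / D) ^ k * volume Q ≤ volume (Q ∩ Metric.closedBall z r) := by
  have hD0 : 0 < D := hr.trans_le hrD
  have h := Measure.addHaar_image_homothety volume z (r / D) Q
  rw [finrank_euclideanSpace_fin, abs_of_nonneg (by positivity),
    ENNReal.ofReal_pow (by positivity)] at h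
  rw [← h]
  refine measure_mono ?_
  rintro _ ⟨w, hw, rfl⟩
  have h01 : r / D ≤ 1 := (div_le_one hD0).2 hrD
  refine ⟨?_, ?_⟩
  · rw [AffineMap.homothety_eq_lineMap]
    exact hQ.lineMap_mem hz hw ⟨by positivity, h01⟩
  · rw [Metric.mem_closedBall, dist_homothety_center, Real.norm_eq_abs,
      abs_of_nonneg (by positivity), dist_comm]
    calc _ ≤ r / D * D := by gcongr; exact hD w hw
      _ = r := by field_simp

lemma Chart.le_measure_closedBall (c : Chart S k p) (hS : MeasurableSet S) :
    ∃ a : ℝ≥0, 0 < a ∧ ∀ x ∈ S, x ∈ c.U → ∀ r : ℝ, 0 < r → r ≤ 1 →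
      a * ENNReal.ofReal r ^ k ≤ (vol S k) (Metric.closedBall x r) := by
  obtain ⟨D, hD⟩ := c.isCompact.isBounded.subset_closedBall (c.G p)
  have hLpos : (0 : ℝ) < c.L := lt_of_lt_of_le one_pos c.one_le_L
  have hL1 : (1 : ℝ) ≤ c.L := c.one_le_L
  set D' : ℝ := max 1 (2 * D) with hD'
  have hdist : ∀ z ∈ c.Q, ∀ w ∈ c.Q, dist w z ≤ D' := fun z hz w hw => by
    have h1 := hD hz; have h2 := hD hw
    rw [Metric.mem_closedBall] at h1 h2
    have := dist_triangle_right w z (c.G p)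
    exact le_trans (by linarith) (le_max_right _ _)
  have hD1 : 1 ≤ D' := le_max_left _ _
  have hVfin := c.volume_Q_lt_top.ne
  set V := (volume c.Q).toNNReal with hV
  have hVpos : 0 < V := ENNReal.toNNReal_pos c.volume_pos.ne' hVfin
  set q : ℝ≥0 := ⟨(c.L * D')⁻¹, by positivity⟩ with hq
  have hqpos : 0 < q := by
    rw [← NNReal.coe_pos]; change 0 < ((c.L : ℝ) * D')⁻¹; positivity
  refine ⟨(c.L ^ k)⁻¹ * (q ^ k * V), by
    have : 0 < c.L := lt_of_lt_of_le one_pos c.one_le_L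
    positivity, fun x hxS hxU r hr hr1 => ?_⟩
  have hsub : c.F '' (c.Q ∩ Metric.closedBall (c.G x) (r / c.L)) ⊆ Metric.closedBall x r ∩ S := by
    rintro _ ⟨z, ⟨hzQ, hzr⟩, rfl⟩
    refine ⟨?_, c.mapsTo z hzQ⟩
    have h1 := c.dist_F_le z hzQ _ (c.G_mem x hxS hxU)
    rw [c.F_G x hxS hxU] at h1
    rw [Metric.mem_closedBall] at hzr ⊢
    calc _ ≤ _ := h1
      _ ≤ c.L * (r / c.L) := by gcongr
      _ = r := by field_simp
  have h1 := volume_inter_closedBall_ge c.convex (c.G_mem x hxS hxU) (hdist _ (c.G_mem x hxS hxU))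
    (r := r / c.L) (by positivity) (by
      refine le_trans ?_ hD1
      rw [div_le_one hLpos]; linarith)
  have h2 := h1.trans (c.volume_le (s := c.Q ∩ Metric.closedBall (c.G x) (r / c.L))
    Set.inter_subset_left)
  rw [vol, Measure.restrict_apply' hS]
  have h3 : ENNReal.ofReal (r / c.L / D') = q * ENNReal.ofReal r := by
    rw [← ENNReal.ofReal_coe_nnreal, ← ENNReal.ofReal_mul (by positivity)]
    congr 1
    change _ = ((c.L : ℝ) * D')⁻¹ * r
    field_simp
  have hLne : (c.L : ℝ≥0∞) ^ k ≠ 0 := by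
    refine pow_ne_zero _ ?_
    exact_mod_cast (lt_of_lt_of_le one_pos c.one_le_L).ne'
  have hLtop : (c.L : ℝ≥0∞) ^ k ≠ ⊤ := ENNReal.pow_ne_top ENNReal.coe_ne_top
  have hLne' : c.L ^ k ≠ 0 := pow_ne_zero _ (lt_of_lt_of_le one_pos c.one_le_L).ne'
  rw [h3, mul_pow] at h2
  have h4 : (((c.L ^ k)⁻¹ * (q ^ k * V) : ℝ≥0) : ℝ≥0∞) * ENNReal.ofReal r ^ k =
      ((c.L : ℝ≥0∞) ^ k)⁻¹ * ((q : ℝ≥0∞) ^ k * ENNReal.ofReal r ^ k * volume c.Q) := by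
    push_cast [ENNReal.coe_inv hLne']
    rw [hV, ENNReal.coe_toNNReal hVfin]; ring
  rw [h4]
  calc _ ≤ ((c.L : ℝ≥0∞) ^ k)⁻¹ * ((c.L : ℝ≥0∞) ^ k * Measure.euclideanHausdorffMeasure k
        (c.F '' (c.Q ∩ Metric.closedBall (c.G x) (r / c.L)))) := mul_le_mul_right h2 _
    _ = Measure.euclideanHausdorffMeasure k
        (c.F '' (c.Q ∩ Metric.closedBall (c.G x) (r / c.L))) := by
        rw [← mul_assoc, ENNReal.inv_mul_cancel hLne hLtop, one_mul]
    _ ≤ _ := measure_mono hsub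

/-- Upper Ahlfors regularity of compact submanifolds. -/
theorem exists_vol_closedBall_le (hS : IsCompact S) (hc : ∀ p ∈ S, Nonempty (Chart S k p)) :
    ∃ A : ℝ≥0, ∀ x : E d, ∀ r : ℝ, 0 < r →
      (vol S k) (Metric.closedBall x r) ≤ A * ENNReal.ofReal r ^ k := by
  have key : ∃ A : ℝ≥0, ∀ x : E d, ∀ r : ℝ, 0 < r →
      (vol S k) (Metric.closedBall x r ∩ S) ≤ A * ENNReal.ofReal r ^ k := by
    -- The property passes to subsets and finite unions, so by compactness it suffices to have it in
    -- a chart around each point.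
    refine hS.induction_on (p := fun s => ∃ A : ℝ≥0, ∀ x : E d, ∀ r : ℝ, 0 < r →
      (vol S k) (Metric.closedBall x r ∩ s) ≤ A * ENNReal.ofReal r ^ k) ?_ ?_ ?_ ?_
    · exact ⟨0, fun x r _ => by simp⟩
    · rintro s t hst ⟨A, hA⟩
      exact ⟨A, fun x r hr => (measure_mono (Set.inter_subset_inter_right _ hst)).trans (hA x r hr)⟩
    · rintro s t ⟨A, hA⟩ ⟨B, hB⟩
      refine ⟨A + B, fun x r hr => ?_⟩
      rw [Set.inter_union_distrib_left]
      refine (measure_union_le _ _).trans ?_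
      push_cast
      rw [add_mul]
      exact add_le_add (hA x r hr) (hB x r hr)
    · intro p hp
      obtain ⟨c⟩ := hc p hp
      exact ⟨c.U, mem_nhdsWithin_of_mem_nhds (c.isOpen.mem_nhds c.mem), c.measure_closedBall_le⟩
  obtain ⟨A, hA⟩ := key
  refine ⟨A, fun x r hr => le_trans (le_of_eq ?_) (hA x r hr)⟩
  rw [vol, Measure.restrict_apply' hS.isClosed.measurableSet,
    Measure.restrict_apply' hS.isClosed.measurableSet, Set.inter_assoc, Set.inter_self]

/-- Lower Ahlfors regularity of compact submanifolds. -/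
theorem exists_le_vol_closedBall (hS : IsCompact S) (hc : ∀ p ∈ S, Nonempty (Chart S k p)) :
    ∃ a : ℝ≥0, 0 < a ∧ ∀ x ∈ S, ∀ r : ℝ, 0 < r → r ≤ 1 →
      a * ENNReal.ofReal r ^ k ≤ (vol S k) (Metric.closedBall x r) := by
  have key : ∃ a : ℝ≥0, 0 < a ∧ ∀ x ∈ S, x ∈ S → ∀ r : ℝ, 0 < r → r ≤ 1 →
      a * ENNReal.ofReal r ^ k ≤ (vol S k) (Metric.closedBall x r) := by
    refine hS.induction_on (p := fun s => ∃ a : ℝ≥0, 0 < a ∧ ∀ x ∈ S, x ∈ s → ∀ r : ℝ, 0 < r →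
      r ≤ 1 → a * ENNReal.ofReal r ^ k ≤ (vol S k) (Metric.closedBall x r)) ?_ ?_ ?_ ?_
    · exact ⟨1, one_pos, fun x _ h => absurd h (Set.notMem_empty x)⟩
    · rintro s t hst ⟨a, ha0, ha⟩
      exact ⟨a, ha0, fun x hx hxs => ha x hx (hst hxs)⟩
    · rintro s t ⟨a, ha0, ha⟩ ⟨b, hb0, hb⟩
      refine ⟨min a b, lt_min ha0 hb0, fun x hx hxs r hr hr1 => ?_⟩
      rcases hxs with h | h
      · exact le_trans (mul_le_mul_left (by exact_mod_cast min_le_left a b) _) (ha x hx h r hr hr1)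
      · exact le_trans (mul_le_mul_left (by exact_mod_cast min_le_right a b) _) (hb x hx h r hr hr1)
    · intro p hp
      obtain ⟨c⟩ := hc p hp
      obtain ⟨a, ha0, ha⟩ := c.le_measure_closedBall hS.isClosed.measurableSet
      exact ⟨c.U, mem_nhdsWithin_of_mem_nhds (c.isOpen.mem_nhds c.mem), a, ha0, ha⟩
  obtain ⟨a, ha0, ha⟩ := key
  exact ⟨a, ha0, fun x hx => ha x hx hx⟩

lemma vol_univ_lt_top (hS : IsCompact S) (hc : ∀ p ∈ S, Nonempty (Chart S k p)) :
    (vol S k) Set.univ < ⊤ := by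
  obtain ⟨A, hA⟩ := exists_vol_closedBall_le hS hc
  obtain ⟨D, hD⟩ := hS.isBounded.subset_closedBall (0 : E d)
  have h1 : (vol S k) Set.univ ≤ (vol S k) (Metric.closedBall 0 (max D 1)) := by
    rw [vol, Measure.restrict_apply_univ, Measure.restrict_apply' hS.isClosed.measurableSet]
    exact measure_mono fun x hx =>
      ⟨Metric.closedBall_subset_closedBall (le_max_left _ _) (hD hx), hx⟩
  refine (h1.trans (hA 0 (max D 1) (by positivity))).trans_lt ?_
  exact ENNReal.mul_lt_top ENNReal.coe_lt_top (ENNReal.pow_lt_top ENNReal.ofReal_lt_top)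

end ChartMeasure

/-! ### Differences controlled by the Dirichlet energy -/

section Differences

variable {d m : ℕ} {M : Set (E d)} {p : E d}

/-- The Dirichlet energy of a function. -/
def dirichlet (M : Set (E d)) (m : ℕ) (φ : E d → ℝ) : ℝ≥0∞ :=
  ∫⁻ x, ‖tangentialGradient M φ x‖ₑ ^ 2 ∂(vol M m)

lemma enorm_sub_le_lintegral_fderiv {Q : Set (E m)} (hQ : Convex ℝ Q) {g : E m → ℝ}
    (hg : ∀ z ∈ Q, ContDiffAt ℝ 1 g z) {a b : E m} (ha : a ∈ Q) (hb : b ∈ Q) :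
    ‖g a - g b‖ₑ ≤ ENNReal.ofReal (dist a b) *
      ∫⁻ t in Set.Ioo (0 : ℝ) 1, ‖fderiv ℝ g (a + t • (b - a))‖ₑ := by
  have hmem : ∀ t ∈ Set.Icc (0 : ℝ) 1, a + t • (b - a) ∈ Q := fun t ht =>
    hQ.add_smul_sub_mem ha hb ht
  have hder : ∀ t ∈ Set.uIcc (0 : ℝ) 1, HasDerivAt (fun t : ℝ => g (a + t • (b - a)))
      (fderiv ℝ g (a + t • (b - a)) (b - a)) t := by
    intro t ht
    rw [Set.uIcc_of_le zero_le_one] at ht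
    have h1 : HasDerivAt (fun t : ℝ => a + t • (b - a)) (b - a) t := by
      simpa using ((hasDerivAt_id t).smul_const (b - a)).const_add a
    exact (((hg _ (hmem t ht)).differentiableAt (by simp)).hasFDerivAt).comp_hasDerivAt t h1
  have hcont : ContinuousOn (fun t : ℝ => fderiv ℝ g (a + t • (b - a)) (b - a))
      (Set.uIcc 0 1) := by
    intro t ht
    rw [Set.uIcc_of_le zero_le_one] at ht
    have h1 : ContinuousAt (fun t : ℝ => fderiv ℝ g (a + t • (b - a))) t :=
      ContinuousAt.comp (f := fun t : ℝ => a + t • (b - a))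
        (((hg _ (hmem t ht)).fderiv_right (m := 0) (by simp)).continuousAt) (by fun_prop)
    exact (h1.clm_apply continuousAt_const).continuousWithinAt
  have h := intervalIntegral.integral_eq_sub_of_hasDerivAt hder hcont.intervalIntegrable
  simp only [one_smul, zero_smul, add_zero, add_sub_cancel] at h
  rw [← enorm_neg, neg_sub, ← h, intervalIntegral.integral_of_le zero_le_one,
    integral_Ioc_eq_integral_Ioo]
  refine (enorm_integral_le_lintegral_enorm _).trans ?_
  rw [← lintegral_const_mul' _ _ ENNReal.ofReal_ne_top]
  refine lintegral_mono fun t => ?_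
  rw [mul_comm]
  refine (ContinuousLinearMap.le_opENorm _ _).trans (le_of_eq ?_)
  rw [dist_comm, dist_eq_norm, ofReal_norm]

/-- The derivative of the parametrization takes values in the tangent space, so only the tangential
part of the gradient of `φ` is seen. -/
lemma enorm_fderiv_comp_le {F : E m → E d} {φ : E d → ℝ} {z : E m} (hF : DifferentiableAt ℝ F z)
    (hφ : DifferentiableAt ℝ φ (F z)) (hT : (fderiv ℝ F z).range ≤ tangentSpace M (F z)) :
    ‖fderiv ℝ (φ ∘ F) z‖ ≤ ‖fderiv ℝ F z‖ * ‖tangentialGradient M φ (F z)‖ := by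
  refine ContinuousLinearMap.opNorm_le_bound _ (by positivity) fun v => ?_
  rw [fderiv_comp z hφ hF, ContinuousLinearMap.comp_apply, ← inner_gradient_left]
  have h1 : inner ℝ (gradient φ (F z)) (fderiv ℝ F z v) =
      inner ℝ (tangentialGradient M φ (F z)) (fderiv ℝ F z v) := by
    have := Submodule.starProjection_inner_eq_zero (K := tangentSpace M (F z))
      (gradient φ (F z)) _ (hT ⟨v, rfl⟩)
    rw [inner_sub_left, sub_eq_zero] at this
    exact this
  rw [h1]
  refine (norm_inner_le_norm _ _).trans ?_
  calc _ ≤ ‖tangentialGradient M φ (F z)‖ * (‖fderiv ℝ F z‖ * ‖v‖) := by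
        gcongr; exact ContinuousLinearMap.le_opNorm _ _
    _ = _ := by ring

/-- Differences of functions in a chart are controlled by the Dirichlet energy. -/
lemma Chart.difference_estimate (c : Chart M m p) (hm : 1 ≤ m) (hM : MeasurableSet M) :
    ∃ C : ℝ≥0, ∀ (τ : Measure (E d)) [SFinite τ] (A : ℝ≥0∞),
      (∀ x : E d, ∀ r : ℝ, 0 < r → τ (Metric.closedBall x r) ≤ A * ENNReal.ofReal r ^ (m - 1)) →
      ∀ φ : E d → ℝ, (∀ x ∈ M, ContDiffAt ℝ 1 φ x) → ∀ ρ : ℝ, 0 < ρ →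
      ∫⁻ x in M ∩ c.U, (∫⁻ y in M ∩ c.U, near ρ x y * ‖φ x - φ y‖ₑ ^ 2
        ∂(Measure.euclideanHausdorffMeasure m)) ∂τ ≤
        C * A * ENNReal.ofReal ρ ^ (m + 1) * dirichlet M m φ := by
  obtain ⟨B, hB⟩ := c.isCompact.exists_bound_of_continuousOn
    (f := fderiv ℝ c.F) fun z hz => (c.continuousAt_fderiv hz).continuousWithinAt
  have hLpos : (0 : ℝ) < c.L := lt_of_lt_of_le one_pos c.one_le_L
  refine ⟨c.L ^ m * (4 * c.L ^ (m - 1) * c.L ^ (m + 1) * (B.toNNReal ^ 2 * c.L ^ m)),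
    fun τ _ A hA φ hφ ρ hρ => ?_⟩
  have hMU : MeasurableSet (M ∩ c.U) := hM.inter c.isOpen.measurableSet
  set g := φ ∘ c.F with hg
  have hgC : ∀ z ∈ c.Q, ContDiffAt ℝ 1 g z := fun z hz =>
    (hφ _ (c.mapsTo z hz)).comp z ((c.contDiffAt z hz).of_le (by simp))
  have hseg := lintegral_segment_le hm (τ.restrict (M ∩ c.U)) c.measurable_G
    c.isCompact.isClosed.measurableSet c.convex
    ((ae_restrict_iff' hMU).2 (Eventually.of_forall fun x hx => c.G_mem x hx.1 hx.2))
    (g := g) (h := fun z => ‖fderiv ℝ g z‖ₑ) (measurable_fderiv ℝ g).enorm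
    (fun a ha b hb => enorm_sub_le_lintegral_fderiv c.convex hgC ha hb)
    (A := A * c.L ^ (m - 1)) (by
      intro z hz r hr
      calc ∫⁻ x in M ∩ c.U, near r (c.G x) z ∂τ
          ≤ ∫⁻ x in M ∩ c.U, near (c.L * r) x (c.F z) ∂τ := by
            refine setLIntegral_mono' hMU fun x hx => ?_
            by_cases h : dist (c.G x) z ≤ r
            · rw [near_of_le h, near_of_le]
              have := c.dist_F_le _ (c.G_mem x hx.1 hx.2) z hz
              rw [c.F_G x hx.1 hx.2] at this
              exact this.trans (by gcongr)
            · rw [near, if_neg h]; exact zero_le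
        _ ≤ ∫⁻ x, near (c.L * r) x (c.F z) ∂τ := setLIntegral_le_lintegral _ _
        _ ≤ A * ENNReal.ofReal (c.L * r) ^ (m - 1) := by
            rw [lintegral_near]; exact hA _ _ (by positivity)
        _ = _ := by
            rw [ENNReal.ofReal_mul hLpos.le, ENNReal.ofReal_coe_nnreal, mul_pow]; ring)
    (ρ := c.L * ρ) (by positivity)
  have hgrad : ∫⁻ z in c.Q, ‖fderiv ℝ g z‖ₑ ^ 2 ≤
      ENNReal.ofReal B ^ 2 * ((c.L : ℝ≥0∞) ^ m * dirichlet M m φ) := by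
    calc _ ≤ ∫⁻ z in c.Q, ENNReal.ofReal B ^ 2 * ‖tangentialGradient M φ (c.F z)‖ₑ ^ 2 := by
          refine setLIntegral_mono' c.isCompact.isClosed.measurableSet fun z hz => ?_
          rw [← mul_pow]
          refine pow_le_pow_left' ?_ 2
          rw [← ofReal_norm, ← ofReal_norm, ← ENNReal.ofReal_mul
            ((norm_nonneg _).trans (hB z hz))]
          refine ENNReal.ofReal_le_ofReal ((enorm_fderiv_comp_le
            ((c.contDiffAt z hz).differentiableAt (by simp))
            ((hφ _ (c.mapsTo z hz)).differentiableAt (by simp)) (c.tangentSpace_eq z hz).ge).trans ?_)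
          gcongr
          exact hB z hz
      _ = ENNReal.ofReal B ^ 2 * ∫⁻ z in c.Q, ‖tangentialGradient M φ (c.F z)‖ₑ ^ 2 :=
          lintegral_const_mul' _ _ (ENNReal.pow_ne_top ENNReal.ofReal_ne_top)
      _ ≤ _ := mul_le_mul_right (c.lintegral_comp_le fun x => ‖tangentialGradient M φ x‖ₑ ^ 2) _
  have hinner : ∀ x ∈ M ∩ c.U, ∫⁻ y in M ∩ c.U, near ρ x y * ‖φ x - φ y‖ₑ ^ 2
        ∂(Measure.euclideanHausdorffMeasure m) ≤
      (c.L : ℝ≥0∞) ^ m * ∫⁻ z in c.Q, near (c.L * ρ) (c.G x) z * ‖g (c.G x) - g z‖ₑ ^ 2 := by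
    intro x hx
    refine (c.lintegral_le _).trans (mul_le_mul_right ?_ _)
    refine setLIntegral_mono' c.isCompact.isClosed.measurableSet fun z hz => ?_
    have hgx : g (c.G x) = φ x := by rw [hg, Function.comp_apply, c.F_G x hx.1 hx.2]
    rw [hgx]
    refine mul_le_mul_left ?_ _
    by_cases h : dist x (c.F z) ≤ ρ
    · rw [near_of_le h, near_of_le]
      have := c.dist_le _ (c.G_mem x hx.1 hx.2) z hz
      rw [c.F_G x hx.1 hx.2] at this
      exact this.trans (by gcongr)
    · rw [near, if_neg h]; exact zero_le
  calc _ ≤ ∫⁻ x in M ∩ c.U, (c.L : ℝ≥0∞) ^ m *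
        (∫⁻ z in c.Q, near (c.L * ρ) (c.G x) z * ‖g (c.G x) - g z‖ₑ ^ 2) ∂τ :=
        setLIntegral_mono' hMU hinner
    _ = (c.L : ℝ≥0∞) ^ m * ∫⁻ x in M ∩ c.U,
        (∫⁻ z in c.Q, near (c.L * ρ) (c.G x) z * ‖g (c.G x) - g z‖ₑ ^ 2) ∂τ :=
        lintegral_const_mul' _ _ (ENNReal.pow_ne_top ENNReal.coe_ne_top)
    _ ≤ (c.L : ℝ≥0∞) ^ m * (4 * (A * c.L ^ (m - 1)) * ENNReal.ofReal (c.L * ρ) ^ (m + 1) *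
        (ENNReal.ofReal B ^ 2 * ((c.L : ℝ≥0∞) ^ m * dirichlet M m φ))) := by
        refine mul_le_mul_right (hseg.trans (mul_le_mul_right hgrad _)) _
    _ = _ := by
        rw [ENNReal.ofReal_mul hLpos.le, ENNReal.ofReal_coe_nnreal, mul_pow]
        push_cast
        simp only [ENNReal.ofReal]
        ring

/-- Differences over short distances are controlled by the Dirichlet energy. -/
theorem exists_difference_estimate (hm : 1 ≤ m) (hmd : m ≤ d) (hM : IsCompactSubmanifold M m)
    (τ : Measure (E d)) [SFinite τ] (hτM : ∀ᵐ x ∂τ, x ∈ M) (A : ℝ≥0)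
    (hA : ∀ x : E d, ∀ r : ℝ, 0 < r →
      τ (Metric.closedBall x r) ≤ A * ENNReal.ofReal r ^ (m - 1)) :
    ∃ ρ₀ : ℝ, 0 < ρ₀ ∧ ∃ C : ℝ≥0, ∀ φ : E d → ℝ, (∀ x ∈ M, ContDiffAt ℝ 1 φ x) →
      ∀ ρ : ℝ, 0 < ρ → ρ < ρ₀ →
        ∫⁻ x, (∫⁻ y, near ρ x y * ‖φ x - φ y‖ₑ ^ 2 ∂(vol M m)) ∂τ ≤
          C * ENNReal.ofReal ρ ^ (m + 1) * dirichlet M m φ := by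
  classical
  have hMm := hM.isCompact.isClosed.measurableSet
  let c : ∀ p : M, Chart M m p := fun p => (hM.nonempty_chart hm hmd p.2).some
  obtain ⟨t, ht⟩ := hM.isCompact.elim_finite_subcover (fun p : M => (c p).U)
    (fun p => (c p).isOpen) fun x hx => Set.mem_iUnion.2 ⟨⟨x, hx⟩, (c ⟨x, hx⟩).mem⟩
  -- Below the Lebesgue number of the cover, two points at distance at most `ρ` always share a
  -- chart.
  obtain ⟨ε, hε, hLeb⟩ := lebesgue_number_lemma_of_metric hM.isCompact
    (c := fun p : t => (c p).U) (fun p => (c p).isOpen) (by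
      intro x hx
      obtain ⟨p, hp, hxp⟩ := Set.mem_iUnion₂.1 (ht hx)
      exact Set.mem_iUnion.2 ⟨⟨p, hp⟩, hxp⟩)
  choose C hC using fun p : M => (c p).difference_estimate hm hMm
  refine ⟨ε, hε, ∑ p : t, C p * A, fun φ hφ ρ hρ hρε => ?_⟩
  set f : E d → E d → ℝ≥0∞ := fun x y => near ρ x y * ‖φ x - φ y‖ₑ ^ 2 with hf
  set I : t → E d → ℝ≥0∞ := fun p x => (M ∩ (c p).U).indicator
    (fun x => ∫⁻ y in M ∩ (c p).U, f x y ∂(Measure.euclideanHausdorffMeasure m)) x with hI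
  have hpt : ∀ᵐ x ∂τ, ∫⁻ y, f x y ∂(vol M m) ≤ ∑ p : t, I p x := by
    filter_upwards [hτM] with x hx
    obtain ⟨p, hp⟩ := hLeb x hx
    refine le_trans ?_ (Finset.single_le_sum (f := fun p => I p x) (fun _ _ => zero_le)
      (Finset.mem_univ p))
    simp only [hI]
    have hxp : x ∈ M ∩ (c p).U := ⟨hx, hp (Metric.mem_ball_self hε)⟩
    rw [Set.indicator_of_mem hxp, vol, ← lintegral_indicator hMm,
      ← lintegral_indicator (hMm.inter (c p).isOpen.measurableSet)]
    refine lintegral_mono fun y => ?_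
    by_cases hy : y ∈ M
    · by_cases hxy : dist x y ≤ ρ
      · have hyU : y ∈ (c p).U := hp (by rw [Metric.mem_ball, dist_comm]; linarith)
        have hyp : y ∈ M ∩ (c p).U := ⟨hy, hyU⟩
        rw [Set.indicator_of_mem hy, Set.indicator_of_mem hyp]
      · rw [Set.indicator_of_mem hy]
        simp only [hf]
        rw [near, if_neg hxy, zero_mul]
        exact zero_le
    · rw [Set.indicator_of_notMem hy]; exact zero_le
  have hφm : ContinuousOn φ M := fun x hx => (hφ x hx).continuousAt.continuousWithinAt
  calc _ ≤ ∫⁻ x, ∑ p : t, I p x ∂τ := lintegral_mono_ae hpt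
    _ ≤ ∑ p : t, ∫⁻ x, I p x ∂τ := by
        refine le_of_eq (lintegral_finsetSum' _ fun p _ => ?_)
        refine (aemeasurable_indicator_iff (hMm.inter (c p).isOpen.measurableSet)).2 ?_
        have hprod : AEMeasurable (Function.uncurry f) ((τ.restrict (M ∩ (c p).U)).prod
            ((Measure.euclideanHausdorffMeasure m).restrict (M ∩ (c p).U))) := by
          have hMU := hMm.inter (c p).isOpen.measurableSet
          have h1 : AEMeasurable φ (τ.restrict (M ∩ (c p).U)) :=
            (hφm.mono Set.inter_subset_left).aemeasurable hMU
          have h2 : AEMeasurable φ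
              ((Measure.euclideanHausdorffMeasure m).restrict (M ∩ (c p).U)) :=
            (hφm.mono Set.inter_subset_left).aemeasurable hMU
          refine (measurable_near ρ measurable_fst measurable_snd).aemeasurable.mul ?_
          exact ((h1.comp_fst).sub (h2.comp_snd)).enorm.pow_const 2
        have : SFinite ((Measure.euclideanHausdorffMeasure m).restrict (M ∩ (c p).U) :
            Measure (E d)) := by
          have : IsFiniteMeasure ((Measure.euclideanHausdorffMeasure m).restrict (M ∩ (c p).U) :
              Measure (E d)) := ⟨by
            rw [Measure.restrict_apply_univ]
            refine (measure_mono Set.inter_subset_left).trans_lt ?_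
            have := vol_univ_lt_top hM.isCompact fun p hp => hM.nonempty_chart hm hmd hp
            rwa [vol, Measure.restrict_apply_univ] at this⟩
          infer_instance
        exact hprod.lintegral_prod_right'
    _ ≤ ∑ p : t, (C p * A) * ENNReal.ofReal ρ ^ (m + 1) * dirichlet M m φ := by
        refine Finset.sum_le_sum fun p _ => ?_
        simp only [hI]
        rw [lintegral_indicator (hMm.inter (c p).isOpen.measurableSet)]
        exact hC p τ A hA φ hφ ρ hρ
    _ = _ := by
        rw [← Finset.sum_mul, ← Finset.sum_mul]
        push_cast
        rfl

end Differences

/-! ### The trace and Poincaré inequalities -/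

section Inequalities

variable {d m : ℕ} {M : Set (E d)} {p : E d}

lemma enorm_add_sq_le {V : Type*} [SeminormedAddCommGroup V] (a b : V) :
    ‖a + b‖ₑ ^ 2 ≤ 2 * ‖a‖ₑ ^ 2 + 2 * ‖b‖ₑ ^ 2 := by
  have h : ‖a + b‖₊ ^ 2 ≤ 2 * ‖a‖₊ ^ 2 + 2 * ‖b‖₊ ^ 2 := by
    calc _ ≤ (‖a‖₊ + ‖b‖₊) ^ 2 := pow_le_pow_left' (nnnorm_add_le a b) 2
      _ ≤ 2 * (‖a‖₊ ^ 2 + ‖b‖₊ ^ 2) := add_sq_le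
      _ = _ := by ring
  simp only [enorm_eq_nnnorm]
  exact_mod_cast h

lemma enorm_sq_le_sub_add {V : Type*} [SeminormedAddCommGroup V] (a b : V) :
    ‖a‖ₑ ^ 2 ≤ 2 * ‖a - b‖ₑ ^ 2 + 2 * ‖b‖ₑ ^ 2 := by
  simpa using enorm_add_sq_le (a - b) b

/-- Comparison of the mean squares of a function with respect to two measures. -/
lemma mul_lintegral_sq_le {X Y : Type*} [MeasurableSpace X] [MeasurableSpace Y] (τ : Measure X)
    (σ : Measure Y) {φ : X → ℝ} {ψ : Y → ℝ} (hψ : AEMeasurable ψ σ) :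
    σ Set.univ * ∫⁻ x, ‖φ x‖ₑ ^ 2 ∂τ ≤
      2 * ∫⁻ x, (∫⁻ y, ‖φ x - ψ y‖ₑ ^ 2 ∂σ) ∂τ + 2 * τ Set.univ * ∫⁻ y, ‖ψ y‖ₑ ^ 2 ∂σ := by
  have h1 : ∀ x, σ Set.univ * ‖φ x‖ₑ ^ 2 ≤
      2 * ∫⁻ y, ‖φ x - ψ y‖ₑ ^ 2 ∂σ + 2 * ∫⁻ y, ‖ψ y‖ₑ ^ 2 ∂σ := by
    intro x
    calc σ Set.univ * ‖φ x‖ₑ ^ 2 = ∫⁻ _, ‖φ x‖ₑ ^ 2 ∂σ := by rw [lintegral_const, mul_comm]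
      _ ≤ ∫⁻ y, (2 * ‖φ x - ψ y‖ₑ ^ 2 + 2 * ‖ψ y‖ₑ ^ 2) ∂σ :=
          lintegral_mono fun y => enorm_sq_le_sub_add _ _
      _ = _ := by
          rw [lintegral_add_right' _ ((hψ.enorm.pow_const 2).const_mul 2),
            lintegral_const_mul' _ _ (by simp), lintegral_const_mul' _ _ (by simp)]
  calc σ Set.univ * ∫⁻ x, ‖φ x‖ₑ ^ 2 ∂τ ≤ ∫⁻ x, σ Set.univ * ‖φ x‖ₑ ^ 2 ∂τ :=
        lintegral_const_mul_le _ _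
    _ ≤ ∫⁻ x, (2 * ∫⁻ y, ‖φ x - ψ y‖ₑ ^ 2 ∂σ + 2 * ∫⁻ y, ‖ψ y‖ₑ ^ 2 ∂σ) ∂τ := lintegral_mono h1
    _ = _ := by
        rw [lintegral_add_right _ measurable_const, lintegral_const,
          lintegral_const_mul' _ _ (by simp)]
        ring

/-- The weighted version: in a chart, all differences are controlled by the energy. -/
lemma Chart.full_difference_estimate (c : Chart M m p) (hm : 1 ≤ m) (hM : IsCompact M) (A : ℝ≥0) :
    ∃ C : ℝ≥0, ∀ (τ : Measure (E d)) [SFinite τ],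
      (∀ x : E d, ∀ r : ℝ, 0 < r → τ (Metric.closedBall x r) ≤ A * ENNReal.ofReal r ^ (m - 1)) →
      ∀ φ : E d → ℝ, (∀ x ∈ M, ContDiffAt ℝ 1 φ x) →
      ∫⁻ x in M ∩ c.U, (∫⁻ y in M ∩ c.U, ‖φ x - φ y‖ₑ ^ 2
        ∂(Measure.euclideanHausdorffMeasure m)) ∂τ ≤ C * dirichlet M m φ := by
  obtain ⟨C, hC⟩ := c.difference_estimate hm hM.isClosed.measurableSet
  obtain ⟨D, hD⟩ := hM.isBounded.subset_closedBall (0 : E d)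
  -- This radius exceeds the diameter of `M`, so the cutoff disappears.
  set ρ : ℝ := max 1 (2 * D) with hρ
  have hMU : MeasurableSet (M ∩ c.U) := hM.isClosed.measurableSet.inter c.isOpen.measurableSet
  refine ⟨C * A * ρ.toNNReal ^ (m + 1), fun τ _ hA φ hφ => ?_⟩
  have h := hC τ A hA φ hφ ρ (lt_of_lt_of_le one_pos (le_max_left _ _))
  push_cast
  refine le_trans (le_of_eq ?_) h
  refine setLIntegral_congr_fun hMU fun x hx => setLIntegral_congr_fun hMU fun y hy => ?_
  have h1 := hD hx.1; have h2 := hD hy.1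
  rw [Metric.mem_closedBall] at h1 h2
  have h3 := dist_triangle_right x y 0
  change _ = near ρ x y * ‖φ x - φ y‖ₑ ^ 2
  rw [near_of_le (by exact le_trans (by linarith) (le_max_right _ _)), one_mul]

lemma le_of_mul_le {a b : ℝ≥0} (hb : b ≠ 0) {x y : ℝ≥0∞} (h : b * x ≤ a * y) :
    x ≤ ((b⁻¹ * a : ℝ≥0) : ℝ≥0∞) * y := by
  have hb' : (b : ℝ≥0∞) ≠ 0 := by exact_mod_cast hb
  push_cast [ENNReal.coe_inv hb]
  calc x = (b : ℝ≥0∞)⁻¹ * (b * x) := by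
        rw [← mul_assoc, ENNReal.inv_mul_cancel hb' ENNReal.coe_ne_top, one_mul]
    _ ≤ (b : ℝ≥0∞)⁻¹ * (a * y) := mul_le_mul_right h _
    _ = _ := by ring

lemma IsCompactSubmanifold.isFiniteMeasure_vol (hm : 1 ≤ m) (hmd : m ≤ d)
    (hM : IsCompactSubmanifold M m) : IsFiniteMeasure (vol M m) :=
  ⟨vol_univ_lt_top hM.isCompact fun _ hp => hM.nonempty_chart hm hmd hp⟩

lemma IsCompactSubmanifold.isFiniteMeasure_bvol (hm : 1 ≤ m) (hmd : m ≤ d)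
    (hM : IsCompactSubmanifold M m) : IsFiniteMeasure (bvol M m) :=
  ⟨vol_univ_lt_top (hM.isCompact_bdry hm hmd) fun _ hp => nonempty_chart_bdry hm hmd hp⟩

end Inequalities

section Inequalities

variable {d m : ℕ} {M : Set (E d)}

lemma ae_mem_bdry (hm : 1 ≤ m) (hmd : m ≤ d) (hM : IsCompactSubmanifold M m) :
    ∀ᵐ x ∂(bvol M m), x ∈ bdry M m :=
  ae_restrict_mem (hM.isClosed_bdry hm hmd).measurableSet

lemma ae_mem_vol (hM : IsCompactSubmanifold M m) : ∀ᵐ x ∂(vol M m), x ∈ M :=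
  ae_restrict_mem hM.isCompact.isClosed.measurableSet

/-- The volume measure is also upper regular of codimension one. -/
lemma exists_vol_closedBall_le_pred (hm : 1 ≤ m) (hmd : m ≤ d) (hM : IsCompactSubmanifold M m) :
    ∃ A : ℝ≥0, ∀ x : E d, ∀ r : ℝ, 0 < r →
      (vol M m) (Metric.closedBall x r) ≤ A * ENNReal.ofReal r ^ (m - 1) := by
  obtain ⟨A, hA⟩ := exists_vol_closedBall_le hM.isCompact fun _ hp => hM.nonempty_chart hm hmd hp
  have := hM.isFiniteMeasure_vol hm hmd
  refine ⟨A + ((vol M m) Set.univ).toNNReal, fun x r hr => ?_⟩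
  push_cast
  rw [ENNReal.coe_toNNReal (measure_ne_top _ _)]
  rcases le_total r 1 with h | h
  · calc _ ≤ A * ENNReal.ofReal r ^ m := hA x r hr
      _ ≤ A * ENNReal.ofReal r ^ (m - 1) := by
          refine mul_le_mul_right (pow_le_pow_right_of_le_one' ?_ (by omega)) _
          rwa [ENNReal.ofReal_le_one]
      _ ≤ _ := mul_le_mul_left le_self_add _
  · calc (vol M m) (Metric.closedBall x r) ≤ (vol M m) Set.univ * 1 := by
          rw [mul_one]; exact measure_mono (Set.subset_univ _)
      _ ≤ (vol M m) Set.univ * ENNReal.ofReal r ^ (m - 1) := by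
          refine mul_le_mul_right (one_le_pow_of_one_le' ?_ _) _
          rwa [ENNReal.one_le_ofReal]
      _ ≤ _ := mul_le_mul_left le_add_self _

lemma vol_inter_pos (hm : 1 ≤ m) (hmd : m ≤ d) (hM : IsCompactSubmanifold M m) {x : E d}
    (hx : x ∈ M) {U : Set (E d)} (hU : U ∈ 𝓝 x) : 0 < (vol M m) U := by
  obtain ⟨a, ha0, ha⟩ := exists_le_vol_closedBall hM.isCompact
    fun _ hp => hM.nonempty_chart hm hmd hp
  obtain ⟨r, hr, hrU⟩ := Metric.nhds_basis_closedBall.mem_iff.1 hU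
  have hmin : 0 < min r 1 := lt_min hr one_pos
  refine lt_of_lt_of_le ?_ ((ha x hx (min r 1) hmin (min_le_right _ _)).trans
    (measure_mono ((Metric.closedBall_subset_closedBall (min_le_left _ _)).trans hrU)))
  exact ENNReal.mul_pos (by exact_mod_cast ha0.ne')
    (pow_ne_zero _ (ENNReal.ofReal_pos.2 hmin).ne')

lemma bvol_inter_pos (hm : 1 ≤ m) (hmd : m ≤ d) (hM : IsCompactSubmanifold M m) {x : E d}
    (hx : x ∈ bdry M m) {U : Set (E d)} (hU : U ∈ 𝓝 x) : 0 < (bvol M m) U := by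
  obtain ⟨a, ha0, ha⟩ := exists_le_vol_closedBall (hM.isCompact_bdry hm hmd)
    fun _ hp => nonempty_chart_bdry hm hmd hp
  obtain ⟨r, hr, hrU⟩ := Metric.nhds_basis_closedBall.mem_iff.1 hU
  have hmin : 0 < min r 1 := lt_min hr one_pos
  refine lt_of_lt_of_le ?_ ((ha x hx (min r 1) hmin (min_le_right _ _)).trans
    (measure_mono ((Metric.closedBall_subset_closedBall (min_le_left _ _)).trans hrU)))
  exact ENNReal.mul_pos (by exact_mod_cast ha0.ne')
    (pow_ne_zero _ (ENNReal.ofReal_pos.2 hmin).ne')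

/-- In a chart, the mean square for one measure controls that for the other. -/
lemma Chart.mean_square_le (hm : 1 ≤ m) (hmd : m ≤ d) (hM : IsCompactSubmanifold M m) {p : E d}
    (c : Chart M m p) (τ : Measure (E d)) [IsFiniteMeasure τ] (A : ℝ≥0)
    (hA : ∀ x : E d, ∀ r : ℝ, 0 < r →
      τ (Metric.closedBall x r) ≤ A * ENNReal.ofReal r ^ (m - 1)) :
    ∃ C : ℝ≥0, ∀ φ : E d → ℝ, (∀ x ∈ M, ContDiffAt ℝ 1 φ x) →
      (vol M m) c.U * ∫⁻ x in M ∩ c.U, ‖φ x‖ₑ ^ 2 ∂τ ≤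
        C * (∫⁻ x in M ∩ c.U, ‖φ x‖ₑ ^ 2 ∂(Measure.euclideanHausdorffMeasure m) +
          dirichlet M m φ) ∧
      τ (M ∩ c.U) * ∫⁻ x in M ∩ c.U, ‖φ x‖ₑ ^ 2 ∂(Measure.euclideanHausdorffMeasure m) ≤
        C * (∫⁻ x in M ∩ c.U, ‖φ x‖ₑ ^ 2 ∂τ + dirichlet M m φ) := by
  obtain ⟨C, hC⟩ := c.full_difference_estimate hm hM.isCompact A
  have hMm := hM.isCompact.isClosed.measurableSet
  have hMU : MeasurableSet (M ∩ c.U) := hMm.inter c.isOpen.measurableSet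
  have hfin := hM.isFiniteMeasure_vol hm hmd
  have hvol : (vol M m) c.U = (Measure.euclideanHausdorffMeasure m) (M ∩ c.U) := by
    rw [vol, Measure.restrict_apply' hMm, Set.inter_comm]
  have hfin' : IsFiniteMeasure ((Measure.euclideanHausdorffMeasure m).restrict (M ∩ c.U) :
      Measure (E d)) := ⟨by
    rw [Measure.restrict_apply_univ, ← hvol]; exact measure_lt_top _ _⟩
  set T := (τ Set.univ).toNNReal
  set V := ((vol M m) Set.univ).toNNReal
  have hT : τ Set.univ = T := (ENNReal.coe_toNNReal (measure_ne_top _ _)).symm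
  have hV : (vol M m) Set.univ = V := (ENNReal.coe_toNNReal (measure_ne_top _ _)).symm
  refine ⟨2 * C + 2 * T + 2 * V, fun φ hφ => ?_⟩
  have hφm : ContinuousOn φ (M ∩ c.U) :=
    fun x hx => (hφ x hx.1).continuousAt.continuousWithinAt
  have hdiff := hC τ hA φ hφ
  have h1 := mul_lintegral_sq_le (φ := φ) (ψ := φ) (τ.restrict (M ∩ c.U))
    ((Measure.euclideanHausdorffMeasure m).restrict (M ∩ c.U)) (hφm.aemeasurable hMU)
  have h2 := mul_lintegral_sq_le (φ := φ) (ψ := φ)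
    ((Measure.euclideanHausdorffMeasure m).restrict (M ∩ c.U)) (τ.restrict (M ∩ c.U))
    (hφm.aemeasurable hMU)
  have hswap : ∫⁻ x in M ∩ c.U, (∫⁻ y in M ∩ c.U, ‖φ x - φ y‖ₑ ^ 2 ∂τ)
      ∂(Measure.euclideanHausdorffMeasure m) = ∫⁻ x in M ∩ c.U, (∫⁻ y in M ∩ c.U,
        ‖φ x - φ y‖ₑ ^ 2 ∂(Measure.euclideanHausdorffMeasure m)) ∂τ := by
    rw [lintegral_lintegral_swap]
    · refine lintegral_congr fun x => lintegral_congr fun y => ?_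
      rw [← enorm_neg, neg_sub]
    · exact (((hφm.aemeasurable hMU).comp_fst).sub
        ((hφm.aemeasurable hMU).comp_snd)).enorm.pow_const 2
  rw [Measure.restrict_apply_univ, Measure.restrict_apply_univ] at h1 h2
  rw [hswap] at h2
  rw [← hvol] at h1 h2
  set I := ∫⁻ x in M ∩ c.U, ‖φ x‖ₑ ^ 2 ∂(Measure.euclideanHausdorffMeasure m)
  set J := ∫⁻ x in M ∩ c.U, ‖φ x‖ₑ ^ 2 ∂τ
  have hTle : τ (M ∩ c.U) ≤ T := hT ▸ measure_mono (Set.subset_univ _)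
  have hVle : (vol M m) c.U ≤ V := hV ▸ measure_mono (Set.subset_univ _)
  push_cast
  constructor
  · calc _ ≤ _ := h1
      _ ≤ 2 * (C * dirichlet M m φ) + 2 * T * I := by gcongr
      _ ≤ (2 * (C * dirichlet M m φ) + 2 * T * I) +
          (2 * C * I + 2 * T * dirichlet M m φ + 2 * V * (I + dirichlet M m φ)) := le_self_add
      _ = _ := by ring
  · calc _ ≤ _ := h2
      _ ≤ 2 * (C * dirichlet M m φ) + 2 * V * J := by gcongr
      _ ≤ (2 * (C * dirichlet M m φ) + 2 * V * J) +
          (2 * C * J + 2 * V * dirichlet M m φ + 2 * T * (J + dirichlet M m φ)) := le_self_add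
      _ = _ := by ring

lemma exists_bvol_closedBall_le (hm : 1 ≤ m) (hmd : m ≤ d) (hM : IsCompactSubmanifold M m) :
    ∃ A : ℝ≥0, ∀ x : E d, ∀ r : ℝ, 0 < r →
      (bvol M m) (Metric.closedBall x r) ≤ A * ENNReal.ofReal r ^ (m - 1) :=
  exists_vol_closedBall_le (hM.isCompact_bdry hm hmd) fun _ hp => nonempty_chart_bdry hm hmd hp

/-- The trace inequality. -/
theorem exists_trace_inequality (hm : 1 ≤ m) (hmd : m ≤ d) (hM : IsCompactSubmanifold M m) :
    ∃ C : ℝ≥0, ∀ φ : E d → ℝ, (∀ x ∈ M, ContDiffAt ℝ 1 φ x) →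
      ∫⁻ x, ‖φ x‖ₑ ^ 2 ∂(bvol M m) ≤
        C * (∫⁻ x, ‖φ x‖ₑ ^ 2 ∂(vol M m) + dirichlet M m φ) := by
  obtain ⟨A, hA⟩ := exists_bvol_closedBall_le hm hmd hM
  have hbfin := hM.isFiniteMeasure_bvol hm hmd
  have hfin := hM.isFiniteMeasure_vol hm hmd
  have hMm := hM.isCompact.isClosed.measurableSet
  have key : ∃ C : ℝ≥0, ∀ φ : E d → ℝ, (∀ x ∈ M, ContDiffAt ℝ 1 φ x) →
      ∫⁻ x in M, ‖φ x‖ₑ ^ 2 ∂(bvol M m) ≤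
        C * (∫⁻ x, ‖φ x‖ₑ ^ 2 ∂(vol M m) + dirichlet M m φ) := by
    refine hM.isCompact.induction_on (p := fun s => ∃ C : ℝ≥0, ∀ φ : E d → ℝ,
      (∀ x ∈ M, ContDiffAt ℝ 1 φ x) → ∫⁻ x in s, ‖φ x‖ₑ ^ 2 ∂(bvol M m) ≤
        C * (∫⁻ x, ‖φ x‖ₑ ^ 2 ∂(vol M m) + dirichlet M m φ)) ?_ ?_ ?_ ?_
    · exact ⟨0, fun φ _ => by simp⟩
    · rintro s t hst ⟨C, hC⟩
      exact ⟨C, fun φ hφ => (lintegral_mono_set hst).trans (hC φ hφ)⟩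
    · rintro s t ⟨C, hC⟩ ⟨C', hC'⟩
      refine ⟨C + C', fun φ hφ => (lintegral_union_le _ _ _).trans ?_⟩
      push_cast
      rw [add_mul]
      exact add_le_add (hC φ hφ) (hC' φ hφ)
    · intro p hp
      obtain ⟨c⟩ := hM.nonempty_chart hm hmd hp
      -- Inside a chart, boundary values are compared with interior values on average; dividing by
      -- the positive volume of the chart gives the local inequality.
      obtain ⟨C, hC⟩ := c.mean_square_le hm hmd hM (bvol M m) A hA
      refine ⟨M ∩ c.U, inter_mem self_mem_nhdsWithin
        (mem_nhdsWithin_of_mem_nhds (c.isOpen.mem_nhds c.mem)),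
        (((vol M m) c.U).toNNReal)⁻¹ * C, fun φ hφ => ?_⟩
      have hpos := vol_inter_pos hm hmd hM hp (c.isOpen.mem_nhds c.mem)
      refine le_of_mul_le (ENNReal.toNNReal_pos hpos.ne' (measure_ne_top _ _)).ne' ?_
      rw [ENNReal.coe_toNNReal (measure_ne_top _ _)]
      refine (hC φ hφ).1.trans (mul_le_mul_right (add_le_add_left ?_ _) _)
      exact lintegral_mono' (Measure.restrict_mono Set.inter_subset_left le_rfl) le_rfl
  obtain ⟨C, hC⟩ := key
  refine ⟨C, fun φ hφ => le_trans (le_of_eq ?_) (hC φ hφ)⟩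
  rw [Measure.restrict_eq_self_of_ae_mem]
  filter_upwards [ae_mem_bdry hm hmd hM] with x hx using hx.1

/-- The Poincaré inequality with boundary values. -/
theorem exists_poincare (hm : 1 ≤ m) (hmd : m ≤ d) (hM : IsCompactSubmanifold M m)
    (hbd : ∀ x ∈ M, (connectedComponentIn M x ∩ bdry M m).Nonempty) :
    ∃ C : ℝ≥0, ∀ φ : E d → ℝ, (∀ x ∈ M, ContDiffAt ℝ 1 φ x) →
      ∫⁻ x, ‖φ x‖ₑ ^ 2 ∂(vol M m) ≤
        C * (∫⁻ x, ‖φ x‖ₑ ^ 2 ∂(bvol M m) + dirichlet M m φ) := by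
  obtain ⟨A, hA⟩ := exists_bvol_closedBall_le hm hmd hM
  obtain ⟨A', hA'⟩ := exists_vol_closedBall_le_pred hm hmd hM
  have hbfin := hM.isFiniteMeasure_bvol hm hmd
  have hfin := hM.isFiniteMeasure_vol hm hmd
  have hMm := hM.isCompact.isClosed.measurableSet
  -- The inequality on a piece of `M`. It holds on charts around boundary points and spreads to
  -- every chart overlapping a piece where it is known, until it fills each component.
  let P : Set (E d) → Prop := fun s => ∃ C : ℝ≥0, ∀ φ : E d → ℝ,
      (∀ x ∈ M, ContDiffAt ℝ 1 φ x) → ∫⁻ x in s, ‖φ x‖ₑ ^ 2 ∂(vol M m) ≤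
        C * (∫⁻ x, ‖φ x‖ₑ ^ 2 ∂(bvol M m) + dirichlet M m φ)
  have hres : ∀ U : Set (E d), MeasurableSet U → (vol M m).restrict U =
      (Measure.euclideanHausdorffMeasure m).restrict (M ∩ U) := fun U hU => by
    rw [vol, Measure.restrict_restrict hU, Set.inter_comm]
  -- charts at boundary points
  have hgood_bdry : ∀ p ∈ bdry M m, ∃ V, IsOpen V ∧ p ∈ V ∧ P V := by
    intro p hp
    obtain ⟨c⟩ := hM.nonempty_chart hm hmd hp.1
    obtain ⟨C, hC⟩ := c.mean_square_le hm hmd hM (bvol M m) A hA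
    have hpos : 0 < (bvol M m) (M ∩ c.U) := by
      have h1 := bvol_inter_pos hm hmd hM hp (c.isOpen.mem_nhds c.mem)
      refine lt_of_lt_of_le h1 (measure_mono_ae ?_)
      filter_upwards [ae_mem_bdry hm hmd hM] with x hx hxU using ⟨hx.1, hxU⟩
    refine ⟨c.U, c.isOpen, c.mem, (((bvol M m) (M ∩ c.U)).toNNReal)⁻¹ * C, fun φ hφ => ?_⟩
    refine le_of_mul_le (ENNReal.toNNReal_pos hpos.ne' (measure_ne_top _ _)).ne' ?_
    rw [ENNReal.coe_toNNReal (measure_ne_top _ _), hres _ c.isOpen.measurableSet]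
    exact (hC φ hφ).2.trans (mul_le_mul_right (add_le_add_left (setLIntegral_le_lintegral _ _) _) _)
  -- a chart that meets a good set is good
  have hgood_chart : ∀ p ∈ M, ∀ c : Chart M m p, ∀ V, IsOpen V → P V →
      (M ∩ c.U ∩ V).Nonempty → P c.U := by
    rintro p hp c V hV ⟨C₀, hC₀⟩ ⟨q, ⟨hqM, hqU⟩, hqV⟩
    have hA'' : ∀ x : E d, ∀ r : ℝ, 0 < r → ((vol M m).restrict V) (Metric.closedBall x r) ≤
        A' * ENNReal.ofReal r ^ (m - 1) := fun x r hr =>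
      (Measure.restrict_apply_le _ _).trans (hA' x r hr)
    obtain ⟨C, hC⟩ := c.mean_square_le hm hmd hM ((vol M m).restrict V) A' hA''
    have hpos : 0 < ((vol M m).restrict V) (M ∩ c.U) := by
      rw [Measure.restrict_apply' hV.measurableSet]
      have h1 := vol_inter_pos hm hmd hM hqM ((c.isOpen.inter hV).mem_nhds ⟨hqU, hqV⟩)
      refine lt_of_lt_of_le h1 (measure_mono_ae ?_)
      filter_upwards [ae_mem_vol hM] with x hx hxU using ⟨⟨hx, hxU.1⟩, hxU.2⟩
    refine ⟨((((vol M m).restrict V) (M ∩ c.U)).toNNReal)⁻¹ * (C * (C₀ + 1)), fun φ hφ => ?_⟩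
    refine le_of_mul_le (ENNReal.toNNReal_pos hpos.ne' (measure_ne_top _ _)).ne' ?_
    rw [ENNReal.coe_toNNReal (measure_ne_top _ _), hres _ c.isOpen.measurableSet]
    refine (hC φ hφ).2.trans ?_
    push_cast
    rw [mul_assoc]
    refine mul_le_mul_right ?_ _
    rw [add_mul, one_mul]
    exact add_le_add ((setLIntegral_le_lintegral _ _).trans (hC₀ φ hφ)) le_add_self
  let O₁ : Set (E d) := {x | ∃ V, IsOpen V ∧ x ∈ V ∧ P V}
  have hO₁ : IsOpen O₁ := by
    rw [isOpen_iff_mem_nhds]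
    rintro x ⟨V, hV, hxV, hPV⟩
    exact mem_of_superset (hV.mem_nhds hxV) fun y hy => ⟨V, hV, hy, hPV⟩
  -- The charts centred at bad points. Such a chart cannot meet `O₁` inside `M`, for then its centre
  -- would be good.
  let O₂ : Set (E d) := {x | ∃ p ∈ M, p ∉ O₁ ∧ ∃ c : Chart M m p, x ∈ c.U}
  have hO₂ : IsOpen O₂ := by
    rw [isOpen_iff_mem_nhds]
    rintro x ⟨p, hp, hpO, c, hx⟩
    exact mem_of_superset (c.isOpen.mem_nhds hx) fun y hy => ⟨p, hp, hpO, c, hy⟩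
  have hall : ∀ x ∈ M, x ∈ O₁ := by
    intro x hx
    by_contra hxO
    have hpre := isPreconnected_connectedComponentIn (F := M) (x := x)
    have hsub : connectedComponentIn M x ⊆ M := connectedComponentIn_subset M x
    obtain ⟨b, hbK, hbb⟩ := hbd x hx
    obtain ⟨c₀⟩ := hM.nonempty_chart hm hmd hx
    -- The component of a bad point `x` meets `O₂` at `x` and `O₁` at a boundary point, so
    -- preconnectedness produces a point in both.
    have h := hpre O₁ O₂ hO₁ hO₂ (fun y hy => by
        by_cases hyO : y ∈ O₁
        · exact Or.inl hyO
        · obtain ⟨c⟩ := hM.nonempty_chart hm hmd (hsub hy)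
          exact Or.inr ⟨y, hsub hy, hyO, c, c.mem⟩)
      ⟨b, hbK, hgood_bdry b hbb⟩
      ⟨x, mem_connectedComponentIn hx, x, hx, hxO, c₀, c₀.mem⟩
    obtain ⟨y, hyK, ⟨V, hV, hyV, hPV⟩, p, hp, hpO, c, hyc⟩ := h
    exact hpO ⟨c.U, c.isOpen, c.mem, hgood_chart p hp c V hV hPV ⟨y, ⟨hsub hyK, hyc⟩, hyV⟩⟩
  have key : P M := by
    refine hM.isCompact.induction_on (p := P) ?_ ?_ ?_ ?_
    · exact ⟨0, fun φ _ => by simp⟩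
    · rintro s t hst ⟨C, hC⟩
      exact ⟨C, fun φ hφ => (lintegral_mono_set hst).trans (hC φ hφ)⟩
    · rintro s t ⟨C, hC⟩ ⟨C', hC'⟩
      refine ⟨C + C', fun φ hφ => (lintegral_union_le _ _ _).trans ?_⟩
      push_cast
      rw [add_mul]
      exact add_le_add (hC φ hφ) (hC' φ hφ)
    · intro x hx
      obtain ⟨V, hV, hxV, hPV⟩ := hall x hx
      exact ⟨V, mem_nhdsWithin_of_mem_nhds (hV.mem_nhds hxV), hPV⟩
  obtain ⟨C, hC⟩ := key
  refine ⟨C, fun φ hφ => le_trans (le_of_eq ?_) (hC φ hφ)⟩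
  rw [Measure.restrict_eq_self_of_ae_mem (ae_mem_vol hM)]

end Inequalities

/-! ### Kernel profiles and their tails -/

section Profile

/-- A profile `ρ` on `[0, ∞)` with derivative `ρ'`, vanishing beyond `1` and bounded by `B`. -/
structure IsProfile (ρ ρ' : ℝ → ℝ) (B : ℝ) : Prop where
  hasDeriv : ∀ r, 0 ≤ r → HasDerivWithinAt ρ (ρ' r) (Set.Ici 0) r
  continuousOn_deriv : ContinuousOn ρ' (Set.Ici 0)
  nonneg : ∀ r, 0 ≤ r → 0 ≤ ρ r
  zero : ∀ r, 1 < r → ρ r = 0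
  deriv_zero : ∀ r, 1 < r → ρ' r = 0
  le : ∀ r, 0 ≤ r → ρ r ≤ B
  deriv_le : ∀ r, 0 ≤ r → |ρ' r| ≤ B

lemma IsProfile.continuousOn {ρ ρ' : ℝ → ℝ} {B : ℝ} (h : IsProfile ρ ρ' B) :
    ContinuousOn ρ (Set.Ici 0) := fun r hr => (h.hasDeriv r hr).continuousWithinAt

lemma IsProfile.nonneg_bound {ρ ρ' : ℝ → ℝ} {B : ℝ} (h : IsProfile ρ ρ' B) : 0 ≤ B :=
  (h.nonneg 0 le_rfl).trans (h.le 0 le_rfl)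

lemma IsProfile.mono {ρ ρ' : ℝ → ℝ} {B B' : ℝ} (h : IsProfile ρ ρ' B) (hB : B ≤ B') :
    IsProfile ρ ρ' B' :=
  { h with
    le := fun r hr => (h.le r hr).trans hB
    deriv_le := fun r hr => (h.deriv_le r hr).trans hB }

lemma exists_bound_of_vanishing {f : ℝ → ℝ} (hf : ContinuousOn f (Set.Ici 0))
    (h0 : ∀ r, 1 < r → f r = 0) : ∃ B : ℝ, ∀ r, 0 ≤ r → |f r| ≤ B := by
  obtain ⟨B, hB⟩ := isCompact_Icc.exists_bound_of_continuousOn (s := Set.Icc (0 : ℝ) 1)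
    (hf.mono fun r hr => hr.1)
  refine ⟨max B 0, fun r hr => ?_⟩
  rcases le_or_gt r 1 with h | h
  · exact (hB r ⟨hr, h⟩).trans (le_max_left _ _)
  · rw [h0 r h, abs_zero]; exact le_max_right _ _

/-- As `ρ` is controlled only on the half line, `ρ (max s 0)` serves as a continuous extension. The
fixed upper limit `1`, allowed because `ρ` vanishes beyond it, makes the tail differentiable in the
lower limit. -/
lemma tail_eq_intervalIntegral {ρ : ℝ → ℝ} (h0 : ∀ r, 1 < r → ρ r = 0) {r : ℝ} (hr : 0 ≤ r)
    (hc : ContinuousOn ρ (Set.Ici 0)) : tail ρ r = ∫ s in r..1, ρ (max s 0) := by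
  have hcont : Continuous fun s => ρ (max s 0) := by
    refine hc.comp_continuous (by fun_prop) fun s => Set.mem_Ici.2 (le_max_right _ _)
  set b := max r 1 with hb
  have h1 : ∫ s in r..b, ρ (max s 0) = tail ρ r := by
    rw [intervalIntegral.integral_of_le (le_max_left _ _), tail]
    have e1 : ∫ s in Set.Ioc r b, ρ (max s 0) = ∫ s in Set.Ioc r b, ρ s :=
      setIntegral_congr_fun measurableSet_Ioc fun s hs => by
        simp only [max_eq_left (hr.trans hs.1.le)]
    rw [e1]
    refine (setIntegral_eq_of_subset_of_forall_sdiff_eq_zero measurableSet_Ioi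
      Set.Ioc_subset_Ioi_self fun s hs => ?_).symm
    have hsb : b < s := not_le.1 fun h => hs.2 ⟨hs.1, h⟩
    exact h0 s (lt_of_le_of_lt (le_max_right _ _) hsb)
  have h2 : ∫ s in (1 : ℝ)..b, ρ (max s 0) = 0 := by
    rw [intervalIntegral.integral_of_le (le_max_right _ _)]
    refine setIntegral_eq_zero_of_forall_eq_zero fun s hs => ?_
    rw [max_eq_left (zero_le_one.trans hs.1.le)]
    exact h0 s hs.1
  rw [← h1, ← intervalIntegral.integral_add_adjacent_intervals (hcont.intervalIntegrable r 1)
    (hcont.intervalIntegrable 1 b), h2, add_zero]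

lemma hasDerivWithinAt_tail {ρ : ℝ → ℝ} (h0 : ∀ r, 1 < r → ρ r = 0)
    (hc : ContinuousOn ρ (Set.Ici 0)) {r : ℝ} (hr : 0 ≤ r) :
    HasDerivWithinAt (tail ρ) (-ρ r) (Set.Ici 0) r := by
  have hcont : Continuous fun s => ρ (max s 0) := by
    refine hc.comp_continuous (by fun_prop) fun s => Set.mem_Ici.2 (le_max_right _ _)
  have h1 := intervalIntegral.integral_hasDerivAt_left (hcont.intervalIntegrable r 1)
    hcont.stronglyMeasurable.stronglyMeasurableAtFilter hcont.continuousAt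
  rw [max_eq_left hr] at h1
  exact h1.hasDerivWithinAt.congr (fun s hs => tail_eq_intervalIntegral h0 hs hc)
    (tail_eq_intervalIntegral h0 hr hc)

/-- The support has length at most `1`, so integrating does not enlarge the bound. Hence `R`, `R̄`
and `R̿` are handled with one constant. -/
lemma IsProfile.tail {ρ ρ' : ℝ → ℝ} {B : ℝ} (h : IsProfile ρ ρ' B) :
    IsProfile (tail ρ) (fun r => -ρ r) B where
  hasDeriv := fun r hr => hasDerivWithinAt_tail h.zero h.continuousOn hr
  continuousOn_deriv := h.continuousOn.neg
  nonneg := fun r hr => setIntegral_nonneg measurableSet_Ioi fun s hs =>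
    h.nonneg s (hr.trans (le_of_lt hs))
  zero := fun r hr => setIntegral_eq_zero_of_forall_eq_zero fun s hs => h.zero s (hr.trans hs)
  deriv_zero := fun r hr => by rw [h.zero r hr, neg_zero]
  le := fun r hr => by
    rcases le_or_gt r 1 with h1 | h1
    · rw [tail_eq_intervalIntegral h.zero hr h.continuousOn]
      have := intervalIntegral.norm_integral_le_of_norm_le_const (a := r) (b := 1) (C := B)
        (f := fun s => ρ (max s 0)) fun s _ => by
          rw [Real.norm_eq_abs, abs_of_nonneg (h.nonneg _ (le_max_right _ _))]
          exact h.le _ (le_max_right _ _)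
      rw [Real.norm_eq_abs] at this
      refine (le_abs_self _).trans (this.trans ?_)
      rw [abs_of_nonneg (by linarith)]
      exact mul_le_of_le_one_right h.nonneg_bound (by linarith)
    · have h0 : NonlocalPoisson.tail ρ r = 0 :=
        setIntegral_eq_zero_of_forall_eq_zero fun s hs => h.zero s (h1.trans hs)
      rw [h0]
      exact h.nonneg_bound
  deriv_le := fun r hr => by
    rw [abs_neg, abs_of_nonneg (h.nonneg r hr)]; exact h.le r hr

/-- Integrates the lower bound over `[r, a]`, of length at least `a / 2`. Applied once it makes `R̄`
positive near `0`, applied twice `R̿`. -/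
lemma IsProfile.tail_ge {ρ ρ' : ℝ → ℝ} {B c a : ℝ} (h : IsProfile ρ ρ' B) (hc : 0 ≤ c)
    (ha1 : a ≤ 1) (hρ : ∀ r, 0 ≤ r → r ≤ a → c ≤ ρ r) {r : ℝ} (hr : 0 ≤ r) (hra : r ≤ a / 2) :
    c * (a / 2) ≤ NonlocalPoisson.tail ρ r := by
  have hcont : Continuous fun s => ρ (max s 0) := by
    refine h.continuousOn.comp_continuous (by fun_prop) fun s => Set.mem_Ici.2 (le_max_right _ _)
  rw [tail_eq_intervalIntegral h.zero hr h.continuousOn,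
    ← intervalIntegral.integral_add_adjacent_intervals (hcont.intervalIntegrable r a)
      (hcont.intervalIntegrable a 1)]
  have h1 : c * (a - r) ≤ ∫ s in r..a, ρ (max s 0) := by
    have := intervalIntegral.integral_mono_on (a := r) (b := a) (f := fun _ => c) (by linarith)
      (intervalIntegrable_const (μ := volume)) (hcont.intervalIntegrable r a) fun s hs => by
        rw [max_eq_left (hr.trans hs.1)]; exact hρ s (hr.trans hs.1) hs.2
    simp only [intervalIntegral.integral_const, smul_eq_mul] at this
    linarith
  have h2 : 0 ≤ ∫ s in a..1, ρ (max s 0) :=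
    intervalIntegral.integral_nonneg ha1 fun s _ => h.nonneg _ (le_max_right _ _)
  nlinarith

variable {R : ℝ → ℝ}

/-- The inequality `R'² ≤ B R` is the analytic core. A nonnegative function with `L`-Lipschitz
derivative satisfies `R'² ≤ 4 L R`, as one sees by moving from `r` to `r - R'(r) / (2 L)` and using
`R ≥ 0` there. Near the endpoint `0` that point may be outside the half line, but there `R ≥ c` and
boundedness of `R'` is enough. -/
lemma IsKernel.exists_profile (hR : IsKernel R) :
    ∃ B : ℝ, IsProfile R (derivWithin R (Set.Ici 0)) B ∧
      ∀ r, 0 ≤ r → (derivWithin R (Set.Ici 0) r) ^ 2 ≤ B * R r := by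
  have hdiff : ∀ r, 0 ≤ r → HasDerivWithinAt R (derivWithin R (Set.Ici 0) r) (Set.Ici 0) r :=
    fun r hr => ((hR.contDiffOn.differentiableOn (by simp)) r hr).hasDerivWithinAt
  obtain ⟨K, hK⟩ := hR.lipschitz_deriv
  have hcont' : ContinuousOn (derivWithin R (Set.Ici 0)) (Set.Ici 0) := hK.continuousOn
  have hz' : ∀ r, 1 < r → derivWithin R (Set.Ici 0) r = 0 := by
    intro r hr
    have h1 : R =ᶠ[𝓝 r] fun _ => 0 := by
      filter_upwards [Ioi_mem_nhds hr] with s hs using hR.support s hs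
    have h2 : derivWithin R (Set.Ici 0) r = deriv R r :=
      derivWithin_of_mem_nhds (Ici_mem_nhds (by linarith))
    rw [h2, h1.deriv_eq, deriv_const]
  obtain ⟨B₁, hB₁⟩ := exists_bound_of_vanishing hR.contDiffOn.continuousOn hR.support
  obtain ⟨B₂, hB₂⟩ := exists_bound_of_vanishing hcont' hz'
  obtain ⟨c, hc, hRc⟩ := hR.nondegenerate
  have hB₂0 : 0 ≤ B₂ := (abs_nonneg _).trans (hB₂ 0 le_rfl)
  -- Besides the Lipschitz constant, `L` dominates `|R'|`, so the displacement `R' / (2 L)` is at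
  -- most `1/2` and stays in the half line when `r > 1/2`.
  set L : ℝ := max 1 (max K B₂) with hL
  have hL1 : 1 ≤ L := le_max_left _ _
  have hLK : (K : ℝ) ≤ L := (le_max_left _ _).trans (le_max_right _ _)
  have hLB : B₂ ≤ L := (le_max_right _ _).trans (le_max_right _ _)
  have htaylor : ∀ r s, 0 ≤ r → 0 ≤ s → 0 ≤ R r + derivWithin R (Set.Ici 0) r * (s - r) +
      L * (s - r) ^ 2 := by
    intro r s hr hs
    have hle : ∀ t ∈ Set.uIcc r s, |derivWithin R (Set.Ici 0) t - derivWithin R (Set.Ici 0) r| ≤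
        L * |s - r| := by
      intro t ht
      have ht0 : 0 ≤ t := (le_min hr hs).trans ht.1
      have h1 := hK.dist_le_mul t ht0 r hr
      rw [Real.dist_eq, Real.dist_eq] at h1
      refine h1.trans (mul_le_mul hLK (Set.abs_sub_left_of_mem_uIcc ht) (abs_nonneg _) (by linarith))
    have hmv := (convex_uIcc r s).norm_image_sub_le_of_norm_hasDerivWithin_le
      (f := fun t => R t - derivWithin R (Set.Ici 0) r * t)
      (f' := fun t => derivWithin R (Set.Ici 0) t - derivWithin R (Set.Ici 0) r)
      (C := L * |s - r|) (x := r) (y := s) (fun t ht => by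
        have ht0 : 0 ≤ t := (le_min hr hs).trans ht.1
        have h2 := ((hdiff t ht0).mono (s := Set.uIcc r s) fun u hu => (le_min hr hs).trans hu.1)
        have h3 := h2.fun_sub (((hasDerivAt_id t).const_mul
          (derivWithin R (Set.Ici 0) r)).hasDerivWithinAt)
        simpa using h3) hle Set.left_mem_uIcc Set.right_mem_uIcc
    rw [Real.norm_eq_abs, Real.norm_eq_abs, mul_assoc, ← sq, sq_abs] at hmv
    have h4 := (abs_le.1 hmv).2
    have h5 := hR.nonneg s hs
    nlinarith
  set B : ℝ := max (max B₁ B₂) (max (4 * L) (B₂ ^ 2 / c)) with hB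
  refine ⟨B, ⟨hdiff, hcont', hR.nonneg, hR.support, hz', fun r hr => ?_, fun r hr => ?_⟩, ?_⟩
  · exact ((le_abs_self _).trans (hB₁ r hr)).trans ((le_max_left _ _).trans (le_max_left _ _))
  · exact (hB₂ r hr).trans ((le_max_right _ _).trans (le_max_left _ _))
  · intro r hr
    have hRr := hR.nonneg r hr
    set D := derivWithin R (Set.Ici 0) r with hD
    have hDB : |D| ≤ B₂ := hB₂ r hr
    by_cases hhalf : r ≤ 1 / 2
    · have h1 := hRc r hr hhalf
      have h2 : D ^ 2 ≤ B₂ ^ 2 := by rw [← sq_abs]; gcongr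
      calc D ^ 2 ≤ B₂ ^ 2 / c * c := by rw [div_mul_cancel₀ _ hc.ne']; exact h2
        _ ≤ B₂ ^ 2 / c * R r := by gcongr
        _ ≤ B * R r := by
            gcongr
            exact (le_max_right _ _).trans (le_max_right _ _)
    · have hs : 0 ≤ r - D / (2 * L) := by
        have h1 : D / (2 * L) ≤ 1 / 2 := by
          rw [div_le_iff₀ (by linarith)]
          have := (le_abs_self D).trans (hDB.trans hLB)
          linarith
        linarith
      have h1 := htaylor r (r - D / (2 * L)) hr hs
      rw [← hD] at h1
      have h2 : R r + D * (r - D / (2 * L) - r) + L * (r - D / (2 * L) - r) ^ 2 =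
          R r - D ^ 2 / (4 * L) := by
        field_simp; ring
      rw [h2] at h1
      have h3 : D ^ 2 / (4 * L) ≤ R r := by linarith
      rw [div_le_iff₀ (by linarith)] at h3
      calc D ^ 2 ≤ 4 * L * R r := by linarith
        _ ≤ B * R r := by
            gcongr
            exact (le_max_left _ _).trans (le_max_right _ _)

end Profile

/-! ### Kernel integrals and their derivatives -/

section KernelIntegral

variable {d m : ℕ}

/-- The normalising constant `C_δ = (4 π δ²)^(-m/2)`. -/
def normConst (m : ℕ) (δ : ℝ) : ℝ := 1 / (4 * Real.pi * δ ^ 2) ^ ((m : ℝ) / 2)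

lemma normConst_nonneg (m : ℕ) (δ : ℝ) : 0 ≤ normConst m δ := by
  unfold normConst; positivity

lemma ker_eq (m : ℕ) (f : ℝ → ℝ) (δ : ℝ) (x y : E d) :
    ker m f δ x y = normConst m δ * f (‖x - y‖ ^ 2 / (4 * δ ^ 2)) := rfl

lemma ker_comm (m : ℕ) (f : ℝ → ℝ) (δ : ℝ) (x y : E d) : ker m f δ x y = ker m f δ y x := by
  rw [ker_eq, ker_eq, norm_sub_rev]

lemma ker_nonneg {f : ℝ → ℝ} (hf : ∀ r, 0 ≤ r → 0 ≤ f r) (m : ℕ) (δ : ℝ) (x y : E d) :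
    0 ≤ ker m f δ x y :=
  mul_nonneg (normConst_nonneg m δ) (hf _ (by positivity))

lemma continuous_ker {f : ℝ → ℝ} (hf : ContinuousOn f (Set.Ici 0)) (m : ℕ) (δ : ℝ) :
    Continuous fun p : E d × E d => ker m f δ p.1 p.2 := by
  refine continuous_const.mul (hf.comp_continuous (by fun_prop) fun p => ?_)
  exact Set.mem_Ici.2 (by positivity)

lemma continuous_ker_left {f : ℝ → ℝ} (hf : ContinuousOn f (Set.Ici 0)) (m : ℕ) (δ : ℝ)
    (y : E d) : Continuous fun x => ker m f δ x y := by
  refine continuous_const.mul (hf.comp_continuous (by fun_prop) fun x => ?_)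
  exact Set.mem_Ici.2 (by positivity)

lemma continuous_ker_right {f : ℝ → ℝ} (hf : ContinuousOn f (Set.Ici 0)) (m : ℕ) (δ : ℝ)
    (x : E d) : Continuous fun y => ker m f δ x y := by
  refine continuous_const.mul (hf.comp_continuous (by fun_prop) fun x => ?_)
  exact Set.mem_Ici.2 (by positivity)

lemma abs_ker_le {f : ℝ → ℝ} {B : ℝ} (hf : ∀ r, 0 ≤ r → |f r| ≤ B) (m : ℕ) (δ : ℝ) (x y : E d) :
    |ker m f δ x y| ≤ normConst m δ * B := by
  rw [ker_eq, abs_mul, abs_of_nonneg (normConst_nonneg m δ)]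
  exact mul_le_mul_of_nonneg_left (hf _ (by positivity)) (normConst_nonneg m δ)

lemma ker_eq_zero {f : ℝ → ℝ} (h0 : ∀ r, 1 < r → f r = 0) (m : ℕ) {δ : ℝ} (hδ : 0 < δ) {x y : E d}
    (hxy : 2 * δ < dist x y) : ker m f δ x y = 0 := by
  rw [ker_eq, h0, mul_zero]
  rw [dist_eq_norm] at hxy
  rw [lt_div_iff₀ (by positivity)]
  nlinarith [norm_nonneg (x - y)]

lemma enorm_ker_le {f : ℝ → ℝ} {B : ℝ} (hf : ∀ r, 0 ≤ r → |f r| ≤ B)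
    (h0 : ∀ r, 1 < r → f r = 0) (m : ℕ) {δ : ℝ} (hδ : 0 < δ) (x y : E d) :
    ‖ker m f δ x y‖ₑ ≤ ENNReal.ofReal (normConst m δ * B) * near (2 * δ) x y := by
  rcases le_or_gt (dist x y) (2 * δ) with h | h
  · rw [near_of_le h, mul_one, ← ofReal_norm, Real.norm_eq_abs]
    exact ENNReal.ofReal_le_ofReal (abs_ker_le hf m δ x y)
  · rw [ker_eq_zero h0 m hδ h, enorm_zero]; exact zero_le

variable {ρ ρ' : ℝ → ℝ} {B δ : ℝ}

lemma IsProfile.abs_le (h : IsProfile ρ ρ' B) : ∀ r, 0 ≤ r → |ρ r| ≤ B := fun r hr => by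
  rw [abs_of_nonneg (h.nonneg r hr)]; exact h.le r hr

/-- The argument `|x - y|² / (4 δ²)` never leaves the half line, so the one-sided derivative of the
profile is sufficient, even at `x = y`. -/
lemma IsProfile.hasFDerivAt_ker (h : IsProfile ρ ρ' B) (m : ℕ) (δ : ℝ) (x y : E d) :
    HasFDerivAt (fun x => ker m ρ δ x y)
      ((ker m ρ' δ x y / (2 * δ ^ 2)) • innerSL ℝ (x - y)) x := by
  have h1 : HasFDerivAt (fun x : E d => ‖x - y‖ ^ 2 / (4 * δ ^ 2))
      ((4 * δ ^ 2)⁻¹ • (2 • innerSL ℝ (x - y))) x := by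
    have := ((hasFDerivAt_id x).sub_const y).norm_sq
    have h2 := this.mul_const ((4 * δ ^ 2)⁻¹)
    simpa [div_eq_mul_inv] using h2
  have h2 := ((h.hasDeriv (‖x - y‖ ^ 2 / (4 * δ ^ 2)) (by positivity)).comp_hasFDerivAt x h1
    (Eventually.of_forall fun z => Set.mem_Ici.2 (by positivity))).const_mul (normConst m δ)
  convert! h2 using 1
  rw [ker_eq, two_smul, ← two_smul ℝ, smul_smul, smul_smul, smul_smul]
  congr 1
  rcases eq_or_ne δ 0 with rfl | hδ
  · simp
  · field_simp; ring

/-- The integrand of the derivative of a kernel integral. -/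
def kernelDeriv (m : ℕ) (ρ ρ' : ℝ → ℝ) (δ : ℝ) (α : E d → ℝ) (β : E d → E d) (x y : E d) :
    E d →L[ℝ] ℝ :=
  ker m ρ δ x y • innerSL ℝ (β y) +
    ((α y + inner ℝ (x - y) (β y)) * (ker m ρ' δ x y / (2 * δ ^ 2))) • innerSL ℝ (x - y)

/-- Integrals of this form, with suitable `α` and `β`, cover the kernel mass, the kernel average,
`𝒢_δ`, and both parts of `𝒫_δ`, so one rule for differentiating serves them all. -/
lemma IsProfile.hasFDerivAt_integrand (h : IsProfile ρ ρ' B) (m : ℕ) (δ : ℝ) (α : E d → ℝ)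
    (β : E d → E d) (x y : E d) :
    HasFDerivAt (fun x => (α y + inner ℝ (x - y) (β y)) * ker m ρ δ x y)
      (kernelDeriv m ρ ρ' δ α β x y) x := by
  have h1 : HasFDerivAt (fun x : E d => α y + inner ℝ (x - y) (β y)) (innerSL ℝ (β y)) x := by
    have := ((innerSL ℝ (β y)).hasFDerivAt (x := x - y)).comp x ((hasFDerivAt_id x).sub_const y)
    refine ((this.const_add (α y)).congr_of_eventuallyEq
      (Eventually.of_forall fun z => ?_)).congr_fderiv ?_
    · simp [real_inner_comm]
    · ext z; simp
  refine (h1.mul (h.hasFDerivAt_ker m δ x y)).congr_fderiv ?_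
  rw [kernelDeriv, smul_smul, add_comm]

/-- The support condition `|x - y| ≤ 2 δ` compensates one of the two powers of `δ⁻¹` from the
derivative of the kernel. The `3` is `1` from differentiating the inner product plus `2` from its
size. -/
lemma IsProfile.norm_kernelDeriv_le (h : IsProfile ρ ρ' B) (m : ℕ) (hδ : 0 < δ) (α : E d → ℝ)
    (β : E d → E d) (x y : E d) :
    ‖kernelDeriv m ρ ρ' δ α β x y‖ ≤ normConst m δ * B / δ * (‖α y‖ + 3 * δ * ‖β y‖) := by
  have hc := normConst_nonneg m δ
  have hB := h.nonneg_bound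
  rcases le_or_gt (dist x y) (2 * δ) with hd | hd
  · rw [dist_eq_norm] at hd
    have h1 := abs_ker_le h.abs_le m δ x y
    have h2 := abs_ker_le h.deriv_le m δ x y
    have h3 : ‖α y + inner ℝ (x - y) (β y)‖ ≤ ‖α y‖ + 2 * δ * ‖β y‖ :=
      (norm_add_le _ _).trans (add_le_add_right ((norm_inner_le_norm _ _).trans
        (mul_le_mul_of_nonneg_right hd (norm_nonneg _))) _)
    calc ‖kernelDeriv m ρ ρ' δ α β x y‖
        ≤ normConst m δ * B * ‖β y‖ +
          (‖α y‖ + 2 * δ * ‖β y‖) * (normConst m δ * B / (2 * δ ^ 2)) * (2 * δ) := by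
          refine (norm_add_le _ _).trans (add_le_add ?_ ?_)
          · rw [norm_smul, innerSL_apply_norm, Real.norm_eq_abs]
            gcongr
          · rw [norm_smul, innerSL_apply_norm, norm_mul, norm_div, Real.norm_eq_abs (ker _ _ _ _ _),
              Real.norm_of_nonneg (by positivity : (0 : ℝ) ≤ 2 * δ ^ 2)]
            gcongr
      _ = _ := by field_simp; ring
  · rw [kernelDeriv, ker_eq_zero h.zero m hδ hd, ker_eq_zero h.deriv_zero m hδ hd]
    simp only [zero_smul, zero_div, mul_zero, add_zero, norm_zero]
    positivity

lemma IsProfile.enorm_kernelDeriv_le (h : IsProfile ρ ρ' B) (m : ℕ) (hδ : 0 < δ) (α : E d → ℝ)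
    (β : E d → E d) (x y : E d) :
    ‖kernelDeriv m ρ ρ' δ α β x y‖ₑ ≤ ENNReal.ofReal (normConst m δ * B / δ) *
      (near (2 * δ) x y * (‖α y‖ₑ + ENNReal.ofReal (3 * δ) * ‖β y‖ₑ)) := by
  rcases le_or_gt (dist x y) (2 * δ) with hd | hd
  · have hc : 0 ≤ normConst m δ * B / δ :=
      div_nonneg (mul_nonneg (normConst_nonneg m δ) h.nonneg_bound) hδ.le
    have h1 := ENNReal.ofReal_le_ofReal (h.norm_kernelDeriv_le m hδ α β x y)
    rw [ENNReal.ofReal_mul hc, ENNReal.ofReal_add (norm_nonneg _) (by positivity),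
      ENNReal.ofReal_mul (by positivity : 0 ≤ 3 * δ), ofReal_norm, ofReal_norm,
      ofReal_norm] at h1
    rwa [near_of_le hd, one_mul]
  · rw [kernelDeriv, ker_eq_zero h.zero m hδ hd, ker_eq_zero h.deriv_zero m hδ hd]
    rw [zero_smul, zero_div, mul_zero, zero_smul, add_zero, enorm_zero (E := E d →L[ℝ] ℝ)]
    exact zero_le

variable {ν : Measure (E d)} {α : E d → ℝ} {β : E d → E d}

lemma IsProfile.aestronglyMeasurable_kernelDeriv (h : IsProfile ρ ρ' B) (m : ℕ) (δ : ℝ)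
    (hα : AEStronglyMeasurable α ν) (hβ : AEStronglyMeasurable β ν) (x : E d) :
    AEStronglyMeasurable (kernelDeriv m ρ ρ' δ α β x) ν := by
  have h1 : AEStronglyMeasurable (fun y => ker m ρ δ x y) ν :=
    (continuous_ker_right h.continuousOn m δ x).aestronglyMeasurable
  have h2 : AEStronglyMeasurable (fun y => ker m ρ' δ x y) ν :=
    (continuous_ker_right h.continuousOn_deriv m δ x).aestronglyMeasurable
  have h3 : AEStronglyMeasurable (fun y : E d => x - y) ν :=
    (by fun_prop : Continuous fun y : E d => x - y).aestronglyMeasurable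
  have h4 : AEStronglyMeasurable (fun y => innerSL ℝ (β y)) ν :=
    (innerSL ℝ (E := E d)).continuous.comp_aestronglyMeasurable hβ
  have h5 : AEStronglyMeasurable (fun y => innerSL ℝ (x - y)) ν :=
    (innerSL ℝ (E := E d)).continuous.comp_aestronglyMeasurable h3
  have h6 : AEStronglyMeasurable
      (fun y => (α y + inner ℝ (x - y) (β y)) * (ker m ρ' δ x y / (2 * δ ^ 2))) ν :=
    (hα.add (h3.inner (𝕜 := ℝ) hβ)).mul (h2.mul_const _)
  exact (h1.smul h4).add (h6.smul h5)

lemma IsProfile.aestronglyMeasurable_integrand (h : IsProfile ρ ρ' B) (m : ℕ) (δ : ℝ)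
    (hα : AEStronglyMeasurable α ν) (hβ : AEStronglyMeasurable β ν) (x : E d) :
    AEStronglyMeasurable (fun y => (α y + inner ℝ (x - y) (β y)) * ker m ρ δ x y) ν := by
  have h1 : AEStronglyMeasurable (fun y => ker m ρ δ x y) ν :=
    (continuous_ker_right h.continuousOn m δ x).aestronglyMeasurable
  have h3 : AEStronglyMeasurable (fun y : E d => x - y) ν :=
    (by fun_prop : Continuous fun y : E d => x - y).aestronglyMeasurable
  exact (hα.add (h3.inner (𝕜 := ℝ) hβ)).mul h1

lemma IsProfile.enorm_integrand_le (h : IsProfile ρ ρ' B) (m : ℕ) (hδ : 0 < δ) (α : E d → ℝ)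
    (β : E d → E d) (x y : E d) :
    ‖(α y + inner ℝ (x - y) (β y)) * ker m ρ δ x y‖ₑ ≤ ENNReal.ofReal (normConst m δ * B) *
      (near (2 * δ) x y * (‖α y‖ₑ + ENNReal.ofReal (2 * δ) * ‖β y‖ₑ)) := by
  rcases le_or_gt (dist x y) (2 * δ) with hd | hd
  · rw [enorm_mul, mul_comm, ← mul_assoc]
    refine mul_le_mul' (enorm_ker_le h.abs_le h.zero m hδ x y) ?_
    refine (enorm_add_le _ _).trans (add_le_add_right ?_ _)
    rw [dist_eq_norm] at hd
    rw [← ofReal_norm, ← ofReal_norm, ← ENNReal.ofReal_mul (by positivity)]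
    exact ENNReal.ofReal_le_ofReal ((norm_inner_le_norm _ _).trans
        (mul_le_mul_of_nonneg_right hd (norm_nonneg _)))
  · rw [ker_eq_zero h.zero m hδ hd]
    simp

lemma IsProfile.integrable_integrand (h : IsProfile ρ ρ' B) (m : ℕ) (hδ : 0 < δ)
    (hα : Integrable α ν) (hβ : Integrable β ν) (x : E d) :
    Integrable (fun y => (α y + inner ℝ (x - y) (β y)) * ker m ρ δ x y) ν := by
  have hc : 0 ≤ normConst m δ * B := mul_nonneg (normConst_nonneg m δ) h.nonneg_bound
  refine Integrable.mono' ((hα.norm.add (hβ.norm.const_mul (2 * δ))).const_mul (normConst m δ * B))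
    (h.aestronglyMeasurable_integrand m δ hα.1 hβ.1 x) (Eventually.of_forall fun y => ?_)
  have h1 := h.enorm_integrand_le m hδ α β x y
  have h2 := h1.trans (mul_le_mul_right (mul_le_of_le_one_left zero_le (near_le_one _ _ _)) _)
  rw [← ofReal_norm, ← ofReal_norm, ← ofReal_norm,
    ← ENNReal.ofReal_mul (by positivity), ← ENNReal.ofReal_add (by positivity) (by positivity),
    ← ENNReal.ofReal_mul hc] at h2
  exact (ENNReal.ofReal_le_ofReal_iff (mul_nonneg hc
    (add_nonneg (norm_nonneg _) (mul_nonneg (by positivity) (norm_nonneg _))))).1 h2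

/-- Kernel integrals may be differentiated under the integral sign. -/
lemma IsProfile.hasFDerivAt_integral (h : IsProfile ρ ρ' B) (m : ℕ) (hδ : 0 < δ)
    (hα : Integrable α ν) (hβ : Integrable β ν) (x : E d) :
    HasFDerivAt (fun x => ∫ y, (α y + inner ℝ (x - y) (β y)) * ker m ρ δ x y ∂ν)
      (∫ y, kernelDeriv m ρ ρ' δ α β x y ∂ν) x :=
  hasFDerivAt_integral_of_dominated_of_fderiv_le (s := Set.univ)
    (bound := fun y => normConst m δ * B / δ * (‖α y‖ + 3 * δ * ‖β y‖)) univ_mem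
    (Eventually.of_forall fun z => h.aestronglyMeasurable_integrand m δ hα.1 hβ.1 z)
    (h.integrable_integrand m hδ hα hβ x) (h.aestronglyMeasurable_kernelDeriv m δ hα.1 hβ.1 x)
    (Eventually.of_forall fun y z _ => h.norm_kernelDeriv_le m hδ α β z y)
    ((hα.norm.add (hβ.norm.const_mul (3 * δ))).const_mul _)
    (Eventually.of_forall fun y z _ => h.hasFDerivAt_integrand m δ α β z y)

lemma IsProfile.continuous_kernelDeriv (h : IsProfile ρ ρ' B) (m : ℕ) (δ : ℝ) (α : E d → ℝ)
    (β : E d → E d) (y : E d) : Continuous fun x => kernelDeriv m ρ ρ' δ α β x y := by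
  have h1 : Continuous fun x => ker m ρ δ x y :=
    continuous_ker_left h.continuousOn m δ y
  have h2 : Continuous fun x => ker m ρ' δ x y :=
    continuous_ker_left h.continuousOn_deriv m δ y
  have h5 : Continuous fun x : E d => innerSL ℝ (x - y) :=
    (innerSL ℝ (E := E d)).continuous.comp (continuous_id.sub continuous_const)
  have h6 : Continuous fun x : E d => α y + inner ℝ (x - y) (β y) := by fun_prop
  exact (h1.smul continuous_const).add ((h6.mul (h2.div_const _)).smul h5)

lemma IsProfile.contDiff_integral (h : IsProfile ρ ρ' B) (m : ℕ) (hδ : 0 < δ)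
    (hα : Integrable α ν) (hβ : Integrable β ν) :
    ContDiff ℝ 1 fun x => ∫ y, (α y + inner ℝ (x - y) (β y)) * ker m ρ δ x y ∂ν := by
  have hcont : Continuous fun x => ∫ y, kernelDeriv m ρ ρ' δ α β x y ∂ν :=
    continuous_of_dominated (fun x => h.aestronglyMeasurable_kernelDeriv m δ hα.1 hβ.1 x)
      (fun x => Eventually.of_forall fun y => h.norm_kernelDeriv_le m hδ α β x y)
      ((hα.norm.add (hβ.norm.const_mul (3 * δ))).const_mul (normConst m δ * B / δ))
      (Eventually.of_forall fun y => h.continuous_kernelDeriv m δ α β y)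
  exact contDiff_one_iff_hasFDerivAt.2 ⟨_, hcont, h.hasFDerivAt_integral m hδ hα hβ⟩

lemma IsProfile.enorm_integral_le (h : IsProfile ρ ρ' B) (m : ℕ) (hδ : 0 < δ) (α : E d → ℝ)
    (β : E d → E d) (ν : Measure (E d)) (x : E d) :
    ‖∫ y, (α y + inner ℝ (x - y) (β y)) * ker m ρ δ x y ∂ν‖ₑ ≤
      ENNReal.ofReal (normConst m δ * B) *
        ∫⁻ y, near (2 * δ) x y * (‖α y‖ₑ + ENNReal.ofReal (2 * δ) * ‖β y‖ₑ) ∂ν := by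
  rw [← lintegral_const_mul' _ _ ENNReal.ofReal_ne_top]
  exact (enorm_integral_le_lintegral_enorm _).trans
    (lintegral_mono fun y => h.enorm_integrand_le m hδ α β x y)

lemma IsProfile.enorm_fderiv_integral_le (h : IsProfile ρ ρ' B) (m : ℕ) (hδ : 0 < δ)
    (hα : Integrable α ν) (hβ : Integrable β ν) (x : E d) :
    ‖fderiv ℝ (fun x => ∫ y, (α y + inner ℝ (x - y) (β y)) * ker m ρ δ x y ∂ν) x‖ₑ ≤
      ENNReal.ofReal (normConst m δ * B / δ) *
        ∫⁻ y, near (2 * δ) x y * (‖α y‖ₑ + ENNReal.ofReal (3 * δ) * ‖β y‖ₑ) ∂ν := by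
  rw [(h.hasFDerivAt_integral m hδ hα hβ x).fderiv,
    ← lintegral_const_mul' _ _ ENNReal.ofReal_ne_top]
  exact (enorm_integral_le_lintegral_enorm _).trans
    (lintegral_mono fun y => h.enorm_kernelDeriv_le m hδ α β x y)

end KernelIntegral

/-! ### A Schur test for ball averages -/

section Schur

variable {d : ℕ}

/-- Schur test for the averaging operator over balls of radius `ρ`. -/
lemma lintegral_sq_near_le {σ ν : Measure (E d)} [SFinite σ] [SFinite ν] {c A A' : ℝ≥0∞} {ρ : ℝ}
    (hν : ∀ x, c * ν (Metric.closedBall x ρ) ≤ A) (hσ : ∀ x, c * σ (Metric.closedBall x ρ) ≤ A')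
    {f : E d → ℝ≥0∞} (hf : AEMeasurable f ν) :
    ∫⁻ x, (c * ∫⁻ y, near ρ x y * f y ∂ν) ^ 2 ∂σ ≤ A * A' * ∫⁻ y, f y ^ 2 ∂ν := by
  have hn : ∀ x : E d, Measurable fun y => near ρ x y := fun x =>
    measurable_near ρ measurable_const measurable_id
  calc ∫⁻ x, (c * ∫⁻ y, near ρ x y * f y ∂ν) ^ 2 ∂σ
      ≤ ∫⁻ x, A * (c * ∫⁻ y, near ρ x y * f y ^ 2 ∂ν) ∂σ := by
        refine lintegral_mono fun x => ?_
        have h1 := sq_lintegral_mul_weight_le ν (hn x).aemeasurable hf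
        rw [lintegral_near_right] at h1
        calc (c * ∫⁻ y, near ρ x y * f y ∂ν) ^ 2
            = c ^ 2 * (∫⁻ y, near ρ x y * f y ∂ν) ^ 2 := mul_pow _ _ _
          _ ≤ c ^ 2 * (ν (Metric.closedBall x ρ) * ∫⁻ y, near ρ x y * f y ^ 2 ∂ν) := by gcongr
          _ = (c * ν (Metric.closedBall x ρ)) * (c * ∫⁻ y, near ρ x y * f y ^ 2 ∂ν) := by ring
          _ ≤ _ := by gcongr; exact hν x
    _ ≤ A * (c * ∫⁻ x, (∫⁻ y, near ρ x y * f y ^ 2 ∂ν) ∂σ) := by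
        have hm : AEMeasurable (fun x => ∫⁻ y, near ρ x y * f y ^ 2 ∂ν) σ := by
          obtain ⟨g, hg, hfg⟩ := hf
          have e : (fun x => ∫⁻ y, near ρ x y * f y ^ 2 ∂ν) =
              fun x => ∫⁻ y, near ρ x y * g y ^ 2 ∂ν := by
            ext x
            exact lintegral_congr_ae (hfg.mono fun y hy => by simp only [hy])
          rw [e]
          exact (((measurable_near ρ measurable_fst measurable_snd).mul
            ((hg.comp measurable_snd).pow_const 2)).lintegral_prod_right').aemeasurable
        rw [lintegral_const_mul'' _ (hm.const_mul _), lintegral_const_mul'' _ hm]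
    _ = A * ∫⁻ y, (c * ∫⁻ x, near ρ x y ∂σ) * f y ^ 2 ∂ν := by
        have hsw : ∫⁻ x, (∫⁻ y, near ρ x y * f y ^ 2 ∂ν) ∂σ =
            ∫⁻ y, (∫⁻ x, near ρ x y * f y ^ 2 ∂σ) ∂ν := by
          refine lintegral_lintegral_swap ?_
          exact (measurable_near ρ measurable_fst measurable_snd).aemeasurable.mul
            ((hf.comp_snd (μ := σ)).pow_const 2)
        rw [hsw]
        have hm2 : ∀ y, ∫⁻ x, near ρ x y * f y ^ 2 ∂σ = (∫⁻ x, near ρ x y ∂σ) * f y ^ 2 :=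
          fun y => lintegral_mul_const _ (measurable_near ρ measurable_id measurable_const)
        simp_rw [hm2, mul_assoc]
        have hm3 : AEMeasurable (fun y => (∫⁻ x, near ρ x y ∂σ) * f y ^ 2) ν :=
          ((measurable_near ρ measurable_fst measurable_snd).lintegral_prod_left'
            (μ := σ)).aemeasurable.mul (hf.pow_const 2)
        rw [← lintegral_const_mul'' c hm3]
    _ ≤ A * ∫⁻ y, A' * f y ^ 2 ∂ν := by
        refine mul_le_mul_right (lintegral_mono fun y => ?_) _
        rw [lintegral_near]
        exact mul_le_mul_left (hσ y) _
    _ = _ := by rw [lintegral_const_mul'' _ (hf.pow_const 2), mul_assoc]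

end Schur

/-! ### Scaling of the normalising constant -/

section Normalisation

variable {d m : ℕ}

/-- So `C_δ` times the volume of a ball of radius `2 δ` is bounded in `M`, and of order at most
`δ⁻¹` in `∂M`. -/
lemma normConst_mul_pow (m : ℕ) {δ : ℝ} (hδ : 0 < δ) : normConst m δ * δ ^ m = normConst m 1 := by
  have h1 : (4 * Real.pi * δ ^ 2) ^ ((m : ℝ) / 2) = (4 * Real.pi) ^ ((m : ℝ) / 2) * δ ^ m := by
    rw [Real.mul_rpow (by positivity) (by positivity), ← Real.rpow_natCast δ 2, ← Real.rpow_mul hδ.le]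
    congr 1
    rw [← Real.rpow_natCast]
    congr 1
    push_cast; ring
  have h2 : (4 * Real.pi) ^ ((m : ℝ) / 2) ≠ 0 := (Real.rpow_pos_of_pos (by positivity) _).ne'
  rw [normConst, normConst, h1, one_pow, mul_one]
  field_simp

lemma normConst_one_pos (m : ℕ) : 0 < normConst m 1 := by
  unfold normConst; positivity

lemma ofReal_normConst_mul_pow (m : ℕ) {δ : ℝ} (hδ : 0 < δ) :
    ENNReal.ofReal (normConst m δ) * ENNReal.ofReal δ ^ m = ENNReal.ofReal (normConst m 1) := by
  rw [← ENNReal.ofReal_pow hδ.le, ← ENNReal.ofReal_mul (normConst_nonneg m δ),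
    normConst_mul_pow m hδ]

lemma const_mul_le_integral {ν : Measure (E d)} [IsFiniteMeasure ν] {f : E d → ℝ} {a : ℝ}
    {s : Set (E d)} (hs : MeasurableSet s) (hf : Integrable f ν) (h0 : ∀ᵐ y ∂ν, 0 ≤ f y)
    (ha : ∀ y ∈ s, a ≤ f y) : a * ν.real s ≤ ∫ y, f y ∂ν := by
  calc a * ν.real s = ∫ _ in s, a ∂ν := by simp [mul_comm]
    _ ≤ ∫ y in s, f y ∂ν :=
        setIntegral_mono_on integrableOn_const hf.integrableOn hs ha
    _ ≤ ∫ y, f y ∂ν := setIntegral_le_integral hf h0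

lemma integral_le_of_near {ν : Measure (E d)} [IsFiniteMeasure ν] {f : E d → ℝ} {a ρ : ℝ} {x : E d}
    (ha : ∀ y, dist x y ≤ ρ → |f y| ≤ a) (h0 : ∀ y, ρ < dist x y → f y = 0) :
    |∫ y, f y ∂ν| ≤ a * ν.real (Metric.closedBall x ρ) := by
  have h1 : ∫ y, f y ∂ν = ∫ y in Metric.closedBall x ρ, f y ∂ν := by
    refine (setIntegral_eq_integral_of_forall_compl_eq_zero fun y hy => h0 y ?_).symm
    rw [Metric.mem_closedBall, not_le, dist_comm] at hy
    exact hy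
  rw [h1, ← Real.norm_eq_abs]
  refine norm_setIntegral_le_of_norm_le_const (measure_lt_top _ _) fun y hy => ?_
  rw [Metric.mem_closedBall, dist_comm] at hy
  exact ha y hy

variable {f : ℝ → ℝ} {c a δ : ℝ}

lemma le_ker_of_dist_le (hf : ∀ r, 0 ≤ r → r ≤ a ^ 2 / 4 → c ≤ f r) (m : ℕ) (hδ : 0 < δ)
    {x y : E d} (h : dist x y ≤ a * δ) : normConst m δ * c ≤ ker m f δ x y := by
  rw [ker_eq]
  refine mul_le_mul_of_nonneg_left (hf _ (by positivity) ?_) (normConst_nonneg m δ)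
  rw [dist_eq_norm] at h
  rw [div_le_div_iff₀ (by positivity) (by positivity)]
  nlinarith [norm_nonneg (x - y)]

end Normalisation

/-! ### Bounds uniform in the scale -/

section Uniform

variable {d m : ℕ} {M : Set (E d)} {R : ℝ → ℝ}

/-- The estimates at scale `δ` on which the well-posedness proof rests. -/
structure UniformBounds (M : Set (E d)) (m : ℕ) (R : ℝ → ℝ) (C : ℝ≥0) (δ : ℝ) : Prop where
  pos : 0 < δ
  le_one : δ ≤ 1
  finite_vol : IsFiniteMeasure (vol M m)
  finite_bvol : IsFiniteMeasure (bvol M m)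
  isCompact : IsCompact M
  ae_vol : ∀ᵐ x ∂(vol M m), x ∈ M
  ae_bvol : ∀ᵐ x ∂(bvol M m), x ∈ bdry M m
  normal_meas : AEStronglyMeasurable (outwardNormal M) (bvol M m)
  curvature_meas : AEStronglyMeasurable (curvature M m) (bvol M m)
  norm_normal : ∀ x ∈ bdry M m, ‖outwardNormal M x‖ = 1
  curvature_le : ∀ x ∈ bdry M m, |curvature M m x| ≤ C
  mul_curvature_le : ∀ x ∈ bdry M m, 2 * δ * |curvature M m x| ≤ 1
  profile : IsProfile R (derivWithin R (Set.Ici 0)) C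
  deriv_sq_le : ∀ r, 0 ≤ r → (derivWithin R (Set.Ici 0) r) ^ 2 ≤ C * R r
  vol_le : ∀ x, ENNReal.ofReal (normConst m δ) * vol M m (Metric.closedBall x (2 * δ)) ≤ C
  bvol_le : ∀ x, ENNReal.ofReal (normConst m δ) * bvol M m (Metric.closedBall x (2 * δ)) ≤
    C * (ENNReal.ofReal δ)⁻¹
  mass_ge : ∀ x ∈ M, 1 ≤ C * ∫ y, ker m R δ x y ∂(vol M m)
  weight_ge : ∀ x ∈ bdry M m, 1 ≤ C * ∫ y,
    (2 - inner ℝ (x - y) (curvature M m x • outwardNormal M x)) * kerBar m R δ x y ∂(vol M m)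
  tildeR_le : ∀ x ∈ bdry M m, tildeR M m R δ x ≤ C * δ
  tildeR_ge : ∀ x ∈ bdry M m, δ ≤ C * tildeR M m R δ x
  difference : ∀ φ : E d → ℝ, (∀ x ∈ M, ContDiffAt ℝ 1 φ x) →
    ENNReal.ofReal (normConst m δ) *
      ∫⁻ x, (∫⁻ y, near (2 * δ) x y * ‖φ x - φ y‖ₑ ^ 2 ∂(vol M m)) ∂(bvol M m) ≤
      C * ENNReal.ofReal δ * dirichlet M m φ
  poincare : ∀ φ : E d → ℝ, (∀ x ∈ M, ContDiffAt ℝ 1 φ x) →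
    ∫⁻ x, ‖φ x‖ₑ ^ 2 ∂(vol M m) ≤
      C * (∫⁻ x, ‖φ x‖ₑ ^ 2 ∂(bvol M m) + dirichlet M m φ)

/-- On the ball of radius `a δ` the kernel is at least `C_δ c`, and lower Ahlfors regularity gives
that ball volume at least of order `δ^m`. -/
lemma exists_mass_ge (hm : 1 ≤ m) (hmd : m ≤ d) (hM : IsCompactSubmanifold M m) {ρ ρ' : ℝ → ℝ}
    {B c a : ℝ} (hρ : IsProfile ρ ρ' B) (hc : 0 < c) (ha : 0 < a) (ha1 : a ≤ 1)
    (hρc : ∀ r, 0 ≤ r → r ≤ a ^ 2 / 4 → c ≤ ρ r) :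
    ∃ b : ℝ, 0 < b ∧ ∀ δ : ℝ, 0 < δ → δ ≤ 1 → ∀ x ∈ M, b ≤ ∫ y, ker m ρ δ x y ∂(vol M m) := by
  have := hM.isFiniteMeasure_vol hm hmd
  obtain ⟨A, hA, hAb⟩ := exists_le_vol_closedBall hM.isCompact fun _ hp => hM.nonempty_chart hm hmd hp
  have hN := normConst_one_pos m
  refine ⟨c * normConst m 1 * a ^ m * A, by positivity, fun δ hδ hδ1 x hx => ?_⟩
  have h1 := hAb x hx (a * δ) (by positivity) (by nlinarith)
  have h2 : (A : ℝ) * (a * δ) ^ m ≤ (vol M m).real (Metric.closedBall x (a * δ)) := by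
    rw [← ENNReal.ofReal_pow (by positivity), ← ENNReal.ofReal_coe_nnreal,
      ← ENNReal.ofReal_mul A.coe_nonneg] at h1
    exact (ENNReal.ofReal_le_iff_le_toReal (measure_ne_top _ _)).1 h1
  have hInt : Integrable (fun y => ker m ρ δ x y) (vol M m) := by
    simpa using hρ.integrable_integrand (ν := vol M m) m hδ (integrable_const (1 : ℝ))
      (integrable_const (0 : E d)) x
  have h3 := const_mul_le_integral (a := normConst m δ * c) (s := Metric.closedBall x (a * δ))
    Metric.isClosed_closedBall.measurableSet hInt
    (Eventually.of_forall fun y => ker_nonneg hρ.nonneg m δ x y) fun y hy => by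
      rw [Metric.mem_closedBall, dist_comm] at hy
      exact le_ker_of_dist_le hρc m hδ hy
  refine le_trans ?_ h3
  calc c * normConst m 1 * a ^ m * A = normConst m δ * c * (A * (a * δ) ^ m) := by
        rw [← normConst_mul_pow m hδ]; ring
    _ ≤ _ := mul_le_mul_of_nonneg_left h2 (mul_nonneg (normConst_nonneg m δ) hc.le)

lemma exists_boundary_mass_ge (hm : 1 ≤ m) (hmd : m ≤ d) (hM : IsCompactSubmanifold M m)
    {ρ ρ' : ℝ → ℝ} {B c a : ℝ} (hρ : IsProfile ρ ρ' B) (hc : 0 < c) (ha : 0 < a) (ha1 : a ≤ 1)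
    (hρc : ∀ r, 0 ≤ r → r ≤ a ^ 2 / 4 → c ≤ ρ r) :
    ∃ b : ℝ, 0 < b ∧ ∀ δ : ℝ, 0 < δ → δ ≤ 1 → ∀ x ∈ bdry M m,
      b ≤ δ * ∫ y, ker m ρ δ x y ∂(bvol M m) := by
  have := hM.isFiniteMeasure_bvol hm hmd
  obtain ⟨A, hA, hAb⟩ := exists_le_vol_closedBall (hM.isCompact_bdry hm hmd)
    fun _ hp => nonempty_chart_bdry hm hmd hp
  have hN := normConst_one_pos m
  refine ⟨c * normConst m 1 * a ^ (m - 1) * A, by positivity, fun δ hδ hδ1 x hx => ?_⟩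
  have h1 : _ ≤ bvol M m _ := hAb x hx (a * δ) (by positivity) (by nlinarith)
  have h2 : (A : ℝ) * (a * δ) ^ (m - 1) ≤ (bvol M m).real (Metric.closedBall x (a * δ)) := by
    rw [← ENNReal.ofReal_pow (by positivity), ← ENNReal.ofReal_coe_nnreal,
      ← ENNReal.ofReal_mul A.coe_nonneg] at h1
    exact (ENNReal.ofReal_le_iff_le_toReal (measure_ne_top _ _)).1 h1
  have hInt : Integrable (fun y => ker m ρ δ x y) (bvol M m) := by
    simpa using hρ.integrable_integrand (ν := bvol M m) m hδ (integrable_const (1 : ℝ))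
      (integrable_const (0 : E d)) x
  have h3 := const_mul_le_integral (a := normConst m δ * c) (s := Metric.closedBall x (a * δ))
    Metric.isClosed_closedBall.measurableSet hInt
    (Eventually.of_forall fun y => ker_nonneg hρ.nonneg m δ x y) fun y hy => by
      rw [Metric.mem_closedBall, dist_comm] at hy
      exact le_ker_of_dist_le hρc m hδ hy
  refine le_trans ?_ (mul_le_mul_of_nonneg_left h3 hδ.le)
  have hpow : δ ^ m = δ * δ ^ (m - 1) := by
    rw [← pow_succ', Nat.sub_add_cancel hm]
  calc c * normConst m 1 * a ^ (m - 1) * A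
      = δ * (normConst m δ * c * (A * (a * δ) ^ (m - 1))) := by
        rw [← normConst_mul_pow m hδ, hpow]; ring
    _ ≤ _ := mul_le_mul_of_nonneg_left (mul_le_mul_of_nonneg_left h2
        (mul_nonneg (normConst_nonneg m δ) hc.le)) hδ.le

lemma exists_normConst_mul_vol_le (hm : 1 ≤ m) (hmd : m ≤ d) (hM : IsCompactSubmanifold M m) :
    ∃ A : ℝ≥0, ∀ δ : ℝ, 0 < δ → ∀ x,
      ENNReal.ofReal (normConst m δ) * vol M m (Metric.closedBall x (2 * δ)) ≤ A := by
  obtain ⟨A, hA⟩ := exists_vol_closedBall_le hM.isCompact fun _ hp => hM.nonempty_chart hm hmd hp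
  refine ⟨Real.toNNReal (normConst m 1) * (A * 2 ^ m), fun δ hδ x => ?_⟩
  refine (mul_le_mul_right (hA x (2 * δ) (by positivity)) _).trans_eq ?_
  rw [ENNReal.coe_mul, ← ENNReal.ofReal, ← ofReal_normConst_mul_pow m hδ,
    ENNReal.ofReal_mul (by positivity)]
  push_cast
  rw [ENNReal.ofReal_ofNat]
  ring

lemma exists_normConst_mul_bvol_le (hm : 1 ≤ m) (hmd : m ≤ d) (hM : IsCompactSubmanifold M m) :
    ∃ A : ℝ≥0, ∀ δ : ℝ, 0 < δ → ∀ x,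
      ENNReal.ofReal (normConst m δ) * bvol M m (Metric.closedBall x (2 * δ)) ≤
        A * (ENNReal.ofReal δ)⁻¹ := by
  obtain ⟨A, hA⟩ := exists_bvol_closedBall_le hm hmd hM
  refine ⟨Real.toNNReal (normConst m 1) * (A * 2 ^ (m - 1)), fun δ hδ x => ?_⟩
  refine (mul_le_mul_right (hA x (2 * δ) (by positivity)) _).trans_eq ?_
  have hδ' : ENNReal.ofReal δ ≠ 0 := by simpa using hδ
  have hpow : ENNReal.ofReal δ ^ m = ENNReal.ofReal δ * ENNReal.ofReal δ ^ (m - 1) := by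
    rw [← pow_succ', Nat.sub_add_cancel hm]
  rw [ENNReal.coe_mul, ← ENNReal.ofReal, ← ofReal_normConst_mul_pow m hδ,
    ENNReal.ofReal_mul (by positivity), hpow]
  push_cast
  rw [ENNReal.ofReal_ofNat]
  calc _ = ENNReal.ofReal (normConst m δ) * ENNReal.ofReal δ ^ (m - 1) * (A * 2 ^ (m - 1)) * 1 := by
        ring
    _ = _ := by rw [← ENNReal.mul_inv_cancel hδ' ENNReal.ofReal_ne_top]; ring

lemma exists_curvature_bound (hm : 1 ≤ m) (hmd : m ≤ d) (hM : IsCompactSubmanifold M m) :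
    ∃ K : ℝ, 0 < K ∧ ∀ x ∈ bdry M m, |curvature M m x| ≤ K := by
  obtain ⟨K, hK⟩ := (hM.isCompact_bdry hm hmd).exists_bound_of_continuousOn
    (continuousOn_curvature hm hmd)
  exact ⟨max K 1, by positivity, fun x hx => (hK x hx).trans (le_max_left _ _)⟩

lemma mul_real_le_of_mul_le {ν : Measure (E d)} [IsFiniteMeasure ν] {c A : ℝ} (hc : 0 ≤ c)
    (hA : 0 ≤ A) {s : Set (E d)} (h : ENNReal.ofReal c * ν s ≤ ENNReal.ofReal A) :
    c * ν.real s ≤ A := by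
  rw [← ofReal_measureReal, ← ENNReal.ofReal_mul hc] at h
  exact (ENNReal.ofReal_le_ofReal_iff hA).1 h

lemma kerBar_eq (m : ℕ) (R : ℝ → ℝ) (δ : ℝ) (x y : E d) :
    kerBar m R δ x y = ker m (tail R) δ x y := rfl

lemma abs_inner_smul_le {κ ρ : ℝ} {n z : E d} (hn : ‖n‖ = 1) (hz : ‖z‖ ≤ ρ) :
    |inner ℝ z (κ • n)| ≤ ρ * |κ| := by
  refine (abs_real_inner_le_norm _ _).trans ?_
  rw [norm_smul, hn, mul_one, Real.norm_eq_abs]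
  gcongr

/-- On the support of the kernel the curvature correction is at most `2 δ |κ| ≤ 1`, so the
coefficient is at least `1` and the weight is at least the mass of `R̄_δ`. -/
lemma exists_weight_ge (hm : 1 ≤ m) (hmd : m ≤ d) (hM : IsCompactSubmanifold M m) {R' : ℝ → ℝ}
    {B c : ℝ} (hR : IsProfile R R' B) (hc : 0 < c) (hRc : ∀ r, 0 ≤ r → r ≤ 1 / 2 → c ≤ R r) :
    ∃ b : ℝ, 0 < b ∧ ∀ δ : ℝ, 0 < δ → δ ≤ 1 →
      (∀ x ∈ bdry M m, 2 * δ * |curvature M m x| ≤ 1) → ∀ x ∈ bdry M m, b ≤ ∫ y,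
        (2 - inner ℝ (x - y) (curvature M m x • outwardNormal M x)) * kerBar m R δ x y
          ∂(vol M m) := by
  have := hM.isFiniteMeasure_vol hm hmd
  -- The lower bound `c` of `R` on `[0, 1/2]` becomes `c / 4` for `R̄` on `[0, 1/4]`, which is the
  -- range `a² / 4` for `a = 1`.
  obtain ⟨b, hb, hbw⟩ := exists_mass_ge hm hmd hM (c := c * (1 / 2 / 2)) (a := 1) hR.tail
    (by positivity) one_pos le_rfl (fun r hr hr1 => hR.tail_ge hc.le (by norm_num) hRc hr (by linarith))
  refine ⟨b, hb, fun δ hδ hδ1 hκ x hx => (hbw δ hδ hδ1 x hx.1).trans (integral_mono ?_ ?_ ?_)⟩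
  · simpa using hR.tail.integrable_integrand (ν := vol M m) m hδ (integrable_const (1 : ℝ))
      (integrable_const (0 : E d)) x
  · have h1 := hR.tail.integrable_integrand (ν := vol M m) m hδ (integrable_const (2 : ℝ))
      (integrable_const (-(curvature M m x • outwardNormal M x))) x
    simp only [inner_neg_right, ← sub_eq_add_neg] at h1
    exact h1
  · intro y
    simp only [kerBar_eq]
    rcases le_or_gt (dist x y) (2 * δ) with h | h
    · rw [dist_eq_norm] at h
      have h1 := abs_inner_smul_le (κ := curvature M m x)
        (isOutwardNormal_outwardNormal hm hmd hx).2.1 h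
      have h2 := (le_abs_self _).trans (h1.trans (hκ x hx))
      have h3 := ker_nonneg hR.tail.nonneg m δ x y
      nlinarith
    · rw [ker_eq_zero hR.tail.zero m hδ h, mul_zero]

/-- The boundary integral of `R̿_δ` is of order `δ⁻¹`, so the first term is of order `δ`. The
curvature term carries two factors bounded by `2 δ` and is `O(δ²)`, a perturbation for small `δ`. -/
lemma exists_tildeR_bounds (hm : 1 ≤ m) (hmd : m ≤ d) (hM : IsCompactSubmanifold M m)
    {R' : ℝ → ℝ} {B c : ℝ} (hR : IsProfile R R' B) (hc : 0 < c)
    (hRc : ∀ r, 0 ≤ r → r ≤ 1 / 2 → c ≤ R r) :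
    ∃ δ₀ : ℝ, 0 < δ₀ ∧ ∃ b b' : ℝ, 0 < b ∧ 0 < b' ∧ ∀ δ : ℝ, 0 < δ → δ < δ₀ → ∀ x ∈ bdry M m,
      b * δ ≤ tildeR M m R δ x ∧ tildeR M m R δ x ≤ b' * δ := by
  have := hM.isFiniteMeasure_vol hm hmd
  have := hM.isFiniteMeasure_bvol hm hmd
  obtain ⟨K, hK, hκ⟩ := exists_curvature_bound hm hmd hM
  obtain ⟨A, hA⟩ := exists_normConst_mul_vol_le hm hmd hM
  obtain ⟨A', hA'⟩ := exists_normConst_mul_bvol_le hm hmd hM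
  have ht : ∀ r, 0 ≤ r → r ≤ 1 / 4 → c * (1 / 2 / 2) ≤ tail R r := fun r hr hr1 =>
    hR.tail_ge hc.le (by norm_num) hRc hr (by linarith)
  obtain ⟨b, hb, hbI⟩ := exists_boundary_mass_ge hm hmd hM (c := c * (1 / 2 / 2) * (1 / 4 / 2))
    (a := 1 / 2) hR.tail.tail (by positivity) (by norm_num) (by norm_num)
    (fun r hr hr1 => hR.tail.tail_ge (by positivity) (by norm_num) ht hr (by linarith))
  have hB := hR.nonneg_bound
  -- The threshold makes the curvature term at most `2 b δ`, half of the lower bound `4 b δ` for the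
  -- first term.
  refine ⟨min 1 (b / (2 * (K * B * A + 1))), by positivity, 2 * b, 4 * B * A' + 4 * K * B * A + 1,
    by positivity, by positivity, fun δ hδ hδ₀ x hx => ?_⟩
  have hδ1 : δ ≤ 1 := (hδ₀.trans_le (min_le_left _ _)).le
  have hδ2 : δ * (2 * (K * B * A + 1)) ≤ b :=
    ((lt_div_iff₀ (by positivity)).1 (hδ₀.trans_le (min_le_right _ _))).le
  have hN := normConst_nonneg m δ
  have h1 := hbI δ hδ hδ1 x hx
  have hv : normConst m δ * (vol M m).real (Metric.closedBall x (2 * δ)) ≤ A :=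
    mul_real_le_of_mul_le hN A.coe_nonneg (by simpa using hA δ hδ x)
  have hbv : normConst m δ * (bvol M m).real (Metric.closedBall x (2 * δ)) ≤ A' * δ⁻¹ :=
    mul_real_le_of_mul_le hN (by positivity) (by
      rw [ENNReal.ofReal_mul A'.coe_nonneg, ENNReal.ofReal_inv_of_pos hδ, ENNReal.ofReal_coe_nnreal]
      exact hA' δ hδ x)
  have h2 : |∫ y, kerBarBar m R δ x y ∂(bvol M m)| ≤
      normConst m δ * B * (bvol M m).real (Metric.closedBall x (2 * δ)) :=
    integral_le_of_near (fun y _ => abs_ker_le hR.tail.tail.abs_le m δ x y)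
      (fun y hy => ker_eq_zero hR.tail.tail.zero m hδ hy)
  have h3 : |∫ y, curvature M m x * (inner ℝ (x - y) (outwardNormal M x)) ^ 2 * kerBar m R δ x y
      ∂(vol M m)| ≤ K * (2 * δ) ^ 2 * (normConst m δ * B) *
        (vol M m).real (Metric.closedBall x (2 * δ)) := by
    refine integral_le_of_near (fun y hy => ?_) (fun y hy => ?_)
    · rw [dist_eq_norm] at hy
      have h4 := abs_real_inner_le_norm (x - y) (outwardNormal M x)
      rw [(isOutwardNormal_outwardNormal hm hmd hx).2.1, mul_one] at h4
      rw [abs_mul, abs_mul, abs_pow]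
      have h5 := abs_ker_le hR.tail.abs_le m δ x y
      have h6 := hκ x hx
      have h7 := h4.trans hy
      rw [kerBar_eq]
      gcongr
    · rw [kerBar_eq, ker_eq_zero hR.tail.zero m hδ hy, mul_zero]
  have h4 : 4 * δ ^ 2 * |∫ y, kerBarBar m R δ x y ∂(bvol M m)| ≤ 4 * B * A' * δ := by
    calc 4 * δ ^ 2 * |∫ y, kerBarBar m R δ x y ∂(bvol M m)|
        ≤ 4 * δ ^ 2 * (B * (normConst m δ *
          (bvol M m).real (Metric.closedBall x (2 * δ)))) := by
          gcongr; linarith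
      _ ≤ 4 * δ ^ 2 * (B * (A' * δ⁻¹)) := by gcongr
      _ = _ := by field_simp
  have h5 : |∫ y, curvature M m x * (inner ℝ (x - y) (outwardNormal M x)) ^ 2 * kerBar m R δ x y
      ∂(vol M m)| ≤ 4 * K * B * A * δ ^ 2 := by
    refine h3.trans ?_
    calc _ = 4 * K * B * δ ^ 2 * (normConst m δ *
          (vol M m).real (Metric.closedBall x (2 * δ))) := by ring
      _ ≤ 4 * K * B * δ ^ 2 * A := by gcongr
      _ = _ := by ring
  have h6 : b ≤ δ * ∫ y, kerBarBar m R δ x y ∂(bvol M m) := h1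
  have h7 := (abs_le.1 h5)
  have h8 := le_abs_self (∫ y, kerBarBar m R δ x y ∂(bvol M m))
  unfold tildeR
  constructor
  · nlinarith [mul_le_mul_of_nonneg_left h6 hδ.le, mul_le_mul_of_nonneg_left hδ2 hδ.le]
  · have h9 : 4 * K * B * A * δ ^ 2 ≤ 4 * K * B * A * δ := by
      have : δ ^ 2 ≤ δ := by nlinarith
      gcongr
    nlinarith [mul_le_mul_of_nonneg_left h8 (by positivity : 0 ≤ 4 * δ ^ 2)]

theorem exists_uniformBounds (hm : 1 ≤ m) (hmd : m ≤ d) (hM : IsCompactSubmanifold M m)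
    (hbd : ∀ x ∈ M, (connectedComponentIn M x ∩ bdry M m).Nonempty) (hR : IsKernel R) :
    ∃ δ₀ : ℝ, 0 < δ₀ ∧ ∃ C : ℝ≥0, ∀ δ : ℝ, 0 < δ → δ < δ₀ → UniformBounds M m R C δ := by
  obtain ⟨B, hB, hB2⟩ := hR.exists_profile
  obtain ⟨c, hc, hRc⟩ := hR.nondegenerate
  have hfin := hM.isFiniteMeasure_vol hm hmd
  have hfinb := hM.isFiniteMeasure_bvol hm hmd
  obtain ⟨K, hK, hκ⟩ := exists_curvature_bound hm hmd hM
  obtain ⟨A, hA⟩ := exists_normConst_mul_vol_le hm hmd hM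
  obtain ⟨A', hA'⟩ := exists_normConst_mul_bvol_le hm hmd hM
  obtain ⟨b₁, hb₁, hmass⟩ := exists_mass_ge hm hmd hM (a := 1) hB hc one_pos le_rfl
    (fun r hr hr1 => hRc r hr (by linarith))
  obtain ⟨b₂, hb₂, hweight⟩ := exists_weight_ge hm hmd hM hB hc hRc
  obtain ⟨δ₁, hδ₁, b₃, b₄, hb₃, hb₄, htR⟩ := exists_tildeR_bounds hm hmd hM hB hc hRc
  obtain ⟨A₂, hA₂⟩ := exists_bvol_closedBall_le hm hmd hM
  obtain ⟨ρ₀, hρ₀, C₁, hC₁⟩ := exists_difference_estimate hm hmd hM (bvol M m)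
    ((ae_mem_bdry hm hmd hM).mono fun x hx => hx.1) A₂ hA₂
  obtain ⟨C₂, hC₂⟩ := exists_poincare hm hmd hM hbd
  have hB0 := hB.nonneg_bound
  set C₁' : ℝ≥0 := Real.toNNReal (normConst m 1) * (C₁ * 2 ^ (m + 1)) with hC₁'
  set C : ℝ≥0 := Real.toNNReal B + Real.toNNReal K + A + A' + Real.toNNReal b₁⁻¹ +
    Real.toNNReal b₂⁻¹ + Real.toNNReal b₃⁻¹ + Real.toNNReal b₄ + C₁' + C₂ with hC
  have le1 : B ≤ C := by
    rw [← Real.toNNReal_le_iff_le_coe, hC]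
    simp only [add_assoc]; exact le_self_add
  have hCr : (C : ℝ) = B + K + A + A' + b₁⁻¹ + b₂⁻¹ + b₃⁻¹ + b₄ + C₁' + C₂ := by
    rw [hC]
    push_cast
    rw [Real.coe_toNNReal B hB0, Real.coe_toNNReal K hK.le, Real.coe_toNNReal _ (inv_pos.2 hb₁).le,
      Real.coe_toNNReal _ (inv_pos.2 hb₂).le, Real.coe_toNNReal _ (inv_pos.2 hb₃).le,
      Real.coe_toNNReal _ hb₄.le]
  have i₁ := inv_pos.2 hb₁
  have i₂ := inv_pos.2 hb₂
  have i₃ := inv_pos.2 hb₃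
  have p₁ := A.2
  have p₂ := A'.2
  have p₃ := C₁'.2
  have p₄ := C₂.2
  simp only [NNReal.val_eq_coe] at p₁ p₂ p₃ p₄
  have leK : K ≤ C := by rw [hCr]; linarith
  have le₁ : b₁⁻¹ ≤ C := by rw [hCr]; linarith
  have le₂ : b₂⁻¹ ≤ C := by rw [hCr]; linarith
  have le₃ : b₃⁻¹ ≤ C := by rw [hCr]; linarith
  have le₄ : b₄ ≤ C := by rw [hCr]; linarith
  have leA : A ≤ C := by rw [← NNReal.coe_le_coe, hCr]; linarith
  have leA' : A' ≤ C := by rw [← NNReal.coe_le_coe, hCr]; linarith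
  have leC₁ : C₁' ≤ C := by rw [← NNReal.coe_le_coe, hCr]; linarith
  have leC₂ : C₂ ≤ C := by rw [← NNReal.coe_le_coe, hCr]; linarith
  have inv_le : ∀ {b I : ℝ}, 0 < b → b⁻¹ ≤ C → b ≤ I → 1 ≤ C * I := fun {b I} hb h1 h2 => by
    calc (1 : ℝ) = b⁻¹ * b := (inv_mul_cancel₀ hb.ne').symm
      _ ≤ C * I := by gcongr
  -- `ρ₀ / 2` because the difference estimate is used at radius `2 δ`; `1 / (2 K)` so that `2 δ |κ|
  -- ≤ 1`.
  refine ⟨min (min 1 δ₁) (min (ρ₀ / 2) (1 / (2 * K))), by positivity, C, fun δ hδ hδ₀ => ?_⟩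
  have hδ1 : δ < 1 := hδ₀.trans_le ((min_le_left _ _).trans (min_le_left _ _))
  have hδ2 : δ < δ₁ := hδ₀.trans_le ((min_le_left _ _).trans (min_le_right _ _))
  have hδ3 : δ < ρ₀ / 2 := hδ₀.trans_le ((min_le_right _ _).trans (min_le_left _ _))
  have hδ4 : δ < 1 / (2 * K) := hδ₀.trans_le ((min_le_right _ _).trans (min_le_right _ _))
  have hδ5 : 2 * δ * K ≤ 1 := by
    rw [lt_div_iff₀ (by positivity)] at hδ4; linarith
  have hκδ : ∀ x ∈ bdry M m, 2 * δ * |curvature M m x| ≤ 1 := fun x hx =>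
    (mul_le_mul_of_nonneg_left (hκ x hx) (by positivity)).trans hδ5
  have hmb : MeasurableSet (bdry M m) := (hM.isClosed_bdry hm hmd).measurableSet
  exact
    { pos := hδ
      le_one := hδ1.le
      finite_vol := hfin
      finite_bvol := hfinb
      isCompact := hM.isCompact
      ae_vol := ae_mem_vol hM
      ae_bvol := ae_mem_bdry hm hmd hM
      normal_meas := (continuousOn_outwardNormal hm hmd).aestronglyMeasurable hmb
      curvature_meas := (continuousOn_curvature hm hmd).aestronglyMeasurable hmb
      norm_normal := fun x hx => (isOutwardNormal_outwardNormal hm hmd hx).2.1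
      curvature_le := fun x hx => (hκ x hx).trans leK
      mul_curvature_le := hκδ
      profile := hB.mono le1
      deriv_sq_le := fun r hr => (hB2 r hr).trans
        (mul_le_mul_of_nonneg_right le1 (hR.nonneg r hr))
      vol_le := fun x => (hA δ hδ x).trans (by exact_mod_cast leA)
      bvol_le := fun x => (hA' δ hδ x).trans (mul_le_mul_left (by exact_mod_cast leA') _)
      mass_ge := fun x hx => inv_le hb₁ le₁ (hmass δ hδ hδ1.le x hx)
      weight_ge := fun x hx => inv_le hb₂ le₂ (hweight δ hδ hδ1.le hκδ x hx)
      tildeR_le := fun x hx => (htR δ hδ hδ2 x hx).2.trans (by gcongr)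
      tildeR_ge := fun x hx => by
        calc δ = b₃⁻¹ * (b₃ * δ) := by field_simp
          _ ≤ C * tildeR M m R δ x :=
            mul_le_mul le₃ (htR δ hδ hδ2 x hx).1 (by positivity) C.2
      difference := fun φ hφ => by
        refine (mul_le_mul_right (hC₁ φ hφ (2 * δ) (by positivity) (by linarith)) _).trans ?_
        have h1 : ENNReal.ofReal (normConst m δ) *
            (C₁ * ENNReal.ofReal (2 * δ) ^ (m + 1) * dirichlet M m φ) =
            C₁' * ENNReal.ofReal δ * dirichlet M m φ := by
          rw [hC₁', ENNReal.coe_mul, ← ENNReal.ofReal, ← ofReal_normConst_mul_pow m hδ,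
            ENNReal.ofReal_mul (by positivity)]
          push_cast
          rw [ENNReal.ofReal_ofNat]
          ring
        rw [h1]
        gcongr
      poincare := fun φ hφ => (hC₂ φ hφ).trans (mul_le_mul_left (by exact_mod_cast leC₂) _) }

end Uniform

/-! ### The normalised kernel average and the nonlocal energy -/

section Smoothing

variable {d m : ℕ} {M : Set (E d)} {R : ℝ → ℝ} {C : ℝ≥0} {δ : ℝ} {u : E d → ℝ}

/-- The total mass `∫_M R_δ(x, y) dμ_y`. -/
def mass (M : Set (E d)) (m : ℕ) (R : ℝ → ℝ) (δ : ℝ) (x : E d) : ℝ :=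
  ∫ y, ker m R δ x y ∂(vol M m)

/-- The kernel average `∫_M u(y) R_δ(x, y) dμ_y`. -/
def kerAverage (M : Set (E d)) (m : ℕ) (R : ℝ → ℝ) (δ : ℝ) (u : E d → ℝ) (x : E d) : ℝ :=
  ∫ y, u y * ker m R δ x y ∂(vol M m)

/-- The normalised kernel average of `u`. -/
def smoothing (M : Set (E d)) (m : ℕ) (R : ℝ → ℝ) (δ : ℝ) (u : E d → ℝ) (x : E d) : ℝ :=
  kerAverage M m R δ u x / mass M m R δ x

/-- The local energy density `∫_M R_δ(x, y) |u(x) - u(y)|² dμ_y`. -/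
def localEnergy (M : Set (E d)) (m : ℕ) (R : ℝ → ℝ) (δ : ℝ) (u : E d → ℝ) (x : E d) : ℝ≥0∞ :=
  ∫⁻ y, ENNReal.ofReal (ker m R δ x y) * ‖u y - u x‖ₑ ^ 2 ∂(vol M m)

/-- The nonlocal energy of `u`. -/
def energy (M : Set (E d)) (m : ℕ) (R : ℝ → ℝ) (δ : ℝ) (u : E d → ℝ) : ℝ≥0∞ :=
  ∫⁻ x, localEnergy M m R δ u x ∂(vol M m)

lemma IsProfile.integrable_mul_ker {ρ ρ' : ℝ → ℝ} {B : ℝ} (h : IsProfile ρ ρ' B) (m : ℕ)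
    (hδ : 0 < δ) {ν : Measure (E d)} [IsFiniteMeasure ν] {α : E d → ℝ} (hα : Integrable α ν)
    (x : E d) : Integrable (fun y => α y * ker m ρ δ x y) ν := by
  simpa using h.integrable_integrand m hδ hα (integrable_const (0 : E d)) x

lemma IsProfile.contDiff_integral_mul_ker {ρ ρ' : ℝ → ℝ} {B : ℝ} (h : IsProfile ρ ρ' B) (m : ℕ)
    (hδ : 0 < δ) {ν : Measure (E d)} [IsFiniteMeasure ν] {α : E d → ℝ} (hα : Integrable α ν) :
    ContDiff ℝ 1 fun x => ∫ y, α y * ker m ρ δ x y ∂ν := by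
  simpa using h.contDiff_integral m hδ hα (integrable_const (0 : E d))

lemma UniformBounds.contDiff_mass (h : UniformBounds M m R C δ) :
    ContDiff ℝ 1 (mass M m R δ) := by
  have := h.finite_vol
  have h1 := h.profile.contDiff_integral_mul_ker m h.pos (integrable_const (1 : ℝ))
    (ν := vol M m)
  simp only [one_mul] at h1
  exact h1

lemma UniformBounds.contDiff_kerAverage (h : UniformBounds M m R C δ)
    (hu : Integrable u (vol M m)) : ContDiff ℝ 1 (kerAverage M m R δ u) := by
  have := h.finite_vol
  exact h.profile.contDiff_integral_mul_ker m h.pos hu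

lemma UniformBounds.mass_pos (h : UniformBounds M m R C δ) {x : E d} (hx : x ∈ M) :
    0 < mass M m R δ x := by
  have h1 := h.mass_ge x hx
  by_contra! h2
  have h3 := mul_nonpos_of_nonneg_of_nonpos C.coe_nonneg h2
  unfold mass at h3
  linarith

lemma UniformBounds.enorm_inv_mass_le (h : UniformBounds M m R C δ) {x : E d} (hx : x ∈ M) :
    ‖(mass M m R δ x)⁻¹‖ₑ ≤ C := by
  have h0 := h.mass_pos hx
  rw [← ofReal_norm, Real.norm_of_nonneg (inv_nonneg.2 h0.le), ← ENNReal.ofReal_coe_nnreal]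
  refine ENNReal.ofReal_le_ofReal ?_
  rw [inv_le_iff_one_le_mul₀ h0]
  exact h.mass_ge x hx

lemma UniformBounds.contDiffAt_div_mass (h : UniformBounds M m R C δ) {F : E d → ℝ}
    (hF : ContDiff ℝ 1 F) {x : E d} (hx : x ∈ M) :
    ContDiffAt ℝ 1 (fun z => F z / mass M m R δ z) x :=
  hF.contDiffAt.div h.contDiff_mass.contDiffAt (h.mass_pos hx).ne'

lemma UniformBounds.contDiffAt_smoothing (h : UniformBounds M m R C δ)
    (hu : Integrable u (vol M m)) {x : E d} (hx : x ∈ M) :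
    ContDiffAt ℝ 1 (smoothing M m R δ u) x :=
  h.contDiffAt_div_mass (h.contDiff_kerAverage hu) hx

lemma UniformBounds.coe_mul_inv_ge (h : UniformBounds M m R C δ) :
    1 ≤ (ENNReal.ofReal δ)⁻¹ := by
  rw [ENNReal.one_le_inv]
  exact ENNReal.ofReal_le_one.2 h.le_one

lemma UniformBounds.enorm_fderiv_mass_le (h : UniformBounds M m R C δ) (x : E d) :
    ‖fderiv ℝ (mass M m R δ) x‖ₑ ≤ C ^ 2 * (ENNReal.ofReal δ)⁻¹ := by
  have := h.finite_vol
  have h1 := h.profile.enorm_fderiv_integral_le m h.pos (ν := vol M m) (integrable_const (1 : ℝ))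
    (integrable_const (0 : E d)) x
  simp only [inner_zero_right, add_zero, one_mul, enorm_one, enorm_zero, mul_zero, mul_one,
    lintegral_near_right] at h1
  refine h1.trans ?_
  rw [div_eq_mul_inv, ENNReal.ofReal_mul (mul_nonneg (normConst_nonneg m δ) C.coe_nonneg),
    ENNReal.ofReal_mul (normConst_nonneg m δ), ENNReal.ofReal_inv_of_pos h.pos,
    ENNReal.ofReal_coe_nnreal]
  calc _ = (ENNReal.ofReal (normConst m δ) * vol M m (Metric.closedBall x (2 * δ))) *
        (C * (ENNReal.ofReal δ)⁻¹) := by ring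
    _ ≤ C * (C * (ENNReal.ofReal δ)⁻¹) := mul_le_mul_left (h.vol_le x) _
    _ = _ := by ring

lemma UniformBounds.lintegral_ker_le (h : UniformBounds M m R C δ) (x : E d) :
    ∫⁻ y, ENNReal.ofReal (ker m R δ x y) ∂(vol M m) ≤ C ^ 2 := by
  calc ∫⁻ y, ENNReal.ofReal (ker m R δ x y) ∂(vol M m)
      ≤ ∫⁻ y, ENNReal.ofReal (normConst m δ * C) * near (2 * δ) x y ∂(vol M m) := by
        refine lintegral_mono fun y => ?_
        have h1 := enorm_ker_le h.profile.abs_le h.profile.zero m h.pos x y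
        rwa [← ofReal_norm, Real.norm_of_nonneg (ker_nonneg h.profile.nonneg m δ x y)] at h1
    _ = C * (ENNReal.ofReal (normConst m δ) * vol M m (Metric.closedBall x (2 * δ))) := by
        rw [lintegral_const_mul' _ _ ENNReal.ofReal_ne_top, lintegral_near_right,
          ENNReal.ofReal_mul (normConst_nonneg m δ), ENNReal.ofReal_coe_nnreal]
        ring
    _ ≤ C * C := mul_le_mul_right (h.vol_le x) _
    _ = C ^ 2 := (sq _).symm

lemma measurable_ofReal_ker (h : UniformBounds M m R C δ) (x : E d) :
    Measurable fun y => ENNReal.ofReal (ker m R δ x y) :=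
  (continuous_ker_right h.profile.continuousOn m δ x).measurable.ennreal_ofReal

lemma UniformBounds.sq_enorm_integral_sub_le (h : UniformBounds M m R C δ)
    (hum : Measurable u) (x : E d) :
    ‖∫ y, (u y - u x) * ker m R δ x y ∂(vol M m)‖ₑ ^ 2 ≤ C ^ 2 * localEnergy M m R δ u x := by
  calc ‖∫ y, (u y - u x) * ker m R δ x y ∂(vol M m)‖ₑ ^ 2
      ≤ (∫⁻ y, ENNReal.ofReal (ker m R δ x y) * ‖u y - u x‖ₑ ∂(vol M m)) ^ 2 := by
        gcongr
        refine (enorm_integral_le_lintegral_enorm _).trans_eq (lintegral_congr fun y => ?_)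
        rw [enorm_mul, mul_comm, ← ofReal_norm (ker _ _ _ _ _),
          Real.norm_of_nonneg (ker_nonneg h.profile.nonneg m δ x y)]
    _ ≤ _ := sq_lintegral_mul_weight_le _ (measurable_ofReal_ker h x).aemeasurable
        (hum.sub_const _).enorm.aemeasurable
    _ ≤ _ := mul_le_mul_left (h.lintegral_ker_le x) _

lemma UniformBounds.kerAverage_sub (h : UniformBounds M m R C δ) (hu : Integrable u (vol M m))
    (c : ℝ) (x : E d) :
    ∫ y, (u y - c) * ker m R δ x y ∂(vol M m) = kerAverage M m R δ u x - c * mass M m R δ x := by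
  have := h.finite_vol
  simp_rw [sub_mul]
  rw [integral_sub (h.profile.integrable_mul_ker m h.pos hu x)
    (h.profile.integrable_mul_ker m h.pos (integrable_const c) x), integral_const_mul]
  rfl

/-- The difference is the kernel average of `u(x) - u(y)`, so Cauchy-Schwarz with the kernel as
weight applies. -/
lemma UniformBounds.sq_enorm_sub_smoothing_le (h : UniformBounds M m R C δ)
    (hum : Measurable u) (hu : Integrable u (vol M m)) {x : E d} (hx : x ∈ M) :
    ‖u x - smoothing M m R δ u x‖ₑ ^ 2 ≤ C ^ 4 * localEnergy M m R δ u x := by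
  have h0 := (h.mass_pos hx).ne'
  have h1 : u x - smoothing M m R δ u x =
      -((mass M m R δ x)⁻¹ * ∫ y, (u y - u x) * ker m R δ x y ∂(vol M m)) := by
    rw [h.kerAverage_sub hu, smoothing]
    field_simp; ring
  rw [h1, enorm_neg, enorm_mul, mul_pow]
  calc _ ≤ (C : ℝ≥0∞) ^ 2 * (C ^ 2 * localEnergy M m R δ u x) :=
        mul_le_mul' (pow_le_pow_left' (h.enorm_inv_mass_le hx) 2)
          (h.sq_enorm_integral_sub_le hum x)
    _ = _ := by ring

/-- By `R'² ≤ C R` the gradient of the kernel is at most `δ⁻¹` times the geometric mean of `C_δ C`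
and `R_δ`. Cauchy-Schwarz then separates the mass of a ball from the local energy, which contains
`R_δ` itself. A mere bound on `R'` would leave differences weighted where `R_δ` may vanish. The
value `u x` is frozen while differentiating. -/
lemma UniformBounds.sq_enorm_fderiv_integral_sub_le (h : UniformBounds M m R C δ)
    (hum : Measurable u) (hu : Integrable u (vol M m)) (x : E d) :
    ‖fderiv ℝ (fun z => ∫ y, (u y - u x) * ker m R δ z y ∂(vol M m)) x‖ₑ ^ 2 ≤
      C ^ 2 * (ENNReal.ofReal δ)⁻¹ ^ 2 * localEnergy M m R δ u x := by
  have := h.finite_vol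
  have hδ := h.pos
  have h1 := h.profile.hasFDerivAt_integral m h.pos (ν := vol M m)
    (hu.sub (integrable_const (u x))) (integrable_const (0 : E d)) x
  simp only [inner_zero_right, add_zero, Pi.sub_apply] at h1
  rw [h1.fderiv]
  have hpt : ∀ y, ‖kernelDeriv m R (derivWithin R (Set.Ici 0)) δ (u - fun _ => u x) (fun _ => 0)
      x y‖ₑ ≤ (ENNReal.ofReal δ)⁻¹ *
        ((ENNReal.ofReal (√(normConst m δ * C)) * near (2 * δ) x y) *
          (ENNReal.ofReal (√(ker m R δ x y)) * ‖u y - u x‖ₑ)) := by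
    intro y
    rcases le_or_gt (dist x y) (2 * δ) with hd | hd
    · rw [near_of_le hd, mul_one]
      have hk : |ker m (derivWithin R (Set.Ici 0)) δ x y| ≤
          √(normConst m δ * C) * √(ker m R δ x y) := by
        rw [← Real.sqrt_mul (mul_nonneg (normConst_nonneg m δ) C.coe_nonneg)]
        refine Real.abs_le_sqrt ?_
        rw [ker_eq, ker_eq, mul_pow]
        have := h.deriv_sq_le (‖x - y‖ ^ 2 / (4 * δ ^ 2)) (by positivity)
        have h2 := mul_le_mul_of_nonneg_left this (sq_nonneg (normConst m δ))
        linarith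
      have h3 : ‖kernelDeriv m R (derivWithin R (Set.Ici 0)) δ (u - fun _ => u x) (fun _ => 0)
          x y‖ ≤ δ⁻¹ * (√(normConst m δ * C) * (√(ker m R δ x y) * ‖u y - u x‖)) := by
        rw [dist_eq_norm] at hd
        simp only [kernelDeriv, map_zero, smul_zero, zero_add, inner_zero_right, add_zero,
          Pi.sub_apply]
        rw [norm_smul, innerSL_apply_norm, norm_mul, norm_div,
          Real.norm_of_nonneg (by positivity : (0 : ℝ) ≤ 2 * δ ^ 2),
          Real.norm_eq_abs (ker _ _ _ _ _)]
        calc _ ≤ ‖u y - u x‖ * (√(normConst m δ * C) * √(ker m R δ x y) / (2 * δ ^ 2)) *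
              (2 * δ) := by gcongr
          _ = _ := by field_simp
      have h4 := ENNReal.ofReal_le_ofReal h3
      rwa [ENNReal.ofReal_mul (by positivity), ENNReal.ofReal_mul (by positivity),
        ENNReal.ofReal_mul (by positivity), ENNReal.ofReal_inv_of_pos h.pos, ofReal_norm,
        ofReal_norm] at h4
    · rw [kernelDeriv, ker_eq_zero h.profile.zero m hδ hd,
        ker_eq_zero h.profile.deriv_zero m hδ hd, zero_smul, zero_div, mul_zero, zero_smul,
        add_zero, enorm_zero (E := E d →L[ℝ] ℝ)]
      exact zero_le
  calc _ ≤ (∫⁻ y, (ENNReal.ofReal δ)⁻¹ *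
        ((ENNReal.ofReal (√(normConst m δ * C)) * near (2 * δ) x y) *
          (ENNReal.ofReal (√(ker m R δ x y)) * ‖u y - u x‖ₑ)) ∂(vol M m)) ^ 2 := by
        gcongr
        exact (enorm_integral_le_lintegral_enorm _).trans (lintegral_mono hpt)
    _ = (ENNReal.ofReal δ)⁻¹ ^ 2 *
        (∫⁻ y, (ENNReal.ofReal (√(normConst m δ * C)) * near (2 * δ) x y) *
          (ENNReal.ofReal (√(ker m R δ x y)) * ‖u y - u x‖ₑ) ∂(vol M m)) ^ 2 := by
        rw [lintegral_const_mul' _ _ (by simpa using hδ), mul_pow]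
    _ ≤ (ENNReal.ofReal δ)⁻¹ ^ 2 *
        ((∫⁻ y, (ENNReal.ofReal (√(normConst m δ * C)) * near (2 * δ) x y) ^ 2 ∂(vol M m)) *
          ∫⁻ y, (ENNReal.ofReal (√(ker m R δ x y)) * ‖u y - u x‖ₑ) ^ 2 ∂(vol M m)) := by
        refine mul_le_mul_right (sq_lintegral_mul_le _ ?_ ?_) _
        · exact ((measurable_near _ measurable_const measurable_id).const_mul _).aemeasurable
        · exact ((continuous_ker_right h.profile.continuousOn m δ x).sqrt.measurable.ennreal_ofReal.mul
            (hum.sub_const _).enorm).aemeasurable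
    _ ≤ (ENNReal.ofReal δ)⁻¹ ^ 2 * (C ^ 2 * localEnergy M m R δ u x) := by
        refine mul_le_mul_right (mul_le_mul' ?_ (le_of_eq ?_)) _
        · calc _ ≤ ∫⁻ y, ENNReal.ofReal (normConst m δ * C) * near (2 * δ) x y ∂(vol M m) := by
                refine lintegral_mono fun y => ?_
                rw [mul_pow, ← ENNReal.ofReal_pow (Real.sqrt_nonneg _),
                  Real.sq_sqrt (mul_nonneg (normConst_nonneg m δ) C.coe_nonneg)]
                refine mul_le_mul_right ?_ _
                rw [sq]
                exact mul_le_of_le_one_left zero_le (near_le_one _ _ _)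
            _ = C * (ENNReal.ofReal (normConst m δ) *
                vol M m (Metric.closedBall x (2 * δ))) := by
                rw [lintegral_const_mul' _ _ ENNReal.ofReal_ne_top, lintegral_near_right,
                  ENNReal.ofReal_mul (normConst_nonneg m δ), ENNReal.ofReal_coe_nnreal]
                ring
            _ ≤ C * C := mul_le_mul_right (h.vol_le x) _
            _ = C ^ 2 := (sq _).symm
        · refine lintegral_congr fun y => ?_
          rw [mul_pow, ← ENNReal.ofReal_pow (Real.sqrt_nonneg _),
            Real.sq_sqrt (ker_nonneg h.profile.nonneg m δ x y)]
    _ = _ := by ring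

lemma UniformBounds.sq_enorm_fderiv_div_mass_le (h : UniformBounds M m R C δ) {F : E d → ℝ}
    (hF : ContDiff ℝ 1 F) {x : E d} (hx : x ∈ M) :
    ‖fderiv ℝ (fun z => F z / mass M m R δ z) x‖ₑ ^ 2 ≤
      2 * C ^ 2 * ‖fderiv ℝ F x‖ₑ ^ 2 + 2 * C ^ 8 * (ENNReal.ofReal δ)⁻¹ ^ 2 * ‖F x‖ₑ ^ 2 := by
  have h0 := (h.mass_pos hx).ne'
  have hFd := (hF.differentiable (by simp)) x
  have hwd := (h.contDiff_mass.differentiable (by simp)) x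
  have h1 : fderiv ℝ (fun z => F z / mass M m R δ z) x =
      (mass M m R δ x)⁻¹ • fderiv ℝ F x +
        (-((mass M m R δ x)⁻¹ * (mass M m R δ x)⁻¹ * F x)) • fderiv ℝ (mass M m R δ) x := by
    have h2 := hFd.hasFDerivAt.mul ((hasDerivAt_inv h0).comp_hasFDerivAt x hwd.hasFDerivAt)
    have h3 : (fun z => F z / mass M m R δ z) = F * (Inv.inv ∘ mass M m R δ) := by
      ext z; simp [div_eq_mul_inv]
    rw [h3, h2.fderiv, smul_smul, add_comm, Function.comp_apply]
    congr 2
    field_simp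
  rw [h1]
  refine (enorm_add_sq_le _ _).trans ?_
  rw [enorm_smul, enorm_smul, enorm_neg, enorm_mul, enorm_mul, mul_assoc 2, mul_assoc 2, mul_assoc 2]
  have h3 := h.enorm_inv_mass_le hx
  have h4 := h.enorm_fderiv_mass_le x
  refine add_le_add (mul_le_mul_right ?_ _) (mul_le_mul_right ?_ _)
  · rw [mul_pow]; gcongr
  · calc _ ≤ ((C : ℝ≥0∞) * C * ‖F x‖ₑ * (C ^ 2 * (ENNReal.ofReal δ)⁻¹)) ^ 2 := by gcongr
      _ = _ := by ring

/-- Subtracting the constant `u x` from `u` shifts the average by a constant only. Both terms of the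
quotient rule then contain differences, controlled by the local energy. -/
lemma UniformBounds.sq_enorm_fderiv_smoothing_le (h : UniformBounds M m R C δ)
    (hum : Measurable u) (hu : Integrable u (vol M m)) {x : E d} (hx : x ∈ M) :
    ‖fderiv ℝ (smoothing M m R δ u) x‖ₑ ^ 2 ≤
      (2 * C ^ 4 + 2 * C ^ 10) * (ENNReal.ofReal δ)⁻¹ ^ 2 * localEnergy M m R δ u x := by
  have := h.finite_vol
  have h1 : smoothing M m R δ u =ᶠ[𝓝 x] fun z =>
      (∫ y, (u y - u x) * ker m R δ z y ∂(vol M m)) / mass M m R δ z + u x := by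
    filter_upwards [h.contDiff_mass.continuous.continuousAt.eventually_ne (h.mass_pos hx).ne']
      with z hz
    rw [h.kerAverage_sub hu, smoothing]
    field_simp; ring
  rw [h1.fderiv_eq, fderiv_add_const]
  have h2 := h.sq_enorm_fderiv_div_mass_le
    (h.profile.contDiff_integral_mul_ker m h.pos (hu.sub (integrable_const (u x)))) hx
  refine h2.trans ?_
  calc _ ≤ 2 * (C : ℝ≥0∞) ^ 2 * (C ^ 2 * (ENNReal.ofReal δ)⁻¹ ^ 2 * localEnergy M m R δ u x) +
        2 * C ^ 8 * (ENNReal.ofReal δ)⁻¹ ^ 2 * (C ^ 2 * localEnergy M m R δ u x) :=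
        add_le_add (mul_le_mul_right (h.sq_enorm_fderiv_integral_sub_le hum hu x) _)
          (mul_le_mul_right (h.sq_enorm_integral_sub_le hum x) _)
    _ = _ := by ring

lemma enorm_tangentialGradient_le (M : Set (E d)) (φ : E d → ℝ) (x : E d) :
    ‖tangentialGradient M φ x‖ₑ ≤ ‖fderiv ℝ φ x‖ₑ := by
  rw [enorm_le_iff_norm_le]
  refine ((tangentSpace M x).norm_starProjection_apply_le _).trans_eq ?_
  rw [gradient, LinearIsometryEquiv.norm_map]

lemma dirichlet_le_lintegral_fderiv (M : Set (E d)) (m : ℕ) (φ : E d → ℝ) :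
    dirichlet M m φ ≤ ∫⁻ x, ‖fderiv ℝ φ x‖ₑ ^ 2 ∂(vol M m) :=
  lintegral_mono fun x => pow_le_pow_left' (enorm_tangentialGradient_le M φ x) 2

lemma UniformBounds.measurable_localEnergy (h : UniformBounds M m R C δ) (hum : Measurable u) :
    Measurable (localEnergy M m R δ u) := by
  have := h.finite_vol
  have h1 : Measurable fun p : E d × E d =>
      ENNReal.ofReal (ker m R δ p.1 p.2) * ‖u p.2 - u p.1‖ₑ ^ 2 :=
    (continuous_ker h.profile.continuousOn m δ).measurable.ennreal_ofReal.mul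
      (((hum.comp measurable_snd).sub (hum.comp measurable_fst)).enorm.pow_const 2)
  exact h1.lintegral_prod_right'

lemma UniformBounds.dirichlet_smoothing_le (h : UniformBounds M m R C δ)
    (hum : Measurable u) (hu : Integrable u (vol M m)) :
    dirichlet M m (smoothing M m R δ u) ≤
      (2 * C ^ 4 + 2 * C ^ 10) * (ENNReal.ofReal δ)⁻¹ ^ 2 * energy M m R δ u := by
  refine (dirichlet_le_lintegral_fderiv M m _).trans ?_
  rw [energy, ← lintegral_const_mul _ (h.measurable_localEnergy hum)]
  exact lintegral_mono_ae (h.ae_vol.mono fun x hx => h.sq_enorm_fderiv_smoothing_le hum hu hx)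

lemma UniformBounds.lintegral_sub_smoothing_le (h : UniformBounds M m R C δ)
    (hum : Measurable u) (hu : Integrable u (vol M m)) :
    ∫⁻ x, ‖u x - smoothing M m R δ u x‖ₑ ^ 2 ∂(vol M m) ≤ C ^ 4 * energy M m R δ u := by
  rw [energy, ← lintegral_const_mul _ (h.measurable_localEnergy hum)]
  exact lintegral_mono_ae (h.ae_vol.mono fun x hx => h.sq_enorm_sub_smoothing_le hum hu hx)

lemma UniformBounds.measurable_smoothing (h : UniformBounds M m R C δ)
    (hu : Integrable u (vol M m)) : Measurable (smoothing M m R δ u) :=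
  (h.contDiff_kerAverage hu).continuous.measurable.div h.contDiff_mass.continuous.measurable

end Smoothing

/-! ### Coercivity -/

section Coercivity

variable {d m : ℕ} {M : Set (E d)} {R : ℝ → ℝ} {C : ℝ≥0} {δ : ℝ} {u : E d → ℝ}

/-- On the support the curvature correction is at most `1` in absolute value, whence `3 = 2 + 1`. -/
lemma UniformBounds.enorm_coeff_mul_kerBar_le (h : UniformBounds M m R C δ) {x y z : E d}
    (hz : z ∈ bdry M m) {s : ℝ} (hs : |s| = 1) :
    ‖(2 + s * inner ℝ (x - y) (curvature M m z • outwardNormal M z)) * kerBar m R δ x y‖ₑ ≤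
      3 * C * (ENNReal.ofReal (normConst m δ) * near (2 * δ) x y) := by
  have hk := enorm_ker_le h.profile.tail.abs_le h.profile.tail.zero m h.pos x y
  rw [ENNReal.ofReal_mul (normConst_nonneg m δ), ENNReal.ofReal_coe_nnreal] at hk
  rcases le_or_gt (dist x y) (2 * δ) with hd | hd
  · rw [enorm_mul]
    have h1 : ‖2 + s * inner ℝ (x - y) (curvature M m z • outwardNormal M z)‖ₑ ≤ 3 := by
      rw [← ofReal_norm, ← ENNReal.ofReal_ofNat 3]
      refine ENNReal.ofReal_le_ofReal ((norm_add_le _ _).trans ?_)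
      rw [dist_eq_norm] at hd
      have h2 := (abs_inner_smul_le (κ := curvature M m z) (h.norm_normal z hz) hd).trans
        (h.mul_curvature_le z hz)
      rw [norm_mul, Real.norm_eq_abs, Real.norm_eq_abs, Real.norm_eq_abs, hs, one_mul]
      norm_num
      linarith
    calc _ ≤ 3 * (ENNReal.ofReal (normConst m δ) * C * near (2 * δ) x y) := mul_le_mul' h1 hk
      _ = _ := by ring
  · rw [kerBar_eq, ker_eq_zero h.profile.tail.zero m h.pos hd, mul_zero, enorm_zero]
    exact zero_le

lemma UniformBounds.integrable_mul_coeff (h : UniformBounds M m R C δ)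
    (hu : Integrable u (vol M m)) (x b : E d) :
    Integrable (fun y => u y * (2 - inner ℝ (x - y) b) * kerBar m R δ x y) (vol M m) := by
  have h1 := h.profile.tail.integrable_integrand (ν := vol M m) m h.pos (hu.const_mul 2)
    (hu.smul_const (-b)) x
  refine h1.congr (Eventually.of_forall fun y => ?_)
  simp only [inner_smul_right, inner_neg_right, kerBar_eq]
  ring

/-- A boundary value `c` is read off from `𝒟_δ u`: the weight is bounded below, and the error
consists of differences `c - u(y)` over short distances. -/
lemma UniformBounds.mul_weight_eq (h : UniformBounds M m R C δ) (hu : Integrable u (vol M m))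
    (c : ℝ) (x : E d) :
    c * ∫ y, (2 - inner ℝ (x - y) (curvature M m x • outwardNormal M x)) * kerBar m R δ x y
      ∂(vol M m) = opD M m R δ u x + ∫ y, (c - u y) *
        ((2 - inner ℝ (x - y) (curvature M m x • outwardNormal M x)) * kerBar m R δ x y)
          ∂(vol M m) := by
  have := h.finite_vol
  have h1 := h.integrable_mul_coeff hu x (curvature M m x • outwardNormal M x)
  have h2 := h.integrable_mul_coeff (integrable_const c) x (curvature M m x • outwardNormal M x)
  rw [opD, ← integral_const_mul, ← integral_add h1]
  · refine integral_congr_ae (Eventually.of_forall fun y => ?_)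
    simp only
    ring
  · refine (h2.sub h1).congr (Eventually.of_forall fun y => ?_)
    simp only [Pi.sub_apply]
    ring

lemma sq_mul_lintegral_near_le {ν : Measure (E d)} {c A : ℝ≥0∞} {ρ : ℝ} {x : E d}
    (hν : c * ν (Metric.closedBall x ρ) ≤ A) {f : E d → ℝ≥0∞} (hf : AEMeasurable f ν) :
    (c * ∫⁻ y, near ρ x y * f y ∂ν) ^ 2 ≤ A * (c * ∫⁻ y, near ρ x y * f y ^ 2 ∂ν) := by
  have h1 := sq_lintegral_mul_weight_le ν
    (measurable_near ρ (measurable_const (a := x)) measurable_id).aemeasurable hf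
  simp only [id_eq] at h1
  rw [lintegral_near_right] at h1
  calc (c * ∫⁻ y, near ρ x y * f y ∂ν) ^ 2
      = c ^ 2 * (∫⁻ y, near ρ x y * f y ∂ν) ^ 2 := mul_pow _ _ _
    _ ≤ c ^ 2 * (ν (Metric.closedBall x ρ) * ∫⁻ y, near ρ x y * f y ^ 2 ∂ν) := by gcongr
    _ = (c * ν (Metric.closedBall x ρ)) * (c * ∫⁻ y, near ρ x y * f y ^ 2 ∂ν) := by ring
    _ ≤ _ := by gcongr

lemma UniformBounds.sq_enorm_le_opD (h : UniformBounds M m R C δ) (hum : Measurable u)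
    (hu : Integrable u (vol M m)) (c : ℝ) {x : E d} (hx : x ∈ bdry M m) :
    ‖c‖ₑ ^ 2 ≤ 2 * C ^ 2 * ‖opD M m R δ u x‖ₑ ^ 2 + 18 * C ^ 5 *
      (ENNReal.ofReal (normConst m δ) *
        ∫⁻ y, near (2 * δ) x y * ‖c - u y‖ₑ ^ 2 ∂(vol M m)) := by
  set W := ∫ y, (2 - inner ℝ (x - y) (curvature M m x • outwardNormal M x)) * kerBar m R δ x y
      ∂(vol M m) with hW
  have hW1 : 1 ≤ C * W := h.weight_ge x hx
  have h1 : ‖c‖ₑ ≤ C * ‖c * W‖ₑ := by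
    rw [← ofReal_norm, ← ofReal_norm, ← ENNReal.ofReal_coe_nnreal, ← ENNReal.ofReal_mul C.coe_nonneg]
    refine ENNReal.ofReal_le_ofReal ?_
    rw [norm_mul]
    have h2 : 1 ≤ C * ‖W‖ := hW1.trans (mul_le_mul_of_nonneg_left (le_abs_self W) C.coe_nonneg)
    nlinarith [norm_nonneg c]
  rw [h.mul_weight_eq hu c x] at h1
  have h3 : ‖∫ y, (c - u y) *
        ((2 - inner ℝ (x - y) (curvature M m x • outwardNormal M x)) * kerBar m R δ x y)
          ∂(vol M m)‖ₑ ≤ 3 * C * (ENNReal.ofReal (normConst m δ) *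
            ∫⁻ y, near (2 * δ) x y * ‖c - u y‖ₑ ∂(vol M m)) := by
    rw [← mul_assoc, ← lintegral_const_mul' _ _
      (ENNReal.mul_ne_top (ENNReal.mul_ne_top (by simp) (by simp)) ENNReal.ofReal_ne_top)]
    refine (enorm_integral_le_lintegral_enorm _).trans (lintegral_mono fun y => ?_)
    have h4 := h.enorm_coeff_mul_kerBar_le (x := x) (y := y) hx (s := -1) (by simp)
    rw [neg_one_mul, ← sub_eq_add_neg] at h4
    rw [enorm_mul]
    calc _ ≤ ‖c - u y‖ₑ * _ := mul_le_mul_right h4 _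
      _ = _ := by ring
  calc ‖c‖ₑ ^ 2 ≤ (C * ‖opD M m R δ u x + ∫ y, (c - u y) *
        ((2 - inner ℝ (x - y) (curvature M m x • outwardNormal M x)) * kerBar m R δ x y)
          ∂(vol M m)‖ₑ) ^ 2 := by gcongr
    _ ≤ C ^ 2 * (2 * ‖opD M m R δ u x‖ₑ ^ 2 + 2 * (3 * C * (ENNReal.ofReal (normConst m δ) *
            ∫⁻ y, near (2 * δ) x y * ‖c - u y‖ₑ ∂(vol M m))) ^ 2) := by
        rw [mul_pow]
        refine mul_le_mul_right ((enorm_add_sq_le _ _).trans ?_) _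
        gcongr
    _ ≤ C ^ 2 * (2 * ‖opD M m R δ u x‖ₑ ^ 2 + 2 * ((3 * C) ^ 2 *
          (C * (ENNReal.ofReal (normConst m δ) *
            ∫⁻ y, near (2 * δ) x y * ‖c - u y‖ₑ ^ 2 ∂(vol M m))))) := by
        rw [mul_pow (3 * (C : ℝ≥0∞))]
        refine mul_le_mul_right (add_le_add_right (mul_le_mul_right (mul_le_mul_right ?_ _) _) _) _
        exact sq_mul_lintegral_near_le (h.vol_le x) (measurable_const.sub hum).enorm.aemeasurable
    _ = _ := by ring

/-- Takes `c = s(x)` in the previous estimate and splits `s(x) - u(y)` at `s(y)`. The difference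
estimate gives `δ` times the Dirichlet energy of `s`, hence `δ · δ⁻²` times the nonlocal energy; the
Schur bound gives `δ⁻¹ ‖u - s‖²`. Both are of order `δ⁻¹` times the energy. -/
lemma UniformBounds.boundary_smoothing_le (h : UniformBounds M m R C δ) (hum : Measurable u)
    (hu : Integrable u (vol M m)) :
    ∫⁻ x, ‖smoothing M m R δ u x‖ₑ ^ 2 ∂(bvol M m) ≤
      2 * C ^ 2 * ∫⁻ x, ‖opD M m R δ u x‖ₑ ^ 2 ∂(bvol M m) +
        18 * C ^ 5 * (2 * C * (2 * C ^ 4 + 2 * C ^ 10) + 2 * C ^ 5) *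
          (ENNReal.ofReal δ)⁻¹ * energy M m R δ u := by
  have := h.finite_vol
  have := h.finite_bvol
  set N := ENNReal.ofReal (normConst m δ) with hN
  set D := ENNReal.ofReal δ with hD
  have hD0 : D ≠ 0 := by simpa [hD] using h.pos
  set s := smoothing M m R δ u with hs
  have hsm : Measurable s := h.measurable_smoothing hu
  have hmeas : Measurable fun p : E d × E d => near (2 * δ) p.1 p.2 * ‖s p.1 - u p.2‖ₑ ^ 2 :=
    (measurable_near _ measurable_fst measurable_snd).mul
      (((hsm.comp measurable_fst).sub (hum.comp measurable_snd)).enorm.pow_const 2)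
  have hmeas₁ : Measurable fun p : E d × E d => near (2 * δ) p.1 p.2 * ‖s p.1 - s p.2‖ₑ ^ 2 :=
    (measurable_near _ measurable_fst measurable_snd).mul
      (((hsm.comp measurable_fst).sub (hsm.comp measurable_snd)).enorm.pow_const 2)
  have hmeas₂ : Measurable fun p : E d × E d => near (2 * δ) p.1 p.2 * ‖u p.2 - s p.2‖ₑ ^ 2 :=
    (measurable_near _ measurable_fst measurable_snd).mul
      (((hum.comp measurable_snd).sub (hsm.comp measurable_snd)).enorm.pow_const 2)
  have hI := hmeas.lintegral_prod_right' (ν := vol M m)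
  have hI₁ := hmeas₁.lintegral_prod_right' (ν := vol M m)
  have hI₂ := hmeas₂.lintegral_prod_right' (ν := vol M m)
  have hpt : ∀ x, ∫⁻ y, near (2 * δ) x y * ‖s x - u y‖ₑ ^ 2 ∂(vol M m) ≤
      2 * ∫⁻ y, near (2 * δ) x y * ‖s x - s y‖ₑ ^ 2 ∂(vol M m) +
        2 * ∫⁻ y, near (2 * δ) x y * ‖u y - s y‖ₑ ^ 2 ∂(vol M m) := by
    intro x
    have m₁ : Measurable fun y => near (2 * δ) x y * ‖s x - s y‖ₑ ^ 2 :=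
      (measurable_near _ measurable_const measurable_id).mul
        ((measurable_const.sub hsm).enorm.pow_const 2)
    have m₂ : Measurable fun y => near (2 * δ) x y * ‖u y - s y‖ₑ ^ 2 :=
      (measurable_near _ measurable_const measurable_id).mul
        ((hum.sub hsm).enorm.pow_const 2)
    rw [← lintegral_const_mul _ m₁, ← lintegral_const_mul _ m₂,
      ← lintegral_add_left (m₁.const_mul 2)]
    refine lintegral_mono fun y => ?_
    have h1 := enorm_add_sq_le (s x - s y) (s y - u y)
    rw [sub_add_sub_cancel, enorm_sub_rev (s y)] at h1
    calc _ ≤ near (2 * δ) x y * _ := mul_le_mul_right h1 _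
      _ = _ := by ring
  have hS : N * ∫⁻ x, (∫⁻ y, near (2 * δ) x y * ‖u y - s y‖ₑ ^ 2 ∂(vol M m)) ∂(bvol M m) ≤
      C * D⁻¹ * (C ^ 4 * energy M m R δ u) := by
    rw [lintegral_lintegral_swap hmeas₂.aemeasurable]
    have h2 : ∀ y, ∫⁻ x, near (2 * δ) x y * ‖u y - s y‖ₑ ^ 2 ∂(bvol M m) =
        bvol M m (Metric.closedBall y (2 * δ)) * ‖u y - s y‖ₑ ^ 2 := fun y => by
      have m₁ : Measurable fun x => near (2 * δ) x y :=
        measurable_near _ measurable_id measurable_const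
      rw [lintegral_mul_const _ m₁, lintegral_near]
    simp_rw [h2]
    rw [← lintegral_const_mul' _ _ ENNReal.ofReal_ne_top]
    calc _ ≤ ∫⁻ y, C * D⁻¹ * ‖u y - s y‖ₑ ^ 2 ∂(vol M m) := by
          refine lintegral_mono fun y => ?_
          rw [← mul_assoc]
          exact mul_le_mul_left (h.bvol_le y) _
      _ = C * D⁻¹ * ∫⁻ y, ‖u y - s y‖ₑ ^ 2 ∂(vol M m) :=
          lintegral_const_mul _ ((hum.sub hsm).enorm.pow_const 2)
      _ ≤ _ := mul_le_mul_right (h.lintegral_sub_smoothing_le hum hu) _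
  have hT := (h.difference s fun x hx => h.contDiffAt_smoothing hu hx).trans
    (mul_le_mul_right (h.dirichlet_smoothing_le hum hu) _)
  have hTS : N * ∫⁻ x, (∫⁻ y, near (2 * δ) x y * ‖s x - u y‖ₑ ^ 2 ∂(vol M m)) ∂(bvol M m) ≤
      (2 * C * (2 * C ^ 4 + 2 * C ^ 10) + 2 * C ^ 5) * D⁻¹ * energy M m R δ u := by
    calc _ ≤ N * ∫⁻ x, (2 * ∫⁻ y, near (2 * δ) x y * ‖s x - s y‖ₑ ^ 2 ∂(vol M m) +
        2 * ∫⁻ y, near (2 * δ) x y * ‖u y - s y‖ₑ ^ 2 ∂(vol M m)) ∂(bvol M m) :=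
          mul_le_mul_right (lintegral_mono hpt) _
      _ = 2 * (N * ∫⁻ x, (∫⁻ y, near (2 * δ) x y * ‖s x - s y‖ₑ ^ 2 ∂(vol M m)) ∂(bvol M m)) +
          2 * (N * ∫⁻ x, (∫⁻ y, near (2 * δ) x y * ‖u y - s y‖ₑ ^ 2 ∂(vol M m)) ∂(bvol M m)) := by
          rw [lintegral_add_left (hI₁.const_mul 2), lintegral_const_mul _ hI₁,
            lintegral_const_mul _ hI₂]
          ring
      _ ≤ 2 * (C * D * ((2 * C ^ 4 + 2 * C ^ 10) * D⁻¹ ^ 2 * energy M m R δ u)) +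
          2 * (C * D⁻¹ * (C ^ 4 * energy M m R δ u)) := by gcongr
      _ = 2 * C * (2 * C ^ 4 + 2 * C ^ 10) * (D * D⁻¹) * D⁻¹ * energy M m R δ u +
          2 * C ^ 5 * D⁻¹ * energy M m R δ u := by ring
      _ = _ := by
          rw [ENNReal.mul_inv_cancel hD0 ENNReal.ofReal_ne_top]; ring
  calc ∫⁻ x, ‖s x‖ₑ ^ 2 ∂(bvol M m)
      ≤ ∫⁻ x, (2 * C ^ 2 * ‖opD M m R δ u x‖ₑ ^ 2 + 18 * C ^ 5 *
        (N * ∫⁻ y, near (2 * δ) x y * ‖s x - u y‖ₑ ^ 2 ∂(vol M m))) ∂(bvol M m) :=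
        lintegral_mono_ae (h.ae_bvol.mono fun x hx => h.sq_enorm_le_opD hum hu (s x) hx)
    _ = 2 * C ^ 2 * ∫⁻ x, ‖opD M m R δ u x‖ₑ ^ 2 ∂(bvol M m) + 18 * C ^ 5 *
        (N * ∫⁻ x, (∫⁻ y, near (2 * δ) x y * ‖s x - u y‖ₑ ^ 2 ∂(vol M m)) ∂(bvol M m)) := by
        rw [lintegral_add_right _ ((hI.const_mul N).const_mul _), lintegral_const_mul' _ _
          (ENNReal.mul_ne_top (by simp) (by simp)), lintegral_const_mul _ (hI.const_mul N),
          lintegral_const_mul _ hI]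
    _ ≤ 2 * C ^ 2 * ∫⁻ x, ‖opD M m R δ u x‖ₑ ^ 2 ∂(bvol M m) + 18 * C ^ 5 *
        ((2 * C * (2 * C ^ 4 + 2 * C ^ 10) + 2 * C ^ 5) * D⁻¹ * energy M m R δ u) := by gcongr
    _ = _ := by ring

/-- Coercivity of the nonlocal energy together with the boundary operator. -/
theorem exists_coercivity (M : Set (E d)) (m : ℕ) (R : ℝ → ℝ) (C : ℝ≥0) : ∃ K : ℝ≥0, ∀ δ : ℝ,
    UniformBounds M m R C δ → ∀ u : E d → ℝ, Measurable u → Integrable u (vol M m) →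
      ∫⁻ x, ‖u x‖ₑ ^ 2 ∂(vol M m) ≤ K * (∫⁻ x, ‖opD M m R δ u x‖ₑ ^ 2 ∂(bvol M m) +
        (ENNReal.ofReal δ)⁻¹ ^ 2 * energy M m R δ u) := by
  set A : ℝ≥0 := 2 * C ^ 4 + 2 * C ^ 10 with hA
  set A' : ℝ≥0 := 18 * C ^ 5 * (2 * C * A + 2 * C ^ 5) with hA'
  refine ⟨4 * C ^ 3 + (2 * C ^ 4 + 2 * C * (A' + A)), fun δ h u hum hu => ?_⟩
  have hcast : 18 * C ^ 5 * (2 * C * (2 * C ^ 4 + 2 * C ^ 10) + 2 * C ^ 5) = (A' : ℝ≥0∞) := by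
    rw [hA', hA]; push_cast; ring
  have hcast' : 2 * (C : ℝ≥0∞) ^ 4 + 2 * C ^ 10 = A := by rw [hA]; push_cast; ring
  have h1 := h.boundary_smoothing_le hum hu
  have h2 := h.dirichlet_smoothing_le hum hu
  have h3 := h.lintegral_sub_smoothing_le hum hu
  -- The Poincaré inequality is applied to the smoothing, as `u` itself has no gradient.
  have h4 := h.poincare (smoothing M m R δ u) fun x hx => h.contDiffAt_smoothing hu hx
  rw [hcast] at h1
  rw [hcast'] at h2
  set s := smoothing M m R δ u with hs
  have hsm : Measurable s := h.measurable_smoothing hu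
  set V := ∫⁻ x, ‖opD M m R δ u x‖ₑ ^ 2 ∂(bvol M m) with hV
  set W := energy M m R δ u with hW
  set D' := (ENNReal.ofReal δ)⁻¹ with hD'
  have hD1 : 1 ≤ D' := h.coe_mul_inv_ge
  have e1 : D' ≤ D' ^ 2 := le_self_pow₀ hD1 (by norm_num)
  -- As `δ ≤ 1`, lower powers of `δ⁻¹` are dominated by `δ⁻²`, the scaling at which the energy
  -- equals `2 ⟨L u, u⟩`.
  have e2 : W ≤ D' ^ 2 * W := le_mul_of_one_le_left zero_le (one_le_pow₀ hD1)
  calc ∫⁻ x, ‖u x‖ₑ ^ 2 ∂(vol M m)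
      ≤ ∫⁻ x, (2 * ‖u x - s x‖ₑ ^ 2 + 2 * ‖s x‖ₑ ^ 2) ∂(vol M m) :=
        lintegral_mono fun x => enorm_sq_le_sub_add _ _
    _ = 2 * ∫⁻ x, ‖u x - s x‖ₑ ^ 2 ∂(vol M m) + 2 * ∫⁻ x, ‖s x‖ₑ ^ 2 ∂(vol M m) := by
        have m₁ : Measurable fun x => ‖u x - s x‖ₑ ^ 2 := (hum.sub hsm).enorm.pow_const 2
        rw [lintegral_add_right _ ((hsm.enorm.pow_const 2).const_mul 2),
          lintegral_const_mul _ (hsm.enorm.pow_const 2),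
          lintegral_const_mul _ m₁]
    _ ≤ 2 * (C ^ 4 * W) + 2 * (C * ((2 * C ^ 2 * V + A' * D' * W) + A * D' ^ 2 * W)) := by
        gcongr
        exact h4.trans (by gcongr)
    _ ≤ 2 * (C ^ 4 * (D' ^ 2 * W)) +
        2 * (C * ((2 * C ^ 2 * V + A' * D' ^ 2 * W) + A * D' ^ 2 * W)) := by gcongr
    _ = 4 * C ^ 3 * V + (2 * C ^ 4 + 2 * C * (A' + A)) * (D' ^ 2 * W) := by ring
    _ ≤ (4 * C ^ 3 + (2 * C ^ 4 + 2 * C * (A' + A))) * V +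
        (4 * C ^ 3 + (2 * C ^ 4 + 2 * C * (A' + A))) * (D' ^ 2 * W) := by
        exact add_le_add (mul_le_mul_left le_self_add _) (mul_le_mul_left le_add_self _)
    _ = _ := by push_cast; ring

end Coercivity

open scoped Convolution

/-! ### Approximation of `C¹` functions by smooth ones -/

section SmoothApproximation

variable {d : ℕ}

/-- A function that is `C¹` near a compact set agrees near that set with a compactly supported
`C¹` function. -/
lemma exists_contDiff_hasCompactSupport_eventuallyEq {K : Set (E d)} (hK : IsCompact K)
    {φ : E d → ℝ} (hφ : ∀ x ∈ K, ContDiffAt ℝ 1 φ x) :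
    ∃ ψ : E d → ℝ, ContDiff ℝ 1 ψ ∧ HasCompactSupport ψ ∧ ∀ x ∈ K, ψ =ᶠ[𝓝 x] φ := by
  set U : Set (E d) := {x | ContDiffAt ℝ 1 φ x} with hU
  have hUo : IsOpen U := isOpen_iff_mem_nhds.2 fun x hx =>
    ContDiffAt.eventually (show ContDiffAt ℝ 1 φ x from hx) (by simp)
  obtain ⟨r, hr⟩ := hK.isBounded.subset_ball (0 : E d)
  set V := U ∩ Metric.ball 0 r with hV
  have hVo : IsOpen V := hUo.inter Metric.isOpen_ball
  have hKV : K ⊆ V := fun x hx => ⟨hφ x hx, hr hx⟩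
  obtain ⟨χ, hχ0, hχ1, -⟩ := exists_contMDiffMap_zero_one_nhds_of_isClosed (n := 1)
    (modelWithCornersSelf ℝ (E d)) hVo.isClosed_compl hK.isClosed
    (Set.disjoint_left.2 fun x hx hxK => hx (hKV hxK))
  have hχ : ContDiff ℝ 1 χ := χ.contMDiff.contDiff
  rw [eventually_nhdsSet_iff_forall] at hχ0 hχ1
  refine ⟨fun x => χ x * φ x, contDiff_iff_contDiffAt.2 fun x => ?_, ?_, fun x hx => ?_⟩
  · by_cases hx : x ∈ V
    · exact hχ.contDiffAt.mul hx.1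
    · refine (contDiffAt_const (c := (0 : ℝ))).congr_of_eventuallyEq ?_
      filter_upwards [hχ0 x hx] with z hz
      rw [hz, zero_mul]
  · refine HasCompactSupport.intro (isCompact_closedBall (0 : E d) r) fun x hx => ?_
    have hxV : x ∉ V := fun h => hx (Metric.ball_subset_closedBall h.2)
    rw [(hχ0 x hxV).self_of_nhds, zero_mul]
  · filter_upwards [hχ1 x hx] with z hz
    rw [hz, one_mul]

/-- Compactly supported `C¹` functions are approximated in `C¹` by smooth functions. -/
lemma exists_contDiff_near {ψ : E d → ℝ} (hψ : ContDiff ℝ 1 ψ) (hc : HasCompactSupport ψ) {ε : ℝ}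
    (hε : 0 < ε) : ∃ g : E d → ℝ, ContDiff ℝ ∞ g ∧
      ∀ x, ‖g x - ψ x‖ ≤ ε ∧ ‖fderiv ℝ g x - fderiv ℝ ψ x‖ ≤ ε := by
  have hψ' : Continuous (fderiv ℝ ψ) := hψ.continuous_fderiv (by simp)
  have u₁ := hc.uniformContinuous_of_continuous hψ.continuous
  have u₂ := (hc.fderiv ℝ).uniformContinuous_of_continuous hψ'
  obtain ⟨r₁, hr₁, h₁⟩ := Metric.uniformContinuous_iff.1 u₁ ε hε
  obtain ⟨r₂, hr₂, h₂⟩ := Metric.uniformContinuous_iff.1 u₂ ε hε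
  have hr : 0 < min r₁ r₂ := lt_min hr₁ hr₂
  let η : ContDiffBump (0 : E d) := ⟨min r₁ r₂ / 2, min r₁ r₂, by positivity, by linarith⟩
  refine ⟨(η.normed volume) ⋆[ContinuousLinearMap.lsmul ℝ ℝ, volume] ψ, ?_, fun x => ⟨?_, ?_⟩⟩
  · exact η.hasCompactSupport_normed.contDiff_convolution_left _ η.contDiff_normed
      hψ.continuous.locallyIntegrable
  · rw [← dist_eq_norm]
    refine η.dist_normed_convolution_le hψ.continuous.aestronglyMeasurable fun z hz => ?_
    exact (h₁ ((Metric.mem_ball.1 hz).trans_le (min_le_left _ _))).le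
  · have hd := hc.hasFDerivAt_convolution_right (ContinuousLinearMap.lsmul ℝ ℝ) (μ := volume)
      (f := η.normed volume) η.continuous_normed.locallyIntegrable hψ x
    -- With this identification the derivative of the mollification is the mollification of the
    -- derivative, by the same bump.
    have he : (ContinuousLinearMap.lsmul ℝ ℝ : ℝ →L[ℝ] ℝ →L[ℝ] ℝ).precompR (E d) =
        ContinuousLinearMap.lsmul ℝ ℝ := by
      ext; simp
    rw [he] at hd
    rw [hd.fderiv, ← dist_eq_norm]
    refine η.dist_normed_convolution_le hψ'.aestronglyMeasurable fun z hz => ?_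
    exact (h₂ ((Metric.mem_ball.1 hz).trans_le (min_le_right _ _))).le

end SmoothApproximation

/-! ### The space `H¹(M)` and the trace -/

section Sobolev

variable {d m : ℕ} {M : Set (E d)}

lemma ofReal_norm_sq {X F : Type*} [MeasurableSpace X] [NormedAddCommGroup F] {ν : Measure X}
    (f : Lp F 2 ν) : ENNReal.ofReal (‖f‖ ^ 2) = ∫⁻ x, ‖f x‖ₑ ^ 2 ∂ν := by
  have h1 := eLpNorm_nnreal_pow_eq_lintegral (μ := ν) (f := f) (p := 2) (by norm_num)
  rw [ENNReal.ofReal_pow (norm_nonneg _), Lp.norm_def, ENNReal.ofReal_toReal (Lp.eLpNorm_ne_top f)]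
  simpa using h1

lemma norm_tangentialGradient_sub_le (M : Set (E d)) (φ ψ : E d → ℝ) (x : E d) :
    ‖tangentialGradient M φ x - tangentialGradient M ψ x‖ ≤ ‖fderiv ℝ φ x - fderiv ℝ ψ x‖ := by
  rw [tangentialGradient, tangentialGradient, ← map_sub]
  refine ((tangentSpace M x).norm_starProjection_apply_le _).trans_eq ?_
  rw [gradient, gradient, ← map_sub, LinearIsometryEquiv.norm_map]

lemma tangentialGradient_sub {φ ψ : E d → ℝ} {x : E d} (hφ : DifferentiableAt ℝ φ x)
    (hψ : DifferentiableAt ℝ ψ x) :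
    tangentialGradient M (φ - ψ) x = tangentialGradient M φ x - tangentialGradient M ψ x := by
  simp only [tangentialGradient, gradient]
  rw [fderiv_sub hφ hψ, map_sub, map_sub]

lemma continuousOn_tangentialGradient (hm : 1 ≤ m) (hmd : m ≤ d) (hM : IsCompactSubmanifold M m)
    {φ : E d → ℝ} (hφ : ∀ x ∈ M, ContDiffAt ℝ 1 φ x) :
    ContinuousOn (tangentialGradient M φ) M := by
  have h1 : ContinuousOn (gradient φ) M := fun x hx =>
    ((InnerProductSpace.toDual ℝ (E d)).symm.continuous.continuousAt.comp
      ((hφ x hx).continuousAt_fderiv (by simp))).continuousWithinAt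
  exact (hM.continuousOn_starProjection hm hmd).clm_apply h1

lemma memLp_of_continuousOn {F : Type*} [NormedAddCommGroup F] {ν : Measure (E d)}
    [IsFiniteMeasure ν] {K : Set (E d)} (hK : IsCompact K) {f : E d → F} (hf : ContinuousOn f K)
    (hfm : AEStronglyMeasurable f ν) (hν : ∀ᵐ x ∂ν, x ∈ K) : MemLp f 2 ν := by
  obtain ⟨B, hB⟩ := hK.exists_bound_of_continuousOn hf
  exact MemLp.of_bound hfm B (hν.mono fun x hx => hB x hx)

lemma IsCompactSubmanifold.memLp_vol (hm : 1 ≤ m) (hmd : m ≤ d) (hM : IsCompactSubmanifold M m)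
    {F : Type*} [NormedAddCommGroup F] [SecondCountableTopologyEither (E d) F]
    {f : E d → F} (hf : ContinuousOn f M) : MemLp f 2 (vol M m) := by
  have := hM.isFiniteMeasure_vol hm hmd
  exact memLp_of_continuousOn hM.isCompact hf
    (hf.aestronglyMeasurable hM.isCompact.isClosed.measurableSet) (ae_mem_vol hM)

lemma IsCompactSubmanifold.memLp_bvol (hm : 1 ≤ m) (hmd : m ≤ d) (hM : IsCompactSubmanifold M m)
    {f : E d → ℝ} (hf : ContinuousOn f (bdry M m)) : MemLp f 2 (bvol M m) := by
  have := hM.isFiniteMeasure_bvol hm hmd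
  exact memLp_of_continuousOn (hM.isCompact_bdry hm hmd) hf
    (hf.aestronglyMeasurable (hM.isClosed_bdry hm hmd).measurableSet) (ae_mem_bdry hm hmd hM)

/-- Functions that are `C¹` near `M` belong to `H¹(M)`, with the expected gradient. -/
theorem exists_mem_H1 (hm : 1 ≤ m) (hmd : m ≤ d) (hM : IsCompactSubmanifold M m)
    {φ : E d → ℝ} (hφ : ∀ x ∈ M, ContDiffAt ℝ 1 φ x) :
    ∃ p ∈ H1 M m, p.1 =ᵐ[vol M m] φ ∧ p.2 =ᵐ[vol M m] tangentialGradient M φ := by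
  have := hM.isFiniteMeasure_vol hm hmd
  have mem₁ : ∀ φ : E d → ℝ, (∀ x ∈ M, ContDiffAt ℝ 1 φ x) → MemLp φ 2 (vol M m) :=
    fun φ hφ => hM.memLp_vol hm hmd fun x hx => (hφ x hx).continuousAt.continuousWithinAt
  have mem₂ : ∀ φ : E d → ℝ, (∀ x ∈ M, ContDiffAt ℝ 1 φ x) →
      MemLp (tangentialGradient M φ) 2 (vol M m) :=
    fun φ hφ => hM.memLp_vol hm hmd (continuousOn_tangentialGradient hm hmd hM hφ)
  obtain ⟨ψ, hψ, hψc, hψφ⟩ := exists_contDiff_hasCompactSupport_eventuallyEq hM.isCompact hφ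
  refine ⟨((mem₁ φ hφ).toLp φ, (mem₂ φ hφ).toLp _), ?_, (mem₁ φ hφ).coeFn_toLp,
    (mem₂ φ hφ).coeFn_toLp⟩
  refine Metric.mem_closure_iff.2 fun ε hε => ?_
  -- The factor by which a uniform bound becomes an `L²` bound; the `+ 1` below guards against `A =
  -- 0`.
  set A : ℝ := (measureUnivNNReal (vol M m) : ℝ) ^ (2 : ℝ≥0∞).toReal⁻¹ with hA
  have hA0 : 0 ≤ A := by positivity
  obtain ⟨g, hg, hgψ⟩ := exists_contDiff_near hψ hψc (ε := ε / (2 * (A + 1))) (by positivity)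
  have hg1 : ∀ x ∈ M, ContDiffAt ℝ 1 g x := fun x _ => (hg.of_le (by simp)).contDiffAt
  have hlt : A * (ε / (2 * (A + 1))) < ε := by
    rw [mul_div_assoc', div_lt_iff₀ (by positivity)]
    nlinarith
  refine ⟨((mem₁ g hg1).toLp g, (mem₂ g hg1).toLp _),
    ⟨g, hg, (mem₁ g hg1).coeFn_toLp, (mem₂ g hg1).coeFn_toLp⟩, ?_⟩
  rw [Prod.dist_eq, dist_eq_norm, dist_eq_norm]
  refine max_lt (lt_of_le_of_lt (Lp.norm_le_of_ae_bound (by positivity) ?_) hlt)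
    (lt_of_le_of_lt (Lp.norm_le_of_ae_bound (by positivity) ?_) hlt)
  · filter_upwards [ae_mem_vol hM, Lp.coeFn_sub ((mem₁ φ hφ).toLp φ) ((mem₁ g hg1).toLp g),
      (mem₁ φ hφ).coeFn_toLp, (mem₁ g hg1).coeFn_toLp] with x hx e1 e2 e3
    rw [e1, Pi.sub_apply, e2, e3, ← (hψφ x hx).self_of_nhds, norm_sub_rev]
    exact (hgψ x).1
  · filter_upwards [ae_mem_vol hM, Lp.coeFn_sub ((mem₂ φ hφ).toLp _) ((mem₂ g hg1).toLp _),
      (mem₂ φ hφ).coeFn_toLp, (mem₂ g hg1).coeFn_toLp] with x hx e1 e2 e3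
    rw [e1, Pi.sub_apply, e2, e3]
    refine (norm_tangentialGradient_sub_le M φ g x).trans ?_
    rw [← (hψφ x hx).fderiv_eq, norm_sub_rev]
    exact (hgψ x).2

/-- The constants of the trace inequality. -/
def IsTraceConst (M : Set (E d)) (m : ℕ) (C : ℝ≥0) : Prop :=
  ∀ φ : E d → ℝ, ContDiff ℝ ∞ φ → ∀ (p : L2 M m) (q : L2Vec M m) (g : L2Bdry M m),
    p =ᵐ[vol M m] φ → q =ᵐ[vol M m] tangentialGradient M φ → g =ᵐ[bvol M m] φ →
      ‖g‖ ^ 2 ≤ C * (‖p‖ ^ 2 + ‖q‖ ^ 2)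

lemma exists_isTraceConst (hm : 1 ≤ m) (hmd : m ≤ d) (hM : IsCompactSubmanifold M m) :
    ∃ C : ℝ≥0, IsTraceConst M m C := by
  obtain ⟨C, hC⟩ := exists_trace_inequality hm hmd hM
  refine ⟨C, ?_⟩
  intro φ hφ p q g hp hq hg
  have h1 := hC φ fun x _ => (hφ.of_le (by simp)).contDiffAt
  have e1 : ∫⁻ x, ‖φ x‖ₑ ^ 2 ∂(bvol M m) = ENNReal.ofReal (‖g‖ ^ 2) := by
    rw [ofReal_norm_sq]; exact lintegral_congr_ae (hg.mono fun x hx => by simp only [hx])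
  have e2 : ∫⁻ x, ‖φ x‖ₑ ^ 2 ∂(vol M m) = ENNReal.ofReal (‖p‖ ^ 2) := by
    rw [ofReal_norm_sq]; exact lintegral_congr_ae (hp.mono fun x hx => by simp only [hx])
  have e3 : dirichlet M m φ = ENNReal.ofReal (‖q‖ ^ 2) := by
    rw [ofReal_norm_sq]; exact lintegral_congr_ae (hq.mono fun x hx => by simp only [hx])
  rw [e1, e2, e3, ← ENNReal.ofReal_add (by positivity) (by positivity),
    ← ENNReal.ofReal_coe_nnreal, ← ENNReal.ofReal_mul C.coe_nonneg] at h1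
  exact (ENNReal.ofReal_le_ofReal_iff (by positivity)).1 h1

/-- The trace inequality for differences makes the boundary values of an approximating sequence
Cauchy in `L²(∂M)`. Existence of the limit is what gives `trace`, defined by choice, its meaning. -/
lemma IsTraceConst.exists_mem_closure (hm : 1 ≤ m) (hmd : m ≤ d) (hM : IsCompactSubmanifold M m)
    {C : ℝ≥0} (key : IsTraceConst M m C) {f : L2 M m × L2Vec M m} (hf : f ∈ H1 M m) :
    ∃ g, (f.1, f.2, g) ∈ closure (smoothTriples M m) := by
  obtain ⟨p, hp, hpf⟩ := mem_closure_iff_seq_limit.1 hf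
  choose φ hφ hφ₁ hφ₂ using hp
  have hmem : ∀ n, MemLp (φ n) 2 (bvol M m) := fun n =>
    hM.memLp_bvol hm hmd (hφ n).continuous.continuousOn
  set g : ℕ → L2Bdry M m := fun n => (hmem n).toLp (φ n) with hg
  have hgφ : ∀ n, g n =ᵐ[bvol M m] φ n := fun n => (hmem n).coeFn_toLp
  have hdiff : ∀ n k, ‖g n - g k‖ ^ 2 ≤ (2 * C) * (dist (p n) (p k)) ^ 2 := by
    intro n k
    have h1 := key (φ n - φ k) ((hφ n).sub (hφ k)) ((p n).1 - (p k).1) ((p n).2 - (p k).2)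
      (g n - g k) ((Lp.coeFn_sub _ _).trans ((hφ₁ n).sub (hφ₁ k))) ?_
      ((Lp.coeFn_sub _ _).trans ((hgφ n).sub (hgφ k)))
    · refine h1.trans ?_
      have h2 : ‖(p n).1 - (p k).1‖ ≤ dist (p n) (p k) := by
        rw [← dist_eq_norm]; exact le_max_left _ _
      have h3 : ‖(p n).2 - (p k).2‖ ≤ dist (p n) (p k) := by
        rw [← dist_eq_norm]; exact le_max_right _ _
      calc _ ≤ C * (dist (p n) (p k) ^ 2 + dist (p n) (p k) ^ 2) := by gcongr
        _ = _ := by ring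
    · refine (Lp.coeFn_sub _ _).trans (((hφ₂ n).sub (hφ₂ k)).trans
        (Eventually.of_forall fun x => ?_))
      exact (tangentialGradient_sub ((hφ n).differentiable (by simp) x)
        ((hφ k).differentiable (by simp) x)).symm
  have hcauchy : CauchySeq g := by
    refine Metric.cauchySeq_iff.2 fun ε hε => ?_
    obtain ⟨N, hN⟩ := Metric.cauchySeq_iff.1 hpf.cauchySeq (ε / √(2 * C + 1)) (by positivity)
    refine ⟨N, fun n hn k hk => ?_⟩
    have h1 := hN n hn k hk
    rw [lt_div_iff₀ (by positivity)] at h1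
    rw [dist_eq_norm]
    refine lt_of_pow_lt_pow_left₀ 2 hε.le ?_
    calc ‖g n - g k‖ ^ 2 ≤ (2 * C) * (dist (p n) (p k)) ^ 2 := hdiff n k
      _ ≤ (dist (p n) (p k) * √(2 * C + 1)) ^ 2 := by
          rw [mul_pow, Real.sq_sqrt (by positivity)]
          nlinarith [sq_nonneg (dist (p n) (p k))]
      _ < ε ^ 2 := pow_lt_pow_left₀ h1 (by positivity) (by norm_num)
  obtain ⟨g₀, hg₀⟩ := cauchySeq_tendsto_of_complete hcauchy
  refine ⟨g₀, mem_closure_iff_seq_limit.2 ⟨fun n => ((p n).1, (p n).2, g n), fun n =>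
    ⟨φ n, hφ n, hφ₁ n, hφ₂ n, hgφ n⟩, ?_⟩⟩
  exact ((continuous_fst.tendsto _).comp hpf).prodMk_nhds
    (((continuous_snd.tendsto _).comp hpf).prodMk_nhds hg₀)

/-- The boundary trace is bounded on `H¹(M)`. -/
theorem exists_norm_trace_le (hm : 1 ≤ m) (hmd : m ≤ d) (hM : IsCompactSubmanifold M m) :
    ∃ C : ℝ≥0, ∀ f ∈ H1 M m, ‖trace f‖ ^ 2 ≤ C * h1NormSq f := by
  obtain ⟨C, hC⟩ := exists_isTraceConst hm hmd hM
  refine ⟨C, fun f hf => ?_⟩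
  have hspec : (f.1, f.2, trace f) ∈ closure (smoothTriples M m) :=
    Classical.epsilon_spec (hC.exists_mem_closure hm hmd hM hf)
  obtain ⟨p, hp, hlim⟩ := mem_closure_iff_seq_limit.1 hspec
  have t₁ : Tendsto (fun n => (p n).1) atTop (𝓝 f.1) := (continuous_fst.tendsto _).comp hlim
  have t : Tendsto (fun n => (p n).2) atTop (𝓝 (f.2, trace f)) :=
    (continuous_snd.tendsto _).comp hlim
  have t₂ : Tendsto (fun n => (p n).2.1) atTop (𝓝 f.2) := (continuous_fst.tendsto _).comp t
  have t₃ : Tendsto (fun n => (p n).2.2) atTop (𝓝 (trace f)) := (continuous_snd.tendsto _).comp t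
  refine le_of_tendsto_of_tendsto' (t₃.norm.pow 2)
    (((t₁.norm.pow 2).add (t₂.norm.pow 2)).const_mul (C : ℝ)) fun n => ?_
  obtain ⟨φ, hφ, h1, h2, h3⟩ := hp n
  exact hC φ hφ _ _ _ h1 h2 h3

end Sobolev

/-! ### Estimates for the integral operators -/

section Operators

variable {d m : ℕ} {M : Set (E d)} {R : ℝ → ℝ} {C : ℝ≥0} {δ : ℝ}

/-- The normalised integral of `|f|` over the ball of radius `2 δ`. -/
def ballAverage (m : ℕ) (δ : ℝ) (ν : Measure (E d)) (f : E d → ℝ) (x : E d) : ℝ≥0∞ :=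
  ENNReal.ofReal (normConst m δ) * ∫⁻ y, near (2 * δ) x y * ‖f y‖ₑ ∂ν

lemma aemeasurable_ballAverage {ν σ : Measure (E d)} [SFinite ν] {f : E d → ℝ}
    (hf : AEStronglyMeasurable f ν) : AEMeasurable (ballAverage m δ ν f) σ := by
  have hf' := hf.enorm
  obtain ⟨g, hg, hfg⟩ := hf'
  have e : ballAverage m δ ν f =
      fun x => ENNReal.ofReal (normConst m δ) * ∫⁻ y, near (2 * δ) x y * g y ∂ν := by
    ext x
    rw [ballAverage]
    congr 1
    exact lintegral_congr_ae (hfg.mono fun y hy => by simp only [hy])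
  rw [e]
  exact ((((measurable_near _ measurable_fst measurable_snd).mul
    (hg.comp measurable_snd)).lintegral_prod_right').const_mul _).aemeasurable

lemma UniformBounds.schur_vol_vol (h : UniformBounds M m R C δ) {f : E d → ℝ}
    (hf : AEStronglyMeasurable f (vol M m)) :
    ∫⁻ x, ballAverage m δ (vol M m) f x ^ 2 ∂(vol M m) ≤
      C ^ 2 * ∫⁻ x, ‖f x‖ₑ ^ 2 ∂(vol M m) := by
  have := h.finite_vol
  refine (lintegral_sq_near_le h.vol_le h.vol_le hf.enorm).trans_eq ?_
  ring

/-- The two normalised ball masses in the Schur test are `C` and `C δ⁻¹`, so passing between `M` and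
`∂M` costs `δ^(-1/2)` in norm. -/
lemma UniformBounds.schur_bvol_vol (h : UniformBounds M m R C δ) {f : E d → ℝ}
    (hf : AEStronglyMeasurable f (bvol M m)) :
    ∫⁻ x, ballAverage m δ (bvol M m) f x ^ 2 ∂(vol M m) ≤
      C ^ 2 * (ENNReal.ofReal δ)⁻¹ * ∫⁻ x, ‖f x‖ₑ ^ 2 ∂(bvol M m) := by
  have := h.finite_vol
  have := h.finite_bvol
  refine (lintegral_sq_near_le h.bvol_le h.vol_le hf.enorm).trans_eq ?_
  ring

lemma UniformBounds.schur_vol_bvol (h : UniformBounds M m R C δ) {f : E d → ℝ}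
    (hf : AEStronglyMeasurable f (vol M m)) :
    ∫⁻ x, ballAverage m δ (vol M m) f x ^ 2 ∂(bvol M m) ≤
      C ^ 2 * (ENNReal.ofReal δ)⁻¹ * ∫⁻ x, ‖f x‖ₑ ^ 2 ∂(vol M m) := by
  have := h.finite_vol
  have := h.finite_bvol
  refine (lintegral_sq_near_le h.vol_le h.bvol_le hf.enorm).trans_eq ?_
  ring

lemma IsProfile.enorm_integral_le_ballAverage {ρ ρ' : ℝ → ℝ} {B : ℝ≥0} (h : IsProfile ρ ρ' B)
    (m : ℕ) (hδ : 0 < δ) {α g : E d → ℝ} {β : E d → E d} {ν : Measure (E d)} {A : ℝ≥0∞}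
    (hA : A ≠ ⊤) (hg : ∀ᵐ y ∂ν, ‖α y‖ₑ + ENNReal.ofReal (2 * δ) * ‖β y‖ₑ ≤ A * ‖g y‖ₑ) (x : E d) :
    ‖∫ y, (α y + inner ℝ (x - y) (β y)) * ker m ρ δ x y ∂ν‖ₑ ≤
      A * B * ballAverage m δ ν g x := by
  refine (h.enorm_integral_le m hδ α β ν x).trans ?_
  rw [ENNReal.ofReal_mul (normConst_nonneg m δ), ENNReal.ofReal_coe_nnreal, ballAverage]
  calc _ ≤ ENNReal.ofReal (normConst m δ) * B * ∫⁻ y, A * (near (2 * δ) x y * ‖g y‖ₑ) ∂ν := by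
        refine mul_le_mul_right (lintegral_mono_ae (hg.mono fun y hy => ?_)) _
        refine (mul_le_mul_right hy _).trans_eq ?_
        ring
    _ = _ := by rw [lintegral_const_mul' _ _ hA]; ring

lemma IsProfile.enorm_fderiv_integral_le_ballAverage {ρ ρ' : ℝ → ℝ} {B : ℝ≥0}
    (h : IsProfile ρ ρ' B) (m : ℕ) (hδ : 0 < δ) {α g : E d → ℝ} {β : E d → E d}
    {ν : Measure (E d)} (hα : Integrable α ν) (hβ : Integrable β ν) {A : ℝ≥0∞} (hA : A ≠ ⊤)
    (hg : ∀ᵐ y ∂ν, ‖α y‖ₑ + ENNReal.ofReal (3 * δ) * ‖β y‖ₑ ≤ A * ‖g y‖ₑ) (x : E d) :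
    ‖fderiv ℝ (fun x => ∫ y, (α y + inner ℝ (x - y) (β y)) * ker m ρ δ x y ∂ν) x‖ₑ ≤
      A * B * (ENNReal.ofReal δ)⁻¹ * ballAverage m δ ν g x := by
  refine (h.enorm_fderiv_integral_le m hδ hα hβ x).trans ?_
  rw [div_eq_mul_inv, ENNReal.ofReal_mul (mul_nonneg (normConst_nonneg m δ) B.coe_nonneg),
    ENNReal.ofReal_mul (normConst_nonneg m δ), ENNReal.ofReal_inv_of_pos hδ,
    ENNReal.ofReal_coe_nnreal, ballAverage]
  calc _ ≤ ENNReal.ofReal (normConst m δ) * B * (ENNReal.ofReal δ)⁻¹ *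
        ∫⁻ y, A * (near (2 * δ) x y * ‖g y‖ₑ) ∂ν := by
        refine mul_le_mul_right (lintegral_mono_ae (hg.mono fun y hy => ?_)) _
        refine (mul_le_mul_right hy _).trans_eq ?_
        ring
    _ = _ := by rw [lintegral_const_mul' _ _ hA]; ring

lemma UniformBounds.ofReal_mul_le (h : UniformBounds M m R C δ) (k : ℕ) [k.AtLeastTwo] :
    ENNReal.ofReal (OfNat.ofNat k * δ) ≤ OfNat.ofNat k := by
  rw [← ENNReal.ofReal_ofNat k]
  exact ENNReal.ofReal_le_ofReal (mul_le_of_le_one_right (Nat.ofNat_nonneg k) h.le_one)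

section opG

variable {v : E d → ℝ}

lemma UniformBounds.enorm_smul_curvature_le (h : UniformBounds M m R C δ) :
    ∀ᵐ y ∂(bvol M m), ‖v y • curvature M m y • outwardNormal M y‖ₑ ≤ C * ‖v y‖ₑ := by
  filter_upwards [h.ae_bvol] with y hy
  rw [enorm_smul, enorm_smul, ← ofReal_norm (outwardNormal M y), h.norm_normal y hy,
    ENNReal.ofReal_one, mul_one, mul_comm, ← ofReal_norm (curvature M m y)]
  refine mul_le_mul_left ?_ _
  rw [← ENNReal.ofReal_coe_nnreal]
  exact ENNReal.ofReal_le_ofReal (h.curvature_le y hy)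

lemma UniformBounds.integrable_smul_curvature (h : UniformBounds M m R C δ)
    (hv : Integrable v (bvol M m)) :
    Integrable (fun y => v y • curvature M m y • outwardNormal M y) (bvol M m) := by
  refine (hv.norm.const_mul (C : ℝ)).mono' (hv.1.smul (h.curvature_meas.smul h.normal_meas)) ?_
  filter_upwards [h.enorm_smul_curvature_le (v := v)] with y hy
  rw [← ofReal_norm, ← ofReal_norm, ← ENNReal.ofReal_coe_nnreal,
    ← ENNReal.ofReal_mul C.coe_nonneg] at hy
  exact (ENNReal.ofReal_le_ofReal_iff (by positivity)).1 hy

lemma opG_eq (M : Set (E d)) (m : ℕ) (R : ℝ → ℝ) (δ : ℝ) (v : E d → ℝ) :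
    opG M m R δ v = fun x => ∫ y, (2 * v y +
      inner ℝ (x - y) (v y • curvature M m y • outwardNormal M y)) * ker m (tail R) δ x y
        ∂(bvol M m) := by
  ext x
  rw [opG]
  refine integral_congr_ae (Eventually.of_forall fun y => ?_)
  simp only [inner_smul_right, kerBar_eq]
  ring

lemma UniformBounds.contDiff_opG (h : UniformBounds M m R C δ) (hv : Integrable v (bvol M m)) :
    ContDiff ℝ 1 (opG M m R δ v) := by
  rw [opG_eq]
  exact h.profile.tail.contDiff_integral m h.pos (hv.const_mul 2) (h.integrable_smul_curvature hv)

lemma UniformBounds.enorm_two_mul_add_le (h : UniformBounds M m R C δ) {s : ℝ≥0∞} (hs : s ≤ 3) :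
    ∀ᵐ y ∂(bvol M m), ‖2 * v y‖ₑ + s * ‖v y • curvature M m y • outwardNormal M y‖ₑ ≤
      (2 + 3 * C) * ‖v y‖ₑ := by
  filter_upwards [h.enorm_smul_curvature_le (v := v)] with y hy
  have h2 : ‖(2 : ℝ)‖ₑ = 2 := by
    rw [← ofReal_norm]; norm_num
  rw [enorm_mul, h2, add_mul, mul_assoc]
  gcongr

lemma UniformBounds.enorm_opG_le (h : UniformBounds M m R C δ) (x : E d) :
    ‖opG M m R δ v x‖ₑ ≤ (2 + 3 * C) * C * ballAverage m δ (bvol M m) v x := by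
  rw [opG_eq]
  exact h.profile.tail.enorm_integral_le_ballAverage m h.pos (by finiteness)
    (h.enorm_two_mul_add_le ((h.ofReal_mul_le 2).trans (by norm_num))) x

lemma UniformBounds.enorm_fderiv_opG_le (h : UniformBounds M m R C δ)
    (hv : Integrable v (bvol M m)) (x : E d) :
    ‖fderiv ℝ (opG M m R δ v) x‖ₑ ≤
      (2 + 3 * C) * C * (ENNReal.ofReal δ)⁻¹ * ballAverage m δ (bvol M m) v x := by
  rw [opG_eq]
  exact h.profile.tail.enorm_fderiv_integral_le_ballAverage m h.pos (hv.const_mul 2)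
    (h.integrable_smul_curvature hv) (by finiteness)
    (h.enorm_two_mul_add_le (h.ofReal_mul_le 3)) x

end opG

section opP

variable {f g : E d → ℝ}

lemma UniformBounds.enorm_smul_normal (h : UniformBounds M m R C δ) :
    ∀ᵐ y ∂(bvol M m), ‖g y • outwardNormal M y‖ₑ = ‖g y‖ₑ := by
  filter_upwards [h.ae_bvol] with y hy
  rw [enorm_smul, ← ofReal_norm (outwardNormal M y), h.norm_normal y hy, ENNReal.ofReal_one, mul_one]

lemma UniformBounds.integrable_smul_normal (h : UniformBounds M m R C δ)
    (hg : Integrable g (bvol M m)) :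
    Integrable (fun y => g y • outwardNormal M y) (bvol M m) := by
  refine hg.norm.mono' (hg.1.smul h.normal_meas) ?_
  filter_upwards [h.ae_bvol] with y hy
  rw [norm_smul, h.norm_normal y hy, mul_one]

lemma opP_eq (M : Set (E d)) (m : ℕ) (R : ℝ → ℝ) (δ : ℝ) (f g : E d → ℝ) :
    opP M m R δ f g =
      (fun x => ∫ y, (f y + inner ℝ (x - y) (0 : E d)) * ker m (tail R) δ x y ∂(vol M m)) -
      fun x => ∫ y, (0 + inner ℝ (x - y) (g y • outwardNormal M y)) * ker m (tail R) δ x y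
        ∂(bvol M m) := by
  ext x
  simp only [opP, Pi.sub_apply, inner_zero_right, add_zero, zero_add, inner_smul_right, kerBar_eq]
  congr 1
  refine integral_congr_ae (Eventually.of_forall fun y => ?_)
  ring

lemma UniformBounds.contDiff_opP (h : UniformBounds M m R C δ) (hf : Integrable f (vol M m))
    (hg : Integrable g (bvol M m)) : ContDiff ℝ 1 (opP M m R δ f g) := by
  have := h.finite_vol
  have := h.finite_bvol
  rw [opP_eq]
  exact (h.profile.tail.contDiff_integral m h.pos hf (integrable_const (0 : E d))).sub
    (h.profile.tail.contDiff_integral m h.pos (integrable_const (0 : ℝ))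
      (h.integrable_smul_normal hg))

lemma UniformBounds.enorm_opP_le (h : UniformBounds M m R C δ) (x : E d) :
    ‖opP M m R δ f g x‖ₑ ≤ 1 * C * ballAverage m δ (vol M m) f x +
      ENNReal.ofReal (3 * δ) * C * ballAverage m δ (bvol M m) g x := by
  rw [opP_eq]
  refine enorm_sub_le.trans (add_le_add ?_ ?_)
  · exact h.profile.tail.enorm_integral_le_ballAverage m h.pos (by finiteness)
      (Eventually.of_forall fun y => by simp) x
  · refine h.profile.tail.enorm_integral_le_ballAverage m h.pos (by finiteness) ?_ x
    filter_upwards [h.enorm_smul_normal (g := g)] with y hy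
    rw [hy, enorm_zero, zero_add]
    exact mul_le_mul_left (ENNReal.ofReal_le_ofReal (by linarith [h.pos])) _

lemma UniformBounds.enorm_fderiv_opP_le (h : UniformBounds M m R C δ)
    (hf : Integrable f (vol M m)) (hg : Integrable g (bvol M m)) (x : E d) :
    ‖fderiv ℝ (opP M m R δ f g) x‖ₑ ≤
      1 * C * (ENNReal.ofReal δ)⁻¹ * ballAverage m δ (vol M m) f x +
      ENNReal.ofReal (3 * δ) * C * (ENNReal.ofReal δ)⁻¹ * ballAverage m δ (bvol M m) g x := by
  have := h.finite_vol
  have := h.finite_bvol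
  have c₁ := h.profile.tail.contDiff_integral m h.pos hf (integrable_const (0 : E d))
  have c₂ := h.profile.tail.contDiff_integral m h.pos (integrable_const (0 : ℝ))
      (h.integrable_smul_normal hg)
  rw [opP_eq, fderiv_sub (c₁.differentiable (by simp) x) (c₂.differentiable (by simp) x)]
  refine enorm_sub_le.trans (add_le_add ?_ ?_)
  · exact h.profile.tail.enorm_fderiv_integral_le_ballAverage m h.pos hf
      (integrable_const (0 : E d)) (by finiteness) (Eventually.of_forall fun y => by simp) x
  · refine h.profile.tail.enorm_fderiv_integral_le_ballAverage m h.pos (integrable_const (0 : ℝ))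
      (h.integrable_smul_normal hg) (by finiteness) ?_ x
    filter_upwards [h.enorm_smul_normal (g := g)] with y hy
    rw [hy, enorm_zero, zero_add]

end opP

section opQ

variable {f : E d → ℝ}

lemma UniformBounds.continuous_opQ (h : UniformBounds M m R C δ) (hf : Integrable f (vol M m)) :
    Continuous (opQ M m R δ f) := by
  have := h.finite_vol
  exact continuous_const.mul (h.profile.tail.tail.contDiff_integral_mul_ker m h.pos hf).continuous

lemma UniformBounds.enorm_opQ_le (h : UniformBounds M m R C δ) (x : E d) :
    ‖opQ M m R δ f x‖ₑ ≤ 2 * ENNReal.ofReal δ ^ 2 * C * ballAverage m δ (vol M m) f x := by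
  have h1 := h.profile.tail.tail.enorm_integral_le_ballAverage m h.pos (ν := vol M m) (α := f)
    (g := f) (β := fun _ => 0) (A := 1) (by simp) (Eventually.of_forall fun y => by simp) x
  simp only [inner_zero_right, add_zero, one_mul] at h1
  have h2 : ‖-2 * δ ^ 2‖ₑ = 2 * ENNReal.ofReal δ ^ 2 := by
    rw [neg_mul, enorm_neg, ← ofReal_norm, Real.norm_of_nonneg (by positivity),
      ENNReal.ofReal_mul (by norm_num), ENNReal.ofReal_pow h.pos.le, ENNReal.ofReal_ofNat]
  rw [opQ, enorm_mul, h2, mul_assoc _ (C : ℝ≥0∞)]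
  exact mul_le_mul_right h1 _

end opQ

section opD

variable {u : E d → ℝ}

/-- In `𝒟_δ` the curvature and the normal sit at the outer variable, where only measurability is
assumed. Joint measurability then replaces differentiation under the integral. -/
lemma UniformBounds.aestronglyMeasurable_coeff (h : UniformBounds M m R C δ) :
    AEStronglyMeasurable (fun p : E d × E d =>
      (2 - inner ℝ (p.1 - p.2) (curvature M m p.1 • outwardNormal M p.1)) *
        kerBar m R δ p.1 p.2) ((bvol M m).prod (vol M m)) := by
  have := h.finite_vol
  have := h.finite_bvol
  have h1 : AEStronglyMeasurable (fun p : E d × E d => p.1 - p.2) ((bvol M m).prod (vol M m)) :=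
    (by fun_prop : Continuous fun p : E d × E d => p.1 - p.2).aestronglyMeasurable
  have h2 : AEStronglyMeasurable (fun p : E d × E d => curvature M m p.1 • outwardNormal M p.1)
      ((bvol M m).prod (vol M m)) := (h.curvature_meas.smul h.normal_meas).comp_fst
  exact (aestronglyMeasurable_const.sub (h1.inner (𝕜 := ℝ) h2)).mul
    (continuous_ker h.profile.tail.continuousOn m δ).aestronglyMeasurable

lemma UniformBounds.aestronglyMeasurable_opD (h : UniformBounds M m R C δ)
    (hu : AEStronglyMeasurable u (vol M m)) :
    AEStronglyMeasurable (opD M m R δ u) (bvol M m) := by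
  have := h.finite_vol
  have := h.finite_bvol
  have h1 := (hu.comp_snd (μ := bvol M m)).mul h.aestronglyMeasurable_coeff
  refine h1.integral_prod_right'.congr (Eventually.of_forall fun x => ?_)
  simp only [opD, Pi.mul_apply, mul_assoc]

lemma UniformBounds.aestronglyMeasurable_tildeR (h : UniformBounds M m R C δ) :
    AEStronglyMeasurable (tildeR M m R δ) (bvol M m) := by
  have := h.finite_vol
  have := h.finite_bvol
  have h1 : AEStronglyMeasurable (fun p : E d × E d => p.1 - p.2) ((bvol M m).prod (vol M m)) :=
    (by fun_prop : Continuous fun p : E d × E d => p.1 - p.2).aestronglyMeasurable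
  have h2 := ((h.curvature_meas.comp_fst (ν := vol M m)).mul
    ((h1.inner (𝕜 := ℝ) (h.normal_meas.comp_fst (ν := vol M m))).pow 2)).mul
      (continuous_ker h.profile.tail.continuousOn m δ).aestronglyMeasurable
  have h3 : Continuous fun x => ∫ y, (1 : ℝ) * ker m (tail (tail R)) δ x y ∂(bvol M m) :=
    (h.profile.tail.tail.contDiff_integral_mul_ker m h.pos (integrable_const (1 : ℝ))).continuous
  simp only [one_mul] at h3
  exact ((h3.const_mul (4 * δ ^ 2)).aestronglyMeasurable).sub h2.integral_prod_right'

lemma UniformBounds.enorm_opD_le (h : UniformBounds M m R C δ) {x : E d} (hx : x ∈ bdry M m) :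
    ‖opD M m R δ u x‖ₑ ≤ 3 * C * ballAverage m δ (vol M m) u x := by
  rw [opD, ballAverage, ← mul_assoc, ← lintegral_const_mul' _ _ (by finiteness)]
  refine (enorm_integral_le_lintegral_enorm _).trans (lintegral_mono fun y => ?_)
  have h4 := h.enorm_coeff_mul_kerBar_le (x := x) (y := y) hx (s := -1) (by simp)
  rw [neg_one_mul, ← sub_eq_add_neg] at h4
  rw [mul_assoc (u y), enorm_mul]
  calc _ ≤ ‖u y‖ₑ * _ := mul_le_mul_right h4 _
    _ = _ := by ring

end opD

end Operators

/-! ### Operators on `L²` from operators on functions -/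

section LpOperator

variable {X Y : Type*} [MeasurableSpace X] [MeasurableSpace Y]

lemma norm_sq_le_of_lintegral_le {F G : Type*} [NormedAddCommGroup F] [NormedAddCommGroup G]
    {ν : Measure X} {σ : Measure Y} {f : Lp F 2 ν} {g : Lp G 2 σ} {K : ℝ} (hK : 0 ≤ K)
    (h : ∫⁻ x, ‖f x‖ₑ ^ 2 ∂ν ≤ ENNReal.ofReal K * ∫⁻ y, ‖g y‖ₑ ^ 2 ∂σ) :
    ‖f‖ ^ 2 ≤ K * ‖g‖ ^ 2 := by
  rw [← ofReal_norm_sq, ← ofReal_norm_sq, ← ENNReal.ofReal_mul hK] at h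
  exact (ENNReal.ofReal_le_ofReal_iff (by positivity)).1 h

lemma memLp_two_of_lintegral_lt_top {ν : Measure X} {f : X → ℝ} (hf : AEStronglyMeasurable f ν)
    (h : ∫⁻ x, ‖f x‖ₑ ^ 2 ∂ν < ⊤) : MemLp f 2 ν := by
  refine ⟨hf, ?_⟩
  have h1 := eLpNorm_nnreal_pow_eq_lintegral (μ := ν) (f := f) (p := 2) (by norm_num)
  have h2 : eLpNorm f 2 ν ^ 2 = ∫⁻ x, ‖f x‖ₑ ^ 2 ∂ν := by simpa using h1
  rw [← h2] at h
  by_contra hc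
  rw [not_lt, top_le_iff] at hc
  rw [hc] at h
  simp at h

lemma lintegral_sq_lt_top {ν : Measure X} {F : Type*} [NormedAddCommGroup F] (f : Lp F 2 ν) :
    ∫⁻ x, ‖f x‖ₑ ^ 2 ∂ν < ⊤ := by
  rw [← ofReal_norm_sq]; exact ENNReal.ofReal_lt_top

/-- An operator on functions that respects almost everywhere equality and is linear and bounded
in `L²` defines a bounded operator between the `L²` spaces. -/
lemma exists_clm {ν : Measure X} {σ : Measure Y} (T : (X → ℝ) → Y → ℝ)
    (hmeas : ∀ u : Lp ℝ 2 ν, AEStronglyMeasurable (T u) σ)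
    (hadd : ∀ u v : Lp ℝ 2 ν, T (u + v : Lp ℝ 2 ν) =ᵐ[σ] T u + T v)
    (hsmul : ∀ (c : ℝ) (u : Lp ℝ 2 ν), T (c • u : Lp ℝ 2 ν) =ᵐ[σ] c • T u) {K : ℝ} (hK : 0 ≤ K)
    (hbound : ∀ u : Lp ℝ 2 ν, ∫⁻ y, ‖T u y‖ₑ ^ 2 ∂σ ≤ ENNReal.ofReal K * ∫⁻ x, ‖u x‖ₑ ^ 2 ∂ν) :
    ∃ A : Lp ℝ 2 ν →L[ℝ] Lp ℝ 2 σ, ∀ u, A u =ᵐ[σ] T u := by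
  have hmem : ∀ u : Lp ℝ 2 ν, MemLp (T u) 2 σ := fun u =>
    memLp_two_of_lintegral_lt_top (hmeas u) ((hbound u).trans_lt
      (ENNReal.mul_lt_top ENNReal.ofReal_lt_top (lintegral_sq_lt_top u)))
  let A₀ : Lp ℝ 2 ν →ₗ[ℝ] Lp ℝ 2 σ :=
    { toFun := fun u => (hmem u).toLp (T u)
      map_add' := fun u v => by
        rw [← MemLp.toLp_add, MemLp.toLp_eq_toLp_iff]
        exact hadd u v
      map_smul' := fun c u => by
        rw [RingHom.id_apply, ← MemLp.toLp_const_smul, MemLp.toLp_eq_toLp_iff]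
        exact hsmul c u }
  refine ⟨A₀.mkContinuous (√K) fun u => ?_, fun u => (hmem u).coeFn_toLp⟩
  have h1 : ‖A₀ u‖ ^ 2 ≤ K * ‖u‖ ^ 2 := by
    refine norm_sq_le_of_lintegral_le hK ((le_of_eq ?_).trans (hbound u))
    exact lintegral_congr_ae ((hmem u).coeFn_toLp.mono fun y hy => by
      show ‖((hmem u).toLp (T u)) y‖ₑ ^ 2 = _
      rw [hy])
  refine le_of_sq_le_sq ?_ (by positivity)
  rwa [mul_pow, Real.sq_sqrt hK]

lemma inner_eq_integral {ν : Measure X} {f g : Lp ℝ 2 ν} {φ ψ : X → ℝ} (hf : f =ᵐ[ν] φ)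
    (hg : g =ᵐ[ν] ψ) : inner ℝ f g = ∫ x, φ x * ψ x ∂ν := by
  rw [L2.inner_def]
  refine integral_congr_ae ?_
  filter_upwards [hf, hg] with x h1 h2
  rw [h1, h2]
  simp [mul_comm]

lemma integrable_Lp_two {ν : Measure X} [IsFiniteMeasure ν] (f : Lp ℝ 2 ν) : Integrable f ν :=
  (Lp.memLp f).integrable (by norm_num)

end LpOperator

/-! ### The bounded operators of the system -/

section SystemOperators

variable {d m : ℕ} {M : Set (E d)} {R : ℝ → ℝ} {C : ℝ≥0} {δ : ℝ}

lemma UniformBounds.lintegral_opD_le (h : UniformBounds M m R C δ) {u : E d → ℝ}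
    (hu : AEStronglyMeasurable u (vol M m)) :
    ∫⁻ x, ‖opD M m R δ u x‖ₑ ^ 2 ∂(bvol M m) ≤
      9 * C ^ 4 * (ENNReal.ofReal δ)⁻¹ * ∫⁻ x, ‖u x‖ₑ ^ 2 ∂(vol M m) := by
  have := h.finite_vol
  calc _ ≤ ∫⁻ x, (3 * C) ^ 2 * ballAverage m δ (vol M m) u x ^ 2 ∂(bvol M m) := by
        refine lintegral_mono_ae (h.ae_bvol.mono fun x hx => ?_)
        rw [← mul_pow]
        exact pow_le_pow_left' (h.enorm_opD_le hx) 2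
    _ = (3 * C) ^ 2 * ∫⁻ x, ballAverage m δ (vol M m) u x ^ 2 ∂(bvol M m) :=
        lintegral_const_mul' _ _ (by finiteness)
    _ ≤ (3 * C) ^ 2 * (C ^ 2 * (ENNReal.ofReal δ)⁻¹ * ∫⁻ x, ‖u x‖ₑ ^ 2 ∂(vol M m)) :=
        mul_le_mul_right (h.schur_vol_bvol hu) _
    _ = _ := by ring

lemma opD_congr {u v : E d → ℝ} (huv : u =ᵐ[vol M m] v) : opD M m R δ u = opD M m R δ v := by
  ext x
  exact integral_congr_ae (huv.mono fun y hy => by simp only [hy])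

lemma UniformBounds.exists_clm_opD (h : UniformBounds M m R C δ) :
    ∃ A : L2 M m →L[ℝ] L2Bdry M m, ∀ u, A u =ᵐ[bvol M m] opD M m R δ u := by
  have := h.finite_vol
  have := h.finite_bvol
  refine exists_clm (opD M m R δ) (fun u => h.aestronglyMeasurable_opD (Lp.aestronglyMeasurable u))
    (fun u v => ?_) (fun c u => ?_) (K := 9 * C ^ 4 * δ⁻¹)
    (mul_nonneg (by positivity) (inv_nonneg.2 h.pos.le)) (fun u => ?_)
  · rw [opD_congr (Lp.coeFn_add u v)]
    refine Eventually.of_forall fun x => ?_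
    rw [Pi.add_apply, opD, opD, opD, ← integral_add
      (h.integrable_mul_coeff (integrable_Lp_two u) x _)
      (h.integrable_mul_coeff (integrable_Lp_two v) x _)]
    refine integral_congr_ae (Eventually.of_forall fun y => ?_)
    simp only [Pi.add_apply]
    ring
  · rw [opD_congr (Lp.coeFn_smul c u)]
    refine Eventually.of_forall fun x => ?_
    rw [Pi.smul_apply, opD, opD, smul_eq_mul, ← integral_const_mul]
    refine integral_congr_ae (Eventually.of_forall fun y => ?_)
    simp only [Pi.smul_apply, smul_eq_mul]
    ring
  · refine (h.lintegral_opD_le (Lp.aestronglyMeasurable u)).trans_eq ?_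
    rw [ENNReal.ofReal_mul (by positivity), ENNReal.ofReal_inv_of_pos h.pos,
      ENNReal.ofReal_mul (by norm_num), ENNReal.ofReal_pow C.coe_nonneg, ENNReal.ofReal_coe_nnreal,
      ENNReal.ofReal_ofNat]

/-- Multiplication by the mass minus the kernel average. This form yields boundedness and, later,
lets the equation be solved for `u x`. -/
lemma UniformBounds.opL_eq (h : UniformBounds M m R C δ) {u : E d → ℝ}
    (hu : Integrable u (vol M m)) (x : E d) :
    opL M m R δ u x = 1 / δ ^ 2 * (u x * mass M m R δ x - kerAverage M m R δ u x) := by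
  have h1 := h.kerAverage_sub hu (u x) x
  rw [opL]
  congr 1
  rw [← neg_sub, ← h1, ← integral_neg]
  refine integral_congr_ae (Eventually.of_forall fun y => ?_)
  simp only
  ring

lemma UniformBounds.enorm_kerAverage_le (h : UniformBounds M m R C δ) {u : E d → ℝ} (x : E d) :
    ‖kerAverage M m R δ u x‖ₑ ≤ C * ballAverage m δ (vol M m) u x := by
  have h1 := h.profile.enorm_integral_le_ballAverage m h.pos (ν := vol M m) (α := u)
    (g := u) (β := fun _ => 0) (A := 1) (by simp) (Eventually.of_forall fun y => by simp) x
  simp only [inner_zero_right, add_zero, one_mul] at h1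
  exact h1

lemma UniformBounds.enorm_mass_le (h : UniformBounds M m R C δ) (x : E d) :
    ‖mass M m R δ x‖ₑ ≤ C ^ 2 := by
  refine (enorm_integral_le_lintegral_enorm _).trans ((le_of_eq ?_).trans (h.lintegral_ker_le x))
  refine lintegral_congr fun y => ?_
  rw [← ofReal_norm, Real.norm_of_nonneg (ker_nonneg h.profile.nonneg m δ x y)]

lemma UniformBounds.lintegral_opL_le (h : UniformBounds M m R C δ) {u : E d → ℝ}
    (hu : Integrable u (vol M m)) :
    ∫⁻ x, ‖opL M m R δ u x‖ₑ ^ 2 ∂(vol M m) ≤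
      ENNReal.ofReal ((1 / δ ^ 2) ^ 2 * (4 * C ^ 4)) * ∫⁻ x, ‖u x‖ₑ ^ 2 ∂(vol M m) := by
  have := h.finite_vol
  have hc : ENNReal.ofReal ((1 / δ ^ 2) ^ 2 * (4 * C ^ 4)) =
      ‖1 / δ ^ 2‖ₑ ^ 2 * (4 * C ^ 4) := by
    rw [ENNReal.ofReal_mul (by positivity), ENNReal.ofReal_pow (by positivity), ← ofReal_norm,
      Real.norm_of_nonneg (by positivity), ENNReal.ofReal_mul (by norm_num),
      ENNReal.ofReal_pow C.coe_nonneg, ENNReal.ofReal_coe_nnreal, ENNReal.ofReal_ofNat]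
  have hum : AEMeasurable (fun x => ‖u x‖ₑ ^ 2) (vol M m) := hu.1.enorm.pow_const 2
  calc _ ≤ ∫⁻ x, ‖1 / δ ^ 2‖ₑ ^ 2 * (2 * C ^ 4 * ‖u x‖ₑ ^ 2 +
          2 * C ^ 2 * ballAverage m δ (vol M m) u x ^ 2) ∂(vol M m) := by
        refine lintegral_mono fun x => ?_
        rw [h.opL_eq hu, enorm_mul, mul_pow, sub_eq_add_neg]
        refine mul_le_mul_right ((enorm_add_sq_le _ _).trans ?_) _
        rw [enorm_neg, enorm_mul, mul_assoc, mul_assoc]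
        have h1 := h.enorm_mass_le x
        have h2 := h.enorm_kerAverage_le (u := u) x
        gcongr
        · calc _ ≤ (‖u x‖ₑ * C ^ 2) ^ 2 := by gcongr
            _ = _ := by ring
        · rw [← mul_pow]; gcongr
    _ = ‖1 / δ ^ 2‖ₑ ^ 2 * (2 * C ^ 4 * ∫⁻ x, ‖u x‖ₑ ^ 2 ∂(vol M m) +
          2 * C ^ 2 * ∫⁻ x, ballAverage m δ (vol M m) u x ^ 2 ∂(vol M m)) := by
        rw [lintegral_const_mul' _ _ (by finiteness), lintegral_add_left' (hum.const_mul _),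
          lintegral_const_mul' _ _ (by finiteness), lintegral_const_mul' _ _ (by finiteness)]
    _ ≤ ‖1 / δ ^ 2‖ₑ ^ 2 * (2 * C ^ 4 * ∫⁻ x, ‖u x‖ₑ ^ 2 ∂(vol M m) +
          2 * C ^ 2 * (C ^ 2 * ∫⁻ x, ‖u x‖ₑ ^ 2 ∂(vol M m))) := by
        gcongr
        exact h.schur_vol_vol hu.1
    _ = _ := by rw [hc]; ring

lemma UniformBounds.exists_clm_opL (h : UniformBounds M m R C δ) :
    ∃ A : L2 M m →L[ℝ] L2 M m, ∀ u, A u =ᵐ[vol M m] opL M m R δ u := by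
  have := h.finite_vol
  have hcongr : ∀ {u v : E d → ℝ}, u =ᵐ[vol M m] v → opL M m R δ u =ᵐ[vol M m] opL M m R δ v := by
    intro u v huv
    filter_upwards [huv] with x hx
    rw [opL, opL]
    congr 1
    exact integral_congr_ae (huv.mono fun y hy => by simp only [hy, hx])
  have hInt : ∀ u : L2 M m, Integrable u (vol M m) := fun u => integrable_Lp_two u
  refine exists_clm (opL M m R δ) (fun u => ?_)
    (fun u v => (hcongr (Lp.coeFn_add u v)).trans (Eventually.of_forall fun x => ?_))
    (fun c u => (hcongr (Lp.coeFn_smul c u)).trans (Eventually.of_forall fun x => ?_))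
    (K := (1 / δ ^ 2) ^ 2 * (4 * C ^ 4)) (by positivity) (fun u => h.lintegral_opL_le (hInt u))
  · have e : opL M m R δ u = fun x => 1 / δ ^ 2 *
        (u x * mass M m R δ x - kerAverage M m R δ u x) := funext fun x => h.opL_eq (hInt u) x
    rw [e]
    exact (((Lp.aestronglyMeasurable u).mul
      h.contDiff_mass.continuous.aestronglyMeasurable).sub
        (h.contDiff_kerAverage (hInt u)).continuous.aestronglyMeasurable).const_mul _
  · have h1 : kerAverage M m R δ (u + v) x = kerAverage M m R δ u x + kerAverage M m R δ v x := by
      simp only [kerAverage, Pi.add_apply, add_mul]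
      exact integral_add (h.profile.integrable_mul_ker m h.pos (hInt u) x)
        (h.profile.integrable_mul_ker m h.pos (hInt v) x)
    rw [Pi.add_apply, h.opL_eq (hInt u), h.opL_eq (hInt v), h.opL_eq ((hInt u).add (hInt v)), h1,
      Pi.add_apply]
    ring
  · have h1 : kerAverage M m R δ (c • u) x = c * kerAverage M m R δ u x := by
      simp only [kerAverage, Pi.smul_apply, smul_eq_mul, mul_assoc]
      exact integral_const_mul _ _
    rw [Pi.smul_apply, h.opL_eq (hInt u), h.opL_eq ((hInt u).smul c), h1, Pi.smul_apply,
      smul_eq_mul, smul_eq_mul]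
    ring

/-- Multiplication by a bounded function, as an operator on `L²`. -/
lemma exists_clm_mul {ν : Measure (E d)} {a : E d → ℝ} (ha : AEStronglyMeasurable a ν) {B : ℝ}
    (hB : 0 ≤ B) (hab : ∀ᵐ x ∂ν, |a x| ≤ B) :
    ∃ A : Lp ℝ 2 ν →L[ℝ] Lp ℝ 2 ν, ∀ u, A u =ᵐ[ν] fun x => a x * u x := by
  refine exists_clm (fun u x => a x * u x) (fun u => ha.mul (Lp.aestronglyMeasurable u))
    (fun u v => ?_) (fun c u => ?_) (K := B ^ 2) (by positivity) (fun u => ?_)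
  · filter_upwards [Lp.coeFn_add u v] with x hx
    simp only [hx, Pi.add_apply]; ring
  · filter_upwards [Lp.coeFn_smul c u] with x hx
    simp only [hx, Pi.smul_apply, smul_eq_mul]; ring
  · rw [← lintegral_const_mul' _ _ ENNReal.ofReal_ne_top]
    refine lintegral_mono_ae (hab.mono fun x hx => ?_)
    rw [enorm_mul, mul_pow, ENNReal.ofReal_pow hB, ← ofReal_norm (a x)]
    gcongr
    exact hx

/-- Justifies Fubini in the adjointness of the boundary operators: the coefficient is bounded for
fixed `δ`. -/
lemma UniformBounds.integrable_prod (h : UniformBounds M m R C δ) {v w : E d → ℝ}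
    (hv : Integrable v (bvol M m)) (hw : Integrable w (vol M m)) :
    Integrable (fun p : E d × E d => v p.1 * (w p.2 *
      (2 - inner ℝ (p.1 - p.2) (curvature M m p.1 • outwardNormal M p.1)) *
        kerBar m R δ p.1 p.2)) ((bvol M m).prod (vol M m)) := by
  have := h.finite_vol
  have := h.finite_bvol
  have hvw := hv.mul_prod hw
  refine (hvw.norm.const_mul (3 * C * normConst m δ)).mono' ?_ ?_
  · refine (hvw.1.mul h.aestronglyMeasurable_coeff).congr (Eventually.of_forall fun p => ?_)
    simp only [Pi.mul_apply]; ring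
  · have hae : ∀ᵐ p ∂((bvol M m).prod (vol M m)), p.1 ∈ bdry M m :=
      Measure.quasiMeasurePreserving_fst.ae h.ae_bvol
    filter_upwards [hae] with p hp
    have h4 := h.enorm_coeff_mul_kerBar_le (x := p.1) (y := p.2) hp (s := -1) (by simp)
    rw [neg_one_mul, ← sub_eq_add_neg] at h4
    have h5 : ‖(2 - inner ℝ (p.1 - p.2) (curvature M m p.1 • outwardNormal M p.1)) *
        kerBar m R δ p.1 p.2‖ ≤ 3 * C * normConst m δ := by
      have hN := normConst_nonneg m δ
      have hC := C.coe_nonneg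
      rw [← ENNReal.ofReal_le_ofReal_iff (by positivity), ofReal_norm,
        ENNReal.ofReal_mul (by positivity), ENNReal.ofReal_mul (by norm_num),
        ENNReal.ofReal_coe_nnreal, ENNReal.ofReal_ofNat]
      exact h4.trans (mul_le_mul_right (mul_le_of_le_one_right zero_le (near_le_one _ _ _)) _)
    rw [mul_assoc (w p.2), ← mul_assoc, norm_mul, mul_comm]
    exact mul_le_mul_of_nonneg_right h5 (norm_nonneg _)

/-- The boundary operators `𝒢_δ` and `𝒟_δ` are adjoint to each other. -/
lemma UniformBounds.integral_opG_mul (h : UniformBounds M m R C δ) {v w : E d → ℝ}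
    (hv : Integrable v (bvol M m)) (hw : Integrable w (vol M m)) :
    ∫ x, opG M m R δ v x * w x ∂(vol M m) = ∫ y, v y * opD M m R δ w y ∂(bvol M m) := by
  have := h.finite_vol
  have := h.finite_bvol
  have h1 := integral_integral_swap (f := fun y x => v y * (w x *
    (2 - inner ℝ (y - x) (curvature M m y • outwardNormal M y)) * kerBar m R δ y x))
    (h.integrable_prod hv hw)
  simp only [opD, ← integral_const_mul]
  rw [h1]
  refine integral_congr_ae (Eventually.of_forall fun x => ?_)
  simp only [opG]
  rw [← integral_mul_const]
  refine integral_congr_ae (Eventually.of_forall fun y => ?_)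
  simp only [kerBar_eq]
  -- The kernel is symmetric and `(y - x) · n` changes sign, which turns the minus in `𝒟_δ` into the
  -- plus in `𝒢_δ`.
  rw [ker_comm m (tail R) δ y x, ← neg_sub x y, inner_neg_left]
  ring

lemma UniformBounds.memLp_opG (h : UniformBounds M m R C δ) {v : E d → ℝ}
    (hv : Integrable v (bvol M m)) : MemLp (opG M m R δ v) 2 (vol M m) := by
  have := h.finite_vol
  have hc := (h.contDiff_opG hv).continuous
  exact memLp_of_continuousOn h.isCompact hc.continuousOn hc.aestronglyMeasurable h.ae_vol

lemma UniformBounds.adjoint_eq_opG (h : UniformBounds M m R C δ) {A : L2 M m →L[ℝ] L2Bdry M m}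
    (hA : ∀ u, A u =ᵐ[bvol M m] opD M m R δ u) (v : L2Bdry M m) :
    ContinuousLinearMap.adjoint A v =ᵐ[vol M m] opG M m R δ v := by
  have := h.finite_vol
  have := h.finite_bvol
  have hv := integrable_Lp_two v
  have h1 : ContinuousLinearMap.adjoint A v = (h.memLp_opG hv).toLp _ := by
    refine ext_inner_right ℝ fun w => ?_
    rw [ContinuousLinearMap.adjoint_inner_left, inner_eq_integral (EventuallyEq.refl _ v) (hA w),
      inner_eq_integral (h.memLp_opG hv).coeFn_toLp (EventuallyEq.refl _ w),
      h.integral_opG_mul hv (integrable_Lp_two w)]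
  rw [h1]
  exact (h.memLp_opG hv).coeFn_toLp

end SystemOperators

/-! ### The quadratic forms of the system -/

section Energy

variable {d m : ℕ} {M : Set (E d)} {R : ℝ → ℝ} {C : ℝ≥0} {δ : ℝ}

lemma UniformBounds.integrable_energy (h : UniformBounds M m R C δ) {u : E d → ℝ}
    (hu : MemLp u 2 (vol M m)) : Integrable (fun p : E d × E d =>
      u p.1 * ((u p.1 - u p.2) * ker m R δ p.1 p.2)) ((vol M m).prod (vol M m)) := by
  have := h.finite_vol
  have hsq : Integrable (fun x => u x ^ 2) (vol M m) := hu.integrable_sq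
  have h1 : Integrable (fun p : E d × E d => u p.1 ^ 2) ((vol M m).prod (vol M m)) :=
    hsq.comp_fst _
  have hu1 : Integrable u (vol M m) := hu.integrable (by norm_num)
  have h2 : Integrable (fun p : E d × E d => u p.1 * u p.2) ((vol M m).prod (vol M m)) :=
    hu1.mul_prod hu1
  have h3 : Integrable (fun p : E d × E d => u p.1 ^ 2 - u p.1 * u p.2)
      ((vol M m).prod (vol M m)) := h1.sub h2
  refine (h3.mul_bdd (c := normConst m δ * C)
    (continuous_ker h.profile.continuousOn m δ).aestronglyMeasurable
    (Eventually.of_forall fun p => abs_ker_le h.profile.abs_le m δ p.1 p.2)).congr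
    (Eventually.of_forall fun p => ?_)
  simp only
  ring

/-- Adding the same double integral with `x` and `y` exchanged completes the square, since the
kernel is symmetric. -/
lemma UniformBounds.integral_mul_opL (h : UniformBounds M m R C δ) {u : E d → ℝ}
    (hu : MemLp u 2 (vol M m)) :
    2 * δ ^ 2 * ∫ x, u x * opL M m R δ u x ∂(vol M m) =
      ∫ p : E d × E d, (u p.2 - u p.1) ^ 2 * ker m R δ p.1 p.2 ∂((vol M m).prod (vol M m)) := by
  have := h.finite_vol
  have hδ := h.pos.ne'
  have hI := h.integrable_energy hu
  have hI' : Integrable (fun p : E d × E d => u p.2 * ((u p.2 - u p.1) * ker m R δ p.2 p.1))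
      ((vol M m).prod (vol M m)) := hI.swap
  have h1 : δ ^ 2 * ∫ x, u x * opL M m R δ u x ∂(vol M m) =
      ∫ p : E d × E d, u p.1 * ((u p.1 - u p.2) * ker m R δ p.1 p.2)
        ∂((vol M m).prod (vol M m)) := by
    rw [integral_prod _ hI, ← integral_const_mul]
    refine integral_congr_ae (Eventually.of_forall fun x => ?_)
    simp only [opL]
    rw [integral_const_mul]
    field_simp
  have h2 : ∫ p : E d × E d, u p.1 * ((u p.1 - u p.2) * ker m R δ p.1 p.2)
      ∂((vol M m).prod (vol M m)) = ∫ p : E d × E d,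
        u p.2 * ((u p.2 - u p.1) * ker m R δ p.2 p.1) ∂((vol M m).prod (vol M m)) :=
    (integral_prod_swap (fun p : E d × E d => u p.1 * ((u p.1 - u p.2) * ker m R δ p.1 p.2))).symm
  have h3 : 2 * δ ^ 2 * ∫ x, u x * opL M m R δ u x ∂(vol M m) =
      (∫ p : E d × E d, u p.1 * ((u p.1 - u p.2) * ker m R δ p.1 p.2)
        ∂((vol M m).prod (vol M m))) + ∫ p : E d × E d,
        u p.2 * ((u p.2 - u p.1) * ker m R δ p.2 p.1) ∂((vol M m).prod (vol M m)) := by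
    rw [← h2, ← h1]; ring
  rw [h3, ← integral_add hI hI']
  refine integral_congr_ae (Eventually.of_forall fun p => ?_)
  simp only
  rw [ker_comm m R δ p.2 p.1]
  ring

lemma UniformBounds.energy_eq (h : UniformBounds M m R C δ) {u : E d → ℝ} (hum : Measurable u)
    (hu : MemLp u 2 (vol M m)) :
    energy M m R δ u =
      ENNReal.ofReal (2 * δ ^ 2 * ∫ x, u x * opL M m R δ u x ∂(vol M m)) := by
  have := h.finite_vol
  have hI := h.integrable_energy hu
  have hI' := hI.swap
  have hInt : Integrable (fun p : E d × E d => (u p.2 - u p.1) ^ 2 * ker m R δ p.1 p.2)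
      ((vol M m).prod (vol M m)) := by
    refine (hI.add hI').congr (Eventually.of_forall fun p => ?_)
    simp only [Pi.add_apply, Function.comp_apply, Prod.fst_swap, Prod.snd_swap]
    rw [ker_comm m R δ p.2 p.1]
    ring
  have hmeas : Measurable fun p : E d × E d =>
      ENNReal.ofReal (ker m R δ p.1 p.2) * ‖u p.2 - u p.1‖ₑ ^ 2 :=
    (continuous_ker h.profile.continuousOn m δ).measurable.ennreal_ofReal.mul
      (((hum.comp measurable_snd).sub (hum.comp measurable_fst)).enorm.pow_const 2)
  rw [h.integral_mul_opL hu, ofReal_integral_eq_lintegral_ofReal hInt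
    (Eventually.of_forall fun p => mul_nonneg (sq_nonneg _) (ker_nonneg h.profile.nonneg m δ _ _))]
  have e : ∀ p : E d × E d, ENNReal.ofReal ((u p.2 - u p.1) ^ 2 * ker m R δ p.1 p.2) =
      ENNReal.ofReal (ker m R δ p.1 p.2) * ‖u p.2 - u p.1‖ₑ ^ 2 := fun p => by
    rw [ENNReal.ofReal_mul (sq_nonneg _), ← sq_abs, ENNReal.ofReal_pow (abs_nonneg _),
      ← Real.norm_eq_abs, ofReal_norm, mul_comm]
  simp_rw [e]
  rw [lintegral_prod _ hmeas.aemeasurable]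
  rfl

/-- The bounded operators attached to the nonlocal system at scale `δ`: the interior operator `L`,
the boundary operator `D`, and the multiplications `r` by `R̃_δ` and `s` by its inverse. -/
structure SystemOperators (M : Set (E d)) (m : ℕ) (R : ℝ → ℝ) (δ : ℝ) where
  L : L2 M m →L[ℝ] L2 M m
  D : L2 M m →L[ℝ] L2Bdry M m
  r : L2Bdry M m →L[ℝ] L2Bdry M m
  s : L2Bdry M m →L[ℝ] L2Bdry M m
  L_eq : ∀ u, L u =ᵐ[vol M m] opL M m R δ u
  D_eq : ∀ u, D u =ᵐ[bvol M m] opD M m R δ u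
  r_eq : ∀ v, r v =ᵐ[bvol M m] fun x => tildeR M m R δ x * v x
  s_eq : ∀ v, s v =ᵐ[bvol M m] fun x => (tildeR M m R δ x)⁻¹ * v x

lemma UniformBounds.tildeR_pos (h : UniformBounds M m R C δ) {x : E d} (hx : x ∈ bdry M m) :
    0 < tildeR M m R δ x := by
  have h1 := h.pos.trans_le (h.tildeR_ge x hx)
  exact pos_of_mul_pos_right h1 C.coe_nonneg

lemma UniformBounds.inv_tildeR_le (h : UniformBounds M m R C δ) {x : E d} (hx : x ∈ bdry M m) :
    (tildeR M m R δ x)⁻¹ ≤ C / δ := by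
  rw [inv_le_iff_one_le_mul₀ (h.tildeR_pos hx), div_mul_eq_mul_div, one_le_div h.pos]
  exact h.tildeR_ge x hx

lemma UniformBounds.nonempty_systemOperators (h : UniformBounds M m R C δ) :
    Nonempty (SystemOperators M m R δ) := by
  obtain ⟨L, hL⟩ := h.exists_clm_opL
  obtain ⟨D, hD⟩ := h.exists_clm_opD
  have hδ := h.pos
  obtain ⟨r, hr⟩ := exists_clm_mul h.aestronglyMeasurable_tildeR (B := C * δ) (by positivity)
    (h.ae_bvol.mono fun x hx => by
      rw [abs_of_pos (h.tildeR_pos hx)]; exact h.tildeR_le x hx)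
  obtain ⟨s, hs⟩ := exists_clm_mul h.aestronglyMeasurable_tildeR.aemeasurable.inv.aestronglyMeasurable
    (B := C / δ) (by positivity) (h.ae_bvol.mono fun x hx => by
      rw [Pi.inv_apply, abs_of_pos (inv_pos.2 (h.tildeR_pos hx))]
      exact h.inv_tildeR_le hx)
  exact ⟨⟨L, D, r, s, hL, hD, hr, hs⟩⟩

variable (S : SystemOperators M m R δ)

lemma UniformBounds.r_s (h : UniformBounds M m R C δ) (v : L2Bdry M m) : S.r (S.s v) = v := by
  refine Lp.ext ?_
  filter_upwards [S.r_eq (S.s v), S.s_eq v, h.ae_bvol] with x h1 h2 hx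
  rw [h1, h2, mul_inv_cancel_left₀ (h.tildeR_pos hx).ne']

lemma UniformBounds.mul_norm_sq_le_inner_r (h : UniformBounds M m R C δ) (v : L2Bdry M m) :
    δ * ‖v‖ ^ 2 ≤ C * inner ℝ (S.r v) v ∧ 0 ≤ inner ℝ (S.r v) v := by
  have hv : Integrable (fun x => v x ^ 2) (bvol M m) := (Lp.memLp v).integrable_sq
  have hnorm : ‖v‖ ^ 2 = ∫ x, v x ^ 2 ∂(bvol M m) := by
    rw [← real_inner_self_eq_norm_sq, inner_eq_integral (EventuallyEq.refl _ v)
      (EventuallyEq.refl _ v)]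
    simp_rw [sq]
  have hin : inner ℝ (S.r v) v = ∫ x, tildeR M m R δ x * v x ^ 2 ∂(bvol M m) := by
    rw [inner_eq_integral (S.r_eq v) (EventuallyEq.refl _ v)]
    refine integral_congr_ae (Eventually.of_forall fun x => ?_)
    simp only
    ring
  have hInt : Integrable (fun x => tildeR M m R δ x * v x ^ 2) (bvol M m) :=
    hv.bdd_mul (c := C * δ) h.aestronglyMeasurable_tildeR (h.ae_bvol.mono fun x hx => by
      rw [Real.norm_of_nonneg (h.tildeR_pos hx).le]; exact h.tildeR_le x hx)
  refine ⟨?_, ?_⟩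
  · rw [hnorm, hin, ← integral_const_mul, ← integral_const_mul]
    refine integral_mono_ae (hv.const_mul δ) (hInt.const_mul C) (h.ae_bvol.mono fun x hx => ?_)
    have := mul_le_mul_of_nonneg_right (h.tildeR_ge x hx) (sq_nonneg (v x))
    simp only
    linarith
  · rw [hin]
    exact integral_nonneg_of_ae (h.ae_bvol.mono fun x hx =>
      mul_nonneg (h.tildeR_pos hx).le (sq_nonneg _))

lemma UniformBounds.norm_r_le (h : UniformBounds M m R C δ) (v : L2Bdry M m) :
    ‖S.r v‖ ^ 2 ≤ (C * δ) ^ 2 * ‖v‖ ^ 2 := by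
  refine norm_sq_le_of_lintegral_le (by positivity) ?_
  rw [← lintegral_const_mul' _ _ ENNReal.ofReal_ne_top]
  refine lintegral_mono_ae ?_
  filter_upwards [S.r_eq v, h.ae_bvol] with x h1 hx
  have hδ := h.pos
  rw [h1, enorm_mul, mul_pow, ENNReal.ofReal_pow (by positivity), ← ofReal_norm (tildeR _ _ _ _ _),
    Real.norm_of_nonneg (h.tildeR_pos hx).le]
  gcongr
  exact h.tildeR_le x hx

lemma UniformBounds.energy_eq_inner (h : UniformBounds M m R C δ) (u : L2 M m) :
    energy M m R δ u = ENNReal.ofReal (2 * δ ^ 2 * inner ℝ (S.L u) u) := by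
  rw [h.energy_eq (Lp.stronglyMeasurable u).measurable (Lp.memLp u), real_inner_comm,
    inner_eq_integral (EventuallyEq.refl _ u) (S.L_eq u)]

lemma UniformBounds.inner_L_nonneg (h : UniformBounds M m R C δ) (u : L2 M m) :
    0 ≤ inner ℝ (S.L u) u := by
  have h1 := h.integral_mul_opL (Lp.memLp u)
  rw [← inner_eq_integral (EventuallyEq.refl _ u) (S.L_eq u), real_inner_comm] at h1
  have h2 : 0 ≤ 2 * δ ^ 2 * inner ℝ (S.L u) u := by
    rw [h1]
    exact integral_nonneg fun p => mul_nonneg (sq_nonneg _) (ker_nonneg h.profile.nonneg m δ _ _)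
  have hδ := h.pos
  exact (mul_nonneg_iff_of_pos_left (by positivity)).1 h2

end Energy

/-! ### A priori estimate and existence -/

section WellPosedness

variable {d m : ℕ} {M : Set (E d)} {R : ℝ → ℝ} {C : ℝ≥0} {δ : ℝ}

/-- The energy is `2 δ² ⟨L u, u⟩`, so the factor `δ⁻²` of the coercivity estimate cancels and the
constant is uniform in `δ`. -/
lemma exists_real_coercivity (M : Set (E d)) (m : ℕ) (R : ℝ → ℝ) (C : ℝ≥0) :
    ∃ K : ℝ≥0, ∀ δ : ℝ, UniformBounds M m R C δ → ∀ (S : SystemOperators M m R δ) (u : L2 M m),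
      ‖u‖ ^ 2 ≤ K * (‖S.D u‖ ^ 2 + 2 * inner ℝ (S.L u) u) := by
  obtain ⟨K, hK⟩ := exists_coercivity M m R C
  refine ⟨K, fun δ h S u => ?_⟩
  have := h.finite_vol
  have h1 := hK δ h u (Lp.stronglyMeasurable u).measurable (integrable_Lp_two u)
  have hδ := h.pos
  have hX := h.inner_L_nonneg S u
  have h2 : ∫⁻ x, ‖opD M m R δ u x‖ₑ ^ 2 ∂(bvol M m) = ENNReal.ofReal (‖S.D u‖ ^ 2) := by
    rw [ofReal_norm_sq]
    exact lintegral_congr_ae ((S.D_eq u).mono fun x hx => by simp only [hx])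
  have h3 : (ENNReal.ofReal δ)⁻¹ ^ 2 * energy M m R δ u =
      ENNReal.ofReal (2 * inner ℝ (S.L u) u) := by
    rw [h.energy_eq_inner S, ← ENNReal.ofReal_inv_of_pos hδ, ← ENNReal.ofReal_pow (by positivity),
      ← ENNReal.ofReal_mul (by positivity)]
    congr 1
    field_simp
  rw [h2, h3, ← ofReal_norm_sq, ← ENNReal.ofReal_add (by positivity) (by positivity),
    ← ENNReal.ofReal_coe_nnreal, ← ENNReal.ofReal_mul K.coe_nonneg] at h1
  exact (ENNReal.ofReal_le_ofReal_iff (by positivity)).1 h1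

/-- Here `a = ‖u‖`, `b = ‖v‖`, `X = ⟨L u, u⟩`, `Z = ⟨R̃ v, v⟩`, `N = ‖𝒟 u‖²`, and `P`, `Q` are the
norms of the data. With `Y = X + Z`, both `a²` and `δ b²` are bounded by multiples of `Y` plus data,
so Young's inequality hides half of `Y` on the left. -/
lemma energy_absorption {a b X Z P Q N δ C K : ℝ} (hX : 0 ≤ X) (hZ : 0 ≤ Z)
    (hδ : 0 < δ) (hδ1 : δ ≤ 1) (hC : 0 ≤ C) (hK : 0 ≤ K)
    (h1 : X + Z ≤ P * a + Q * b) (h2 : δ * b ^ 2 ≤ C * Z) (h3 : a ^ 2 ≤ K * (N + 2 * X))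
    (h4 : N ≤ 2 * Q ^ 2 + 2 * ((C * δ) ^ 2 * b ^ 2)) :
    a ^ 2 + δ * b ^ 2 + X ≤ (2 * K + (2 * K * (C ^ 3 + 1) + C + 1) *
      (2 * (2 * K * (C ^ 3 + 1) + 1) + K + 2 * C + 2)) * (P ^ 2 + δ⁻¹ * Q ^ 2) := by
  set K₁ := 2 * K * (C ^ 3 + 1) with hK₁
  have hK₁0 : 0 ≤ K₁ := by positivity
  set Y := X + Z with hY
  have hY0 : 0 ≤ Y := by positivity
  set q := δ⁻¹ * Q ^ 2 with hq
  have hqQ : Q ^ 2 ≤ q := le_mul_of_one_le_left (sq_nonneg _) ((one_le_inv₀ hδ).2 hδ1)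
  have hq0 : 0 ≤ q := by positivity
  have e1 : δ * b ^ 2 ≤ C * Y := h2.trans (mul_le_mul_of_nonneg_left (by linarith) hC)
  have e2 : (C * δ) ^ 2 * b ^ 2 ≤ C ^ 3 * Y := by
    calc (C * δ) ^ 2 * b ^ 2 = C ^ 2 * (δ * (δ * b ^ 2)) := by ring
      _ ≤ C ^ 2 * (1 * (C * Y)) := by gcongr
      _ = _ := by ring
  have e3 : a ^ 2 ≤ 2 * K * Q ^ 2 + K₁ * Y := by
    calc a ^ 2 ≤ K * (N + 2 * X) := h3
      _ ≤ K * (2 * Q ^ 2 + 2 * (C ^ 3 * Y) + 2 * Y) := by gcongr; linarith; linarith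
      _ = _ := by rw [hK₁]; ring
  -- Young's inequality with parameter `K₁ + 1`, so that the part `K₁ Y` of `a²` contributes at most
  -- `Y / 4`.
  have e4 : P * a ≤ (K₁ + 1) * P ^ 2 + K / 2 * Q ^ 2 + Y / 4 := by
    have f1 : 4 * (K₁ + 1) * (P * a) ≤ (2 * (K₁ + 1) * P) ^ 2 + a ^ 2 := by
      nlinarith [sq_nonneg (2 * (K₁ + 1) * P - a)]
    have f2 : 2 * K * Q ^ 2 ≤ (K₁ + 1) * (2 * K * Q ^ 2) :=
      le_mul_of_one_le_left (by positivity) (by linarith)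
    have f3 : 4 * (K₁ + 1) * (P * a) ≤
        4 * (K₁ + 1) * ((K₁ + 1) * P ^ 2 + K / 2 * Q ^ 2 + Y / 4) := by
      nlinarith
    exact le_of_mul_le_mul_left f3 (by positivity)
  -- Only `δ b²` is controlled, so Young's inequality is scaled by `δ` and the data enter as `q =
  -- δ⁻¹ Q²`.
  have e5 : Q * b ≤ (C + 1) * q + Y / 4 := by
    have f1 : 4 * (C + 1) * δ * (Q * b) ≤ (2 * (C + 1) * Q) ^ 2 + (δ * b) ^ 2 := by
      nlinarith [sq_nonneg (2 * (C + 1) * Q - δ * b)]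
    have f2 : (δ * b) ^ 2 ≤ δ * ((C + 1) * Y) := by
      calc (δ * b) ^ 2 = δ * (δ * b ^ 2) := by ring
        _ ≤ δ * ((C + 1) * Y) := mul_le_mul_of_nonneg_left (by linarith) hδ.le
    have f3 : Q ^ 2 = δ * q := by rw [hq]; field_simp
    have f4 : 4 * (C + 1) * δ * (Q * b) ≤ 4 * (C + 1) * δ * ((C + 1) * q + Y / 4) := by
      calc _ ≤ 4 * (C + 1) ^ 2 * Q ^ 2 + δ * ((C + 1) * Y) := by linarith
        _ = _ := by rw [f3]; ring
    exact le_of_mul_le_mul_left f4 (by positivity)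
  set K₂ := 2 * (K₁ + 1) + K + 2 * C + 2 with hK₂
  have e6 : Y ≤ K₂ * (P ^ 2 + q) := by
    have g1 : K / 2 * Q ^ 2 ≤ K / 2 * q := by gcongr
    have g2 : Y ≤ 2 * (K₁ + 1) * P ^ 2 + (K + 2 * C + 2) * q := by linarith
    have g3 : 0 ≤ (K + 2 * C + 2) * P ^ 2 := by positivity
    have g4 : 0 ≤ 2 * (K₁ + 1) * q := by positivity
    rw [hK₂]
    linarith
  have e7 : K₁ * Y + C * Y + Y ≤ (K₁ + C + 1) * (K₂ * (P ^ 2 + q)) := by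
    calc _ = (K₁ + C + 1) * Y := by ring
      _ ≤ _ := by gcongr
  have e8 : 2 * K * Q ^ 2 ≤ 2 * K * (P ^ 2 + q) := by
    gcongr
    linarith [sq_nonneg P]
  calc a ^ 2 + δ * b ^ 2 + X ≤ 2 * K * Q ^ 2 + (K₁ * Y + C * Y + Y) := by linarith
    _ ≤ 2 * K * (P ^ 2 + q) + (K₁ + C + 1) * (K₂ * (P ^ 2 + q)) := by linarith
    _ = _ := by ring

/-- The a priori estimate for the nonlocal system. -/
theorem exists_apriori (M : Set (E d)) (m : ℕ) (R : ℝ → ℝ) (C : ℝ≥0) :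
    ∃ K : ℝ, 0 ≤ K ∧ ∀ δ : ℝ, UniformBounds M m R C δ → ∀ (S : SystemOperators M m R δ)
      (u : L2 M m) (v : L2Bdry M m),
      ‖u‖ ^ 2 + δ * ‖v‖ ^ 2 + inner ℝ (S.L u) u ≤
        K * (‖S.L u - ContinuousLinearMap.adjoint S.D v‖ ^ 2 + δ⁻¹ * ‖S.D u + S.r v‖ ^ 2) := by
  obtain ⟨K, hK⟩ := exists_real_coercivity M m R C
  refine ⟨_, ?_, fun δ h S u v => energy_absorption (a := ‖u‖) (b := ‖v‖) (X := inner ℝ (S.L u) u)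
    (Z := inner ℝ (S.r v) v) (N := ‖S.D u‖ ^ 2) (h.inner_L_nonneg S u)
    (h.mul_norm_sq_le_inner_r S v).2 h.pos h.le_one C.coe_nonneg K.coe_nonneg
    ?_ (h.mul_norm_sq_le_inner_r S v).1 (hK δ h S u) ?_⟩
  · positivity
  -- The coupling terms `⟨𝒟* v, u⟩` and `⟨𝒟 u, v⟩` cancel.
  · calc inner ℝ (S.L u) u + inner ℝ (S.r v) v
        = inner ℝ (S.L u - ContinuousLinearMap.adjoint S.D v) u +
          inner ℝ (S.D u + S.r v) v := by
          rw [inner_sub_left, ContinuousLinearMap.adjoint_inner_left, inner_add_left,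
            real_inner_comm v (S.D u)]
          ring
      _ ≤ _ := add_le_add (real_inner_le_norm _ _) (real_inner_le_norm _ _)
  · have h1 : S.D u = (S.D u + S.r v) - S.r v := by abel
    have h2 : ‖S.D u‖ ≤ ‖S.D u + S.r v‖ + ‖S.r v‖ := by
      conv_lhs => rw [h1]
      exact norm_sub_le _ _
    have h3 := h.norm_r_le S v
    nlinarith [norm_nonneg (S.D u), norm_nonneg (S.r v), norm_nonneg (S.D u + S.r v),
      sq_nonneg (‖S.D u + S.r v‖ - ‖S.r v‖)]

/-- A coercive bounded operator on a real Hilbert space is surjective. -/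
lemma surjective_of_coercive {V : Type*} [NormedAddCommGroup V] [InnerProductSpace ℝ V]
    [CompleteSpace V] (A : V →L[ℝ] V) {c : ℝ} (hc : 0 < c)
    (h : ∀ u, c * ‖u‖ ^ 2 ≤ inner ℝ (A u) u) : Function.Surjective A := by
  let B : V →L[ℝ] V →L[ℝ] ℝ := LinearMap.mkContinuous₂
    (LinearMap.mk₂ ℝ (fun u w => inner ℝ (A u) w)
      (fun u v w => by rw [map_add, inner_add_left])
      (fun a u w => by rw [map_smul, real_inner_smul_left, smul_eq_mul])
      (fun u v w => inner_add_right _ _ _)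
      (fun a u w => by rw [real_inner_smul_right, smul_eq_mul])) ‖A‖ (fun u w => by
        rw [LinearMap.mk₂_apply]
        exact (norm_inner_le_norm _ _).trans
          (mul_le_mul_of_nonneg_right (A.le_opNorm u) (norm_nonneg _)))
  have hB : IsCoercive B := ⟨c, hc, fun u => by
    have := h u
    rw [sq, ← mul_assoc] at this
    exact this⟩
  have hA : ∀ u, hB.continuousLinearEquivOfBilin u = A u := fun u =>
    ext_inner_right ℝ fun w => hB.continuousLinearEquivOfBilin_apply u w
  intro p
  refine ⟨hB.continuousLinearEquivOfBilin.symm p, ?_⟩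
  rw [← hA, ContinuousLinearEquiv.apply_symm_apply]

/-- Eliminating `v = R̃⁻¹ (q - 𝒟 u)` leaves `(L + 𝒟* R̃⁻¹ 𝒟) u = p + 𝒟* R̃⁻¹ q`. The operator is
coercive because `⟨R̃⁻¹ 𝒟 u, 𝒟 u⟩` dominates a multiple of `‖𝒟 u‖²`, so Lax-Milgram gives `u`. -/
lemma UniformBounds.exists_solution (h : UniformBounds M m R C δ) (S : SystemOperators M m R δ)
    (p : L2 M m) (q : L2Bdry M m) : ∃ (u : L2 M m) (v : L2Bdry M m),
      S.L u - ContinuousLinearMap.adjoint S.D v = p ∧ S.D u + S.r v = q := by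
  obtain ⟨K, hK⟩ := exists_real_coercivity M m R C
  have hδ := h.pos
  let A : L2 M m →L[ℝ] L2 M m := S.L + (ContinuousLinearMap.adjoint S.D).comp (S.s.comp S.D)
  have hAu : ∀ u, inner ℝ (A u) u = inner ℝ (S.L u) u + inner ℝ (S.s (S.D u)) (S.D u) := fun u => by
    show inner ℝ (S.L u + ContinuousLinearMap.adjoint S.D (S.s (S.D u))) u = _
    rw [inner_add_left, ContinuousLinearMap.adjoint_inner_left]
  -- Both bounds for `r` are applied to `S.s w`, whose image under `r` is `w`.
  have hs : ∀ w : L2Bdry M m, ‖w‖ ^ 2 ≤ C ^ 3 * inner ℝ (S.s w) w ∧ 0 ≤ inner ℝ (S.s w) w := by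
    intro w
    have h1 := h.mul_norm_sq_le_inner_r S (S.s w)
    have h2 := h.norm_r_le S (S.s w)
    rw [h.r_s S w] at h1 h2
    rw [real_inner_comm] at h1
    refine ⟨h2.trans ?_, h1.2⟩
    calc (C * δ) ^ 2 * ‖S.s w‖ ^ 2 = C ^ 2 * δ * (δ * ‖S.s w‖ ^ 2) := by ring
      _ ≤ C ^ 2 * δ * (C * inner ℝ (S.s w) w) := mul_le_mul_of_nonneg_left h1.1 (by positivity)
      _ = δ * (C ^ 3 * inner ℝ (S.s w) w) := by ring
      _ ≤ _ := mul_le_of_le_one_left (mul_nonneg (by positivity) h1.2) h.le_one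
  obtain ⟨u, hu⟩ := surjective_of_coercive A (c := ((K + 1 : ℝ) * (C ^ 3 + 2))⁻¹) (by positivity)
    (fun u => by
      rw [hAu, inv_mul_le_iff₀ (by positivity)]
      have h1 := hs (S.D u)
      have h2 := h.inner_L_nonneg S u
      calc ‖u‖ ^ 2 ≤ K * (‖S.D u‖ ^ 2 + 2 * inner ℝ (S.L u) u) := hK δ h S u
        _ ≤ (K + 1) * (‖S.D u‖ ^ 2 + 2 * inner ℝ (S.L u) u) := by gcongr; linarith
        _ ≤ (K + 1) * ((C ^ 3 + 2) * (inner ℝ (S.L u) u + inner ℝ (S.s (S.D u)) (S.D u))) := by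
            refine mul_le_mul_of_nonneg_left ?_ (by positivity)
            have h3 : 0 ≤ (C : ℝ) ^ 3 * inner ℝ (S.L u) u := by positivity
            linarith
        _ = _ := by ring) (p + ContinuousLinearMap.adjoint S.D (S.s q))
  refine ⟨u, S.s (q - S.D u), ?_, ?_⟩
  · have h1 : S.L u + ContinuousLinearMap.adjoint S.D (S.s (S.D u)) =
        p + ContinuousLinearMap.adjoint S.D (S.s q) := hu
    rw [map_sub, map_sub, sub_sub_eq_add_sub, sub_eq_iff_eq_add, ← h1]
  · rw [h.r_s S]
    abel

end WellPosedness

/-! ### Regularity of the solution -/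

section Regularity

variable {d m : ℕ} {M : Set (E d)} {R : ℝ → ℝ} {C : ℝ≥0} {δ : ℝ} {u v f g : E d → ℝ}

lemma ennreal_add_sq_le (a b : ℝ≥0∞) : (a + b) ^ 2 ≤ 4 * a ^ 2 + 4 * b ^ 2 := by
  rcases le_total a b with h | h
  · calc (a + b) ^ 2 ≤ (b + b) ^ 2 := by gcongr
      _ = 4 * b ^ 2 := by ring
      _ ≤ _ := le_add_self
  · calc (a + b) ^ 2 ≤ (a + a) ^ 2 := by gcongr
      _ = 4 * a ^ 2 := by ring
      _ ≤ _ := le_self_add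

lemma UniformBounds.ofReal_mul_inv (h : UniformBounds M m R C δ) :
    ENNReal.ofReal δ * (ENNReal.ofReal δ)⁻¹ = 1 :=
  ENNReal.mul_inv_cancel (by simpa using h.pos) ENNReal.ofReal_ne_top

lemma UniformBounds.ofReal_le_one (h : UniformBounds M m R C δ) : ENNReal.ofReal δ ≤ 1 :=
  ENNReal.ofReal_le_one.2 h.le_one

lemma ofReal_three_mul (δ : ℝ) :
    ENNReal.ofReal (3 * δ) = 3 * ENNReal.ofReal δ := by
  rw [ENNReal.ofReal_mul (by norm_num), ENNReal.ofReal_ofNat]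

/-- The source density `|v| + |f| + δ |g|`, averaged at scale `δ`. -/
def sourceAverage (M : Set (E d)) (m : ℕ) (δ : ℝ) (v f g : E d → ℝ) (x : E d) : ℝ≥0∞ :=
  ballAverage m δ (bvol M m) v x + (ballAverage m δ (vol M m) f x +
    ENNReal.ofReal δ * ballAverage m δ (bvol M m) g x)

/-- The prefactor `δ²` beats the loss `δ⁻¹` of boundary averages and leaves `δ ‖v‖²`, exactly the
quantity that the a priori estimate controls. -/
lemma UniformBounds.lintegral_sourceAverage_le (h : UniformBounds M m R C δ)
    (hv : AEStronglyMeasurable v (bvol M m)) (hf : AEStronglyMeasurable f (vol M m))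
    (hg : AEStronglyMeasurable g (bvol M m)) :
    ENNReal.ofReal δ ^ 2 * ∫⁻ x, sourceAverage M m δ v f g x ^ 2 ∂(vol M m) ≤
      16 * C ^ 2 * (ENNReal.ofReal δ * ∫⁻ x, ‖v x‖ₑ ^ 2 ∂(bvol M m) +
        (∫⁻ x, ‖f x‖ₑ ^ 2 ∂(vol M m) + ∫⁻ x, ‖g x‖ₑ ^ 2 ∂(bvol M m))) := by
  have := h.finite_vol
  have := h.finite_bvol
  set D := ENNReal.ofReal δ with hD
  have hDD : D * D⁻¹ = 1 := h.ofReal_mul_inv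
  have hD1 : D ≤ 1 := h.ofReal_le_one
  set V := ∫⁻ x, ‖v x‖ₑ ^ 2 ∂(bvol M m)
  set F := ∫⁻ x, ‖f x‖ₑ ^ 2 ∂(vol M m)
  set G := ∫⁻ x, ‖g x‖ₑ ^ 2 ∂(bvol M m)
  have m₁ : AEMeasurable (fun x => ballAverage m δ (bvol M m) v x ^ 2) (vol M m) :=
    (aemeasurable_ballAverage hv).pow_const 2
  have m₂ : AEMeasurable (fun x => ballAverage m δ (vol M m) f x ^ 2) (vol M m) :=
    (aemeasurable_ballAverage hf).pow_const 2
  have m₃ : AEMeasurable (fun x => ballAverage m δ (bvol M m) g x ^ 2) (vol M m) :=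
    (aemeasurable_ballAverage hg).pow_const 2
  calc _ ≤ D ^ 2 * ∫⁻ x, (16 * ballAverage m δ (bvol M m) v x ^ 2 +
          (16 * ballAverage m δ (vol M m) f x ^ 2 +
            16 * D ^ 2 * ballAverage m δ (bvol M m) g x ^ 2)) ∂(vol M m) := by
        refine mul_le_mul_right (lintegral_mono fun x => ?_) _
        rw [sourceAverage]
        refine (ennreal_add_sq_le _ _).trans (add_le_add ?_ ?_)
        · gcongr; norm_num
        · refine (mul_le_mul_right (ennreal_add_sq_le _ _) 4).trans_eq ?_
          ring
    _ = D ^ 2 * (16 * ∫⁻ x, ballAverage m δ (bvol M m) v x ^ 2 ∂(vol M m) +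
          (16 * ∫⁻ x, ballAverage m δ (vol M m) f x ^ 2 ∂(vol M m) +
            16 * D ^ 2 * ∫⁻ x, ballAverage m δ (bvol M m) g x ^ 2 ∂(vol M m))) := by
        rw [lintegral_add_left' (m₁.const_mul _), lintegral_add_left' (m₂.const_mul _),
          lintegral_const_mul'' _ m₁, lintegral_const_mul'' _ m₂, lintegral_const_mul'' _ m₃]
    _ ≤ D ^ 2 * (16 * (C ^ 2 * D⁻¹ * V) + (16 * (C ^ 2 * F) +
            16 * D ^ 2 * (C ^ 2 * D⁻¹ * G))) := by
        gcongr
        · exact h.schur_bvol_vol hv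
        · exact h.schur_vol_vol hf
        · exact h.schur_bvol_vol hg
    _ = 16 * C ^ 2 * ((D * D⁻¹) * D * V + (D ^ 2 * F + (D * D⁻¹) * D ^ 3 * G)) := by ring
    _ ≤ 16 * C ^ 2 * (D * V + (F + G)) := by
        rw [hDD]
        gcongr
        · rw [one_mul]
        · exact mul_le_of_le_one_left zero_le (pow_le_one₀ zero_le hD1)
        · rw [one_mul]; exact mul_le_of_le_one_left zero_le (pow_le_one₀ zero_le hD1)

/-- The right-hand side `δ² (𝒢_δ v + 𝒫_δ f)` of the equation for `u`. -/
def source (M : Set (E d)) (m : ℕ) (R : ℝ → ℝ) (δ : ℝ) (v f g : E d → ℝ) (x : E d) : ℝ :=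
  δ ^ 2 * (opG M m R δ v x + opP M m R δ f g x)

lemma UniformBounds.contDiff_source (h : UniformBounds M m R C δ) (hv : Integrable v (bvol M m))
    (hf : Integrable f (vol M m)) (hg : Integrable g (bvol M m)) :
    ContDiff ℝ 1 (source M m R δ v f g) :=
  contDiff_const.mul ((h.contDiff_opG hv).add (h.contDiff_opP hf hg))

lemma UniformBounds.enorm_sq_pos (h : UniformBounds M m R C δ) :
    ‖δ ^ 2‖ₑ = ENNReal.ofReal δ ^ 2 := by
  rw [← ofReal_norm, Real.norm_of_nonneg (sq_nonneg _), ENNReal.ofReal_pow h.pos.le]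

lemma UniformBounds.enorm_source_le (h : UniformBounds M m R C δ) (x : E d) :
    ‖source M m R δ v f g x‖ₑ ≤
      ENNReal.ofReal δ ^ 2 * ((3 + 3 * C) * C * sourceAverage M m δ v f g x) := by
  rw [source, enorm_mul, h.enorm_sq_pos]
  refine mul_le_mul_right ((enorm_add_le _ _).trans
    ((add_le_add (h.enorm_opG_le x) (h.enorm_opP_le x)).trans ?_)) _
  rw [ofReal_three_mul, sourceAverage, mul_add, mul_add]
  refine add_le_add ?_ (add_le_add ?_ ?_)
  · gcongr; norm_num
  · gcongr
    exact (by norm_num : (1 : ℝ≥0∞) ≤ 3).trans le_self_add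
  · calc _ = 3 * C * (ENNReal.ofReal δ * ballAverage m δ (bvol M m) g x) := by ring
      _ ≤ _ := by gcongr; exact le_self_add

/-- One of the two factors `δ` in the source pays for the `δ⁻¹` lost in differentiating the kernel.
-/
lemma UniformBounds.enorm_fderiv_source_le (h : UniformBounds M m R C δ)
    (hv : Integrable v (bvol M m)) (hf : Integrable f (vol M m)) (hg : Integrable g (bvol M m))
    (x : E d) : ‖fderiv ℝ (source M m R δ v f g) x‖ₑ ≤
      ENNReal.ofReal δ * ((3 + 3 * C) * C * sourceAverage M m δ v f g x) := by
  have d₁ := (h.contDiff_opG hv).differentiable (by simp) x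
  have d₂ := (h.contDiff_opP hf hg).differentiable (by simp) x
  have e : fderiv ℝ (source M m R δ v f g) x =
      δ ^ 2 • (fderiv ℝ (opG M m R δ v) x + fderiv ℝ (opP M m R δ f g) x) :=
    ((d₁.hasFDerivAt.add d₂.hasFDerivAt).const_mul (δ ^ 2)).fderiv
  rw [e, enorm_smul, h.enorm_sq_pos]
  set D := ENNReal.ofReal δ with hD
  have hDD : D * D⁻¹ = 1 := h.ofReal_mul_inv
  calc _ ≤ D ^ 2 * (D⁻¹ * ((3 + 3 * C) * C * sourceAverage M m δ v f g x)) := by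
        have t : ‖fderiv ℝ (opG M m R δ v) x + fderiv ℝ (opP M m R δ f g) x‖ₑ ≤
            ‖fderiv ℝ (opG M m R δ v) x‖ₑ + ‖fderiv ℝ (opP M m R δ f g) x‖ₑ := by
          simp only [enorm_eq_nnnorm]
          exact_mod_cast nnnorm_add_le (fderiv ℝ (opG M m R δ v) x) _
        refine mul_le_mul_right (t.trans
          ((add_le_add (h.enorm_fderiv_opG_le hv x) (h.enorm_fderiv_opP_le hf hg x)).trans ?_)) _
        rw [ofReal_three_mul, sourceAverage, mul_add, mul_add, mul_add, mul_add]
        refine add_le_add ?_ (add_le_add ?_ ?_)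
        · calc _ = D⁻¹ * ((2 + 3 * C) * C * ballAverage m δ (bvol M m) v x) := by ring
            _ ≤ _ := by gcongr; norm_num
        · calc _ = D⁻¹ * (1 * C * ballAverage m δ (vol M m) f x) := by ring
            _ ≤ _ := by
              gcongr
              exact (by norm_num : (1 : ℝ≥0∞) ≤ 3).trans le_self_add
        · calc _ = D⁻¹ * (3 * C * (D * ballAverage m δ (bvol M m) g x)) := by ring
            _ ≤ _ := by gcongr; exact le_self_add
    _ = (D * D⁻¹) * D * ((3 + 3 * C) * C * sourceAverage M m δ v f g x) := by ring
    _ = _ := by rw [hDD, one_mul]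

/-- The `C¹` representative of the solution. -/
def representative (M : Set (E d)) (m : ℕ) (R : ℝ → ℝ) (δ : ℝ) (u v f g : E d → ℝ) (x : E d) : ℝ :=
  smoothing M m R δ u x + source M m R δ v f g x / mass M m R δ x

lemma UniformBounds.contDiffAt_representative (h : UniformBounds M m R C δ)
    (hu : Integrable u (vol M m)) (hv : Integrable v (bvol M m)) (hf : Integrable f (vol M m))
    (hg : Integrable g (bvol M m)) {x : E d} (hx : x ∈ M) :
    ContDiffAt ℝ 1 (representative M m R δ u v f g) x :=
  (h.contDiffAt_smoothing hu hx).add (h.contDiffAt_div_mass (h.contDiff_source hv hf hg) hx)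

/-- The equation reads `u · mass = average + source`; dividing by the positive mass expresses `u`
through kernel integrals. -/
lemma UniformBounds.eq_representative (h : UniformBounds M m R C δ) (hu : Integrable u (vol M m))
    {x : E d} (hx : x ∈ M) (heq : opL M m R δ u x - opG M m R δ v x = opP M m R δ f g x) :
    u x = representative M m R δ u v f g x := by
  have hδ := h.pos.ne'
  have hm := (h.mass_pos hx).ne'
  rw [h.opL_eq hu] at heq
  have h1 : u x * mass M m R δ x - kerAverage M m R δ u x = source M m R δ v f g x := by
    rw [source, ← heq]
    field_simp
    ring
  rw [representative, smoothing, ← h1]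
  field_simp
  ring

/-- The gradient bound for the representative of the solution. -/
theorem exists_dirichlet_representative_le (M : Set (E d)) (m : ℕ) (R : ℝ → ℝ) (C : ℝ≥0) :
    ∃ K : ℝ≥0, ∀ δ : ℝ, UniformBounds M m R C δ → ∀ u v f g : E d → ℝ, Measurable u →
      Integrable u (vol M m) → Integrable v (bvol M m) → Integrable f (vol M m) →
      Integrable g (bvol M m) → dirichlet M m (representative M m R δ u v f g) ≤
        K * ((ENNReal.ofReal δ)⁻¹ ^ 2 * energy M m R δ u +
          (ENNReal.ofReal δ * ∫⁻ x, ‖v x‖ₑ ^ 2 ∂(bvol M m) +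
            (∫⁻ x, ‖f x‖ₑ ^ 2 ∂(vol M m) + ∫⁻ x, ‖g x‖ₑ ^ 2 ∂(bvol M m)))) := by
  set A : ℝ≥0 := 2 * (2 * C ^ 4 + 2 * C ^ 10) with hA
  set A' : ℝ≥0 := 2 * ((2 * C ^ 2 + 2 * C ^ 8) * ((3 + 3 * C) * C) ^ 2) with hA'
  refine ⟨A + A' * (16 * C ^ 2), fun δ h u v f g hum hu hv hf hg => ?_⟩
  set D := ENNReal.ofReal δ with hD
  have hDD : D * D⁻¹ = 1 := h.ofReal_mul_inv
  have hpt : ∀ x ∈ M, ‖fderiv ℝ (representative M m R δ u v f g) x‖ₑ ^ 2 ≤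
      A * D⁻¹ ^ 2 * localEnergy M m R δ u x + A' * (D ^ 2 * sourceAverage M m δ v f g x ^ 2) := by
    intro x hx
    have d₁ := (h.contDiffAt_smoothing hu hx).differentiableAt (by simp)
    have d₂ := (h.contDiffAt_div_mass (h.contDiff_source hv hf hg) hx).differentiableAt (by simp)
    have e : fderiv ℝ (representative M m R δ u v f g) x = fderiv ℝ (smoothing M m R δ u) x +
        fderiv ℝ (fun z => source M m R δ v f g z / mass M m R δ z) x :=
      (d₁.hasFDerivAt.add d₂.hasFDerivAt).fderiv
    rw [e]
    refine (enorm_add_sq_le _ _).trans (add_le_add ?_ ?_)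
    · refine (mul_le_mul_right (h.sq_enorm_fderiv_smoothing_le hum hu hx) 2).trans_eq ?_
      rw [hA]; push_cast; ring
    · calc _ ≤ 2 * (2 * C ^ 2 * (D * ((3 + 3 * C) * C * sourceAverage M m δ v f g x)) ^ 2 +
            2 * C ^ 8 * D⁻¹ ^ 2 *
              (D ^ 2 * ((3 + 3 * C) * C * sourceAverage M m δ v f g x)) ^ 2) := by
            refine mul_le_mul_right
              ((h.sq_enorm_fderiv_div_mass_le (h.contDiff_source hv hf hg) hx).trans ?_) 2
            gcongr
            · exact h.enorm_fderiv_source_le hv hf hg x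
            · exact h.enorm_source_le x
        _ = 2 * ((2 * C ^ 2 + 2 * C ^ 8 * (D * D⁻¹) ^ 2) * ((3 + 3 * C) * C) ^ 2) *
            (D ^ 2 * sourceAverage M m δ v f g x ^ 2) := by ring
        _ = _ := by rw [hDD, hA']; push_cast; ring
  have hle := h.measurable_localEnergy hum
  calc _ ≤ ∫⁻ x, ‖fderiv ℝ (representative M m R δ u v f g) x‖ₑ ^ 2 ∂(vol M m) :=
        dirichlet_le_lintegral_fderiv M m _
    _ ≤ ∫⁻ x, (A * D⁻¹ ^ 2 * localEnergy M m R δ u x +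
          A' * (D ^ 2 * sourceAverage M m δ v f g x ^ 2)) ∂(vol M m) :=
        lintegral_mono_ae (h.ae_vol.mono hpt)
    _ = A * D⁻¹ ^ 2 * energy M m R δ u +
          A' * (D ^ 2 * ∫⁻ x, sourceAverage M m δ v f g x ^ 2 ∂(vol M m)) := by
        rw [lintegral_add_left (hle.const_mul _), lintegral_const_mul _ hle,
          lintegral_const_mul' _ _ ENNReal.coe_ne_top, lintegral_const_mul' _ _ (by finiteness)]
        rfl
    _ ≤ A * D⁻¹ ^ 2 * energy M m R δ u + A' * (16 * C ^ 2 *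
          (D * ∫⁻ x, ‖v x‖ₑ ^ 2 ∂(bvol M m) +
            (∫⁻ x, ‖f x‖ₑ ^ 2 ∂(vol M m) + ∫⁻ x, ‖g x‖ₑ ^ 2 ∂(bvol M m)))) :=
        add_le_add_right (mul_le_mul_right (h.lintegral_sourceAverage_le hv.1 hf.1 hg.1) _) _
    _ = A * (D⁻¹ ^ 2 * energy M m R δ u) + A' * (16 * C ^ 2) *
          (D * ∫⁻ x, ‖v x‖ₑ ^ 2 ∂(bvol M m) +
            (∫⁻ x, ‖f x‖ₑ ^ 2 ∂(vol M m) + ∫⁻ x, ‖g x‖ₑ ^ 2 ∂(bvol M m))) := by ring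
    _ ≤ (A + A' * (16 * C ^ 2)) * (D⁻¹ ^ 2 * energy M m R δ u) + (A + A' * (16 * C ^ 2)) *
          (D * ∫⁻ x, ‖v x‖ₑ ^ 2 ∂(bvol M m) +
            (∫⁻ x, ‖f x‖ₑ ^ 2 ∂(vol M m) + ∫⁻ x, ‖g x‖ₑ ^ 2 ∂(bvol M m))) :=
        add_le_add (mul_le_mul_left le_self_add _) (mul_le_mul_left le_add_self _)
    _ = _ := by push_cast; ring

lemma UniformBounds.lintegral_opP_le (h : UniformBounds M m R C δ)
    (hf : AEStronglyMeasurable f (vol M m)) (hg : AEStronglyMeasurable g (bvol M m)) :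
    ∫⁻ x, ‖opP M m R δ f g x‖ₑ ^ 2 ∂(vol M m) ≤
      36 * C ^ 4 * (∫⁻ x, ‖f x‖ₑ ^ 2 ∂(vol M m) + ∫⁻ x, ‖g x‖ₑ ^ 2 ∂(bvol M m)) := by
  have := h.finite_vol
  have := h.finite_bvol
  set D := ENNReal.ofReal δ with hD
  have hDD : D * D⁻¹ = 1 := h.ofReal_mul_inv
  have hD1 : D ≤ 1 := h.ofReal_le_one
  have m₂ : AEMeasurable (fun x => ballAverage m δ (vol M m) f x ^ 2) (vol M m) :=
    (aemeasurable_ballAverage hf).pow_const 2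
  have m₃ : AEMeasurable (fun x => ballAverage m δ (bvol M m) g x ^ 2) (vol M m) :=
    (aemeasurable_ballAverage hg).pow_const 2
  calc _ ≤ ∫⁻ x, (4 * C ^ 2 * ballAverage m δ (vol M m) f x ^ 2 +
          36 * C ^ 2 * D ^ 2 * ballAverage m δ (bvol M m) g x ^ 2) ∂(vol M m) := by
        refine lintegral_mono fun x => ?_
        refine (pow_le_pow_left' (h.enorm_opP_le x) 2).trans ((ennreal_add_sq_le _ _).trans_eq ?_)
        rw [ofReal_three_mul]
        ring
    _ = 4 * C ^ 2 * ∫⁻ x, ballAverage m δ (vol M m) f x ^ 2 ∂(vol M m) +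
          36 * C ^ 2 * D ^ 2 * ∫⁻ x, ballAverage m δ (bvol M m) g x ^ 2 ∂(vol M m) := by
        rw [lintegral_add_left' (m₂.const_mul _), lintegral_const_mul'' _ m₂,
          lintegral_const_mul'' _ m₃]
    _ ≤ 4 * C ^ 2 * (C ^ 2 * ∫⁻ x, ‖f x‖ₑ ^ 2 ∂(vol M m)) +
          36 * C ^ 2 * D ^ 2 * (C ^ 2 * D⁻¹ * ∫⁻ x, ‖g x‖ₑ ^ 2 ∂(bvol M m)) := by
        gcongr
        · exact h.schur_vol_vol hf
        · exact h.schur_bvol_vol hg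
    _ = 4 * C ^ 4 * ∫⁻ x, ‖f x‖ₑ ^ 2 ∂(vol M m) +
          36 * C ^ 4 * ((D * D⁻¹) * D * ∫⁻ x, ‖g x‖ₑ ^ 2 ∂(bvol M m)) := by ring
    _ ≤ 36 * C ^ 4 * ∫⁻ x, ‖f x‖ₑ ^ 2 ∂(vol M m) +
          36 * C ^ 4 * ∫⁻ x, ‖g x‖ₑ ^ 2 ∂(bvol M m) := by
        rw [hDD, one_mul]
        gcongr
        · norm_num
        · exact mul_le_of_le_one_left zero_le hD1
    _ = _ := by ring

/-- The right-hand side must supply a factor `δ`, since the a priori estimate weighs the boundary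
data by `δ⁻¹`. The `δ²` in `𝒬_δ` provides more than enough. -/
lemma UniformBounds.lintegral_opQ_le (h : UniformBounds M m R C δ)
    (hf : AEStronglyMeasurable f (vol M m)) :
    ∫⁻ x, ‖opQ M m R δ f x‖ₑ ^ 2 ∂(bvol M m) ≤
      4 * C ^ 4 * ENNReal.ofReal δ * ∫⁻ x, ‖f x‖ₑ ^ 2 ∂(vol M m) := by
  set D := ENNReal.ofReal δ with hD
  have hDD : D * D⁻¹ = 1 := h.ofReal_mul_inv
  have hD1 : D ≤ 1 := h.ofReal_le_one
  calc _ ≤ ∫⁻ x, (2 * D ^ 2 * C) ^ 2 * ballAverage m δ (vol M m) f x ^ 2 ∂(bvol M m) := by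
        refine lintegral_mono fun x => ?_
        rw [← mul_pow]
        exact pow_le_pow_left' (h.enorm_opQ_le x) 2
    _ = (2 * D ^ 2 * C) ^ 2 * ∫⁻ x, ballAverage m δ (vol M m) f x ^ 2 ∂(bvol M m) :=
        lintegral_const_mul' _ _ (by finiteness)
    _ ≤ (2 * D ^ 2 * C) ^ 2 * (C ^ 2 * D⁻¹ * ∫⁻ x, ‖f x‖ₑ ^ 2 ∂(vol M m)) :=
        mul_le_mul_right (h.schur_vol_bvol hf) _
    _ = 4 * C ^ 4 * (D ^ 2 * ((D * D⁻¹) * D)) * ∫⁻ x, ‖f x‖ₑ ^ 2 ∂(vol M m) := by ring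
    _ ≤ _ := by
        rw [hDD, one_mul]
        gcongr
        exact mul_le_of_le_one_left zero_le (pow_le_one₀ zero_le hD1)

end Regularity

/-! ### The system as an operator equation -/

section Main

variable {d m : ℕ} {M : Set (E d)} {R : ℝ → ℝ} {C : ℝ≥0} {δ : ℝ}

lemma UniformBounds.exists_toLp_opP (h : UniformBounds M m R C δ) (f : L2 M m) (g : L2Bdry M m) :
    ∃ p : L2 M m, p =ᵐ[vol M m] opP M m R δ f g ∧
      ‖p‖ ^ 2 ≤ 36 * C ^ 4 * (‖f‖ ^ 2 + ‖g‖ ^ 2) := by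
  have := h.finite_vol
  have := h.finite_bvol
  have hc := (h.contDiff_opP (integrable_Lp_two f) (integrable_Lp_two g)).continuous
  have hmem := memLp_of_continuousOn h.isCompact hc.continuousOn hc.aestronglyMeasurable h.ae_vol
  refine ⟨hmem.toLp _, hmem.coeFn_toLp, ?_⟩
  have h1 := h.lintegral_opP_le (Lp.aestronglyMeasurable f) (Lp.aestronglyMeasurable g)
  have e : ∫⁻ x, ‖opP M m R δ f g x‖ₑ ^ 2 ∂(vol M m) = ∫⁻ x, ‖hmem.toLp _ x‖ₑ ^ 2 ∂(vol M m) :=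
    lintegral_congr_ae (hmem.coeFn_toLp.mono fun x hx => by simp only [hx])
  rw [e, ← ofReal_norm_sq, ← ofReal_norm_sq, ← ofReal_norm_sq, ← ENNReal.ofReal_add (by positivity) (by positivity)] at h1
  rw [← ENNReal.ofReal_le_ofReal_iff (by positivity), ENNReal.ofReal_mul (by positivity),
    ENNReal.ofReal_mul (by norm_num), ENNReal.ofReal_pow C.coe_nonneg, ENNReal.ofReal_coe_nnreal,
    ENNReal.ofReal_ofNat]
  exact h1

lemma UniformBounds.exists_toLp_opQ (h : UniformBounds M m R C δ) (f : L2 M m) :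
    ∃ q : L2Bdry M m, q =ᵐ[bvol M m] opQ M m R δ f ∧ δ⁻¹ * ‖q‖ ^ 2 ≤ 4 * C ^ 4 * ‖f‖ ^ 2 := by
  have := h.finite_vol
  have := h.finite_bvol
  have hδ := h.pos
  have hc := h.continuous_opQ (integrable_Lp_two f)
  have hmem := memLp_of_continuousOn h.isCompact hc.continuousOn
    (hc.aestronglyMeasurable (μ := bvol M m)) (h.ae_bvol.mono fun x hx => hx.1)
  refine ⟨hmem.toLp _, hmem.coeFn_toLp, ?_⟩
  have h1 := h.lintegral_opQ_le (Lp.aestronglyMeasurable f)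
  have e : ∫⁻ x, ‖opQ M m R δ f x‖ₑ ^ 2 ∂(bvol M m) = ∫⁻ x, ‖hmem.toLp _ x‖ₑ ^ 2 ∂(bvol M m) :=
    lintegral_congr_ae (hmem.coeFn_toLp.mono fun x hx => by simp only [hx])
  rw [e] at h1
  have h2 := norm_sq_le_of_lintegral_le (f := hmem.toLp _) (g := f) (K := 4 * C ^ 4 * δ)
    (by positivity) (by
      rw [ENNReal.ofReal_mul (by positivity), ENNReal.ofReal_mul (by norm_num),
        ENNReal.ofReal_pow C.coe_nonneg, ENNReal.ofReal_coe_nnreal, ENNReal.ofReal_ofNat]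
      exact h1)
  rw [inv_mul_le_iff₀ hδ]
  linarith

/-- Since `𝒢_δ` is represented by the adjoint of `S.D`, the almost everywhere system is a pair of
equations in Hilbert space. -/
lemma UniformBounds.isSolution_iff (h : UniformBounds M m R C δ) (S : SystemOperators M m R δ)
    {f : L2 M m × L2Vec M m} {p : L2 M m} {q : L2Bdry M m}
    (hp : p =ᵐ[vol M m] opP M m R δ f.1 (trace f)) (hq : q =ᵐ[bvol M m] opQ M m R δ f.1)
    (u : L2 M m) (v : L2Bdry M m) :
    IsSolution M m R δ f u v ↔
      S.L u - ContinuousLinearMap.adjoint S.D v = p ∧ S.D u + S.r v = q := by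
  have hG := h.adjoint_eq_opG S.D_eq v
  refine and_congr ⟨fun hs => Lp.ext ?_, fun hs => ?_⟩ ⟨fun hs => Lp.ext ?_, fun hs => ?_⟩
  · filter_upwards [hs, Lp.coeFn_sub (S.L u) (ContinuousLinearMap.adjoint S.D v), S.L_eq u, hG, hp]
      with x h1 h2 h3 h4 h5
    rw [h2, Pi.sub_apply, h3, h4, h5, h1]
  · rw [← hs] at hp
    filter_upwards [hp, Lp.coeFn_sub (S.L u) (ContinuousLinearMap.adjoint S.D v), S.L_eq u, hG]
      with x h1 h2 h3 h4
    rw [← h1, h2, Pi.sub_apply, h3, h4]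
  · filter_upwards [hs, Lp.coeFn_add (S.D u) (S.r v), S.D_eq u, S.r_eq v, hq] with x h1 h2 h3 h4 h5
    rw [h2, Pi.add_apply, h3, h4, h5, h1]
  · rw [← hs] at hq
    filter_upwards [hq, Lp.coeFn_add (S.D u) (S.r v), S.D_eq u, S.r_eq v] with x h1 h2 h3 h4
    rw [← h1, h2, Pi.add_apply, h3, h4]

end Main

end NonlocalPoisson

end

/-! ### The main theorem -/

open NonlocalPoisson in
theorem theorem1 (d m : ℕ) (hm : 1 ≤ m) (hmd : m ≤ d) (M : Set (E d))
    (hM : IsCompactSubmanifold M m)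
    (hbd : ∀ x ∈ M, (connectedComponentIn M x ∩ bdry M m).Nonempty)
    (R : ℝ → ℝ) (hR : IsKernel R) :
    ∃ δ₀ : ℝ, 0 < δ₀ ∧ ∃ C : ℝ, ∀ δ : ℝ, 0 < δ → δ < δ₀ → ∀ f ∈ H1 M m,
      ∃ (u : L2 M m) (v : L2Bdry M m),
        IsSolution M m R δ f u v ∧
        (∀ (u' : L2 M m) (v' : L2Bdry M m), IsSolution M m R δ f u' v' → u' = u ∧ v' = v) ∧
        ‖u‖ ^ 2 + δ * ‖v‖ ^ 2 ≤ C * h1NormSq f ∧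
        ∃ U : L2Vec M m, (u, U) ∈ H1 M m ∧ h1NormSq (u, U) ≤ C * h1NormSq f := by
  obtain ⟨δ₀, hδ₀, C, hC⟩ := exists_uniformBounds hm hmd hM hbd hR
  obtain ⟨T, hT⟩ := exists_norm_trace_le hm hmd hM
  obtain ⟨A, hA, hap⟩ := exists_apriori M m R C
  obtain ⟨K, hK⟩ := exists_dirichlet_representative_le M m R C
  set B : ℝ := A * (36 * C ^ 4 * (1 + T) + 4 * C ^ 4) with hB
  have hB0 : 0 ≤ B := by positivity
  -- `B` comes from the a priori estimate. In the gradient bound, `2 B` covers `2 ⟨L u, u⟩ + δ ‖v‖²`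
  -- and `1 + T` covers `f` with its trace.
  refine ⟨δ₀, hδ₀, B + K * (2 * B + (1 + T)), fun δ hδ hδ' f hf => ?_⟩
  have h := hC δ hδ hδ'
  have := h.finite_vol
  have := h.finite_bvol
  obtain ⟨S⟩ := h.nonempty_systemOperators
  obtain ⟨p, hp, hpn⟩ := h.exists_toLp_opP f.1 (trace f)
  obtain ⟨q, hq, hqn⟩ := h.exists_toLp_opQ f.1
  obtain ⟨u, v, hu, hv⟩ := h.exists_solution S p q
  have hsol : IsSolution M m R δ f u v := (h.isSolution_iff S hp hq u v).2 ⟨hu, hv⟩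
  have hF : h1NormSq f = ‖f.1‖ ^ 2 + ‖f.2‖ ^ 2 := rfl
  have hF0 : 0 ≤ h1NormSq f := by rw [hF]; positivity
  have hfF : ‖f.1‖ ^ 2 ≤ h1NormSq f := by rw [hF]; linarith [sq_nonneg ‖f.2‖]
  have hsum : ‖f.1‖ ^ 2 + ‖trace f‖ ^ 2 ≤ (1 + T) * h1NormSq f := by
    linarith [hT f hf]
  have hX := h.inner_L_nonneg S u
  have hest : ‖u‖ ^ 2 + δ * ‖v‖ ^ 2 + inner ℝ (S.L u) u ≤ B * h1NormSq f := by
    have h1 := hap δ h S u v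
    rw [hu, hv] at h1
    calc _ ≤ A * (‖p‖ ^ 2 + δ⁻¹ * ‖q‖ ^ 2) := h1
      _ ≤ A * (36 * C ^ 4 * ((1 + T) * h1NormSq f) + 4 * C ^ 4 * h1NormSq f) :=
          mul_le_mul_of_nonneg_left (add_le_add
            (hpn.trans (mul_le_mul_of_nonneg_left hsum (by positivity)))
            (hqn.trans (mul_le_mul_of_nonneg_left hfF (by positivity)))) hA
      _ = B * h1NormSq f := by rw [hB]; ring
  have hv0 : 0 ≤ δ * ‖v‖ ^ 2 := by positivity
  have hKF : 0 ≤ K * (2 * B + (1 + T)) * h1NormSq f := by positivity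
  refine ⟨u, v, hsol, fun u' v' hs => ?_, by linarith, ?_⟩
  · obtain ⟨hu', hv'⟩ := (h.isSolution_iff S hp hq u' v').1 hs
    -- Uniqueness is the a priori estimate for the difference, which has zero data.
    have h1 := hap δ h S (u' - u) (v' - v)
    have e1 : S.L (u' - u) - ContinuousLinearMap.adjoint S.D (v' - v) = 0 := by
      rw [map_sub, map_sub, sub_sub_sub_comm, hu', hu, sub_self]
    have e2 : S.D (u' - u) + S.r (v' - v) = 0 := by
      rw [map_sub, map_sub, ← add_sub_add_comm, hv', hv, sub_self]
    rw [e1, e2, norm_zero, norm_zero] at h1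
    have h2 := h.inner_L_nonneg S (u' - u)
    have h3 : 0 ≤ δ * ‖v' - v‖ ^ 2 := by positivity
    have h4 : ‖u' - u‖ ^ 2 ≤ 0 := by linarith
    have h5 : δ * ‖v' - v‖ ^ 2 ≤ 0 := by linarith [sq_nonneg ‖u' - u‖]
    have h6 : ‖v' - v‖ ^ 2 ≤ 0 := nonpos_of_mul_nonpos_right h5 hδ
    constructor
    · exact sub_eq_zero.1 (norm_eq_zero.1 (pow_eq_zero_iff two_ne_zero |>.1
        (le_antisymm h4 (sq_nonneg _))))
    · exact sub_eq_zero.1 (norm_eq_zero.1 (pow_eq_zero_iff two_ne_zero |>.1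
        (le_antisymm h6 (sq_nonneg _))))
  · have iu := integrable_Lp_two u
    have iv := integrable_Lp_two v
    have if' := integrable_Lp_two f.1
    have ig := integrable_Lp_two (trace f)
    obtain ⟨w, hw, hw₁, hw₂⟩ := exists_mem_H1 hm hmd hM
      (φ := representative M m R δ u v f.1 (trace f))
      fun x hx => h.contDiffAt_representative iu iv if' ig hx
    -- By the first equation the `C¹` representative agrees with `u` almost everywhere, so its
    -- gradient serves as the gradient of `u`.
    have hwu : w.1 = u := by
      refine Lp.ext (hw₁.trans ?_)
      filter_upwards [hsol.1, h.ae_vol] with x h1 hx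
      exact (h.eq_representative iu hx h1).symm
    refine ⟨w.2, ?_, ?_⟩
    · rw [← hwu]; exact hw
    · have h1 := hK δ h u v f.1 (trace f) (Lp.stronglyMeasurable u).measurable iu iv if' ig
      have h2 : dirichlet M m (representative M m R δ u v f.1 (trace f)) =
          ENNReal.ofReal (‖w.2‖ ^ 2) := by
        rw [ofReal_norm_sq]
        exact lintegral_congr_ae (hw₂.mono fun x hx => by simp only [hx])
      have h3 : (ENNReal.ofReal δ)⁻¹ ^ 2 * energy M m R δ u =
          ENNReal.ofReal (2 * inner ℝ (S.L u) u) := by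
        rw [h.energy_eq_inner S, ← ENNReal.ofReal_inv_of_pos hδ,
          ← ENNReal.ofReal_pow (by positivity), ← ENNReal.ofReal_mul (by positivity)]
        congr 1
        field_simp
      rw [h2, h3, ← ofReal_norm_sq, ← ofReal_norm_sq, ← ofReal_norm_sq, ← ENNReal.ofReal_mul hδ.le,
        ← ENNReal.ofReal_add (by positivity) (by positivity),
        ← ENNReal.ofReal_add (by positivity) (by positivity),
        ← ENNReal.ofReal_add (by positivity) (by positivity),
        ← ENNReal.ofReal_coe_nnreal, ← ENNReal.ofReal_mul K.coe_nonneg,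
        ENNReal.ofReal_le_ofReal_iff (by positivity)] at h1
      have h4 : ‖w.2‖ ^ 2 ≤ K * (2 * (B * h1NormSq f) + (1 + T) * h1NormSq f) :=
        h1.trans (mul_le_mul_of_nonneg_left (by linarith [sq_nonneg ‖u‖]) K.coe_nonneg)
      have h5 : h1NormSq (u, w.2) = ‖u‖ ^ 2 + ‖w.2‖ ^ 2 := rfl
      rw [h5]
      linarith
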